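/- **Setting.** Let $p,q\ge 1$, $\boldsymbol t=(t_1,\dots,t_{2p-1})\in\mathbb C^{2p-1}$ and $$V(z;\boldsymbol t)=\frac{z^{2p}}{2p}+\sum_{j=1}^{2p-1}\frac{t_jz^j}{j}.$$ An *admissible contour* is a curve $\Gamma$ in $\mathbb C$, parametrized continuously and injectively by $\mathbb R$, which is a finite union of regular $C^1$ arcs and which, for some $0<\varepsilon<\frac{\pi}{4p}$, comes from infinity inside the sector $|\arg (-z)|\le \frac{\pi}{4p}-\varepsilon$ and goes to infinity inside the sector $|\arg z|\le\frac{\pi}{4p}-\varepsilon$. It carries $2q$ marked points $a_1,b_1,a_2,b_2,\dots,a_q,b_q$ (the *endpoints*), in this order; the *cuts* $\Gamma[a_j,b_j]$ are regular $C^1$ arcs up to their ends. Put $J=\bigcup_j\Gamma[a_j,b_j]$ and $R(z)=\prod_{j=1}^q(z-a_j)(z-b_j)$, let $R^{1/2}$ be the branch that is analytic on $\mathbb C\setminus J$ with $R^{1/2}(z)\sim z^q$ at infinity, and let $R^{1/2}_+$ be its boundary value on $J$ from the left-hand side of $\Gamma$. Put $$T_\ell=\int_J\frac{V'(s;\boldsymbol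 t)}{R_+^{1/2}(s)}\,s^\ell\,ds,\qquad h(z)=\frac1{2\pi i}\oint\frac{V'(s;\boldsymbol t)}{R^{1/2}(s)}\frac{ds}{s-z},$$ the last integral being over a positively oriented circle around $J$ and $z$ ($h$ is a polynomial). The *endpoint equations* $\mathscr F=0$ are the $4q$ real equations $$T_\ell=0\ (0\le\ell\le q-1),\qquad T_q=-2\pi i,$$ $$\operatorname{Re}\int_{a_j}^{b_j}hR_+^{1/2}\,ds=0,\qquad \operatorname{Re}\int_{b_j}^{a_{j+1}}hR^{1/2}\,ds=0\qquad(1\le j\le q-1),$$ with integrals along $\Gamma$. Let $\eta(z)=-\int_{b_q}^z hR^{1/2}\,ds$ on $\mathbb C\setminus\Gamma(-\infty,b_q]$; on $\Gamma(-\infty,b_q]$ the function $\operatorname{Re}\eta$ is understood through its boundary values. A point $\boldsymbol t^*$ is a *regular $q$-cut point*, with contour $\Gamma^*$ and endpoints $a_j^*,b_j^*$, if for $\Gamma=\Gamma^*$ and $\boldsymbol t=\boldsymbol t^*$: $\mathscr F=0$; the cuts lie in $\{\operatorname{Re}\eta=0\}$; $h$ has no zero on $J$; $\Gamma(b_q,+\infty)$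 and $\Gamma(-\infty,a_1)$ lie in the components of $\{\operatorname{Re}\eta<0\}$ that contain $(M_1,+\infty)$ and $(-\infty,-M_2)$ respectively, for some $M_1,M_2>0$; and every gap $\Gamma(b_j,a_{j+1})$, $1\le j\le q-1$, lies in $\{\operatorname{Re}\eta<0\}$. For $\delta>0$, a $\delta$-deformation of $\Gamma^*$ is an admissible contour with $q$ cuts, parametrized so that its marked points have the same parameters as those of $\Gamma^*$, which is uniformly $\delta$-close to $\Gamma^*$ and whose cuts have derivatives $\delta$-close to those of the cuts of $\Gamma^*$. **Theorem 1.2.** Let $\boldsymbol t^*$ be a regular $q$-cut point with contour $\Gamma^*$ and endpoints $\boldsymbol x^*=(a_1^*,\dots,a_q^*,b_1^*,\dots,b_q^*)$. There are an open neighbourhood $\Omega$ of $\boldsymbol t^*$ in $\mathbb C^{2p-1}$, an open neighbourhood $U$ of $\boldsymbol x^*$ in $\mathbb C^{2q}$, a $\delta>0$ and functions $a_j,b_j:\Omega\to\mathbb C$ $(1\le j\le q)$ with $a_j(\boldsymbol t^*)=a_j^*$, $b_j(\boldsymbol t^*)=b_j^*$, such that 1. every $\boldsymbol x\in U$ is the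 vector of endpoints of some $\delta$-deformation of $\Gamma^*$; 2. for every $\boldsymbol t\in\Omega$ the endpoint equations have one and only one solution near $\boldsymbol x^*$, namely $\boldsymbol x(\boldsymbol t)=(a_1(\boldsymbol t),\dots,a_q(\boldsymbol t),b_1(\boldsymbol t),\dots,b_q(\boldsymbol t))\in U$: a $\delta$-deformation of $\Gamma^*$ satisfies $\mathscr F=0$ at the parameter $\boldsymbol t$ if and only if its vector of endpoints is $\boldsymbol x(\boldsymbol t)$; 3. for every $\boldsymbol t\in\Omega$ the $2q$ points $a_j(\boldsymbol t),b_j(\boldsymbol t)$ are distinct; 4. the functions $\operatorname{Re}a_j,\operatorname{Im}a_j,\operatorname{Re}b_j,\operatorname{Im}b_j$ are real-analytic on $\Omega$ in $\operatorname{Re}t_k,\operatorname{Im}t_k$, $1\le k\le 2p-1$. -/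

import Mathlib

open Filter Topology Set
open scoped Polynomial

/-- The external field `V(z; t) = z^{2p}/(2p) + ∑_{j=1}^{2p-1} t_j z^j / j`. The coordinate `t k`,
`k = 0, …, 2p-2`, is the parameter `t_{k+1}`. -/
noncomputable def potential (p : ℕ) (t : Fin (2 * p - 1) → ℂ) : ℂ[X] :=
  Polynomial.C (1 / ((2 * p : ℕ) : ℂ)) * Polynomial.X ^ (2 * p) +
    ∑ k : Fin (2 * p - 1),
      Polynomial.C (t k / (((k : ℕ) + 1 : ℕ) : ℂ)) * Polynomial.X ^ ((k : ℕ) + 1)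

/-- The derivative `V'(z; t)`. -/
noncomputable def dPotential (p : ℕ) (t : Fin (2 * p - 1) → ℂ) (z : ℂ) : ℂ :=
  (potential p t).derivative.eval z

/-- The closed sector `S⁺_ε = {|arg z| ≤ π/(4p) - ε}`. The sector `S⁻_ε` around the negative real
axis is its image under `z ↦ -z`. -/
def sectorPlus (p : ℕ) (ε : ℝ) : Set ℂ :=
  {z | |Complex.arg z| ≤ Real.pi / (4 * p) - ε}

/-- An admissible contour `Γ` for the external field of degree `2p`, oriented from `-∞` to `+∞`
and carrying `q = n + 1` cuts `Γ[a_j, b_j]` in this order. The cuts are cut out by the parameters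
`α₀ < β₀ < α₁ < β₁ < ⋯ < αₙ < βₙ`. -/
structure CutContour (p n : ℕ) where
  /-- the contour -/
  Γ : ℝ → ℂ
  /-- parameters of the left endpoints of the cuts -/
  α : Fin (n + 1) → ℝ
  /-- parameters of the right endpoints of the cuts -/
  β : Fin (n + 1) → ℝ
  continuous : Continuous Γ
  injective : Function.Injective Γ
  /-- `Γ` is a finite union of (regular) `C¹` arcs -/
  piecewise_C1 : ∃ P : Set ℝ, P.Finite ∧ ∀ x y : ℝ, x < y → Disjoint (Ioo x y) P →
    ContDiffOn ℝ 1 Γ (Icc x y) ∧ ∀ τ ∈ Icc x y, derivWithin Γ (Icc x y) τ ≠ 0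
  /-- `Γ` goes to infinity inside the sectors `S⁻_ε` and `S⁺_ε` -/
  sectors : ∃ ε : ℝ, 0 < ε ∧ ε < Real.pi / (4 * p) ∧ ∀ r : ℝ, ∃ τ₀ τ₁ : ℝ, τ₀ < τ₁ ∧
    (∀ τ < τ₀, -Γ τ ∈ sectorPlus p ε ∧ r ≤ ‖Γ τ‖) ∧
    (∀ τ > τ₁, Γ τ ∈ sectorPlus p ε ∧ r ≤ ‖Γ τ‖)
  α_lt_β : ∀ j, α j < β j
  β_lt_α : ∀ j : Fin n, β j.castSucc < α j.succ
  /-- each cut is a single regular `C¹` arc -/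
  cut_C1 : ∀ j, ContDiffOn ℝ 1 Γ (Icc (α j) (β j)) ∧
    ∀ τ ∈ Icc (α j) (β j), derivWithin Γ (Icc (α j) (β j)) τ ≠ 0

namespace CutContour

variable {p n : ℕ}

/-- The endpoint `a_j`. -/
def a (C : CutContour p n) (j : Fin (n + 1)) : ℂ := C.Γ (C.α j)

/-- The endpoint `b_j`. -/
def b (C : CutContour p n) (j : Fin (n + 1)) : ℂ := C.Γ (C.β j)

/-- All `2q` endpoints `(a₁, …, a_q; b₁, …, b_q)`. -/
def endpoints (C : CutContour p n) : (Fin (n + 1) → ℂ) × (Fin (n + 1) → ℂ) := (C.a, C.b)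

/-- The union `J` of the cuts. -/
def J (C : CutContour p n) : Set ℂ := ⋃ j, C.Γ '' Icc (C.α j) (C.β j)

/-- `R(z) = ∏_j (z - a_j)(z - b_j)`. -/
def R (C : CutContour p n) (z : ℂ) : ℂ := ∏ j, (z - C.a j) * (z - C.b j)

/-- The branch of `R^{1/2}` which is analytic on `ℂ \ J` and `∼ z^q` at infinity. Since
`∫_{a_j}^{b_j} ds/(z - s)` along the cut is the branch on `ℂ \ Γ[a_j, b_j]`, vanishing at infinity,
of `log ((z - a_j)/(z - b_j))`, this branch is
`∏_j (z - b_j) exp (½ ∫_{a_j}^{b_j} ds/(z - s))`; see `sqrtR_sq`, `differentiableOn_sqrtR`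
and `tendsto_sqrtR`. -/
noncomputable def sqrtR (C : CutContour p n) (z : ℂ) : ℂ :=
  ∏ j, (z - C.b j) * Complex.exp ((1 / 2) * ∫ τ in (C.α j)..(C.β j), deriv C.Γ τ / (z - C.Γ τ))

theorem deriv_eqOn_cut (C : CutContour p n) (j : Fin (n + 1)) :
    EqOn (deriv C.Γ) (derivWithin C.Γ (Icc (C.α j) (C.β j))) (Ioo (C.α j) (C.β j)) :=
  fun _ hτ => (derivWithin_of_mem_nhds (Icc_mem_nhds hτ.1 hτ.2)).symm

theorem integral_cut_eq (C : CutContour p n) (j : Fin (n + 1)) (z : ℂ) :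
    ∫ τ in (C.α j)..(C.β j), deriv C.Γ τ / (z - C.Γ τ) =
      ∫ τ in (C.α j)..(C.β j), derivWithin C.Γ (Icc (C.α j) (C.β j)) τ / (z - C.Γ τ) := by
  rw [intervalIntegral.integral_of_le (C.α_lt_β j).le,
    intervalIntegral.integral_of_le (C.α_lt_β j).le, MeasureTheory.integral_Ioc_eq_integral_Ioo,
    MeasureTheory.integral_Ioc_eq_integral_Ioo]
  refine MeasureTheory.setIntegral_congr_fun measurableSet_Ioo fun τ hτ => ?_
  simp only [C.deriv_eqOn_cut j hτ]

theorem continuousOn_derivWithin_cut (C : CutContour p n) (j : Fin (n + 1)) :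
    ContinuousOn (derivWithin C.Γ (Icc (C.α j) (C.β j))) (Icc (C.α j) (C.β j)) :=
  (C.cut_C1 j).1.continuousOn_derivWithin (uniqueDiffOn_Icc (C.α_lt_β j)) le_rfl

theorem exp_integral_cut (C : CutContour p n) (j : Fin (n + 1)) {z : ℂ} (hz : z ∉ C.J) :
    (z - C.b j) * Complex.exp (∫ τ in (C.α j)..(C.β j), deriv C.Γ τ / (z - C.Γ τ)) =
      z - C.a j := by
  have hab := C.α_lt_β j
  rw [integral_cut_eq]
  set A := C.α j
  set B := C.β j
  set g : ℝ → ℂ := fun τ => derivWithin C.Γ (Icc A B) τ / (z - C.Γ τ) with hg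
  have hne : ∀ τ ∈ Icc A B, z - C.Γ τ ≠ 0 := fun τ hτ h0 =>
    hz (mem_iUnion.2 ⟨j, τ, hτ, (sub_eq_zero.1 h0).symm⟩)
  have hgc : ContinuousOn g (Icc A B) :=
    (C.continuousOn_derivWithin_cut j).div (continuousOn_const.sub C.continuous.continuousOn) hne
  have hint : IntervalIntegrable g MeasureTheory.volume A B := by
    apply ContinuousOn.intervalIntegrable; rwa [uIcc_of_le hab.le]
  have hIc : ContinuousOn (fun x => ∫ τ in A..x, g τ) (Icc A B) :=
    intervalIntegral.continuousOn_primitive_interval' hint (by simp) |>.mono (by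
      rw [uIcc_of_le hab.le])
  have key := constant_of_has_deriv_right_zero
    (f := fun x => (z - C.Γ x) * Complex.exp (∫ τ in A..x, g τ)) (a := A) (b := B)
    ((continuousOn_const.sub C.continuous.continuousOn).mul
      (Complex.continuous_exp.comp_continuousOn hIc)) (fun x hx => by
      have hxI : x ∈ Icc A B := Ico_subset_Icc_self hx
      have hmem : Icc A B ∈ 𝓝[≥] x := mem_of_superset (Icc_mem_nhdsGE hx.2)
        (Icc_subset_Icc_left hx.1)
      have h1 : HasDerivWithinAt C.Γ (derivWithin C.Γ (Icc A B) x) (Ici x) x :=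
        ((((C.cut_C1 j).1.differentiableOn one_ne_zero) x hxI).hasDerivWithinAt).mono_of_mem_nhdsWithin
          hmem
      have h2 : HasDerivWithinAt (fun x => ∫ τ in A..x, g τ) (g x) (Ici x) x := by
        have hcx : ContinuousWithinAt g (Ioi x) x :=
          ((hgc x hxI).mono_of_mem_nhdsWithin hmem).mono Ioi_subset_Ici_self
        refine intervalIntegral.integral_hasDerivWithinAt_right
          (hint.mono_set (by rw [uIcc_of_le hx.1, uIcc_of_le hab.le]; exact Icc_subset_Icc_right hxI.2))
          ?_ hcx
        exact ⟨Ioc x B, Ioc_mem_nhdsGT hx.2, (hgc.mono (fun y hy =>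
          ⟨hx.1.trans hy.1.le, hy.2⟩)).aestronglyMeasurable measurableSet_Ioc⟩
      have h3 := (h1.const_sub z).mul h2.cexp
      refine h3.congr_deriv ?_
      have hgx : derivWithin C.Γ (Icc A B) x = g x * (z - C.Γ x) :=
        (div_mul_cancel₀ _ (hne x hxI)).symm
      rw [hgx]
      ring)
  have := key B ⟨hab.le, le_rfl⟩
  simpa [b, a] using this

/-- `sqrtR` is a square root of `R` off the cuts. -/
theorem sqrtR_sq (C : CutContour p n) {z : ℂ} (hz : z ∉ C.J) : C.sqrtR z ^ 2 = C.R z := by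
  rw [sqrtR, R, ← Finset.prod_pow]
  refine Finset.prod_congr rfl fun j _ => ?_
  rw [← C.exp_integral_cut j hz, mul_pow, sq (Complex.exp _), ← Complex.exp_add]
  rw [← add_mul, add_halves, one_mul]
  ring

theorem isCompact_J (C : CutContour p n) : IsCompact C.J :=
  isCompact_iUnion fun _ => isCompact_Icc.image C.continuous

/-- `sqrtR` is analytic off the cuts. -/
theorem differentiableOn_sqrtR (C : CutContour p n) : DifferentiableOn ℂ C.sqrtR C.Jᶜ := by
  have hmain : ∀ j, DifferentiableOn ℂ
      (fun z => ∫ τ in (C.α j)..(C.β j), deriv C.Γ τ / (z - C.Γ τ)) C.Jᶜ := by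
    intro j z₀ hz₀
    apply DifferentiableAt.differentiableWithinAt
    have hab := C.α_lt_β j
    simp only [integral_cut_eq]
    obtain ⟨r, hr, hball⟩ := Metric.isOpen_iff.1 C.isCompact_J.isClosed.isOpen_compl z₀ hz₀
    obtain ⟨K, hK⟩ := isCompact_Icc.exists_bound_of_continuousOn (C.continuousOn_derivWithin_cut j)
    have hdist : ∀ τ ∈ Icc (C.α j) (C.β j), ∀ z ∈ Metric.ball z₀ (r / 2),
        r / 2 ≤ ‖z - C.Γ τ‖ := by
      intro τ hτ z hz
      by_contra! hlt
      have : C.Γ τ ∈ Metric.ball z₀ r := by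
        rw [Metric.mem_ball, dist_comm, dist_eq_norm]
        rw [Metric.mem_ball, dist_comm, dist_eq_norm] at hz
        calc ‖z₀ - C.Γ τ‖ = ‖(z₀ - z) + (z - C.Γ τ)‖ := by ring_nf
          _ ≤ _ := norm_add_le _ _
          _ < r := by linarith
      exact hball this (mem_iUnion.2 ⟨j, τ, hτ, rfl⟩)
    have hcont : ∀ z ∈ Metric.ball z₀ (r / 2), ∀ k : ℕ, ContinuousOn
        (fun τ => derivWithin C.Γ (Icc (C.α j) (C.β j)) τ / (z - C.Γ τ) ^ k)
        (Icc (C.α j) (C.β j)) := fun z hz k =>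
      (C.continuousOn_derivWithin_cut j).div
        ((continuousOn_const.sub C.continuous.continuousOn).pow k)
        fun τ hτ => pow_ne_zero _ (norm_pos_iff.1 ((half_pos hr).trans_le (hdist τ hτ z hz)))
    have hsub : uIoc (C.α j) (C.β j) ⊆ Icc (C.α j) (C.β j) := by
      rw [uIoc_of_le hab.le]; exact Ioc_subset_Icc_self
    have hz₀m : z₀ ∈ Metric.ball z₀ (r / 2) := Metric.mem_ball_self (half_pos hr)
    refine (intervalIntegral.hasDerivAt_integral_of_dominated_loc_of_deriv_le
      (F' := fun z τ => -(derivWithin C.Γ (Icc (C.α j) (C.β j)) τ) / (z - C.Γ τ) ^ 2)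
      (bound := fun _ => K / (r / 2) ^ 2)
      (Metric.ball_mem_nhds z₀ (half_pos hr)) ?_ ?_ ?_ ?_ ?_ ?_).2.differentiableAt
    · filter_upwards [Metric.ball_mem_nhds z₀ (half_pos hr)] with z hz
      have := (hcont z hz 1).mono hsub
      simp only [pow_one] at this
      exact this.aestronglyMeasurable measurableSet_uIoc
    · apply ContinuousOn.intervalIntegrable
      rw [uIcc_of_le hab.le]
      simpa using hcont z₀ hz₀m 1
    · have := ((hcont z₀ hz₀m 2).mono hsub).neg
      simp only [neg_div]
      exact this.aestronglyMeasurable measurableSet_uIoc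
    · refine .of_forall fun τ hτ z hz => ?_
      rw [norm_div, norm_neg, norm_pow]
      exact div_le_div₀ ((norm_nonneg _).trans (hK τ (hsub hτ))) (hK τ (hsub hτ))
        (by positivity) (pow_le_pow_left₀ (half_pos hr).le (hdist τ (hsub hτ) z hz) 2)
    · exact intervalIntegrable_const
    · refine .of_forall fun τ hτ z hz => ?_
      have hne : z - C.Γ τ ≠ 0 :=
        norm_pos_iff.1 ((half_pos hr).trans_le (hdist τ (hsub hτ) z hz))
      have := (((hasDerivAt_id z).sub_const (C.Γ τ)).fun_inv hne).const_mul
        (derivWithin C.Γ (Icc (C.α j) (C.β j)) τ)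
      simpa [div_eq_mul_inv] using this
  unfold sqrtR
  refine DifferentiableOn.fun_finsetProd fun j _ => ?_
  exact (differentiableOn_id.sub_const _).mul ((hmain j).const_mul _).cexp

/-- `sqrtR z ∼ z^q` at infinity. -/
theorem tendsto_sqrtR (C : CutContour p n) :
    Tendsto (fun z => C.sqrtR z / z ^ (n + 1)) (Bornology.cobounded ℂ) (𝓝 1) := by
  have hinv : Tendsto (fun z : ℂ => z⁻¹) (Bornology.cobounded ℂ) (𝓝 0) :=
    tendsto_inv₀_cobounded
  have hI : ∀ j, Tendsto (fun z => ∫ τ in (C.α j)..(C.β j), deriv C.Γ τ / (z - C.Γ τ))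
      (Bornology.cobounded ℂ) (𝓝 0) := by
    intro j
    have hab := C.α_lt_β j
    simp only [integral_cut_eq]
    obtain ⟨K, hK⟩ := isCompact_Icc.exists_bound_of_continuousOn (C.continuousOn_derivWithin_cut j)
    obtain ⟨M, hM⟩ := isCompact_Icc.exists_bound_of_continuousOn
      (C.continuous.continuousOn (s := Icc (C.α j) (C.β j)))
    have hn : Tendsto (fun z : ℂ => ‖z‖ - M) (Bornology.cobounded ℂ) atTop :=
      tendsto_atTop_add_const_right _ (-M) tendsto_norm_cobounded_atTop
    have hlim : Tendsto (fun z : ℂ => K / (‖z‖ - M) * |C.β j - C.α j|)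
        (Bornology.cobounded ℂ) (𝓝 0) := by
      simpa using (hn.const_div_atTop K).mul_const (|C.β j - C.α j|)
    refine squeeze_zero_norm' ?_ hlim
    filter_upwards [hn.eventually_gt_atTop 0] with z hz
    refine intervalIntegral.norm_integral_le_of_norm_le_const fun τ hτ => ?_
    rw [uIoc_of_le hab.le] at hτ
    have hτ' := Ioc_subset_Icc_self hτ
    rw [norm_div]
    exact div_le_div₀ ((norm_nonneg _).trans (hK τ hτ')) (hK τ hτ') hz
      ((sub_le_sub_left (hM τ hτ') _).trans (norm_sub_norm_le _ _))
  have hfac : ∀ j, Tendsto (fun z => (1 - C.b j * z⁻¹) *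
      Complex.exp ((1 / 2) * ∫ τ in (C.α j)..(C.β j), deriv C.Γ τ / (z - C.Γ τ)))
      (Bornology.cobounded ℂ) (𝓝 1) := by
    intro j
    have h1 := (hinv.const_mul (C.b j)).const_sub 1
    have h2 := (Complex.continuous_exp.tendsto _).comp ((hI j).const_mul (1 / 2))
    simpa using h1.mul h2
  have hprod := tendsto_finsetProd (Finset.univ : Finset (Fin (n + 1))) fun j _ => hfac j
  simp only [Finset.prod_const_one] at hprod
  refine hprod.congr' ?_
  have hne : ∀ᶠ z : ℂ in Bornology.cobounded ℂ, z ≠ 0 := by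
    filter_upwards [tendsto_norm_cobounded_atTop.eventually_gt_atTop (0 : ℝ)] with z hz
    exact norm_pos_iff.1 hz
  filter_upwards [hne] with z hz
  have : z ^ (n + 1) = ∏ _j : Fin (n + 1), z := by simp
  rw [sqrtR, this, ← Finset.prod_div_distrib]
  refine Finset.prod_congr rfl fun j _ => ?_
  field_simp

/-- The boundary value `R₊^{1/2}(Γ(τ))` from the left-hand side of the oriented contour: the left
normal direction at `Γ(τ)` is `i Γ'(τ)`. -/
noncomputable def sqrtRPlus (C : CutContour p n) (τ : ℝ) : ℂ :=
  limUnder (𝓝[>] (0 : ℝ)) fun ε : ℝ => C.sqrtR (C.Γ τ + ε * (Complex.I * deriv C.Γ τ))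

/-- The moments `T_ℓ = ∫_J V'(s) s^ℓ / R₊^{1/2}(s) ds`. -/
noncomputable def moment (C : CutContour p n) (t : Fin (2 * p - 1) → ℂ) (l : ℕ) : ℂ :=
  ∑ j, ∫ τ in (C.α j)..(C.β j),
    dPotential p t (C.Γ τ) / C.sqrtRPlus τ * C.Γ τ ^ l * deriv C.Γ τ

/-- The polynomial `h(z) = (2πi)⁻¹ ∮ V'(s) / R^{1/2}(s) ds/(s - z)` over a positively oriented
circle around `J` and `z`. The integral does not depend on the radius `ρ` once `ρ` is large. -/
noncomputable def h (C : CutContour p n) (t : Fin (2 * p - 1) → ℂ) (z : ℂ) : ℂ :=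
  limUnder (atTop : Filter ℝ) fun ρ : ℝ =>
    (2 * Real.pi * Complex.I)⁻¹ * ∮ s in C(0, ρ), dPotential p t s / C.sqrtR s / (s - z)

/-- The map whose zeros are the solutions of the endpoint equations. Its entries are, for
`q = n + 1`, the `q + 1` complex numbers `T_ℓ + 2πi δ_{ℓq}` (`ℓ = 0, …, q`), the `q - 1` real
numbers `Re ∫_{a_j}^{b_j} h R₊^{1/2} ds` and the `q - 1` real numbers
`Re ∫_{b_j}^{a_{j+1}} h R^{1/2} ds` (`j = 1, …, q - 1`), the integrals being along `Γ`. -/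
noncomputable def endpointMap (C : CutContour p n) (t : Fin (2 * p - 1) → ℂ) :
    (Fin (n + 2) → ℂ) × (Fin n → ℝ) × (Fin n → ℝ) :=
  (fun l => C.moment t l + if (l : ℕ) = n + 1 then 2 * Real.pi * Complex.I else 0,
   fun j => (∫ τ in (C.α j.castSucc)..(C.β j.castSucc),
      C.h t (C.Γ τ) * C.sqrtRPlus τ * deriv C.Γ τ).re,
   fun j => (∫ τ in (C.β j.castSucc)..(C.α j.succ),
      C.h t (C.Γ τ) * C.sqrtR (C.Γ τ) * deriv C.Γ τ).re)

/-- The slit `Γ(-∞, b_q]`. -/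
def slit (C : CutContour p n) : Set ℂ := C.Γ '' Iic (C.β (Fin.last n))

/-- `η` is the function `η_q(z) = -∫_{b_q}^z h R^{1/2} ds` on `ℂ \ Γ(-∞, b_q]`, that is, the
primitive of `-h R^{1/2}` there which vanishes at `b_q`. -/
def IsEta (C : CutContour p n) (t : Fin (2 * p - 1) → ℂ) (η : ℂ → ℂ) : Prop :=
  (∀ z ∉ C.slit, HasDerivAt η (-(C.h t z * C.sqrtR z)) z) ∧
    Tendsto η (𝓝[C.slitᶜ] (C.b (Fin.last n))) (𝓝 0)

/-- `{z : Re η_q(z) = 0}`; at the points of the slit, where `η` is not defined, `Re η` is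
understood through its boundary values. -/
def zeroSet (C : CutContour p n) (η : ℂ → ℂ) : Set ℂ :=
  {z | Tendsto (fun w => (η w).re) (𝓝[C.slitᶜ] z) (𝓝 0)}

/-- `{z : Re η_q(z) < 0}`, with the same convention on the slit. -/
def stableLands (C : CutContour p n) (η : ℂ → ℂ) : Set ℂ :=
  {z | ∃ c < 0, Tendsto (fun w => (η w).re) (𝓝[C.slitᶜ] z) (𝓝 c)}

/-- `t` is a regular `q`-cut point, `q = n + 1`, with contour `Γ`. (The endpoints are distinct
because `Γ` is injective.) -/
structure IsRegular (C : CutContour p n) (t : Fin (2 * p - 1) → ℂ) : Prop where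
  /-- the endpoint equations hold -/
  endpoint_eq : C.endpointMap t = 0
  /-- no zero of `h` lies on the cuts -/
  h_ne_zero : ∀ z ∈ C.J, C.h t z ≠ 0
  exists_eta : ∃ η : ℂ → ℂ, C.IsEta t η ∧
    /- each cut is an arc of the critical graph -/
    C.J ⊆ C.zeroSet η ∧
    /- `Γ(b_q, +∞)` lies in the component of `{Re η < 0}` which contains `(M₁, +∞)` -/
    (∃ M : ℝ, 0 < M ∧ (∀ x : ℝ, M < x → (x : ℂ) ∈ C.stableLands η) ∧
      C.Γ '' Ioi (C.β (Fin.last n)) ⊆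
        connectedComponentIn (C.stableLands η) ((M + 1 : ℝ) : ℂ)) ∧
    /- `Γ(-∞, a_1)` lies in the component of `{Re η < 0}` which contains `(-∞, -M₂)` -/
    (∃ M : ℝ, 0 < M ∧ (∀ x : ℝ, x < -M → (x : ℂ) ∈ C.stableLands η) ∧
      C.Γ '' Iio (C.α 0) ⊆
        connectedComponentIn (C.stableLands η) ((-M - 1 : ℝ) : ℂ)) ∧
    /- every gap `Γ(b_j, a_{j+1})` lies in (a component of) `{Re η < 0}` -/
    ∀ j : Fin n, C.Γ '' Ioo (C.β j.castSucc) (C.α j.succ) ⊆ C.stableLands η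

/-- `C` is a `δ`-small deformation of `C₀`: the two contours are uniformly `δ`-close, and their
cuts are `δ`-close in `C¹`. -/
def CloseTo (C C₀ : CutContour p n) (δ : ℝ) : Prop :=
  C.α = C₀.α ∧ C.β = C₀.β ∧ (∀ τ, ‖C.Γ τ - C₀.Γ τ‖ < δ) ∧
    ∀ j, ∀ τ ∈ Ioo (C.α j) (C.β j), ‖deriv C.Γ τ - deriv C₀.Γ τ‖ < δ

end CutContour

/-! There are 4q real unknowns and 4q real equations, so the statement is an instance of the
real-analytic implicit function theorem (`exists_analytic_implicit`). Two things have to be shown: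
near the given solution the equations depend on the parameters and the endpoints alone, and
analytically; and their differential with respect to the endpoints is injective.

The moments. By coprimality of R and R', a differential G dz / R^{1/2} equals d(w R^{1/2}) + k
R^{3/2} dz with polynomials w, k (`exists_reduction`). The density k R₊^{3/2} is Lipschitz and
vanishes at the ends of the cuts, so its Cauchy integral obeys a Plemelj formula without endpoint
singularities (`exists_entire_cauchyCut`). Hence an integral over the cuts is -1/2 times an integral
over a large circle, each moment is -πi times a Laurent coefficient of V' / R^{1/2} at infinity
(`moment_eq_coeff`), and h is the polynomial part of that expansion (`h_eq`). All these coefficients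
are polynomials in the parameters and the endpoints.

The integrals along cuts and gaps. On the double cover of the plane branched at the endpoints,
integrals of h R^{1/2} along two neighbouring paths between the same branch points agree up to sign
(`exists_integral_comparison`); the sign is harmless, since only the vanishing of a real part is at
stake. The contour can therefore be replaced by the image of the original arc under the affine map
that carries its ends to the new endpoints. The integrand along this image is an analytic map into
the Banach algebra of continuous functions on an interval (`exists_reference_integral`).

Injectivity. A variation of the endpoints changes h R^{1/2} by P / R^{1/2}, where P is h-dot times R
plus half of h times R-dot. If the moments are stationary, P / R^{1/2} = O(z⁻²) at infinity
(`exists_variation`), so P dz / R^{1/2} is a regular differential on the compact hyperelliptic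
curve. If the real parts of the other integrals are stationary too, its periods are purely
imaginary. The real part u of its integral is then single valued on the complement of the cuts, and
after subtraction of a constant the exchange of sheets acts on it by a sign. Thus |u| lives on the
Riemann sphere and is locally |Re g| with g holomorphic in a chart of the curve. The maximum
principle makes g constant, whence P = 0 (`eq_zero_of_re_integral_eq_zero`). At an endpoint R = 0
and h ≠ 0, so R-dot vanishes there, which says that the endpoint does not move
(`variation_eq_zero`).

Finally, every nearby vector of endpoints is realized by composing the contour with a small
perturbation of the identity supported near the old endpoints (`exists_deformation`). -/

/-! ### Nearly straight arcs and the Cauchy kernel across them. -/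

/-- On `[u, v]` the arc `γ` is close, in the Lipschitz sense, to a linear path of velocity `c`. -/
def NearlyLinear (γ : ℝ → ℂ) (c : ℂ) (u v : ℝ) : Prop :=
  c ≠ 0 ∧ ∀ τ ∈ Icc u v, ∀ τ' ∈ Icc u v,
    ‖γ τ - γ τ' - c * ((τ : ℂ) - τ')‖ ≤ ‖c‖ / 4 * |τ - τ'|

namespace NearlyLinear

variable {γ : ℝ → ℂ} {c : ℂ} {u v : ℝ}

theorem norm_div_sub_le (h : NearlyLinear γ c u v) {τ τ' : ℝ} (hτ : τ ∈ Icc u v)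
    (hτ' : τ' ∈ Icc u v) : ‖(γ τ - γ τ') / c - ((τ - τ' : ℝ) : ℂ)‖ ≤ |τ - τ'| / 4 := by
  have hc := norm_pos_iff.2 h.1
  have : (γ τ - γ τ') / c - ((τ - τ' : ℝ) : ℂ) = (γ τ - γ τ' - c * ((τ : ℂ) - τ')) / c := by
    have := h.1
    field_simp
    push_cast
    ring
  rw [this, norm_div, div_le_iff₀ hc]
  linarith [h.2 τ hτ τ' hτ']

theorem abs_re_le (h : NearlyLinear γ c u v) {τ τ' : ℝ} (hτ : τ ∈ Icc u v)
    (hτ' : τ' ∈ Icc u v) : |((γ τ - γ τ') / c).re - (τ - τ')| ≤ |τ - τ'| / 4 := by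
  have := (Complex.abs_re_le_norm _).trans (h.norm_div_sub_le hτ hτ')
  simpa using this

theorem abs_im_le (h : NearlyLinear γ c u v) {τ τ' : ℝ} (hτ : τ ∈ Icc u v)
    (hτ' : τ' ∈ Icc u v) : |((γ τ - γ τ') / c).im| ≤ |τ - τ'| / 4 := by
  have := (Complex.abs_im_le_norm _).trans (h.norm_div_sub_le hτ hτ')
  simpa using this

theorem re_ge (h : NearlyLinear γ c u v) {τ τ' : ℝ} (hτ : τ ∈ Icc u v)
    (hτ' : τ' ∈ Icc u v) (hle : τ' ≤ τ) : 3 / 4 * (τ - τ') ≤ ((γ τ - γ τ') / c).re := by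
  have := abs_le.1 (h.abs_re_le hτ hτ')
  rw [abs_of_nonneg (sub_nonneg.2 hle)] at this
  linarith [this.1]

theorem abs_re_ge (h : NearlyLinear γ c u v) {τ τ' : ℝ} (hτ : τ ∈ Icc u v)
    (hτ' : τ' ∈ Icc u v) : 3 / 4 * |τ - τ'| ≤ |((γ τ - γ τ') / c).re| := by
  have h1 := h.abs_re_le hτ hτ'
  have h2 : |τ - τ'| - |((γ τ - γ τ') / c).re| ≤ |(τ - τ') - ((γ τ - γ τ') / c).re| :=
    abs_sub_abs_le_abs_sub _ _
  rw [abs_sub_comm (τ - τ') (Complex.re _)] at h2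
  linarith

theorem norm_ge (h : NearlyLinear γ c u v) {τ τ' : ℝ} (hτ : τ ∈ Icc u v)
    (hτ' : τ' ∈ Icc u v) : 3 / 4 * ‖c‖ * |τ - τ'| ≤ ‖γ τ - γ τ'‖ := by
  have h1 := (h.abs_re_ge hτ hτ').trans (Complex.abs_re_le_norm _)
  rw [norm_div, le_div_iff₀ (norm_pos_iff.2 h.1)] at h1
  linarith

theorem norm_le (h : NearlyLinear γ c u v) {τ τ' : ℝ} (hτ : τ ∈ Icc u v)
    (hτ' : τ' ∈ Icc u v) : ‖γ τ - γ τ'‖ ≤ 2 * ‖c‖ * |τ - τ'| := by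
  have h1 := h.2 τ hτ τ' hτ'
  have h2 : ‖c * ((τ : ℂ) - τ')‖ = ‖c‖ * |τ - τ'| := by
    rw [norm_mul, ← Complex.ofReal_sub, Complex.norm_real, Real.norm_eq_abs]
  have h3 := norm_add_le (γ τ - γ τ' - c * ((τ : ℂ) - τ')) (c * ((τ : ℂ) - τ'))
  rw [sub_add_cancel] at h3
  nlinarith [norm_nonneg c, abs_nonneg (τ - τ'), mul_nonneg (norm_nonneg c) (abs_nonneg (τ - τ'))]

theorem continuousOn (h : NearlyLinear γ c u v) : ContinuousOn γ (Icc u v) := by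
  have : LipschitzOnWith (Real.toNNReal (2 * ‖c‖)) γ (Icc u v) := by
    refine LipschitzOnWith.of_dist_le_mul fun x hx y hy => ?_
    rw [dist_eq_norm, Real.dist_eq, Real.coe_toNNReal _ (by positivity)]
    exact h.norm_le hx hy
  exact this.continuousOn

/-- After division by `c` the two points have the same abscissa, while the abscissa grows along the
arc at rate at least 3/4. So a line of direction `I * c` meets the arc at most once. -/
theorem eq_of_add_eq (h : NearlyLinear γ c u v) {τ τ' s : ℝ} (hτ : τ ∈ Icc u v)
    (hτ' : τ' ∈ Icc u v) (heq : γ τ + s * (Complex.I * c) = γ τ') : τ = τ' := by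
  have hc := h.1
  have h1 : (γ τ - γ τ') / c = -(s * Complex.I) := by
    rw [← heq]; field_simp; ring
  have h2 := h.abs_re_ge hτ hτ'
  rw [h1] at h2
  simp at h2
  by_contra hne
  have : 0 < |τ - τ'| := abs_pos.2 (sub_ne_zero.2 hne)
  linarith

/-- A point whose abscissa is in the range of that of the arc lies on a normal to the arc. -/
theorem exists_eq_add (h : NearlyLinear γ c u v) {z : ℂ} {u' v' : ℝ}
    (hu : u ≤ u') (hv : v' ≤ v) (huv' : u' ≤ v')
    (hz1 : (γ u' / c).re ≤ (z / c).re) (hz2 : (z / c).re ≤ (γ v' / c).re) :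
    ∃ τ ∈ Icc u' v', ∃ s : ℝ, z = γ τ + s * (Complex.I * c) ∧ (z / c).re = (γ τ / c).re := by
  have hcont : ContinuousOn (fun τ => (γ τ / c).re) (Icc u' v') :=
    Complex.continuous_re.comp_continuousOn
      ((h.continuousOn.mono (Icc_subset_Icc hu hv)).div_const c)
  obtain ⟨τ, hτ, hτe⟩ := intermediate_value_Icc huv' hcont ⟨hz1, hz2⟩
  refine ⟨τ, hτ, ((z - γ τ) / c).im, ?_, hτe.symm⟩
  have hc := h.1
  have h1 : (z - γ τ) / c = ((z - γ τ) / c).im * Complex.I := by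
    apply Complex.ext
    · simp only [sub_div, Complex.sub_re, Complex.mul_re, Complex.ofReal_re, Complex.I_re,
        Complex.ofReal_im, Complex.I_im, Complex.sub_im]
      simp only at hτe
      rw [hτe]; ring
    · simp
  have h2 : z - γ τ = ((z - γ τ) / c) * c := by field_simp
  linear_combination h2 + c * h1

theorem re_add_sub (hc : c ≠ 0) {z w : ℂ} {s : ℝ} :
    ((z + s * (Complex.I * c) - w) / (Complex.I * c)).re = s + ((z - w) / c).im ∧
    ((z + s * (Complex.I * c) - w) / (Complex.I * c)).im = -((z - w) / c).re := by
  have h1 : (z + s * (Complex.I * c) - w) / (Complex.I * c) = s + (-Complex.I) * ((z - w) / c) := by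
    field_simp
    have := Complex.I_sq
    linear_combination (-(w - z)) * this
  rw [h1]
  constructor <;> simp

/-- In the frame `I * c` the imaginary part vanishes only for `τ = τ'`, and then the real part is `s
> 0`. Consequently the principal logarithm is smooth along the whole arc when seen from its left
side, and provides a primitive of the Cauchy kernel. -/
theorem mem_slitPlane (h : NearlyLinear γ c u v) {τ τ' s : ℝ} (hτ : τ ∈ Icc u v)
    (hτ' : τ' ∈ Icc u v) (hs : 0 < s) :
    (γ τ + s * (Complex.I * c) - γ τ') / (Complex.I * c) ∈ Complex.slitPlane := by
  rw [Complex.mem_slitPlane_iff, (re_add_sub h.1).1, (re_add_sub h.1).2]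
  by_cases he : τ = τ'
  · left; simp [he, hs]
  · right
    have h1 := h.abs_re_ge hτ hτ'
    have : 0 < |τ - τ'| := abs_pos.2 (sub_ne_zero.2 he)
    intro h0
    rw [neg_eq_zero.1 h0] at h1
    simp at h1
    linarith

theorem neg_mem_slitPlane (h : NearlyLinear γ c u v) {τ τ' s : ℝ} (hτ : τ ∈ Icc u v)
    (hτ' : τ' ∈ Icc u v) (hs : s < 0) :
    -((γ τ + s * (Complex.I * c) - γ τ') / (Complex.I * c)) ∈ Complex.slitPlane := by
  rw [Complex.mem_slitPlane_iff, Complex.neg_re, Complex.neg_im, (re_add_sub h.1).1,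
    (re_add_sub h.1).2]
  by_cases he : τ = τ'
  · left; simp [he, hs]
  · right
    have h1 := h.abs_re_ge hτ hτ'
    have : 0 < |τ - τ'| := abs_pos.2 (sub_ne_zero.2 he)
    intro h0
    rw [neg_neg] at h0
    rw [h0] at h1
    simp at h1
    linarith

end NearlyLinear

/-- Integrability of the Cauchy kernel of an arc off the arc. -/
theorem intervalIntegrable_div_sub {γ m : ℝ → ℂ} {u v : ℝ} (huv : u ≤ v)
    (hγ : ContinuousOn γ (Icc u v)) (hm : IntervalIntegrable m MeasureTheory.volume u v)
    {z : ℂ} (hz : ∀ τ ∈ Icc u v, z ≠ γ τ) :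
    IntervalIntegrable (fun τ => m τ / (z - γ τ)) MeasureTheory.volume u v := by
  simp only [div_eq_mul_inv]
  refine hm.mul_continuousOn ?_
  rw [uIcc_of_le huv]
  exact (continuousOn_const.sub hγ).inv₀ fun τ hτ => sub_ne_zero.2 (hz τ hτ)

namespace NearlyLinear

variable {γ m : ℝ → ℂ} {c : ℂ} {u v : ℝ}

theorem integral_left (h : NearlyLinear γ c u v) (huv : u ≤ v)
    (hd : ∀ τ ∈ Ioo u v, HasDerivAt γ (m τ) τ)
    (hm : IntervalIntegrable m MeasureTheory.volume u v) {τ s : ℝ} (hτ : τ ∈ Icc u v)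
    (hs : 0 < s) {z : ℂ} (hz : z = γ τ + s * (Complex.I * c)) :
    ∫ x in u..v, m x / (z - γ x) =
      Complex.log ((z - γ u) / (Complex.I * c)) - Complex.log ((z - γ v) / (Complex.I * c)) := by
  have hIc : Complex.I * c ≠ 0 := mul_ne_zero Complex.I_ne_zero h.1
  have hmem : ∀ x ∈ Icc u v, (z - γ x) / (Complex.I * c) ∈ Complex.slitPlane := fun x hx => by
    rw [hz]; exact h.mem_slitPlane hτ hx hs
  have hne : ∀ x ∈ Icc u v, z ≠ γ x := fun x hx h0 => by
    have := hmem x hx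
    rw [h0, sub_self, zero_div] at this
    exact Complex.slitPlane_ne_zero this rfl
  have key := intervalIntegral.integral_eq_sub_of_hasDerivAt_of_le huv
    (f := fun x => -Complex.log ((z - γ x) / (Complex.I * c))) (f' := fun x => m x / (z - γ x))
    (ContinuousOn.neg (ContinuousOn.clog ((continuousOn_const.sub h.continuousOn).div_const _)
      hmem)) (fun x hx => by
        have h1 := (((hd x hx).const_sub z).div_const (Complex.I * c)).clog_real
          (hmem x (Ioo_subset_Icc_self hx))
        refine h1.neg.congr_deriv ?_
        have := sub_ne_zero.2 (hne x (Ioo_subset_Icc_self hx))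
        have hc := h.1
        field_simp) (intervalIntegrable_div_sub huv h.continuousOn hm hne)
  rw [key]; ring

/-- From the right side the chords avoid the opposite half-line, so the logarithm of the negated
chord is the usable primitive. -/
theorem integral_right (h : NearlyLinear γ c u v) (huv : u ≤ v)
    (hd : ∀ τ ∈ Ioo u v, HasDerivAt γ (m τ) τ)
    (hm : IntervalIntegrable m MeasureTheory.volume u v) {τ s : ℝ} (hτ : τ ∈ Icc u v)
    (hs : s < 0) {z : ℂ} (hz : z = γ τ + s * (Complex.I * c)) :
    ∫ x in u..v, m x / (z - γ x) =
      Complex.log (-((z - γ u) / (Complex.I * c))) -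
        Complex.log (-((z - γ v) / (Complex.I * c))) := by
  have hIc : Complex.I * c ≠ 0 := mul_ne_zero Complex.I_ne_zero h.1
  have hmem : ∀ x ∈ Icc u v, -((z - γ x) / (Complex.I * c)) ∈ Complex.slitPlane := fun x hx => by
    rw [hz]; exact h.neg_mem_slitPlane hτ hx hs
  have hne : ∀ x ∈ Icc u v, z ≠ γ x := fun x hx h0 => by
    have := hmem x hx
    rw [h0, sub_self, zero_div, neg_zero] at this
    exact Complex.slitPlane_ne_zero this rfl
  have key := intervalIntegral.integral_eq_sub_of_hasDerivAt_of_le huv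
    (f := fun x => -Complex.log (-((z - γ x) / (Complex.I * c)))) (f' := fun x => m x / (z - γ x))
    (ContinuousOn.neg (ContinuousOn.clog
      ((continuousOn_const.sub h.continuousOn).div_const _).neg hmem)) (fun x hx => by
        have h1 := (((hd x hx).const_sub z).div_const (Complex.I * c)).fun_neg.clog_real
          (hmem x (Ioo_subset_Icc_self hx))
        refine h1.neg.congr_deriv ?_
        have := sub_ne_zero.2 (hne x (Ioo_subset_Icc_self hx))
        have hc := h.1
        field_simp) (intervalIntegrable_div_sub huv h.continuousOn hm hne)
  rw [key]; ring

theorem im_neg_of_lt (h : NearlyLinear γ c u v) {τ τ' s : ℝ} (hτ : τ ∈ Icc u v)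
    (hτ' : τ' ∈ Icc u v) (hlt : τ' < τ) :
    ((γ τ + s * (Complex.I * c) - γ τ') / (Complex.I * c)).im < 0 := by
  rw [(re_add_sub h.1).2]
  linarith [h.re_ge hτ hτ' hlt.le]

theorem im_pos_of_lt (h : NearlyLinear γ c u v) {τ τ' s : ℝ} (hτ : τ ∈ Icc u v)
    (hτ' : τ' ∈ Icc u v) (hlt : τ < τ') :
    0 < ((γ τ + s * (Complex.I * c) - γ τ') / (Complex.I * c)).im := by
  rw [(re_add_sub h.1).2]
  have := h.re_ge hτ' hτ hlt.le
  have h2 : ((γ τ - γ τ') / c).re = -((γ τ' - γ τ) / c).re := by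
    rw [← Complex.neg_re, ← neg_div, neg_sub]
  linarith

/-- Across the arc, from left to right, the Cauchy integral jumps by `2πi`. -/
theorem integral_right' (h : NearlyLinear γ c u v) (huv : u ≤ v)
    (hd : ∀ τ ∈ Ioo u v, HasDerivAt γ (m τ) τ)
    (hm : IntervalIntegrable m MeasureTheory.volume u v) {τ s : ℝ} (hτ : τ ∈ Ioo u v)
    (hs : s < 0) {z : ℂ} (hz : z = γ τ + s * (Complex.I * c)) :
    ∫ x in u..v, m x / (z - γ x) =
      Complex.log ((z - γ u) / (Complex.I * c)) - Complex.log ((z - γ v) / (Complex.I * c)) +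
        2 * Real.pi * Complex.I := by
  rw [h.integral_right huv hd hm (Ioo_subset_Icc_self hτ) hs hz]
  have h1 : ((z - γ u) / (Complex.I * c)).im < 0 := by
    rw [hz]; exact h.im_neg_of_lt (Ioo_subset_Icc_self hτ) (left_mem_Icc.2 huv) hτ.1
  have h2 : 0 < ((z - γ v) / (Complex.I * c)).im := by
    rw [hz]; exact h.im_pos_of_lt (Ioo_subset_Icc_self hτ) (right_mem_Icc.2 huv) hτ.2
  -- Negation adds π to an argument in the lower half-plane and subtracts π in the upper one. The
  -- two ends of the arc lie in different half-planes, so the two corrections add up to 2π.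
  simp only [Complex.log, norm_neg, Complex.arg_neg_eq_arg_add_pi_of_im_neg h1,
    Complex.arg_neg_eq_arg_sub_pi_of_im_pos h2]
  push_cast
  ring

end NearlyLinear

/-- A `C¹` arc is nearly linear around each of its regular points. -/
theorem exists_nearlyLinear {γ : ℝ → ℂ} {A B : ℝ} (hAB : A < B)
    (hγ : ContDiffOn ℝ 1 γ (Icc A B)) {τ₀ : ℝ} (hτ₀ : τ₀ ∈ Icc A B)
    (hne : derivWithin γ (Icc A B) τ₀ ≠ 0) :
    ∃ r > 0, (∀ u v, A ≤ u → v ≤ B → τ₀ - r ≤ u → v ≤ τ₀ + r →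
      NearlyLinear γ (derivWithin γ (Icc A B) τ₀) u v) ∧
      ∀ τ ∈ Icc A B, |τ - τ₀| ≤ r →
        ‖derivWithin γ (Icc A B) τ - derivWithin γ (Icc A B) τ₀‖ ≤
          ‖derivWithin γ (Icc A B) τ₀‖ / 4 := by
  set c := derivWithin γ (Icc A B) τ₀ with hc
  have hcont := hγ.continuousOn_derivWithin (uniqueDiffOn_Icc hAB) le_rfl
  have hpos : 0 < ‖c‖ / 4 := by have := norm_pos_iff.2 hne; positivity
  obtain ⟨r, hr, hr'⟩ := Metric.continuousWithinAt_iff.1 (hcont τ₀ hτ₀) _ hpos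
  have hb : ∀ τ ∈ Icc A B, |τ - τ₀| ≤ r / 2 →
      ‖derivWithin γ (Icc A B) τ - c‖ ≤ ‖c‖ / 4 := fun τ hτ hτr => by
    have := hr' hτ (by rw [Real.dist_eq]; linarith)
    rw [dist_eq_norm] at this
    exact this.le
  refine ⟨r / 2, half_pos hr, fun u v hu hv hu' hv' => ⟨hne, fun τ hτ τ' hτ' => ?_⟩, hb⟩
  have hsub : Icc u v ⊆ Icc A B := Icc_subset_Icc hu hv
  -- Mean value inequality for `γ x - c * x`, whose derivative has norm at most `‖c‖ / 4`.
  have key := Convex.norm_image_sub_le_of_norm_hasDerivWithin_le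
    (f := fun x : ℝ => γ x - c * x) (f' := fun x => derivWithin γ (Icc A B) x - c)
    (s := Icc u v) (C := ‖c‖ / 4) (fun x hx => by
      have h1 := ((hγ.differentiableOn one_ne_zero) x (hsub hx)).hasDerivWithinAt.mono hsub
      have h2 : HasDerivWithinAt (fun x : ℝ => c * (x : ℂ)) c (Icc u v) x := by
        simpa using (Complex.ofRealCLM.hasDerivAt (x := x)).hasDerivWithinAt.const_mul c
      exact h1.sub h2) (fun x hx => hb x (hsub hx) (by
        rw [abs_le]; constructor <;> linarith [hx.1, hx.2])) (convex_Icc u v) hτ' hτ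
  rw [Real.norm_eq_abs] at key
  refine le_trans (le_of_eq ?_) key
  congr 1
  ring

/-- A strip along the arc `γ`, on its left-hand side for `e = 1`, on its right-hand side for
`e = -1`. -/
def sideStrip (γ : ℝ → ℂ) (c : ℂ) (τ₀ η s₀ e : ℝ) : Set ℂ :=
  (fun x : ℝ × ℝ => γ x.1 + ((e * x.2 : ℝ) : ℂ) * (Complex.I * c)) ''
    (Ioo (τ₀ - η) (τ₀ + η) ×ˢ Ioo 0 s₀)

namespace NearlyLinear

variable {γ : ℝ → ℂ} {c : ℂ} {u v : ℝ}

theorem isPreconnected_sideStrip (h : NearlyLinear γ c u v) {τ₀ η s₀ e : ℝ}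
    (hu : u ≤ τ₀ - η) (hv : τ₀ + η ≤ v) : IsPreconnected (sideStrip γ c τ₀ η s₀ e) := by
  refine (isPreconnected_Ioo.prod isPreconnected_Ioo).image _ ?_
  refine ContinuousOn.add ?_ (by fun_prop)
  refine h.continuousOn.comp continuousOn_fst fun x hx => ?_
  exact ⟨hu.trans hx.1.1.le, hx.1.2.le.trans hv⟩

theorem sideStrip_notMem (h : NearlyLinear γ c u v) {τ₀ η s₀ e : ℝ} (he : e ≠ 0)
    (hu : u ≤ τ₀ - η) (hv : τ₀ + η ≤ v) {z : ℂ} (hz : z ∈ sideStrip γ c τ₀ η s₀ e) :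
    z ∉ γ '' Icc u v := by
  obtain ⟨⟨τ, s⟩, ⟨hτ, hs⟩, rfl⟩ := hz
  rintro ⟨τ', hτ', heq⟩
  have hτI : τ ∈ Icc u v := ⟨hu.trans hτ.1.le, hτ.2.le.trans hv⟩
  have h1 := h.eq_of_add_eq hτI hτ' heq.symm
  subst h1
  have : ((e * s : ℝ) : ℂ) * (Complex.I * c) = 0 := by
    simpa using heq.symm
  have hs0 : e * s ≠ 0 := mul_ne_zero he (ne_of_gt hs.1)
  simp [h.1, he, (ne_of_gt hs.1)] at this

theorem sideStrip_subset_ball (h : NearlyLinear γ c u v) {τ₀ η s₀ e ε : ℝ} (he : |e| = 1)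
    (hu : u ≤ τ₀ - η) (hv : τ₀ + η ≤ v) (hη0 : 0 < η)
    (hη : ‖c‖ * (2 * η + s₀) ≤ ε) : sideStrip γ c τ₀ η s₀ e ⊆ Metric.ball (γ τ₀) ε := by
  rintro _ ⟨⟨τ, s⟩, ⟨hτ, hs⟩, rfl⟩
  have hτI : τ ∈ Icc u v := ⟨hu.trans hτ.1.le, hτ.2.le.trans hv⟩
  have hτ₀I : τ₀ ∈ Icc u v := ⟨by linarith, by linarith⟩
  rw [Metric.mem_ball, dist_eq_norm]
  have h1 := h.norm_le hτI hτ₀I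
  have h2 : ‖((e * s : ℝ) : ℂ) * (Complex.I * c)‖ = s * ‖c‖ := by
    rw [norm_mul, norm_mul, Complex.norm_I, Complex.norm_real, Real.norm_eq_abs, abs_mul, he,
      abs_of_pos hs.1]
    ring
  have h3 : |τ - τ₀| < η := abs_lt.2 ⟨by linarith [hτ.1], by linarith [hτ.2]⟩
  have hc := norm_pos_iff.2 h.1
  calc ‖γ τ + ((e * s : ℝ) : ℂ) * (Complex.I * c) - γ τ₀‖
      = ‖(γ τ - γ τ₀) + ((e * s : ℝ) : ℂ) * (Complex.I * c)‖ := by ring_nf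
    _ ≤ _ := norm_add_le _ _
    _ < ‖c‖ * (2 * η + s₀) := by rw [h2]; nlinarith [hs.2]
    _ ≤ ε := hη

/-- The strips on both sides fill a neighbourhood of a point of the arc. -/
theorem exists_ball_subset_sideStrip (h : NearlyLinear γ c u v) {τ₀ η s₀ : ℝ}
    (hη : 0 < η) (hs₀ : 0 < s₀) (hu : u ≤ τ₀ - η) (hv : τ₀ + η ≤ v) :
    ∃ ε > 0, Metric.ball (γ τ₀) ε \ γ '' Icc u v ⊆
      sideStrip γ c τ₀ η s₀ 1 ∪ sideStrip γ c τ₀ η s₀ (-1) := by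
  have hc := norm_pos_iff.2 h.1
  have hτ₀I : τ₀ ∈ Icc u v := ⟨by linarith, by linarith⟩
  -- The first bound keeps the abscissa of the point between those of the parameters `τ₀ ± η / 2`.
  -- The second, with slope of the arc at most 1/3, keeps the normal distance below `s₀`.
  refine ⟨‖c‖ * min (3 / 4 * (η / 2)) (s₀ / 2), by positivity, ?_⟩
  rintro z ⟨hz, hzn⟩
  rw [Metric.mem_ball, dist_eq_norm] at hz
  have hw : ‖(z - γ τ₀) / c‖ < min (3 / 4 * (η / 2)) (s₀ / 2) := by
    rw [norm_div, div_lt_iff₀ hc]; linarith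
  have hw1 := hw.trans_le (min_le_left _ _)
  have hw2 := hw.trans_le (min_le_right _ _)
  have hre := abs_lt.1 ((Complex.abs_re_le_norm _).trans_lt hw1)
  have him := abs_le.1 (Complex.abs_im_le_norm ((z - γ τ₀) / c))
  have hA := h.re_ge hτ₀I (τ' := τ₀ - η / 2) ⟨by linarith, by linarith⟩ (by linarith)
  have hB := h.re_ge (τ := τ₀ + η / 2) (τ' := τ₀) ⟨by linarith, by linarith⟩ hτ₀I (by linarith)
  rw [sub_div, Complex.sub_re] at hA hB hre
  obtain ⟨τ, hτ, s, hzs, hxe⟩ := h.exists_eq_add (z := z) (u' := τ₀ - η / 2) (v' := τ₀ + η / 2)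
    (by linarith) (by linarith) (by linarith) (by linarith [hre.1]) (by linarith [hre.2])
  have hτI : τ ∈ Icc u v := ⟨by linarith [hτ.1], by linarith [hτ.2]⟩
  have hτO : τ ∈ Ioo (τ₀ - η) (τ₀ + η) := ⟨by linarith [hτ.1], by linarith [hτ.2]⟩
  have hs0 : s ≠ 0 := by
    rintro rfl
    exact hzn ⟨τ, hτI, by rw [hzs]; simp⟩
  have hsim : s = ((z - γ τ₀) / c).im - ((γ τ - γ τ₀) / c).im := by
    rw [← Complex.sub_im, ← sub_div, hzs]
    have : (γ τ + s * (Complex.I * c) - γ τ₀ - (γ τ - γ τ₀)) / c = s * Complex.I := by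
      have := h.1
      field_simp; ring
    rw [this]; simp
  have h1 := h.abs_im_le hτI hτ₀I
  have h2 := h.abs_re_ge hτI hτ₀I
  have h3 : ((γ τ - γ τ₀) / c).re = ((z - γ τ₀) / c).re := by
    rw [sub_div, sub_div, Complex.sub_re, Complex.sub_re, hxe]
  have h4 := Complex.abs_re_le_norm ((z - γ τ₀) / c)
  have h5 := Complex.abs_im_le_norm ((z - γ τ₀) / c)
  rw [h3] at h2
  have hs1 : |s| < s₀ := by
    have := abs_sub ((z - γ τ₀) / c).im ((γ τ - γ τ₀) / c).im
    rw [← hsim] at this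
    linarith
  rcases lt_or_gt_of_ne hs0 with hneg | hpos
  · right
    refine ⟨(τ, -s), ⟨hτO, by simpa using hneg, ?_⟩, ?_⟩
    · rw [abs_of_neg hneg] at hs1; exact hs1
    · rw [hzs]; simp
  · left
    refine ⟨(τ, s), ⟨hτO, hpos, ?_⟩, ?_⟩
    · rw [abs_of_pos hpos] at hs1; exact hs1
    · rw [hzs]; simp

/-- Points which are displaced from the arc in a nearly normal direction belong to the strips. -/
theorem eventually_mem_sideStrip (h : NearlyLinear γ c u v) {τ₀ η s₀ : ℝ}
    (hs₀ : 0 < s₀) (hu : u ≤ τ₀ - η) (hv : τ₀ + η ≤ v)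
    {τ : ℝ} (hτ : τ ∈ Ioo (τ₀ - η) (τ₀ + η)) {m : ℂ} (hm : ‖m - c‖ ≤ ‖c‖ / 4) {e : ℝ}
    (he : e = 1 ∨ e = -1) :
    ∀ᶠ s : ℝ in 𝓝[>] 0, γ τ + ((e * s : ℝ) : ℂ) * (Complex.I * m) ∈ sideStrip γ c τ₀ η s₀ e := by
  have hc := norm_pos_iff.2 h.1
  set r := min (τ - (τ₀ - η)) (τ₀ + η - τ) with hr
  have hr0 : 0 < r := lt_min (by linarith [hτ.1]) (by linarith [hτ.2])
  have hr1 : r ≤ τ - (τ₀ - η) := min_le_left _ _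
  have hr2 : r ≤ τ₀ + η - τ := min_le_right _ _
  have hpos : 0 < min r (s₀ / 2) := by positivity
  filter_upwards [Ioo_mem_nhdsGT hpos] with s hs
  have hsr : s < r := hs.2.trans_le (min_le_left _ _)
  have hss : s < s₀ / 2 := hs.2.trans_le (min_le_right _ _)
  have hs0 := hs.1
  have hτI : τ ∈ Icc u v := ⟨by linarith [hτ.1], by linarith [hτ.2]⟩
  set z := γ τ + ((e * s : ℝ) : ℂ) * (Complex.I * m) with hz
  have hmc : ‖m / c - 1‖ ≤ 1 / 4 := by
    have : m / c - 1 = (m - c) / c := by have := h.1; field_simp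
    rw [this, norm_div, div_le_iff₀ hc]; linarith
  have hmre := abs_le.1 ((Complex.abs_re_le_norm _).trans hmc)
  have hmim := abs_le.1 ((Complex.abs_im_le_norm _).trans hmc)
  simp only [Complex.sub_re, Complex.sub_im, Complex.one_re, Complex.one_im] at hmre hmim
  have hzc : (z - γ τ) / c = ((e * s : ℝ) : ℂ) * (Complex.I * (m / c)) := by
    rw [hz, add_sub_cancel_left, mul_div_assoc, mul_div_assoc]
  have hzre : ((z - γ τ) / c).re = -(e * s * (m / c).im) := by rw [hzc]; simp
  have hzim : ((z - γ τ) / c).im = e * s * (m / c).re := by rw [hzc]; simp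
  have hA := h.re_ge hτI (τ' := τ - r / 2) ⟨by linarith, by linarith [hτI.2]⟩ (by linarith)
  have hB := h.re_ge (τ := τ + r / 2) (τ' := τ) ⟨by linarith [hτI.1], by linarith⟩ hτI
    (by linarith)
  have hreb : |((z - γ τ) / c).re| ≤ s / 4 := by
    rw [hzre, abs_neg, abs_mul]
    have h1 : |(m / c).im| ≤ 1 / 4 := abs_le.2 ⟨by linarith [hmim.1], by linarith [hmim.2]⟩
    have h2 : |e * s| = s := by rcases he with rfl | rfl <;> simp [abs_of_pos hs0]
    rw [h2]; nlinarith
  have hreb' := abs_le.1 hreb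
  rw [sub_div, Complex.sub_re] at hA hB hreb'
  -- The direction `m` differs from `c` by a quarter at most: the abscissa moves by at most `s / 4`,
  -- the height by at least `3 s / 4`. Projecting back along `I * c` alters the height by at most `s
  -- / 8`, so its sign is kept.
  obtain ⟨τ', hτ', s', hzs, hxe⟩ := h.exists_eq_add (z := z) (u' := τ - r / 2) (v' := τ + r / 2)
    (by linarith) (by linarith) (by linarith) (by linarith [hreb'.1]) (by linarith [hreb'.2])
  have hτ'I : τ' ∈ Icc u v := ⟨by linarith [hτ'.1], by linarith [hτ'.2]⟩
  have hτ'O : τ' ∈ Ioo (τ₀ - η) (τ₀ + η) := ⟨by linarith [hτ'.1], by linarith [hτ'.2]⟩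
  have hsim : s' = ((z - γ τ) / c).im - ((γ τ' - γ τ) / c).im := by
    rw [← Complex.sub_im, ← sub_div, hzs]
    have : (γ τ' + s' * (Complex.I * c) - γ τ - (γ τ' - γ τ)) / c = s' * Complex.I := by
      have := h.1
      field_simp; ring
    rw [this]; simp
  have h1 := h.abs_im_le hτ'I hτI
  have h2 := h.abs_re_ge hτ'I hτI
  have h3 : ((γ τ' - γ τ) / c).re = ((z - γ τ) / c).re := by
    rw [sub_div, sub_div, Complex.sub_re, Complex.sub_re, hxe]
  rw [h3] at h2
  have h4 : |((γ τ' - γ τ) / c).im| ≤ s / 8 := by linarith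
  have h4' := abs_le.1 h4
  rw [hzim] at hsim
  have hes : 0 < e * s' ∧ e * s' < s₀ := by
    have hee : e * e = 1 := by rcases he with rfl | rfl <;> norm_num
    have h6 : e * s' = s * (m / c).re - e * ((γ τ' - γ τ) / c).im := by
      rw [hsim]; linear_combination (s * (m / c).re) * hee
    have h7 : |e * ((γ τ' - γ τ) / c).im| ≤ s / 8 := by
      rw [abs_mul]
      have : |e| = 1 := by rcases he with rfl | rfl <;> simp
      rw [this, one_mul]; exact h4
    have h7' := abs_le.1 h7
    constructor
    · rw [h6]; nlinarith
    · rw [h6]; nlinarith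
  refine ⟨(τ', e * s'), ⟨hτ'O, hes⟩, ?_⟩
  rw [hzs]
  have hee : e * (e * s') = s' := by rcases he with rfl | rfl <;> ring
  simp only [hee]

/-- Around the initial point of a nearly linear arc, the complement of the arc contains arbitrarily
small connected punctured neighbourhoods. -/
theorem exists_slit_nhds {r : ℝ} (hr : 0 < r) (h : NearlyLinear γ c 0 r) {ε : ℝ} (hε : 0 < ε) :
    ∃ N : Set ℂ, IsPreconnected N ∧ N ⊆ Metric.ball (γ 0) ε \ γ '' Icc 0 r ∧
      ∃ ε' > 0, Metric.ball (γ 0) ε' \ γ '' Icc 0 r ⊆ N := by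
  have hc := norm_pos_iff.2 h.1
  have hc0 := h.1
  have h0I : (0 : ℝ) ∈ Icc 0 r := ⟨le_rfl, hr.le⟩
  set κ := min (3 / 4 * r) (ε / (2 * ‖c‖)) with hκ
  have hκ0 : 0 < κ := by positivity
  have hκr : κ ≤ 3 / 4 * r := min_le_left _ _
  have hκε : κ * (2 * ‖c‖) ≤ ε := by
    rw [← le_div_iff₀ (by positivity)]; exact min_le_right _ _
  set ω : ℝ → ℂ := fun τ => (γ τ - γ 0) / c with hω
  set W : Set ℂ := {w | |w.re| < κ ∧ |w.im| < κ ∧ w ∉ ω '' Icc 0 r} with hW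
  have hωe : ∀ τ, γ τ = γ 0 + c * ω τ := fun τ => by simp only [hω]; field_simp; ring
  -- the abscissa and the height of the points of the arc
  have hω1 : ∀ τ ∈ Icc 0 r, 0 ≤ (ω τ).re ∧ |(ω τ).im| ≤ (ω τ).re / 3 := fun τ hτ => by
    have h1 := h.re_ge hτ h0I hτ.1
    have h2 := h.abs_im_le hτ h0I
    rw [sub_zero] at h1 h2
    rw [abs_of_nonneg hτ.1] at h2
    refine ⟨by linarith [hτ.1], by simp only [hω]; linarith⟩
  have hω2 : ∀ τ ∈ Icc 0 r, ∀ τ' ∈ Icc 0 r, (ω τ).re = (ω τ').re → τ = τ' := fun τ hτ τ' hτ' he => by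
    have h1 := h.abs_re_ge hτ hτ'
    have : (γ τ - γ τ') / c = ω τ - ω τ' := by simp only [hω]; field_simp; ring
    rw [this, Complex.sub_re, he, sub_self, abs_zero] at h1
    by_contra hne
    have : 0 < |τ - τ'| := abs_pos.2 (sub_ne_zero.2 hne)
    linarith
  set base : ℂ := ⟨-κ / 2, 0⟩ with hbase
  have hseg : ∀ w₁ w₂ : ℂ, |w₁.re| < κ → |w₁.im| < κ → |w₂.re| < κ → |w₂.im| < κ →
      (∀ w ∈ segment ℝ w₁ w₂, w ∉ ω '' Icc 0 r) → segment ℝ w₁ w₂ ⊆ W := by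
    intro w₁ w₂ a1 a2 a3 a4 hn w hw
    obtain ⟨a, b, ha, hb, hab, rfl⟩ := hw
    rw [abs_lt] at a1 a2 a3 a4
    refine ⟨abs_lt.2 ?_, abs_lt.2 ?_, hn _ ⟨a, b, ha, hb, hab, rfl⟩⟩
    · simp only [Complex.add_re, Complex.real_smul, Complex.mul_re, Complex.ofReal_re,
        Complex.ofReal_im, zero_mul, sub_zero]
      have hb' : b = 1 - a := by linarith
      subst hb'
      rcases ha.eq_or_lt with rfl | ha'
      · constructor <;> linarith
      · constructor <;> nlinarith
    · simp only [Complex.add_im, Complex.real_smul, Complex.mul_im, Complex.ofReal_re,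
        Complex.ofReal_im, zero_mul, add_zero]
      have hb' : b = 1 - a := by linarith
      subst hb'
      rcases ha.eq_or_lt with rfl | ha'
      · constructor <;> linarith
      · constructor <;> nlinarith
  have hsegc : ∀ w₁ w₂ : ℂ, IsPreconnected (segment ℝ w₁ w₂) := fun w₁ w₂ =>
    (convex_segment w₁ w₂).isPreconnected
  have hWc : IsPreconnected W := by
    refine isPreconnected_of_forall base fun w hw => ?_
    obtain ⟨hw1, hw2, hw3⟩ := hw
    -- the height `σ κ / 2` on the side of `w`
    obtain ⟨σ, hσ, hvert⟩ : ∃ σ : ℝ, (σ = 1 ∨ σ = -1) ∧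
        ∀ z ∈ segment ℝ w ⟨w.re, σ * κ / 2⟩, z ∉ ω '' Icc 0 r := by
      by_cases hex : ∃ τ ∈ Icc 0 r, (ω τ).re = w.re
      · obtain ⟨τ, hτ, hτe⟩ := hex
        have hb := abs_le.1 (hω1 τ hτ).2
        rw [hτe] at hb
        have hwlt := (abs_lt.1 hw1).2
        have hne : w.im ≠ (ω τ).im := fun he => hw3 ⟨τ, hτ, Complex.ext hτe he.symm⟩
        -- Only one point of the arc has this abscissa; the vertical motion goes away from it.
        refine ⟨if (ω τ).im < w.im then 1 else -1, by split_ifs <;> simp, ?_⟩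
        rintro z ⟨a, b, ha, hb', hab, rfl⟩ ⟨τ', hτ', hz⟩
        have hre := congrArg Complex.re hz
        have him := congrArg Complex.im hz
        simp only [Complex.add_re, Complex.real_smul, Complex.mul_re, Complex.ofReal_re,
          Complex.ofReal_im, zero_mul, sub_zero, Complex.add_im, Complex.mul_im, add_zero] at hre him
        rw [← add_mul, hab, one_mul] at hre
        have := hω2 τ' hτ' τ hτ (hre.trans hτe.symm)
        subst this
        have hb1 : b = 1 - a := by linarith
        subst hb1
        split_ifs at him with hlt
        · have h2 : (ω τ').im < κ / 2 := by linarith [hb.2]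
          rcases ha.eq_or_lt with rfl | ha'
          · linarith
          · nlinarith [mul_pos ha' (sub_pos.2 hlt), mul_nonneg hb' (sub_pos.2 h2).le]
        · have hlt' : w.im < (ω τ').im := lt_of_le_of_ne (not_lt.1 hlt) hne
          have h2 : -(κ / 2) < (ω τ').im := by linarith [hb.1]
          rcases ha.eq_or_lt with rfl | ha'
          · linarith
          · nlinarith [mul_pos ha' (sub_pos.2 hlt'), mul_nonneg hb' (sub_pos.2 h2).le]
      · refine ⟨1, Or.inl rfl, ?_⟩
        rintro z ⟨a, b, ha, hb', hab, rfl⟩ ⟨τ', hτ', hz⟩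
        have hre := congrArg Complex.re hz
        simp only [Complex.add_re, Complex.real_smul, Complex.mul_re, Complex.ofReal_re,
          Complex.ofReal_im, zero_mul, sub_zero] at hre
        rw [← add_mul, hab, one_mul] at hre
        exact hex ⟨τ', hτ', hre⟩
    have hσa : |σ * κ / 2| < κ := by
      rcases hσ with rfl | rfl
      · rw [abs_lt]; constructor <;> linarith
      · rw [abs_lt]; constructor <;> linarith
    have hka : |(-κ / 2)| < κ := by rw [abs_lt]; constructor <;> linarith
    -- The path to `base` has three segments: vertical, away from the arc, to height `± κ / 2`;
    -- horizontal to the abscissa `-κ / 2`; vertical to the axis.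
    refine ⟨segment ℝ w ⟨w.re, σ * κ / 2⟩ ∪ segment ℝ ⟨w.re, σ * κ / 2⟩ ⟨-κ / 2, σ * κ / 2⟩ ∪
      segment ℝ ⟨-κ / 2, σ * κ / 2⟩ base, ?_, ?_, ?_, ?_⟩
    · refine union_subset (union_subset ?_ ?_) ?_
      · exact hseg _ _ hw1 hw2 hw1 hσa hvert
      -- At height `± κ / 2` the arc is absent: it lies in the wedge of slope 1/3, and abscissas in
      -- the square are below `κ`.
      · refine hseg _ _ hw1 hσa hka hσa ?_
        rintro z ⟨a, b, ha, hb', hab, rfl⟩ ⟨τ', hτ', hz⟩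
        have hre := congrArg Complex.re hz
        have him := congrArg Complex.im hz
        simp only [Complex.add_re, Complex.real_smul, Complex.mul_re, Complex.ofReal_re,
          Complex.ofReal_im, zero_mul, sub_zero, Complex.add_im, Complex.mul_im, add_zero] at hre him
        rw [← add_mul, hab, one_mul] at him
        have h1 := (hω1 τ' hτ').2
        rw [him, hre] at h1
        have h2 : |σ * κ / 2| = κ / 2 := by
          rcases hσ with rfl | rfl
          · rw [one_mul, abs_of_pos (by positivity)]
          · rw [neg_one_mul, neg_div, abs_neg, abs_of_pos (by positivity)]
        rw [h2] at h1
        have hw1' := (abs_lt.1 hw1).2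
        have hb1 : b = 1 - a := by linarith
        subst hb1
        rcases ha.eq_or_lt with rfl | ha'
        · linarith
        · nlinarith
      · refine hseg _ _ hka hσa hka (by simpa [hbase] using hκ0) ?_
        rintro z ⟨a, b, ha, hb', hab, rfl⟩ ⟨τ', hτ', hz⟩
        have hre := congrArg Complex.re hz
        simp only [hbase, Complex.add_re, Complex.real_smul, Complex.mul_re, Complex.ofReal_re,
          Complex.ofReal_im, zero_mul, sub_zero] at hre
        rw [← add_mul, hab, one_mul] at hre
        linarith [(hω1 τ' hτ').1]
    · exact Or.inr (right_mem_segment ℝ _ _)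
    · exact Or.inl (Or.inl (left_mem_segment ℝ _ _))
    · refine IsPreconnected.union _ (Or.inr (right_mem_segment ℝ _ _)) (left_mem_segment ℝ _ _)
        (IsPreconnected.union _ (right_mem_segment ℝ _ _) (left_mem_segment ℝ _ _)
          (hsegc _ _) (hsegc _ _)) (hsegc _ _)
  refine ⟨(fun w => γ 0 + c * w) '' W, hWc.image _ (by fun_prop), ?_, ‖c‖ * κ, by positivity, ?_⟩
  · rintro _ ⟨w, ⟨hw1, hw2, hw3⟩, rfl⟩
    constructor
    · rw [Metric.mem_ball, dist_eq_norm, add_sub_cancel_left, norm_mul]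
      have : ‖w‖ < 2 * κ := (Complex.norm_le_abs_re_add_abs_im w).trans_lt (by linarith)
      nlinarith
    · rintro ⟨τ, hτ, he⟩
      rw [hωe τ] at he
      exact hw3 ⟨τ, hτ, mul_left_cancel₀ hc0 (add_left_cancel he)⟩
  · rintro z ⟨hz, hzn⟩
    rw [Metric.mem_ball, dist_eq_norm] at hz
    have hzw : z = γ 0 + c * ((z - γ 0) / c) := by field_simp; ring
    have hlt : ‖(z - γ 0) / c‖ < κ := by rw [norm_div, div_lt_iff₀ hc]; linarith
    refine ⟨(z - γ 0) / c, ⟨(Complex.abs_re_le_norm _).trans_lt hlt,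
      (Complex.abs_im_le_norm _).trans_lt hlt, ?_⟩, hzw.symm⟩
    rintro ⟨τ, hτ, he⟩
    exact hzn ⟨τ, hτ, by rw [hωe τ, he, ← hzw]⟩

end NearlyLinear

/-! ### Cauchy integrals and removable singularities. -/

/-- Differentiation under the integral sign of an integrand which depends holomorphically on the
parameter. -/
theorem hasDerivAt_integral_of_holomorphic {m : ℝ → ℂ} {ψ : ℝ → ℂ → ℂ} {u v : ℝ} (huv : u ≤ v)
    {U : Set ℂ} (hU : IsOpen U) (hm : IntervalIntegrable m MeasureTheory.volume u v)
    (hψ : ContinuousOn (Function.uncurry ψ) (Icc u v ×ˢ U))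
    (hd : ∀ τ ∈ Icc u v, DifferentiableOn ℂ (ψ τ) U) {z₀ : ℂ} (hz₀ : z₀ ∈ U) :
    HasDerivAt (fun z => ∫ τ in u..v, m τ * ψ τ z) (∫ τ in u..v, m τ * deriv (ψ τ) z₀) z₀ := by
  obtain ⟨R, hR, hball⟩ := Metric.nhds_basis_closedBall.mem_iff.1 (hU.mem_nhds hz₀)
  set r := R / 2 with hr
  have hr0 : 0 < r := half_pos hR
  obtain ⟨K, hK⟩ := (isCompact_Icc.prod (isCompact_closedBall z₀ R)).exists_bound_of_continuousOn
    (hψ.mono (prod_mono_right hball))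
  have hsub : uIoc u v ⊆ Icc u v := by rw [uIoc_of_le huv]; exact Ioc_subset_Icc_self
  have hcb : ∀ z ∈ Metric.ball z₀ r, Metric.closedBall z r ⊆ Metric.closedBall z₀ R := by
    intro z hz w hw
    rw [Metric.mem_closedBall] at hw ⊢
    rw [Metric.mem_ball] at hz
    linarith [dist_triangle w z z₀]
  have hsec : ∀ z ∈ U, ContinuousOn (fun τ => ψ τ z) (Icc u v) := fun z hz =>
    hψ.comp (f := fun τ => (τ, z)) (by fun_prop) fun τ hτ => ⟨hτ, hz⟩
  -- Cauchy's estimate on discs of radius `r` supplies the integrable majorant.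
  have hderb : ∀ τ ∈ Icc u v, ∀ z ∈ Metric.ball z₀ r, ‖deriv (ψ τ) z‖ ≤ K / r := by
    intro τ hτ z hz
    have hsub' : Metric.closedBall z r ⊆ U := (hcb z hz).trans hball
    refine Complex.norm_deriv_le_of_forall_mem_sphere_norm_le hr0 ?_ fun w hw => ?_
    · refine DifferentiableOn.diffContOnCl ?_
      rw [closure_ball _ hr0.ne']
      exact (hd τ hτ).mono hsub'
    · exact hK (τ, w) ⟨hτ, hcb z hz (Metric.sphere_subset_closedBall hw)⟩
  have hz₀b : z₀ ∈ Metric.ball z₀ r := Metric.mem_ball_self hr0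
  have hbU : Metric.ball z₀ r ⊆ U := fun z hz =>
    hball (Metric.ball_subset_closedBall (Metric.ball_subset_ball (by linarith) hz))
  have hmeas : ∀ z ∈ U, MeasureTheory.AEStronglyMeasurable (fun τ => ψ τ z)
      (MeasureTheory.volume.restrict (uIoc u v)) := fun z hz =>
    ((hsec z hz).mono hsub).aestronglyMeasurable measurableSet_uIoc
  have hmm : MeasureTheory.AEStronglyMeasurable m (MeasureTheory.volume.restrict (uIoc u v)) :=
    (intervalIntegrable_iff.1 hm).aestronglyMeasurable
  -- Measurability in `τ` of the derivative comes from writing it as a limit of difference quotients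
  -- along this sequence, which stays in the disc.
  have hseq : Tendsto (fun k : ℕ => z₀ + ((r / (k + 2) : ℝ) : ℂ)) atTop (𝓝[≠] z₀) := by
    refine tendsto_nhdsWithin_iff.2 ⟨?_, .of_forall fun k => ?_⟩
    · have : Tendsto (fun k : ℕ => r / ((k : ℝ) + 2)) atTop (𝓝 0) := by
        refine Tendsto.div_atTop tendsto_const_nhds ?_
        exact tendsto_atTop_add_const_right _ _ tendsto_natCast_atTop_atTop
      have h2 := (Complex.continuous_ofReal.tendsto _).comp this
      simpa using tendsto_const_nhds (x := z₀).add h2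
    · have : (r / ((k : ℝ) + 2)) ≠ 0 := by positivity
      simpa using Complex.ofReal_ne_zero.2 this
  refine (intervalIntegral.hasDerivAt_integral_of_dominated_loc_of_deriv_le
    (F' := fun z τ => m τ * deriv (ψ τ) z) (bound := fun τ => ‖m τ‖ * (K / r))
    (Metric.ball_mem_nhds z₀ hr0) ?_ ?_ ?_ ?_ ?_ ?_).2
  · filter_upwards [hU.mem_nhds hz₀] with z hz
    exact hmm.mul (hmeas z hz)
  · exact hm.mul_continuousOn (by rw [uIcc_of_le huv]; exact hsec z₀ hz₀)
  · refine hmm.mul ?_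
    refine aestronglyMeasurable_of_tendsto_ae atTop
      (f := fun (k : ℕ) τ => slope (ψ τ) z₀ (z₀ + ((r / (k + 2) : ℝ) : ℂ))) ?_ ?_
    · intro k
      have hk : z₀ + ((r / (k + 2) : ℝ) : ℂ) ∈ U := by
        refine hball ?_
        rw [Metric.mem_closedBall, dist_eq_norm, add_sub_cancel_left, Complex.norm_real,
          Real.norm_eq_abs, abs_of_pos (by positivity)]
        rw [div_le_iff₀ (by positivity)]
        nlinarith [Nat.cast_nonneg (α := ℝ) k]
      simp only [slope_def_field, div_eq_mul_inv]
      exact ((hmeas _ hk).sub (hmeas _ hz₀)).mul_const _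
    · filter_upwards [MeasureTheory.ae_restrict_mem measurableSet_uIoc] with τ hτ
      have h1 := ((hd τ (hsub hτ)).differentiableAt (hU.mem_nhds hz₀)).hasDerivAt
      exact (hasDerivAt_iff_tendsto_slope.1 h1).comp hseq
  · refine .of_forall fun τ hτ z hz => ?_
    rw [norm_mul]
    exact mul_le_mul_of_nonneg_left (hderb τ (hsub hτ) z hz) (norm_nonneg _)
  · exact hm.norm.mul_const _
  · refine .of_forall fun τ hτ z hz => ?_
    exact (((hd τ (hsub hτ)).differentiableAt (hU.mem_nhds (hbU hz))).hasDerivAt).const_mul _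

theorem differentiableOn_integral_of_holomorphic {m : ℝ → ℂ} {ψ : ℝ → ℂ → ℂ} {u v : ℝ}
    (huv : u ≤ v) {U : Set ℂ} (hU : IsOpen U)
    (hm : IntervalIntegrable m MeasureTheory.volume u v)
    (hψ : ContinuousOn (Function.uncurry ψ) (Icc u v ×ˢ U))
    (hd : ∀ τ ∈ Icc u v, DifferentiableOn ℂ (ψ τ) U) :
    DifferentiableOn ℂ (fun z => ∫ τ in u..v, m τ * ψ τ z) U := fun _ hz =>
  (hasDerivAt_integral_of_holomorphic huv hU hm hψ hd hz).differentiableAt.differentiableWithinAt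

/-- The Cauchy integral of a density along an arc is holomorphic off the arc. -/
theorem hasDerivAt_cauchyIntegral {γ m : ℝ → ℂ} {u v : ℝ} (huv : u ≤ v)
    (hγ : ContinuousOn γ (Icc u v)) (hm : IntervalIntegrable m MeasureTheory.volume u v)
    {z : ℂ} (hz : z ∉ γ '' Icc u v) :
    HasDerivAt (fun z => ∫ τ in u..v, m τ / (γ τ - z)) (∫ τ in u..v, m τ / (γ τ - z) ^ 2) z := by
  have hopen : IsOpen (γ '' Icc u v)ᶜ := (isCompact_Icc.image_of_continuousOn hγ).isClosed.isOpen_compl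
  have hne : ∀ w ∈ (γ '' Icc u v)ᶜ, ∀ τ ∈ Icc u v, γ τ - w ≠ 0 := fun w hw τ hτ h0 =>
    hw ⟨τ, hτ, sub_eq_zero.1 h0⟩
  have hder : ∀ w ∈ (γ '' Icc u v)ᶜ, ∀ τ ∈ Icc u v,
      HasDerivAt (fun w => (γ τ - w)⁻¹) (((γ τ - w) ^ 2)⁻¹) w := fun w hw τ hτ => by
    have := ((hasDerivAt_id w).const_sub (γ τ)).fun_inv (hne w hw τ hτ)
    simpa using this
  have key := hasDerivAt_integral_of_holomorphic (ψ := fun τ w => (γ τ - w)⁻¹) huv hopen hm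
    (by
      refine ContinuousOn.inv₀ ?_ fun x hx => hne x.2 hx.2 x.1 hx.1
      exact (hγ.comp continuousOn_fst fun x hx => hx.1).sub continuousOn_snd)
    (fun τ hτ w hw => (hder w hw τ hτ).differentiableAt.differentiableWithinAt) hz
  simp only [div_eq_mul_inv]
  convert key using 1
  refine intervalIntegral.integral_congr fun τ hτ => ?_
  rw [uIcc_of_le huv] at hτ
  simp only [(hder z hz τ hτ).deriv]

/-- A function which is holomorphic off a closed set `J` with empty interior, which extends
holomorphically across `J` off finitely many points, and which is bounded near these, is the
restriction of an entire function. -/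
theorem exists_entire_extension {J Z : Set ℂ} {f : ℂ → ℂ} (hJ : IsClosed J) (hD : Dense Jᶜ)
    (hZ : Z.Finite) (hf : DifferentiableOn ℂ f Jᶜ)
    (hloc : ∀ z ∈ J \ Z, ∃ g : ℂ → ℂ, (∀ᶠ w in 𝓝 z, DifferentiableAt ℂ g w) ∧
      ∀ᶠ w in 𝓝 z, w ∉ J → f w = g w)
    (hbd : ∀ z ∈ Z, ∃ K : ℝ, ∀ᶠ w in 𝓝 z, w ∉ J → ‖f w‖ ≤ K) :
    ∃ F : ℂ → ℂ, Differentiable ℂ F ∧ EqOn F f Jᶜ := by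
  classical
  have hloc' : ∀ z ∉ Z, ∃ g : ℂ → ℂ, (∀ᶠ w in 𝓝 z, DifferentiableAt ℂ g w) ∧
      ∀ᶠ w in 𝓝 z, w ∉ J → f w = g w := fun z hz => by
    by_cases hzJ : z ∈ J
    · exact hloc z ⟨hzJ, hz⟩
    · refine ⟨f, ?_, .of_forall fun _ _ => rfl⟩
      filter_upwards [hJ.isOpen_compl.mem_nhds hzJ] with w hw
      exact hf.differentiableAt (hJ.isOpen_compl.mem_nhds hw)
  -- Since the complement of `J` is dense, the value obtained by a limit coincides near each point
  -- with the local continuation, whichever one is used.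
  set f₁ := extendFrom Jᶜ f with hf₁
  have hf₁f : ∀ z ∉ J, f₁ z = f z := extendFrom_extends hf.continuousOn
  have hf₁lim : ∀ z ∉ Z, Tendsto f (𝓝[Jᶜ] z) (𝓝 (f₁ z)) := fun z hz => by
    obtain ⟨g, hg, hfg⟩ := hloc' z hz
    refine tendsto_extendFrom ⟨g z, ?_⟩
    refine (hg.self_of_nhds.continuousAt.tendsto.mono_left nhdsWithin_le_nhds).congr' ?_
    filter_upwards [nhdsWithin_le_nhds hfg, self_mem_nhdsWithin] with w hw hwJ
    exact (hw hwJ).symm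
  have hf₁d : ∀ z ∉ Z, DifferentiableAt ℂ f₁ z := fun z hz => by
    obtain ⟨g, hg, hfg⟩ := hloc' z hz
    refine hg.self_of_nhds.congr_of_eventuallyEq ?_
    filter_upwards [eventually_eventually_nhds.2 hg, eventually_eventually_nhds.2 hfg] with w hgw hfgw
    refine extendFrom_eq (hD w) ?_
    refine (hgw.self_of_nhds.continuousAt.tendsto.mono_left nhdsWithin_le_nhds).congr' ?_
    filter_upwards [nhdsWithin_le_nhds hfgw, self_mem_nhdsWithin] with w' hw' hwJ
    exact (hw' hwJ).symm
  -- Riemann's removable singularity theorem takes care of the exceptional points, where `f₁` is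
  -- bounded on a punctured neighbourhood.
  set F : ℂ → ℂ := fun z => if z ∈ Z then limUnder (𝓝[≠] z) f₁ else f₁ z with hF
  have hFne : ∀ z, F =ᶠ[𝓝[≠] z] f₁ := fun z => by
    have : (Z \ {z})ᶜ ∈ 𝓝 z := (hZ.subset sdiff_subset).isClosed.isOpen_compl.mem_nhds (by simp)
    filter_upwards [nhdsWithin_le_nhds this, self_mem_nhdsWithin] with w hw hwz
    have : w ∉ Z := fun h => hw ⟨h, hwz⟩
    simp [hF, this]
  have hFd : Differentiable ℂ F := fun z => by
    by_cases hz : z ∈ Z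
    · obtain ⟨K, hK⟩ := hbd z hz
      have hn : (Z \ {z})ᶜ ∈ 𝓝 z := (hZ.subset sdiff_subset).isClosed.isOpen_compl.mem_nhds (by simp)
      obtain ⟨s, hsub, hso, hzs⟩ := mem_nhds_iff.1 (inter_mem hK hn)
      have key := Complex.differentiableOn_update_limUnder_of_bddAbove (f := f₁) (s := s) (c := z)
        (hso.mem_nhds hzs) (fun w hw => (hf₁d w fun h => (hsub hw.1).2 ⟨h, hw.2⟩).differentiableWithinAt)
        ⟨K, by
          rintro _ ⟨w, hw, rfl⟩
          have hwZ : w ∉ Z := fun h => (hsub hw.1).2 ⟨h, hw.2⟩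
          have := mem_closure_iff_nhdsWithin_neBot.1 (hD w)
          refine le_of_tendsto (hf₁lim w hwZ).norm ?_
          filter_upwards [nhdsWithin_le_nhds (hso.mem_nhds hw.1), self_mem_nhdsWithin] with w' hw' hJ'
          exact (hsub hw').1 hJ'⟩
      refine (key.differentiableAt (hso.mem_nhds hzs)).congr_of_eventuallyEq ?_
      have h1 := hFne z
      rw [EventuallyEq, eventually_nhdsWithin_iff] at h1
      filter_upwards [h1] with w hw
      by_cases hwz : w = z
      · subst hwz; simp [hF, hz]
      · rw [hw hwz, Function.update_of_ne hwz]
    · refine (hf₁d z hz).congr_of_eventuallyEq ?_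
      filter_upwards [hZ.isClosed.isOpen_compl.mem_nhds hz] with w hw
      simp only [hF, if_neg (show w ∉ Z from hw)]
  refine ⟨F, hFd, fun z hz => ?_⟩
  -- both sides are continuous at `z` and agree on a punctured neighbourhood
  have h1 : ContinuousAt f z := (hf.differentiableAt (hJ.isOpen_compl.mem_nhds hz)).continuousAt
  have h2 : ContinuousAt F z := (hFd z).continuousAt
  refine tendsto_nhds_unique (h2.tendsto.mono_left (nhdsWithin_le_nhds (s := {z}ᶜ)))
    ((h1.tendsto.mono_left nhdsWithin_le_nhds).congr' ?_)
  filter_upwards [hFne z, nhdsWithin_le_nhds (hJ.isOpen_compl.mem_nhds hz)] with w hw hwJ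
  rw [hw, hf₁f w hwJ]

theorem norm_log_le {w : ℂ} : ‖Complex.log w‖ ≤ |Real.log ‖w‖| + Real.pi := by
  refine (Complex.norm_le_abs_re_add_abs_im _).trans ?_
  rw [Complex.log_re, Complex.log_im]
  linarith [Complex.abs_arg_le_pi w]

/-- The Cauchy integral of a Lipschitz density which vanishes at the initial point of an arc is
bounded near this point. -/
theorem NearlyLinear.bounded_cauchyIntegral {γ m f : ℝ → ℂ} {c : ℂ} {r : ℝ} (hr : 0 < r)
    (h : NearlyLinear γ c 0 r) (hd : ∀ τ ∈ Ioo 0 r, HasDerivAt γ (m τ) τ)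
    (hm : IntervalIntegrable m MeasureTheory.volume 0 r) {M K : ℝ}
    (hM : ∀ τ ∈ Ioc 0 r, ‖m τ‖ ≤ M) (hf0 : f 0 = 0)
    (hf : ∀ τ ∈ Icc 0 r, ∀ τ' ∈ Icc 0 r, ‖f τ - f τ'‖ ≤ K * |τ - τ'|) :
    ∃ B : ℝ, ∀ᶠ z in 𝓝 (γ 0), z ∉ γ '' Icc 0 r →
      ‖∫ τ in (0)..r, f τ * (m τ / (z - γ τ))‖ ≤ B := by
  have hc := norm_pos_iff.2 h.1
  have hc0 := h.1
  have h0I : (0 : ℝ) ∈ Icc 0 r := ⟨le_rfl, hr.le⟩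
  have hrI : r ∈ Icc 0 r := ⟨hr.le, le_rfl⟩
  have hM0 : 0 ≤ M := (norm_nonneg _).trans (hM r ⟨hr, le_rfl⟩)
  have hK0 : 0 ≤ K := by
    have := (norm_nonneg _).trans (hf 0 h0I r hrI)
    rw [zero_sub, abs_neg, abs_of_pos hr] at this
    exact nonneg_of_mul_nonneg_left this hr
  have hfc : ContinuousOn f (Icc 0 r) := by
    have : LipschitzOnWith (Real.toNNReal K) f (Icc 0 r) := by
      refine LipschitzOnWith.of_dist_le_mul fun x hx y hy => ?_
      rw [dist_eq_norm, Real.dist_eq, Real.coe_toNNReal _ hK0]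
      exact hf x hx y hy
    exact this.continuousOn
  have hwr := h.re_ge hrI h0I hr.le
  rw [sub_zero] at hwr
  have hwr0 : γ r - γ 0 ≠ 0 := fun h0 => by
    rw [h0] at hwr; simp at hwr; linarith
  set D := ‖γ r - γ 0‖ with hD
  have hD0 : 0 < D := norm_pos_iff.2 hwr0
  -- Three demands on the distance from `z` to the initial point: the final point stays far, `x log
  -- x` is estimated for `x ≤ 1`, and the abscissa of `z` does not exceed that of the final point.
  set ε := min (D / 2) (min ‖c‖ (‖c‖ * (r / 2))) with hε
  have hε0 : 0 < ε := by positivity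
  set B₁ := K * (4 / (3 * ‖c‖)) * M * r with hB₁
  set LB := 2 * Real.pi + (|Real.log (D / 2 / ‖c‖)| + |Real.log (2 * D / ‖c‖)|) with hLB
  have hLB0 : 0 ≤ LB := by have := Real.pi_pos; positivity
  refine ⟨B₁ + 4 / 3 * K * (1 + LB), ?_⟩
  filter_upwards [Metric.ball_mem_nhds (γ 0) hε0] with z hz hzn
  rw [Metric.mem_ball, dist_eq_norm] at hz
  have hz1 : ‖z - γ 0‖ < D / 2 := hz.trans_le (min_le_left _ _)
  have hz2 : ‖z - γ 0‖ < ‖c‖ := hz.trans_le ((min_le_right _ _).trans (min_le_left _ _))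
  have hz3 : ‖z - γ 0‖ < ‖c‖ * (r / 2) := hz.trans_le ((min_le_right _ _).trans (min_le_right _ _))
  have hzne : ∀ τ ∈ Icc 0 r, z ≠ γ τ := fun τ hτ h0 => hzn ⟨τ, hτ, h0.symm⟩
  -- the estimate of the integrand
  have hest : ∀ τ' ∈ Icc 0 r, (∀ τ ∈ Icc 0 r, 3 / 4 * |τ - τ'| ≤ ‖(z - γ τ) / c‖) →
      ‖∫ τ in (0)..r, (f τ - f τ') * (m τ / (z - γ τ))‖ ≤ B₁ := by
    intro τ' hτ' hb
    have := intervalIntegral.norm_integral_le_of_norm_le_const (a := 0) (b := r)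
      (f := fun τ => (f τ - f τ') * (m τ / (z - γ τ))) (C := K * (4 / (3 * ‖c‖)) * M)
      (fun τ hτ => by
        rw [uIoc_of_le hr.le] at hτ
        have hτI := Ioc_subset_Icc_self hτ
        have h1 := hf τ hτI τ' hτ'
        have h2 := hM τ hτ
        have h3 := hb τ hτI
        rw [norm_div, le_div_iff₀ hc] at h3
        have h4 : 0 < ‖z - γ τ‖ := norm_pos_iff.2 (sub_ne_zero.2 (hzne τ hτI))
        rw [norm_mul, norm_div]
        rw [mul_div_assoc', div_le_iff₀ h4]
        calc ‖f τ - f τ'‖ * ‖m τ‖ ≤ (K * |τ - τ'|) * M :=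
              mul_le_mul h1 h2 (norm_nonneg _) (by positivity)
          _ = K * (4 / (3 * ‖c‖)) * M * (3 / 4 * |τ - τ'| * ‖c‖) := by field_simp
          _ ≤ _ := mul_le_mul_of_nonneg_left h3 (by positivity))
    rwa [sub_zero, abs_of_pos hr] at this
  -- Behind the initial point, the distance from `z` to the arc at `τ` is at least of order `τ`,
  -- which the density compensates because it vanishes at 0. Elsewhere `z` is projected to a
  -- parameter `τ'` of the arc.
  rcases le_or_gt ((z - γ 0) / c).re 0 with hneg | hpos
  · have := hest 0 h0I (fun τ hτ => by
      have h1 := h.re_ge hτ h0I hτ.1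
      have h2 : ((z - γ τ) / c).re = ((z - γ 0) / c).re - ((γ τ - γ 0) / c).re := by
        rw [← Complex.sub_re, ← sub_div]; ring_nf
      have h3 := Complex.abs_re_le_norm ((z - γ τ) / c)
      rw [sub_zero, abs_of_nonneg hτ.1]
      rw [sub_zero] at h1
      have := neg_abs_le ((z - γ τ) / c).re
      linarith)
    simp only [hf0, sub_zero] at this
    have : 0 ≤ 4 / 3 * K * (1 + LB) := by positivity
    linarith
  · have hwle : ((z - γ 0) / c).re ≤ ((γ r - γ 0) / c).re := by
      have h1 := Complex.re_le_norm ((z - γ 0) / c)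
      rw [norm_div] at h1
      have h2 : ‖z - γ 0‖ / ‖c‖ < r / 2 := by rw [div_lt_iff₀ hc]; linarith
      linarith
    obtain ⟨τ', hτ', s, hzs, hxe⟩ := h.exists_eq_add (z := z) le_rfl le_rfl hr.le
      (by rw [sub_div, Complex.sub_re] at hpos; linarith)
      (by rw [sub_div, sub_div, Complex.sub_re, Complex.sub_re] at hwle; linarith)
    have hs0 : s ≠ 0 := by
      rintro rfl
      exact hzn ⟨τ', hτ', by rw [hzs]; simp⟩
    have h1 := hest τ' hτ' (fun τ hτ => by
      have h1 := h.abs_re_ge hτ hτ'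
      have h2 : ((z - γ τ) / c).re = -((γ τ - γ τ') / c).re := by
        rw [sub_div, sub_div, Complex.sub_re, Complex.sub_re, hxe]; ring
      have h3 := Complex.abs_re_le_norm ((z - γ τ) / c)
      rw [h2, abs_neg] at h3
      linarith)
    have hint : IntervalIntegrable (fun τ => m τ / (z - γ τ)) MeasureTheory.volume 0 r :=
      intervalIntegrable_div_sub hr.le h.continuousOn hm hzne
    -- The difference `f τ - f τ'` cancels the singularity at the projection. The remaining kernel
    -- is explicit, a difference of logarithms.
    have hsplit : ∫ τ in (0)..r, f τ * (m τ / (z - γ τ)) =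
        (∫ τ in (0)..r, (f τ - f τ') * (m τ / (z - γ τ))) +
          f τ' * ∫ τ in (0)..r, m τ / (z - γ τ) := by
      rw [← intervalIntegral.integral_const_mul, ← intervalIntegral.integral_add]
      · congr 1; ext τ; ring
      · refine hint.continuousOn_mul ?_
        rw [uIcc_of_le hr.le]
        exact hfc.sub continuousOn_const
      · exact hint.const_mul _
    -- the logarithms
    have hIc : ‖Complex.I * c‖ = ‖c‖ := by simp
    have hlog : ∀ w, ‖w‖ = ‖(z - γ 0) / (Complex.I * c)‖ →
        ‖z - γ 0‖ / ‖c‖ * ‖Complex.log w‖ ≤ 1 + Real.pi := fun w hw => by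
      have hx0 : 0 < ‖z - γ 0‖ / ‖c‖ := div_pos (norm_pos_iff.2 (sub_ne_zero.2 (hzne 0 h0I))) hc
      have hx1 : ‖z - γ 0‖ / ‖c‖ ≤ 1 := by rw [div_le_one hc]; exact hz2.le
      have h3 := norm_log_le (w := w)
      rw [hw, norm_div, hIc] at h3
      have h4 := Real.abs_log_mul_self_lt _ hx0 hx1
      rw [abs_mul, abs_of_pos hx0] at h4
      have := Real.pi_pos
      nlinarith
    have hlogr : ∀ w, ‖w‖ = ‖(z - γ r) / (Complex.I * c)‖ →
        ‖Complex.log w‖ ≤ Real.pi + (|Real.log (D / 2 / ‖c‖)| + |Real.log (2 * D / ‖c‖)|) := by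
      intro w hw
      have h3 := norm_log_le (w := w)
      rw [hw, norm_div, hIc] at h3
      have hl : D / 2 ≤ ‖z - γ r‖ := by
        have := norm_sub_norm_le (γ r - γ 0) (z - γ 0)
        rw [sub_sub_sub_cancel_right, norm_sub_rev (γ r) z] at this
        linarith
      have hu : ‖z - γ r‖ ≤ 2 * D := by
        have := norm_sub_le (z - γ 0) (γ r - γ 0)
        rw [sub_sub_sub_cancel_right] at this
        linarith
      have h5 := Real.log_le_log (by positivity) (div_le_div_of_nonneg_right hl hc.le)
      have h6 := Real.log_le_log (div_pos (by linarith) hc) (div_le_div_of_nonneg_right hu hc.le)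
      have h7 : |Real.log (‖z - γ r‖ / ‖c‖)| ≤
          |Real.log (D / 2 / ‖c‖)| + |Real.log (2 * D / ‖c‖)| := by
        rw [abs_le]
        have := neg_abs_le (Real.log (D / 2 / ‖c‖))
        have := le_abs_self (Real.log (2 * D / ‖c‖))
        have := abs_nonneg (Real.log (D / 2 / ‖c‖))
        have := abs_nonneg (Real.log (2 * D / ‖c‖))
        constructor <;> linarith
      linarith
    -- The kernel has size of a logarithm of the distance to the end, and `f τ'` is of the order of
    -- this distance: their product is bounded.
    have hL : ‖z - γ 0‖ / ‖c‖ * ‖∫ τ in (0)..r, m τ / (z - γ τ)‖ ≤ 1 + LB := by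
      have hx1 : ‖z - γ 0‖ / ‖c‖ ≤ 1 := by rw [div_le_one hc]; exact hz2.le
      have hx0 : 0 ≤ ‖z - γ 0‖ / ‖c‖ := by positivity
      have hgen : ∀ w₁ w₂, ‖w₁‖ = ‖(z - γ 0) / (Complex.I * c)‖ →
          ‖w₂‖ = ‖(z - γ r) / (Complex.I * c)‖ →
          ‖z - γ 0‖ / ‖c‖ * ‖Complex.log w₁ - Complex.log w₂‖ ≤ 1 + LB := by
        intro w₁ w₂ hw₁ hw₂
        have h3 := hlog w₁ hw₁
        have h4 := hlogr w₂ hw₂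
        have h5 := norm_sub_le (Complex.log w₁) (Complex.log w₂)
        have h6 : ‖z - γ 0‖ / ‖c‖ * ‖Complex.log w₂‖ ≤ ‖Complex.log w₂‖ :=
          mul_le_of_le_one_left (norm_nonneg _) hx1
        have h7 := mul_le_mul_of_nonneg_left h5 hx0
        rw [mul_add] at h7
        rw [hLB]
        linarith
      rcases lt_or_gt_of_ne hs0 with hsn | hsp
      · rw [h.integral_right hr.le hd hm hτ' hsn hzs]
        exact hgen _ _ (norm_neg _) (norm_neg _)
      · rw [h.integral_left hr.le hd hm hτ' hsp hzs]
        exact hgen _ _ rfl rfl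
    have hfτ' : ‖f τ'‖ ≤ 4 / 3 * K * (‖z - γ 0‖ / ‖c‖) := by
      have h3 := hf τ' hτ' 0 h0I
      rw [hf0, sub_zero, sub_zero, abs_of_nonneg hτ'.1] at h3
      have h4 := h.re_ge hτ' h0I hτ'.1
      have h5 : ((γ τ' - γ 0) / c).re = ((z - γ 0) / c).re := by
        rw [sub_div, sub_div, Complex.sub_re, Complex.sub_re, hxe]
      have h6 := Complex.re_le_norm ((z - γ 0) / c)
      rw [norm_div] at h6
      rw [sub_zero, h5] at h4
      nlinarith
    rw [hsplit]
    refine (norm_add_le _ _).trans (add_le_add h1 ?_)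
    rw [norm_mul]
    calc ‖f τ'‖ * ‖∫ τ in (0)..r, m τ / (z - γ τ)‖
        ≤ (4 / 3 * K * (‖z - γ 0‖ / ‖c‖)) * ‖∫ τ in (0)..r, m τ / (z - γ τ)‖ :=
          mul_le_mul_of_nonneg_right hfτ' (norm_nonneg _)
      _ = 4 / 3 * K * (‖z - γ 0‖ / ‖c‖ * ‖∫ τ in (0)..r, m τ / (z - γ τ)‖) := by ring
      _ ≤ _ := mul_le_mul_of_nonneg_left hL (by positivity)

/-! ### The two sides of a cut. -/

namespace CutContour

variable {p n : ℕ}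

theorem strictMono_α (C : CutContour p n) : StrictMono C.α :=
  Fin.strictMono_iff_lt_succ.2 fun i => (C.α_lt_β i.castSucc).trans (C.β_lt_α i)

theorem β_lt_α_of_lt (C : CutContour p n) {i j : Fin (n + 1)} (h : i < j) : C.β i < C.α j := by
  obtain ⟨k, rfl⟩ : ∃ k : Fin n, i = k.castSucc :=
    ⟨i.castPred (Fin.ne_last_of_lt h), (Fin.castSucc_castPred _ _).symm⟩
  exact (C.β_lt_α k).trans_le (C.strictMono_α.monotone (Fin.castSucc_lt_iff_succ_le.1 h))

theorem Γ_mem_cut_iff (C : CutContour p n) {j : Fin (n + 1)} {τ : ℝ} :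
    C.Γ τ ∈ C.Γ '' Icc (C.α j) (C.β j) ↔ τ ∈ Icc (C.α j) (C.β j) :=
  C.injective.mem_set_image

theorem notMem_cut_of_ne (C : CutContour p n) {i j : Fin (n + 1)} (hij : i ≠ j) {τ : ℝ}
    (hτ : τ ∈ Icc (C.α j) (C.β j)) : C.Γ τ ∉ C.Γ '' Icc (C.α i) (C.β i) := by
  rw [Γ_mem_cut_iff]
  rintro ⟨h1, h2⟩
  rcases lt_or_gt_of_ne hij with h | h
  · linarith [C.β_lt_α_of_lt h, hτ.1]
  · linarith [C.β_lt_α_of_lt h, hτ.2]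

theorem cut_subset_J (C : CutContour p n) (j : Fin (n + 1)) :
    C.Γ '' Icc (C.α j) (C.β j) ⊆ C.J := subset_iUnion (fun j => C.Γ '' Icc (C.α j) (C.β j)) j

theorem isClosed_J (C : CutContour p n) : IsClosed C.J := C.isCompact_J.isClosed

theorem hasDerivAt_cut (C : CutContour p n) {j : Fin (n + 1)} {τ : ℝ}
    (hτ : τ ∈ Ioo (C.α j) (C.β j)) : HasDerivAt C.Γ (deriv C.Γ τ) τ :=
  ((((C.cut_C1 j).1.differentiableOn one_ne_zero) τ (Ioo_subset_Icc_self hτ)).differentiableAt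
    (Icc_mem_nhds hτ.1 hτ.2)).hasDerivAt

theorem exists_bound_deriv (C : CutContour p n) (j : Fin (n + 1)) :
    ∃ M : ℝ, 0 < M ∧ ∀ τ ∈ Ioo (C.α j) (C.β j), ‖deriv C.Γ τ‖ ≤ M := by
  obtain ⟨K, hK⟩ := isCompact_Icc.exists_bound_of_continuousOn (C.continuousOn_derivWithin_cut j)
  refine ⟨max K 1, by positivity, fun τ hτ => ?_⟩
  rw [C.deriv_eqOn_cut j hτ]
  exact (hK τ (Ioo_subset_Icc_self hτ)).trans (le_max_left _ _)

theorem intervalIntegrable_deriv_cut (C : CutContour p n) (j : Fin (n + 1)) :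
    IntervalIntegrable (deriv C.Γ) MeasureTheory.volume (C.α j) (C.β j) := by
  have h1 : IntervalIntegrable (derivWithin C.Γ (Icc (C.α j) (C.β j))) MeasureTheory.volume
      (C.α j) (C.β j) := by
    apply ContinuousOn.intervalIntegrable
    rw [uIcc_of_le (C.α_lt_β j).le]
    exact C.continuousOn_derivWithin_cut j
  rw [intervalIntegrable_iff_integrableOn_Ioo_of_le (C.α_lt_β j).le] at h1 ⊢
  exact h1.congr_fun (C.deriv_eqOn_cut j).symm measurableSet_Ioo

theorem intervalIntegrable_deriv_of_subset (C : CutContour p n) (j : Fin (n + 1)) {u v : ℝ}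
    (huv : u ≤ v) (hu : C.α j ≤ u) (hv : v ≤ C.β j) :
    IntervalIntegrable (deriv C.Γ) MeasureTheory.volume u v := by
  refine (C.intervalIntegrable_deriv_cut j).mono_set ?_
  rw [uIcc_of_le huv, uIcc_of_le (C.α_lt_β j).le]
  exact Icc_subset_Icc hu hv

/-- The branch of `log ((z - a_j) / (z - b_j))` on the complement of the `j`-th cut. -/
noncomputable def cutLog (C : CutContour p n) (j : Fin (n + 1)) (z : ℂ) : ℂ :=
  ∫ τ in (C.α j)..(C.β j), deriv C.Γ τ / (z - C.Γ τ)

theorem sqrtR_eq_prod (C : CutContour p n) (z : ℂ) :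
    C.sqrtR z = ∏ j, (z - C.b j) * Complex.exp ((1 / 2) * C.cutLog j z) := rfl

theorem differentiableAt_integral_piece (C : CutContour p n) (j : Fin (n + 1)) {u v : ℝ}
    (huv : u ≤ v) (hu : C.α j ≤ u) (hv : v ≤ C.β j) {z : ℂ} (hz : z ∉ C.Γ '' Icc u v) :
    DifferentiableAt ℂ (fun z => ∫ τ in u..v, deriv C.Γ τ / (z - C.Γ τ)) z := by
  have h1 := (hasDerivAt_cauchyIntegral huv C.continuous.continuousOn
    (C.intervalIntegrable_deriv_of_subset j huv hu hv) hz).differentiableAt.fun_neg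
  refine h1.congr_of_eventuallyEq (.of_forall fun w => ?_)
  simp only [← intervalIntegral.integral_neg]
  congr 1
  ext τ
  rw [← div_neg, neg_sub]

theorem differentiableAt_cutLog (C : CutContour p n) (j : Fin (n + 1)) {z : ℂ}
    (hz : z ∉ C.Γ '' Icc (C.α j) (C.β j)) : DifferentiableAt ℂ (C.cutLog j) z :=
  C.differentiableAt_integral_piece j (C.α_lt_β j).le le_rfl le_rfl hz

/-- Around an interior point of a cut, the cut is nearly linear. -/
theorem exists_nearlyLinear_cut (C : CutContour p n) (j : Fin (n + 1)) {τ₀ : ℝ}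
    (hτ₀ : τ₀ ∈ Ioo (C.α j) (C.β j)) :
    ∃ r > 0, C.α j < τ₀ - r ∧ τ₀ + r < C.β j ∧
      NearlyLinear C.Γ (deriv C.Γ τ₀) (τ₀ - r) (τ₀ + r) ∧
      ∀ τ ∈ Icc (τ₀ - r) (τ₀ + r), ‖deriv C.Γ τ - deriv C.Γ τ₀‖ ≤ ‖deriv C.Γ τ₀‖ / 4 := by
  obtain ⟨r, hr, h1, h2⟩ := exists_nearlyLinear (C.α_lt_β j) (C.cut_C1 j).1
    (Ioo_subset_Icc_self hτ₀) ((C.cut_C1 j).2 _ (Ioo_subset_Icc_self hτ₀))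
  rw [← C.deriv_eqOn_cut j hτ₀] at h1 h2
  set r' := min r (min ((τ₀ - C.α j) / 2) ((C.β j - τ₀) / 2)) with hr'
  have hA : 0 < τ₀ - C.α j := sub_pos.2 hτ₀.1
  have hB : 0 < C.β j - τ₀ := sub_pos.2 hτ₀.2
  have h3 : r' ≤ r := min_le_left _ _
  have h4 : r' ≤ (τ₀ - C.α j) / 2 := (min_le_right _ _).trans (min_le_left _ _)
  have h5 : r' ≤ (C.β j - τ₀) / 2 := (min_le_right _ _).trans (min_le_right _ _)
  refine ⟨r', by positivity, by linarith, by linarith,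
    h1 _ _ (by linarith) (by linarith) (by linarith) (by linarith), fun τ hτ => ?_⟩
  have hτO : τ ∈ Ioo (C.α j) (C.β j) := ⟨by linarith [hτ.1], by linarith [hτ.2]⟩
  have := h2 τ (Ioo_subset_Icc_self hτO)
    (abs_le.2 ⟨by linarith [hτ.1], by linarith [hτ.2]⟩)
  rwa [← C.deriv_eqOn_cut j hτO] at this

/-- The part of `J` outside a small piece of a cut. -/
def farJ (C : CutContour p n) (j : Fin (n + 1)) (u v : ℝ) : Set ℂ :=
  C.Γ '' (Icc (C.α j) u) ∪ C.Γ '' (Icc v (C.β j)) ∪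
    ⋃ i ∈ (Finset.univ.erase j), C.Γ '' Icc (C.α i) (C.β i)

theorem isClosed_farJ (C : CutContour p n) (j : Fin (n + 1)) (u v : ℝ) :
    IsClosed (C.farJ j u v) := by
  refine ((isCompact_Icc.image C.continuous).isClosed.union
    (isCompact_Icc.image C.continuous).isClosed).union ?_
  exact (Finset.univ.erase j).finite_toSet.isClosed_biUnion fun i _ =>
    (isCompact_Icc.image C.continuous).isClosed

theorem J_subset (C : CutContour p n) (j : Fin (n + 1)) (u v : ℝ) :
    C.J ⊆ C.Γ '' Icc u v ∪ C.farJ j u v := by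
  intro z hz
  obtain ⟨i, hi⟩ := mem_iUnion.1 hz
  by_cases hij : i = j
  · subst hij
    obtain ⟨τ, hτ, rfl⟩ := hi
    rcases le_total τ u with h | h
    · exact Or.inr (Or.inl (Or.inl ⟨τ, ⟨hτ.1, h⟩, rfl⟩))
    · rcases le_total v τ with h' | h'
      · exact Or.inr (Or.inl (Or.inr ⟨τ, ⟨h', hτ.2⟩, rfl⟩))
      · exact Or.inl ⟨τ, ⟨h, h'⟩, rfl⟩
  · refine Or.inr (Or.inr (mem_biUnion (Finset.mem_coe.2 (Finset.mem_erase.2 ⟨hij, Finset.mem_univ i⟩)) hi))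

theorem notMem_farJ (C : CutContour p n) {j : Fin (n + 1)} {u v τ : ℝ} (hα : C.α j ≤ u)
    (hβ : v ≤ C.β j) (hτ : τ ∈ Ioo u v) : C.Γ τ ∉ C.farJ j u v := by
  rintro ((⟨τ', hτ', h⟩ | ⟨τ', hτ', h⟩) | h)
  · have := C.injective h
    linarith [hτ.1, hτ'.2]
  · have := C.injective h
    linarith [hτ.2, hτ'.1]
  · obtain ⟨i, hi, hi'⟩ := mem_iUnion₂.1 h
    exact C.notMem_cut_of_ne (Finset.ne_of_mem_erase hi) ⟨hα.trans hτ.1.le, hτ.2.le.trans hβ⟩ hi'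

/-- An interior point of a cut is a limit of points displaced along the normal, which avoid the
nearby arc by near linearity and the rest of `J` by distance. The ends of the cuts follow by
closure. -/
theorem dense_compl_J (C : CutContour p n) : Dense C.Jᶜ := by
  have hint : ∀ j, ∀ τ ∈ Ioo (C.α j) (C.β j), C.Γ τ ∈ closure C.Jᶜ := by
    intro j τ hτ
    obtain ⟨r, hr, hα, hβ, hNL, hder⟩ := C.exists_nearlyLinear_cut j hτ
    have hfar := C.notMem_farJ hα.le hβ.le (τ := τ) ⟨by linarith, by linarith⟩
    have hev := hNL.eventually_mem_sideStrip (τ₀ := τ) (η := r) (s₀ := 1) one_pos le_rfl le_rfl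
      (τ := τ) ⟨by linarith, by linarith⟩ (m := deriv C.Γ τ) (by simp; positivity) (e := 1) (Or.inl rfl)
    have hlim : Tendsto (fun s : ℝ => C.Γ τ + ((1 * s : ℝ) : ℂ) * (Complex.I * deriv C.Γ τ))
        (𝓝[>] 0) (𝓝 (C.Γ τ)) := by
      have : Continuous fun s : ℝ => C.Γ τ + ((1 * s : ℝ) : ℂ) * (Complex.I * deriv C.Γ τ) := by
        fun_prop
      have h2 := this.tendsto 0
      simp only [mul_zero, Complex.ofReal_zero, zero_mul, add_zero] at h2
      exact h2.mono_left nhdsWithin_le_nhds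
    refine mem_closure_of_tendsto hlim ?_
    filter_upwards [hev, hlim.eventually ((C.isClosed_farJ j (τ - r) (τ + r)).isOpen_compl.mem_nhds hfar)]
      with s hs hs' hJ
    rcases C.J_subset j (τ - r) (τ + r) hJ with h | h
    · exact hNL.sideStrip_notMem one_ne_zero le_rfl le_rfl hs h
    · exact hs' h
  intro z
  by_cases hz : z ∈ C.J
  · obtain ⟨j, τ, hτ, rfl⟩ := mem_iUnion.1 hz
    have : τ ∈ closure (Ioo (C.α j) (C.β j)) := by rwa [closure_Ioo (C.α_lt_β j).ne]
    have h2 : C.Γ τ ∈ closure (C.Γ '' Ioo (C.α j) (C.β j)) :=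
      image_closure_subset_closure_image C.continuous ⟨τ, this, rfl⟩
    refine closure_minimal ?_ isClosed_closure h2
    rintro _ ⟨τ', hτ', rfl⟩
    exact hint j τ' hτ'
  · exact subset_closure hz

/-- The two sides of a cut at one of its interior points: analytic continuations `Q` of `sqrtR` and
`G` of `cutLog` from the left-hand side `N`, and their relation with `sqrtR` and `cutLog` on the
right-hand side `P`. -/
theorem exists_sides (C : CutContour p n) (j : Fin (n + 1)) {τ₀ : ℝ}
    (hτ₀ : τ₀ ∈ Ioo (C.α j) (C.β j)) :
    ∃ Q G : ℂ → ℂ,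
      (∀ᶠ w in 𝓝 (C.Γ τ₀), DifferentiableAt ℂ Q w ∧ DifferentiableAt ℂ G w ∧ Q w ^ 2 = C.R w) ∧
      (∀ᶠ τ in 𝓝 τ₀, C.sqrtRPlus τ = Q (C.Γ τ)) ∧
      ∀ U ∈ 𝓝 (C.Γ τ₀), ∃ N P : Set ℂ, IsPreconnected N ∧ IsPreconnected P ∧
        N ⊆ U \ C.J ∧ P ⊆ U \ C.J ∧ (∀ᶠ w in 𝓝 (C.Γ τ₀), w ∉ C.J → w ∈ N ∨ w ∈ P) ∧
        (∀ w ∈ N, C.sqrtR w = Q w ∧ C.cutLog j w = G w) ∧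
        (∀ w ∈ P, C.sqrtR w = -Q w ∧ C.cutLog j w = G w + 2 * Real.pi * Complex.I) ∧
        ∀ᶠ τ in 𝓝 τ₀, ∀ᶠ s : ℝ in 𝓝[>] 0,
          C.Γ τ + s * (Complex.I * deriv C.Γ τ) ∈ N ∧
          C.Γ τ - s * (Complex.I * deriv C.Γ τ) ∈ P := by
  classical
  obtain ⟨r, hr, hα, hβ, hNL, hder⟩ := C.exists_nearlyLinear_cut j hτ₀
  set u := τ₀ - r with hu
  set v := τ₀ + r with hv
  set c := deriv C.Γ τ₀ with hc
  have huv : u ≤ v := by linarith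
  have hcn := norm_pos_iff.2 hNL.1
  have hIc : Complex.I * c ≠ 0 := mul_ne_zero Complex.I_ne_zero hNL.1
  have hτ₀I : τ₀ ∈ Icc u v := ⟨by linarith, by linarith⟩
  have hfar := C.notMem_farJ hα.le hβ.le (τ := τ₀) ⟨by linarith, by linarith⟩
  have hfaro : (C.farJ j u v)ᶜ ∈ 𝓝 (C.Γ τ₀) := (C.isClosed_farJ j u v).isOpen_compl.mem_nhds hfar
  -- Only the piece of the cut near `τ₀` makes `cutLog` jump; there its integral is replaced by its
  -- closed form on the left, which continues analytically across the arc. The pieces before `u` and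
  -- after `v` are already analytic.
  set G : ℂ → ℂ := fun w => Complex.log ((w - C.Γ u) / (Complex.I * c)) -
    Complex.log ((w - C.Γ v) / (Complex.I * c)) +
    ((∫ τ in (C.α j)..u, deriv C.Γ τ / (w - C.Γ τ)) +
      ∫ τ in v..(C.β j), deriv C.Γ τ / (w - C.Γ τ)) with hG
  set Q : ℂ → ℂ := fun w => (∏ i ∈ Finset.univ.erase j,
    (w - C.b i) * Complex.exp ((1 / 2) * C.cutLog i w)) *
      ((w - C.b j) * Complex.exp ((1 / 2) * G w)) with hQ
  -- differentiability
  have him : ∀ᶠ w in 𝓝 (C.Γ τ₀), ((w - C.Γ u) / (Complex.I * c)).im < 0 ∧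
      0 < ((w - C.Γ v) / (Complex.I * c)).im := by
    have h1 : ContinuousAt (fun w : ℂ => ((w - C.Γ u) / (Complex.I * c)).im) (C.Γ τ₀) := by fun_prop
    have h2 : ContinuousAt (fun w : ℂ => ((w - C.Γ v) / (Complex.I * c)).im) (C.Γ τ₀) := by fun_prop
    have a1 := hNL.im_neg_of_lt (s := 0) hτ₀I (left_mem_Icc.2 huv) (by linarith)
    have a2 := hNL.im_pos_of_lt (s := 0) hτ₀I (right_mem_Icc.2 huv) (by linarith)
    simp only [Complex.ofReal_zero, zero_mul, add_zero] at a1 a2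
    exact (h1.eventually_lt continuousAt_const a1).and (continuousAt_const.eventually_lt h2 a2)
  have hGd : ∀ᶠ w in 𝓝 (C.Γ τ₀), DifferentiableAt ℂ G w := by
    filter_upwards [him, hfaro] with w hw hwf
    refine ((DifferentiableAt.clog (by fun_prop) ?_).sub (DifferentiableAt.clog (by fun_prop) ?_)).add
      ((C.differentiableAt_integral_piece j hα.le le_rfl (by linarith) ?_).add
        (C.differentiableAt_integral_piece j hβ.le (by linarith) le_rfl ?_))
    · exact Complex.mem_slitPlane_iff.2 (Or.inr hw.1.ne)
    · exact Complex.mem_slitPlane_iff.2 (Or.inr hw.2.ne')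
    · exact fun h => hwf (Or.inl (Or.inl h))
    · exact fun h => hwf (Or.inl (Or.inr h))
  have hQd : ∀ᶠ w in 𝓝 (C.Γ τ₀), DifferentiableAt ℂ Q w := by
    filter_upwards [hGd, hfaro] with w hw hwf
    refine DifferentiableAt.mul ?_ ?_
    · refine DifferentiableAt.fun_finsetProd fun i hi => ?_
      refine DifferentiableAt.mul (by fun_prop) (((C.differentiableAt_cutLog i ?_).const_mul _).cexp)
      exact fun h => hwf (Or.inr (mem_biUnion (Finset.mem_coe.2 hi) h))
    · exact DifferentiableAt.mul (by fun_prop) ((hw.const_mul _).cexp)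
  -- the sides
  have hsplit : ∀ w ∉ C.J, C.cutLog j w = (∫ τ in u..v, deriv C.Γ τ / (w - C.Γ τ)) +
      ((∫ τ in (C.α j)..u, deriv C.Γ τ / (w - C.Γ τ)) +
      ∫ τ in v..(C.β j), deriv C.Γ τ / (w - C.Γ τ)) := by
    intro w hw
    have hint : ∀ x y, x ≤ y → C.α j ≤ x → y ≤ C.β j →
        IntervalIntegrable (fun τ => deriv C.Γ τ / (w - C.Γ τ)) MeasureTheory.volume x y :=
      fun x y hxy hx hy => intervalIntegrable_div_sub hxy C.continuous.continuousOn
        (C.intervalIntegrable_deriv_of_subset j hxy hx hy) fun τ hτ h0 =>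
          hw (C.cut_subset_J j ⟨τ, ⟨hx.trans hτ.1, hτ.2.trans hy⟩, h0.symm⟩)
    have i1 := hint (C.α j) u hα.le le_rfl (by linarith)
    have i2 := hint u v huv hα.le hβ.le
    have i3 := hint v (C.β j) hβ.le (by linarith) le_rfl
    rw [cutLog, ← intervalIntegral.integral_add_adjacent_intervals (i1.trans i2) i3,
      ← intervalIntegral.integral_add_adjacent_intervals i1 i2]
    ring
  have hprod : ∀ w, C.sqrtR w = (∏ i ∈ Finset.univ.erase j,
      (w - C.b i) * Complex.exp ((1 / 2) * C.cutLog i w)) *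
      ((w - C.b j) * Complex.exp ((1 / 2) * C.cutLog j w)) := fun w => by
    rw [sqrtR_eq_prod, Finset.prod_erase_mul _ _ (Finset.mem_univ j)]
  have hderI : ∀ τ ∈ Ioo u v, HasDerivAt C.Γ (deriv C.Γ τ) τ := fun τ hτ =>
    C.hasDerivAt_cut (j := j) ⟨hα.trans hτ.1, hτ.2.trans hβ⟩
  have hmI := C.intervalIntegrable_deriv_of_subset j huv hα.le hβ.le
  have hside : ∀ U ∈ 𝓝 (C.Γ τ₀), ∃ N P : Set ℂ, IsPreconnected N ∧ IsPreconnected P ∧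
        N ⊆ U \ C.J ∧ P ⊆ U \ C.J ∧ (∀ᶠ w in 𝓝 (C.Γ τ₀), w ∉ C.J → w ∈ N ∨ w ∈ P) ∧
        (∀ w ∈ N, C.sqrtR w = Q w ∧ C.cutLog j w = G w) ∧
        (∀ w ∈ P, C.sqrtR w = -Q w ∧ C.cutLog j w = G w + 2 * Real.pi * Complex.I) ∧
        ∀ᶠ τ in 𝓝 τ₀, ∀ᶠ s : ℝ in 𝓝[>] 0,
          C.Γ τ + s * (Complex.I * deriv C.Γ τ) ∈ N ∧
          C.Γ τ - s * (Complex.I * deriv C.Γ τ) ∈ P := by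
    intro U hU
    obtain ⟨ε, hε, hball⟩ := Metric.mem_nhds_iff.1 (inter_mem hU hfaro)
    set η := min r (ε / (4 * ‖c‖)) with hη
    have hη0 : 0 < η := by positivity
    have hηr : η ≤ r := min_le_left _ _
    have hηε : η * (4 * ‖c‖) ≤ ε := by
      rw [← le_div_iff₀ (by positivity)]; exact min_le_right _ _
    set s₀ := ε / (2 * ‖c‖) with hs₀
    have hs₀0 : 0 < s₀ := by positivity
    have hs₀ε : s₀ * (2 * ‖c‖) = ε := by rw [hs₀]; field_simp
    have hu' : u ≤ τ₀ - η := by linarith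
    have hv' : τ₀ + η ≤ v := by linarith
    have hsum : ‖c‖ * (2 * η + s₀) ≤ ε := by nlinarith
    have hsubJ : ∀ e : ℝ, |e| = 1 → sideStrip C.Γ c τ₀ η s₀ e ⊆ U \ C.J := by
      intro e he w hw
      have hwb := hball (hNL.sideStrip_subset_ball he hu' hv' hη0 hsum hw)
      have he0 : e ≠ 0 := by rintro rfl; simp at he
      refine ⟨hwb.1, fun hJ => ?_⟩
      rcases C.J_subset j u v hJ with h | h
      · exact hNL.sideStrip_notMem he0 hu' hv' hw h
      · exact hwb.2 h
    refine ⟨sideStrip C.Γ c τ₀ η s₀ 1, sideStrip C.Γ c τ₀ η s₀ (-1),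
      hNL.isPreconnected_sideStrip hu' hv', hNL.isPreconnected_sideStrip hu' hv',
      hsubJ 1 (by simp), hsubJ (-1) (by simp), ?_, ?_, ?_, ?_⟩
    · obtain ⟨ε', hε', h'⟩ := hNL.exists_ball_subset_sideStrip hη0 hs₀0 hu' hv'
      filter_upwards [Metric.ball_mem_nhds _ hε'] with w hw hwJ
      exact h' ⟨hw, fun h => hwJ (C.cut_subset_J j (image_mono (Icc_subset_Icc hα.le hβ.le) h))⟩
    · intro w hw
      have hwJ := (hsubJ 1 (by simp) hw).2
      have hL : C.cutLog j w = G w := by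
        obtain ⟨⟨τ, s⟩, ⟨hτ, hs⟩, hws⟩ := hw
        rw [hsplit w hwJ, hNL.integral_left huv hderI hmI (τ := τ) (s := 1 * s)
          ⟨hu'.trans hτ.1.le, hτ.2.le.trans hv'⟩ (by simpa using hs.1) hws.symm]
      exact ⟨by rw [hprod w, hL], hL⟩
    · intro w hw
      have hwJ := (hsubJ (-1) (by simp) hw).2
      have hL : C.cutLog j w = G w + 2 * Real.pi * Complex.I := by
        obtain ⟨⟨τ, s⟩, ⟨hτ, hs⟩, hws⟩ := hw
        rw [hsplit w hwJ, hNL.integral_right' huv hderI hmI (τ := τ) (s := -1 * s)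
          ⟨hu'.trans_lt hτ.1, hτ.2.trans_le hv'⟩ (by simpa using hs.1) hws.symm]
        simp only [hG]
        ring
      refine ⟨?_, hL⟩
      -- The logarithm jumps by 2πi; after halving and exponentiation this is the change of sign of
      -- the root.
      have hexp : Complex.exp ((1 / 2) * (G w + 2 * Real.pi * Complex.I)) =
          -Complex.exp ((1 / 2) * G w) := by
        rw [mul_add, Complex.exp_add]
        have : (1 / 2 : ℂ) * (2 * Real.pi * Complex.I) = Real.pi * Complex.I := by ring
        rw [this, Complex.exp_pi_mul_I]; ring
      rw [hprod w, hL, hexp]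
      simp only [hQ]
      ring
    · filter_upwards [Ioo_mem_nhds (show τ₀ - η < τ₀ by linarith) (show τ₀ < τ₀ + η by linarith)]
        with τ hτ
      have hm := hder τ ⟨by linarith [hτ.1], by linarith [hτ.2]⟩
      filter_upwards [hNL.eventually_mem_sideStrip hs₀0 hu' hv' hτ hm (Or.inl rfl),
        hNL.eventually_mem_sideStrip hs₀0 hu' hv' hτ hm (Or.inr rfl)] with s h1 h2
      refine ⟨by simpa using h1, ?_⟩
      have : C.Γ τ - s * (Complex.I * deriv C.Γ τ) =
        C.Γ τ + ((-1 * s : ℝ) : ℂ) * (Complex.I * deriv C.Γ τ) := by push_cast; ring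
      rw [this]; exact h2
  refine ⟨Q, G, ?_, ?_, hside⟩
  · -- `Q ^ 2 = R`
    have hsq : ∀ᶠ w in 𝓝 (C.Γ τ₀), w ∉ C.J → Q w ^ 2 = C.R w := by
      obtain ⟨N, P, -, -, -, -, hNP, hN, hP, -⟩ := hside univ univ_mem
      filter_upwards [hNP] with w hw hwJ
      rw [← C.sqrtR_sq hwJ]
      rcases hw hwJ with h | h
      · rw [(hN w h).1]
      · rw [(hP w h).1, neg_sq]
    filter_upwards [hQd, hGd, eventually_eventually_nhds.2 hsq] with w h1 h2 h3
    refine ⟨h1, h2, ?_⟩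
    -- The identity is known off `J`; continuity and density carry it to the points of the cut.
    have := mem_closure_iff_nhdsWithin_neBot.1 (C.dense_compl_J w)
    have hRc : ContinuousAt C.R w := by unfold CutContour.R; fun_prop
    refine tendsto_nhds_unique ((h1.continuousAt.pow 2).tendsto.mono_left
      (nhdsWithin_le_nhds (s := C.Jᶜ))) ((hRc.tendsto.mono_left nhdsWithin_le_nhds).congr' ?_)
    filter_upwards [nhdsWithin_le_nhds h3, self_mem_nhdsWithin] with w' hw' hJ
    exact (hw' hJ).symm
  -- The boundary value is taken along the normal at `Γ τ`, whereas the strip is built on the normal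
  -- at `Γ τ₀`; the approaching points still enter the strip eventually.
  · obtain ⟨N, P, -, -, -, -, -, hN, -, hev⟩ := hside univ univ_mem
    filter_upwards [hev, C.continuous.continuousAt.eventually hQd] with τ hτ hQτ
    refine Tendsto.limUnder_eq ?_
    have hlim : Tendsto (fun s : ℝ => C.Γ τ + s * (Complex.I * deriv C.Γ τ)) (𝓝[>] 0)
        (𝓝 (C.Γ τ)) := by
      have : Continuous fun s : ℝ => C.Γ τ + s * (Complex.I * deriv C.Γ τ) := by fun_prop
      have h2 := this.tendsto 0
      simp only [Complex.ofReal_zero, zero_mul, add_zero] at h2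
      exact h2.mono_left nhdsWithin_le_nhds
    refine (hQτ.continuousAt.tendsto.comp hlim).congr' ?_
    filter_upwards [hτ] with s hs
    exact (hN _ hs.1).1.symm

end CutContour

/-! ### The square root of R off the cuts and on them. -/

/-- The monic polynomial with the roots `y k`. -/
noncomputable def rootPoly {ι : Type*} [Fintype ι] (y : ι → ℂ) : ℂ[X] :=
  ∏ k, (Polynomial.X - Polynomial.C (y k))

theorem eval_rootPoly {ι : Type*} [Fintype ι] (y : ι → ℂ) (z : ℂ) :
    (rootPoly y).eval z = ∏ k, (z - y k) := by
  simp [rootPoly, Polynomial.eval_prod]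

theorem eval_rootPoly_ne_zero {ι : Type*} [Fintype ι] {y : ι → ℂ} {z : ℂ} (h : ∀ k, z ≠ y k) :
    (rootPoly y).eval z ≠ 0 := by
  rw [eval_rootPoly]
  exact Finset.prod_ne_zero_iff.2 fun k _ => sub_ne_zero.2 (h k)

theorem eval_rootPoly_self {ι : Type*} [Fintype ι] (y : ι → ℂ) (k : ι) :
    (rootPoly y).eval (y k) = 0 := by
  rw [eval_rootPoly]
  exact Finset.prod_eq_zero (Finset.mem_univ k) (sub_self _)

theorem isCoprime_rootPoly {ι : Type*} [Fintype ι] {y : ι → ℂ} (hy : Function.Injective y) :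
    IsCoprime (rootPoly y) (rootPoly y).derivative :=
  Polynomial.separable_prod_X_sub_C_iff.2 hy

namespace CutContour

variable {p n : ℕ}

/-- The endpoints of the cuts as a single family. -/
def pts (C : CutContour p n) : Fin (n + 1) ⊕ Fin (n + 1) → ℂ := Sum.elim C.a C.b

theorem R_eq (C : CutContour p n) (z : ℂ) : C.R z = (rootPoly C.pts).eval z := by
  rw [eval_rootPoly, R, Fintype.prod_sum_type, Finset.prod_mul_distrib]
  rfl

theorem strictMono_β (C : CutContour p n) : StrictMono C.β := fun _ j h =>
  (C.β_lt_α_of_lt h).trans (C.α_lt_β j)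

theorem pts_injective (C : CutContour p n) : Function.Injective C.pts := by
  have hne : ∀ i j, C.α i ≠ C.β j := fun i j h => by
    rcases le_or_gt i j with hij | hij
    · linarith [C.strictMono_α.monotone hij, C.α_lt_β j]
    · linarith [C.β_lt_α_of_lt hij]
  rintro (i | i) (j | j) h
  · rw [C.strictMono_α.injective (C.injective h)]
  · exact absurd (C.injective h) (hne i j)
  · exact absurd (C.injective h).symm (hne j i)
  · rw [C.strictMono_β.injective (C.injective h)]

theorem pts_mem_J (C : CutContour p n) (k : Fin (n + 1) ⊕ Fin (n + 1)) : C.pts k ∈ C.J := by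
  rcases k with j | j
  · exact C.cut_subset_J j ⟨_, left_mem_Icc.2 (C.α_lt_β j).le, rfl⟩
  · exact C.cut_subset_J j ⟨_, right_mem_Icc.2 (C.α_lt_β j).le, rfl⟩

theorem ne_pts_of_mem_cut (C : CutContour p n) {j : Fin (n + 1)} {τ : ℝ}
    (hτ : τ ∈ Ioo (C.α j) (C.β j)) (k : Fin (n + 1) ⊕ Fin (n + 1)) : C.Γ τ ≠ C.pts k := by
  have hτ' := Ioo_subset_Icc_self hτ
  rcases k with i | i <;> intro h <;> have h := C.injective h
  · by_cases hij : i = j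
    · subst hij; linarith [hτ.1]
    · refine C.notMem_cut_of_ne hij hτ' ?_
      rw [h]; exact ⟨_, left_mem_Icc.2 (C.α_lt_β i).le, rfl⟩
  · by_cases hij : i = j
    · subst hij; linarith [hτ.2]
    · refine C.notMem_cut_of_ne hij hτ' ?_
      rw [h]; exact ⟨_, right_mem_Icc.2 (C.α_lt_β i).le, rfl⟩

theorem ne_pts_of_notMem_J (C : CutContour p n) {z : ℂ} (hz : z ∉ C.J)
    (k : Fin (n + 1) ⊕ Fin (n + 1)) : z ≠ C.pts k := fun h => hz (h ▸ C.pts_mem_J k)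

theorem sqrtR_ne_zero (C : CutContour p n) {z : ℂ} (hz : z ∉ C.J) : C.sqrtR z ≠ 0 := by
  have h := C.sqrtR_sq hz
  rw [R_eq] at h
  intro h0
  rw [h0, zero_pow two_ne_zero] at h
  exact eval_rootPoly_ne_zero (C.ne_pts_of_notMem_J hz) h.symm

theorem differentiableAt_sqrtR (C : CutContour p n) {z : ℂ} (hz : z ∉ C.J) :
    DifferentiableAt ℂ C.sqrtR z :=
  C.differentiableOn_sqrtR.differentiableAt (C.isClosed_J.isOpen_compl.mem_nhds hz)

theorem hasDerivAt_sqrtR (C : CutContour p n) {z : ℂ} (hz : z ∉ C.J) :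
    HasDerivAt C.sqrtR ((rootPoly C.pts).derivative.eval z / (2 * C.sqrtR z)) z := by
  have h1 := (C.differentiableAt_sqrtR hz).hasDerivAt
  have h2 : HasDerivAt (fun w => C.sqrtR w ^ 2) ((rootPoly C.pts).derivative.eval z) z := by
    refine ((rootPoly C.pts).hasDerivAt z).congr_of_eventuallyEq ?_
    filter_upwards [C.isClosed_J.isOpen_compl.mem_nhds hz] with w hw
    rw [C.sqrtR_sq hw, R_eq]
  have h3 := (h1.fun_pow 2).unique h2
  have hne := C.sqrtR_ne_zero hz
  refine h1.congr_deriv ?_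
  rw [← h3]
  field_simp
  push_cast
  ring

theorem sqrtRPlus_sq (C : CutContour p n) {j : Fin (n + 1)} {τ : ℝ}
    (hτ : τ ∈ Ioo (C.α j) (C.β j)) : C.sqrtRPlus τ ^ 2 = (rootPoly C.pts).eval (C.Γ τ) := by
  obtain ⟨Q, G, h1, h2, -⟩ := C.exists_sides j hτ
  rw [h2.self_of_nhds, h1.self_of_nhds.2.2, R_eq]

theorem sqrtRPlus_ne_zero (C : CutContour p n) {j : Fin (n + 1)} {τ : ℝ}
    (hτ : τ ∈ Ioo (C.α j) (C.β j)) : C.sqrtRPlus τ ≠ 0 := fun h0 => by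
  have h := C.sqrtRPlus_sq hτ
  rw [h0, zero_pow two_ne_zero] at h
  exact eval_rootPoly_ne_zero (C.ne_pts_of_mem_cut hτ) h.symm

theorem hasDerivAt_sqrtRPlus (C : CutContour p n) {j : Fin (n + 1)} {τ : ℝ}
    (hτ : τ ∈ Ioo (C.α j) (C.β j)) :
    HasDerivAt C.sqrtRPlus
      ((rootPoly C.pts).derivative.eval (C.Γ τ) * deriv C.Γ τ / (2 * C.sqrtRPlus τ)) τ := by
  obtain ⟨Q, G, h1, h2, -⟩ := C.exists_sides j hτ
  have hd := C.hasDerivAt_cut hτ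
  have hQ : DifferentiableAt ℝ C.sqrtRPlus τ :=
    (HasDerivAt.comp_of_eq τ (h1.self_of_nhds.1.hasDerivAt) hd rfl).differentiableAt.congr_of_eventuallyEq
      (h2.mono fun x hx => hx)
  have h3 : HasDerivAt (fun x => C.sqrtRPlus x ^ 2)
      ((rootPoly C.pts).derivative.eval (C.Γ τ) * deriv C.Γ τ) τ := by
    refine (HasDerivAt.comp_of_eq τ ((rootPoly C.pts).hasDerivAt (C.Γ τ)) hd
      rfl).congr_of_eventuallyEq ?_
    filter_upwards [Ioo_mem_nhds hτ.1 hτ.2] with x hx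
    exact C.sqrtRPlus_sq hx
  have h4 := (hQ.hasDerivAt.fun_pow 2).unique h3
  have hne := C.sqrtRPlus_ne_zero hτ
  refine hQ.hasDerivAt.congr_deriv ?_
  rw [← h4]
  field_simp
  push_cast
  ring

open Classical in
/-- The boundary value of `sqrtR` on the `j`-th cut, extended by zero. -/
noncomputable def cutRoot (C : CutContour p n) (j : Fin (n + 1)) (τ : ℝ) : ℂ :=
  if τ ∈ Ioo (C.α j) (C.β j) then C.sqrtRPlus τ else 0

theorem cutRoot_of_mem (C : CutContour p n) {j : Fin (n + 1)} {τ : ℝ}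
    (hτ : τ ∈ Ioo (C.α j) (C.β j)) : C.cutRoot j τ = C.sqrtRPlus τ := if_pos hτ

theorem cutRoot_α (C : CutContour p n) (j : Fin (n + 1)) : C.cutRoot j (C.α j) = 0 :=
  if_neg (by simp)

theorem cutRoot_β (C : CutContour p n) (j : Fin (n + 1)) : C.cutRoot j (C.β j) = 0 :=
  if_neg (by simp)

theorem cutRoot_sq (C : CutContour p n) {j : Fin (n + 1)} {τ : ℝ}
    (hτ : τ ∈ Icc (C.α j) (C.β j)) : C.cutRoot j τ ^ 2 = (rootPoly C.pts).eval (C.Γ τ) := by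
  rcases eq_endpoints_or_mem_Ioo_of_mem_Icc hτ with rfl | rfl | h
  · rw [cutRoot_α, zero_pow two_ne_zero]
    exact (eval_rootPoly_self C.pts (Sum.inl j)).symm
  · rw [cutRoot_β, zero_pow two_ne_zero]
    exact (eval_rootPoly_self C.pts (Sum.inr j)).symm
  · rw [cutRoot_of_mem C h, C.sqrtRPlus_sq h]

theorem hasDerivAt_cutRoot (C : CutContour p n) {j : Fin (n + 1)} {τ : ℝ}
    (hτ : τ ∈ Ioo (C.α j) (C.β j)) :
    HasDerivAt (C.cutRoot j)
      ((rootPoly C.pts).derivative.eval (C.Γ τ) * deriv C.Γ τ / (2 * C.cutRoot j τ)) τ := by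
  rw [cutRoot_of_mem C hτ]
  refine (C.hasDerivAt_sqrtRPlus hτ).congr_of_eventuallyEq ?_
  filter_upwards [Ioo_mem_nhds hτ.1 hτ.2] with x hx
  exact C.cutRoot_of_mem hx

end CutContour

/-- A square root of a continuous function is continuous where it vanishes. -/
theorem continuousWithinAt_of_sq {f g : ℝ → ℂ} {s : Set ℝ} {τ : ℝ} (hτ : τ ∈ s)
    (hg : ContinuousWithinAt g s τ) (hfg : ∀ x ∈ s, f x ^ 2 = g x) (h0 : f τ = 0) :
    ContinuousWithinAt f s τ := by
  have hg0 : g τ = 0 := by rw [← hfg τ hτ, h0, zero_pow two_ne_zero]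
  rw [ContinuousWithinAt, h0]
  have h1 : Tendsto (fun x => Real.sqrt ‖g x‖) (𝓝[s] τ) (𝓝 0) := by
    have := (Real.continuous_sqrt.tendsto _).comp hg.norm.tendsto
    simpa [hg0, Function.comp_def] using this
  refine squeeze_zero_norm' ?_ h1
  filter_upwards [self_mem_nhdsWithin] with x hx
  rw [← hfg x hx, norm_pow, Real.sqrt_sq (norm_nonneg _)]

namespace CutContour

variable {p n : ℕ}

theorem continuousOn_cutRoot (C : CutContour p n) (j : Fin (n + 1)) :
    ContinuousOn (C.cutRoot j) (Icc (C.α j) (C.β j)) := by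
  intro τ hτ
  have hg : ContinuousWithinAt (fun x => (rootPoly C.pts).eval (C.Γ x)) (Icc (C.α j) (C.β j)) τ :=
    ((rootPoly C.pts).continuous.comp C.continuous).continuousWithinAt
  rcases eq_endpoints_or_mem_Ioo_of_mem_Icc hτ with rfl | rfl | h
  · exact continuousWithinAt_of_sq hτ hg (fun x hx => C.cutRoot_sq hx) (C.cutRoot_α j)
  · exact continuousWithinAt_of_sq hτ hg (fun x hx => C.cutRoot_sq hx) (C.cutRoot_β j)
  · exact (C.hasDerivAt_cutRoot h).continuousAt.continuousWithinAt

/-- The density `k R₊^{3/2}` on the `j`-th cut. -/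
noncomputable def density (C : CutContour p n) (k : ℂ[X]) (j : Fin (n + 1)) (τ : ℝ) : ℂ :=
  k.eval (C.Γ τ) * C.cutRoot j τ ^ 3

theorem continuousOn_density (C : CutContour p n) (k : ℂ[X]) (j : Fin (n + 1)) :
    ContinuousOn (C.density k j) (Icc (C.α j) (C.β j)) :=
  (k.continuous.comp C.continuous).continuousOn.mul ((C.continuousOn_cutRoot j).pow 3)

theorem density_α (C : CutContour p n) (k : ℂ[X]) (j : Fin (n + 1)) :
    C.density k j (C.α j) = 0 := by simp [density, cutRoot_α]

theorem density_β (C : CutContour p n) (k : ℂ[X]) (j : Fin (n + 1)) :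
    C.density k j (C.β j) = 0 := by simp [density, cutRoot_β]

/-- This is the reason for the exponent 3/2: the derivative of the cube of the root contains the
root times R', with no negative power, and is bounded up to the ends. -/
theorem lipschitz_density (C : CutContour p n) (k : ℂ[X]) (j : Fin (n + 1)) :
    ∃ K : ℝ, ∀ τ ∈ Icc (C.α j) (C.β j), ∀ τ' ∈ Icc (C.α j) (C.β j),
      ‖C.density k j τ - C.density k j τ'‖ ≤ K * |τ - τ'| := by
  set A := C.α j with hA
  set B := C.β j with hB
  have hder : ∀ τ ∈ Ioo A B, HasDerivAt (C.density k j)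
      ((k.derivative.eval (C.Γ τ) * C.cutRoot j τ ^ 3 + k.eval (C.Γ τ) * (3 / 2 *
        (C.cutRoot j τ * (rootPoly C.pts).derivative.eval (C.Γ τ)))) * deriv C.Γ τ) τ := by
    intro τ hτ
    have h1 := C.hasDerivAt_cutRoot hτ
    have h2 := HasDerivAt.comp_of_eq τ (k.hasDerivAt (C.Γ τ)) (C.hasDerivAt_cut hτ) rfl
    have hne : C.cutRoot j τ ≠ 0 := by
      rw [C.cutRoot_of_mem hτ]; exact C.sqrtRPlus_ne_zero hτ
    refine (h2.mul (h1.fun_pow 3)).congr_deriv ?_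
    simp only [Function.comp]
    field_simp
    push_cast
    ring
  have hcont : ContinuousOn (fun τ => k.derivative.eval (C.Γ τ) * C.cutRoot j τ ^ 3 +
      k.eval (C.Γ τ) * (3 / 2 * (C.cutRoot j τ * (rootPoly C.pts).derivative.eval (C.Γ τ))))
      (Icc A B) := by
    have hp : ∀ q : ℂ[X], ContinuousOn (fun τ => q.eval (C.Γ τ)) (Icc A B) := fun q =>
      (q.continuous.comp C.continuous).continuousOn
    exact ((hp _).mul ((C.continuousOn_cutRoot j).pow 3)).add
      ((hp _).mul (continuousOn_const.mul ((C.continuousOn_cutRoot j).mul (hp _))))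
  obtain ⟨K₁, hK₁⟩ := isCompact_Icc.exists_bound_of_continuousOn hcont
  obtain ⟨M, hM0, hM⟩ := C.exists_bound_deriv j
  have hAB : A < B := C.α_lt_β j
  have hK₁0 : 0 ≤ K₁ := (norm_nonneg _).trans (hK₁ A (left_mem_Icc.2 hAB.le))
  have hlip : LipschitzOnWith (Real.toNNReal (K₁ * M)) (C.density k j) (Ioo A B) := by
    refine LipschitzOnWith.of_dist_le_mul fun x hx y hy => ?_
    rw [dist_eq_norm, dist_eq_norm, Real.coe_toNNReal _ (by positivity)]
    refine Convex.norm_image_sub_le_of_norm_hasDerivWithin_le (s := Ioo A B)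
      (fun τ hτ => (hder τ hτ).hasDerivWithinAt) (fun τ hτ => ?_) (convex_Ioo A B) hy hx
    rw [norm_mul]
    exact mul_le_mul (hK₁ τ (Ioo_subset_Icc_self hτ)) (hM τ hτ) (norm_nonneg _) hK₁0
  have hlip' : LipschitzOnWith (Real.toNNReal (K₁ * M)) (C.density k j) (Icc A B) := by
    rw [← closure_Ioo hAB.ne]
    refine hlip.closure ?_
    rw [closure_Ioo hAB.ne]
    exact C.continuousOn_density k j
  refine ⟨K₁ * M, fun τ hτ τ' hτ' => ?_⟩
  have := hlip'.dist_le_mul τ hτ τ' hτ'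
  rwa [dist_eq_norm, Real.dist_eq, Real.coe_toNNReal _ (by positivity)] at this

end CutContour

/-! ### The Plemelj formula for the density k R^{3/2}. -/

theorem NearlyLinear.comp_add_left {γ : ℝ → ℂ} {c : ℂ} {A r : ℝ} (h : NearlyLinear γ c A (A + r)) :
    NearlyLinear (fun τ => γ (A + τ)) c 0 r := by
  refine ⟨h.1, fun τ hτ τ' hτ' => ?_⟩
  have := h.2 (A + τ) ⟨by linarith [hτ.1], by linarith [hτ.2]⟩ (A + τ')
    ⟨by linarith [hτ'.1], by linarith [hτ'.2]⟩
  rw [add_sub_add_left_eq_sub] at this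
  push_cast at this
  rwa [add_sub_add_left_eq_sub] at this

theorem NearlyLinear.comp_sub_left {γ : ℝ → ℂ} {c : ℂ} {B r : ℝ} (h : NearlyLinear γ c (B - r) B) :
    NearlyLinear (fun τ => γ (B - τ)) (-c) 0 r := by
  refine ⟨neg_ne_zero.2 h.1, fun τ hτ τ' hτ' => ?_⟩
  have := h.2 (B - τ) ⟨by linarith [hτ.2], by linarith [hτ.1]⟩ (B - τ')
    ⟨by linarith [hτ'.2], by linarith [hτ'.1]⟩
  rw [sub_sub_sub_cancel_left, abs_sub_comm] at this
  rw [norm_neg]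
  refine le_trans (le_of_eq ?_) this
  congr 1
  push_cast
  ring

namespace CutContour

variable {p n : ℕ}

theorem exists_nearlyLinear_α (C : CutContour p n) (j : Fin (n + 1)) :
    ∃ c, ∃ r > 0, C.α j + r < C.β j ∧ NearlyLinear (fun τ => C.Γ (C.α j + τ)) c 0 r := by
  have hAB := C.α_lt_β j
  obtain ⟨r, hr, h1, -⟩ := exists_nearlyLinear hAB (C.cut_C1 j).1 (left_mem_Icc.2 hAB.le)
    ((C.cut_C1 j).2 _ (left_mem_Icc.2 hAB.le))
  have hpos : 0 < C.β j - C.α j := sub_pos.2 hAB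
  have h2 : min r ((C.β j - C.α j) / 2) ≤ (C.β j - C.α j) / 2 := min_le_right _ _
  have h3 : min r ((C.β j - C.α j) / 2) ≤ r := min_le_left _ _
  exact ⟨_, min r ((C.β j - C.α j) / 2), by positivity, by linarith,
    (h1 _ _ le_rfl (by linarith) (by linarith) (by linarith)).comp_add_left⟩

theorem exists_nearlyLinear_β (C : CutContour p n) (j : Fin (n + 1)) :
    ∃ c, ∃ r > 0, C.α j < C.β j - r ∧ NearlyLinear (fun τ => C.Γ (C.β j - τ)) c 0 r := by
  have hAB := C.α_lt_β j
  obtain ⟨r, hr, h1, -⟩ := exists_nearlyLinear hAB (C.cut_C1 j).1 (right_mem_Icc.2 hAB.le)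
    ((C.cut_C1 j).2 _ (right_mem_Icc.2 hAB.le))
  have hpos : 0 < C.β j - C.α j := sub_pos.2 hAB
  have h2 : min r ((C.β j - C.α j) / 2) ≤ (C.β j - C.α j) / 2 := min_le_right _ _
  have h3 : min r ((C.β j - C.α j) / 2) ≤ r := min_le_left _ _
  exact ⟨_, min r ((C.β j - C.α j) / 2), by positivity, by linarith,
    (h1 _ _ (by linarith) le_rfl (by linarith) (by linarith)).comp_sub_left⟩

end CutContour

/-- On the diagonal this is strict differentiability. It makes the regular part of a Cauchy
integral, with kernel `(F s - F w) / (s - w)`, holomorphic across the arc. -/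
theorem continuousOn_uncurry_dslope {F : ℂ → ℂ} {U : Set ℂ} (hU : IsOpen U)
    (hF : DifferentiableOn ℂ F U) :
    ContinuousOn (fun x : ℂ × ℂ => dslope F x.1 x.2) (U ×ˢ U) := by
  rintro ⟨s, w⟩ ⟨hs, hw⟩
  refine ContinuousAt.continuousWithinAt ?_
  have hFs : ContinuousAt F s := (hF.differentiableAt (hU.mem_nhds hs)).continuousAt
  have hFw : ContinuousAt F w := (hF.differentiableAt (hU.mem_nhds hw)).continuousAt
  by_cases hsw : s = w
  · simp only at hs
    subst hsw
    have han : AnalyticAt ℂ F s := hF.analyticAt (hU.mem_nhds hs)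
    have h1 := han.hasStrictDerivAt.isLittleO
    have h2 : ContinuousAt (deriv F) s := han.deriv.continuousAt
    rw [Metric.continuousAt_iff']
    intro ε hε
    have h3 := h1.def (half_pos hε)
    have h4 := (Metric.continuousAt_iff'.1 (ContinuousAt.comp (f := Prod.fst) (x := (s, s)) h2 continuousAt_fst)) ε hε
    filter_upwards [h3, h4] with x hx hx'
    rw [dslope_same]
    by_cases he : x.2 = x.1
    · rw [he, dslope_same]; exact hx'
    · rw [dslope_of_ne _ he, slope_def_field, dist_eq_norm]
      have hne : x.2 - x.1 ≠ 0 := sub_ne_zero.2 he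
      have h5 : (F x.2 - F x.1) / (x.2 - x.1) - deriv F s =
          (F x.1 - F x.2 - (ContinuousLinearMap.toSpanSingleton ℂ (deriv F s)) (x.1 - x.2)) /
            (x.1 - x.2) := by
        have hne' : x.1 - x.2 ≠ 0 := sub_ne_zero.2 (Ne.symm he)
        rw [div_sub' hne, div_eq_div_iff hne hne']
        simp
        ring
      rw [h5, norm_div]
      refine lt_of_le_of_lt ?_ (half_lt_self hε)
      have hne' : x.1 - x.2 ≠ 0 := sub_ne_zero.2 (Ne.symm he)
      rw [div_le_iff₀ (norm_pos_iff.2 hne')]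
      exact hx
  · have hne : ∀ᶠ x : ℂ × ℂ in 𝓝 (s, w), x.2 ≠ x.1 :=
      (isOpen_ne_fun continuous_snd continuous_fst).mem_nhds (show (s, w).2 ≠ (s, w).1 from Ne.symm hsw)
    have h1 : ContinuousAt (fun x : ℂ × ℂ => (F x.2 - F x.1) / (x.2 - x.1)) (s, w) := by
      refine ContinuousAt.div ?_ (by fun_prop) (sub_ne_zero.2 (Ne.symm hsw))
      exact (ContinuousAt.comp (f := Prod.snd) (x := (s, w)) hFw continuousAt_snd).sub
        (ContinuousAt.comp (f := Prod.fst) (x := (s, w)) hFs continuousAt_fst)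
    refine h1.congr ?_
    filter_upwards [hne] with x hx
    rw [dslope_of_ne _ hx, slope_def_field]

namespace CutContour

variable {p n : ℕ}

/-- The Cauchy integral of the density `k R₊^{3/2}` on the `j`-th cut. -/
noncomputable def cauchyCut (C : CutContour p n) (k : ℂ[X]) (j : Fin (n + 1)) (z : ℂ) : ℂ :=
  ∫ τ in (C.α j)..(C.β j), C.density k j τ * deriv C.Γ τ / (C.Γ τ - z)

theorem intervalIntegrable_density (C : CutContour p n) (k : ℂ[X]) (j : Fin (n + 1)) {u v : ℝ}
    (huv : u ≤ v) (hu : C.α j ≤ u) (hv : v ≤ C.β j) :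
    IntervalIntegrable (fun τ => C.density k j τ * deriv C.Γ τ) MeasureTheory.volume u v := by
  refine (C.intervalIntegrable_deriv_of_subset j huv hu hv).continuousOn_mul ?_
  rw [uIcc_of_le huv]
  exact (C.continuousOn_density k j).mono (Icc_subset_Icc hu hv)

theorem differentiableAt_cauchy_piece (C : CutContour p n) (k : ℂ[X]) (j : Fin (n + 1)) {u v : ℝ}
    (huv : u ≤ v) (hu : C.α j ≤ u) (hv : v ≤ C.β j) {z : ℂ} (hz : z ∉ C.Γ '' Icc u v) :
    DifferentiableAt ℂ
      (fun z => ∫ τ in u..v, C.density k j τ * deriv C.Γ τ / (C.Γ τ - z)) z :=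
  (hasDerivAt_cauchyIntegral huv C.continuous.continuousOn
    (C.intervalIntegrable_density k j huv hu hv) hz).differentiableAt

theorem differentiableAt_cauchyCut (C : CutContour p n) (k : ℂ[X]) (j : Fin (n + 1)) {z : ℂ}
    (hz : z ∉ C.Γ '' Icc (C.α j) (C.β j)) : DifferentiableAt ℂ (C.cauchyCut k j) z :=
  C.differentiableAt_cauchy_piece k j (C.α_lt_β j).le le_rfl le_rfl hz

theorem intervalIntegrable_density_div (C : CutContour p n) (k : ℂ[X]) (j : Fin (n + 1)) {u v : ℝ}
    (huv : u ≤ v) (hu : C.α j ≤ u) (hv : v ≤ C.β j) {z : ℂ} (hz : z ∉ C.Γ '' Icc u v) :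
    IntervalIntegrable (fun τ => C.density k j τ * deriv C.Γ τ / (C.Γ τ - z))
      MeasureTheory.volume u v := by
  have := (intervalIntegrable_div_sub huv C.continuous.continuousOn
    (C.intervalIntegrable_density k j huv hu hv) (z := z) fun τ hτ h0 => hz ⟨τ, hτ, h0.symm⟩).neg
  refine this.congr (fun τ _ => ?_)
  simp only [Pi.neg_apply]
  rw [← div_neg, neg_sub]

/-- Near the end, `NearlyLinear.bounded_cauchyIntegral` applies because the density is Lipschitz and
vanishes there; the remaining part of the cut is away from the end and contributes a continuous
function. -/
theorem bounded_cauchyCut_α (C : CutContour p n) (k : ℂ[X]) (j : Fin (n + 1)) :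
    ∃ K : ℝ, ∀ᶠ z in 𝓝 (C.a j), z ∉ C.J → ‖C.cauchyCut k j z‖ ≤ K := by
  obtain ⟨c, r, hr, hrβ, hNL⟩ := C.exists_nearlyLinear_α j
  obtain ⟨L, hL⟩ := C.lipschitz_density k j
  obtain ⟨M, hM0, hM⟩ := C.exists_bound_deriv j
  have hint := C.intervalIntegrable_deriv_of_subset j (u := C.α j) (v := C.α j + r)
    (by linarith) le_rfl hrβ.le
  have hmem : ∀ τ ∈ Icc 0 r, C.α j + τ ∈ Icc (C.α j) (C.β j) := fun τ hτ =>
    ⟨by linarith [hτ.1], by linarith [hτ.2]⟩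
  obtain ⟨B, hB⟩ := hNL.bounded_cauchyIntegral (m := fun τ => deriv C.Γ (C.α j + τ))
    (f := fun τ => C.density k j (C.α j + τ)) (M := M) (K := L) hr
    (fun τ hτ => by
      have := C.hasDerivAt_cut (j := j) (τ := C.α j + τ) ⟨by linarith [hτ.1], by linarith [hτ.2]⟩
      exact this.comp_const_add (C.α j) τ)
    (by simpa using hint.comp_add_left (C.α j))
    (fun τ hτ => hM _ ⟨by linarith [hτ.1], by linarith [hτ.2]⟩)
    (by simp [density_α])
    (fun τ hτ τ' hτ' => by
      have := hL _ (hmem τ hτ) _ (hmem τ' hτ')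
      rwa [add_sub_add_left_eq_sub] at this)
  have hfar : C.a j ∉ C.Γ '' Icc (C.α j + r) (C.β j) := by
    rintro ⟨τ, hτ, h⟩
    have := C.injective h
    linarith [hτ.1]
  have hcont := (C.differentiableAt_cauchy_piece k j hrβ.le (by linarith) le_rfl hfar).continuousAt
  have hb2 := hcont.norm.eventually_lt continuousAt_const (lt_add_one _)
  simp only [add_zero] at hB
  refine ⟨B + (‖∫ τ in (C.α j + r)..(C.β j),
    C.density k j τ * deriv C.Γ τ / (C.Γ τ - C.a j)‖ + 1), ?_⟩
  filter_upwards [hB, hb2] with z h1 h2 hzJ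
  have hz1 : z ∉ (fun τ => C.Γ (C.α j + τ)) '' Icc 0 r := by
    rintro ⟨τ, hτ, rfl⟩
    exact hzJ (C.cut_subset_J j ⟨_, hmem τ hτ, rfl⟩)
  have hsub : ∀ u v, C.α j ≤ u → v ≤ C.β j → z ∉ C.Γ '' Icc u v := fun u v hu hv h =>
    hzJ (C.cut_subset_J j (image_mono (Icc_subset_Icc hu hv) h))
  have i1 := C.intervalIntegrable_density_div k j (u := C.α j) (v := C.α j + r) (by linarith) le_rfl
    hrβ.le (hsub _ _ le_rfl hrβ.le)
  have i2 := C.intervalIntegrable_density_div k j hrβ.le (by linarith) le_rfl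
    (hsub _ _ (by linarith) le_rfl)
  rw [cauchyCut, ← intervalIntegral.integral_add_adjacent_intervals i1 i2]
  refine (norm_add_le _ _).trans (add_le_add ?_ h2.le)
  have h3 := h1 hz1
  have h4 : ∫ τ in (C.α j)..(C.α j + r), C.density k j τ * deriv C.Γ τ / (C.Γ τ - z) =
      -∫ τ in (0)..r, C.density k j (C.α j + τ) *
        (deriv C.Γ (C.α j + τ) / (z - C.Γ (C.α j + τ))) := by
    have := intervalIntegral.integral_comp_add_left (a := 0) (b := r)
      (fun τ => C.density k j τ * deriv C.Γ τ / (C.Γ τ - z)) (C.α j)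
    rw [add_zero] at this
    rw [← this, ← intervalIntegral.integral_neg]
    congr 1
    ext τ
    rw [← neg_sub z, div_neg, mul_div_assoc]
  rw [h4, norm_neg]
  exact h3

/-- Reversal of the parameter turns the terminal end into an initial one; tangent and velocity
change sign. -/
theorem bounded_cauchyCut_β (C : CutContour p n) (k : ℂ[X]) (j : Fin (n + 1)) :
    ∃ K : ℝ, ∀ᶠ z in 𝓝 (C.b j), z ∉ C.J → ‖C.cauchyCut k j z‖ ≤ K := by
  obtain ⟨c, r, hr, hrα, hNL⟩ := C.exists_nearlyLinear_β j
  obtain ⟨L, hL⟩ := C.lipschitz_density k j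
  obtain ⟨M, hM0, hM⟩ := C.exists_bound_deriv j
  have hint := C.intervalIntegrable_deriv_of_subset j (u := C.β j - r) (v := C.β j)
    (by linarith) hrα.le le_rfl
  have hmem : ∀ τ ∈ Icc 0 r, C.β j - τ ∈ Icc (C.α j) (C.β j) := fun τ hτ =>
    ⟨by linarith [hτ.2], by linarith [hτ.1]⟩
  obtain ⟨B, hB⟩ := hNL.bounded_cauchyIntegral (m := fun τ => -deriv C.Γ (C.β j - τ))
    (f := fun τ => C.density k j (C.β j - τ)) (M := M) (K := L) hr
    (fun τ hτ => by
      have := C.hasDerivAt_cut (j := j) (τ := C.β j - τ) ⟨by linarith [hτ.2], by linarith [hτ.1]⟩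
      exact this.comp_const_sub (C.β j) τ)
    (by
      have := (hint.comp_sub_left (C.β j)).symm.neg
      rw [sub_self, sub_sub_cancel] at this
      exact this)
    (fun τ hτ => by
      rw [norm_neg]; exact hM _ ⟨by linarith [hτ.2], by linarith [hτ.1]⟩)
    (by simp [density_β])
    (fun τ hτ τ' hτ' => by
      have := hL _ (hmem τ hτ) _ (hmem τ' hτ')
      rwa [sub_sub_sub_cancel_left, abs_sub_comm] at this)
  have hfar : C.b j ∉ C.Γ '' Icc (C.α j) (C.β j - r) := by
    rintro ⟨τ, hτ, h⟩
    have := C.injective h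
    linarith [hτ.2]
  have hcont := (C.differentiableAt_cauchy_piece k j hrα.le le_rfl (by linarith) hfar).continuousAt
  have hb2 := hcont.norm.eventually_lt continuousAt_const (lt_add_one _)
  simp only [sub_zero] at hB
  refine ⟨(‖∫ τ in (C.α j)..(C.β j - r),
    C.density k j τ * deriv C.Γ τ / (C.Γ τ - C.b j)‖ + 1) + B, ?_⟩
  filter_upwards [hB, hb2] with z h1 h2 hzJ
  have hz1 : z ∉ (fun τ => C.Γ (C.β j - τ)) '' Icc 0 r := by
    rintro ⟨τ, hτ, rfl⟩
    exact hzJ (C.cut_subset_J j ⟨_, hmem τ hτ, rfl⟩)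
  have hsub : ∀ u v, C.α j ≤ u → v ≤ C.β j → z ∉ C.Γ '' Icc u v := fun u v hu hv h =>
    hzJ (C.cut_subset_J j (image_mono (Icc_subset_Icc hu hv) h))
  have i1 := C.intervalIntegrable_density_div k j hrα.le le_rfl (by linarith)
    (hsub _ _ le_rfl (by linarith))
  have i2 := C.intervalIntegrable_density_div k j (u := C.β j - r) (v := C.β j) (by linarith)
    hrα.le le_rfl (hsub _ _ hrα.le le_rfl)
  rw [cauchyCut, ← intervalIntegral.integral_add_adjacent_intervals i1 i2]
  refine (norm_add_le _ _).trans (add_le_add h2.le ?_)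
  have h3 := h1 hz1
  have h4 : ∫ τ in (C.β j - r)..(C.β j), C.density k j τ * deriv C.Γ τ / (C.Γ τ - z) =
      ∫ τ in (0)..r, C.density k j (C.β j - τ) *
        (-deriv C.Γ (C.β j - τ) / (z - C.Γ (C.β j - τ))) := by
    have := intervalIntegral.integral_comp_sub_left (a := 0) (b := r)
      (fun τ => C.density k j τ * deriv C.Γ τ / (C.Γ τ - z)) (C.β j)
    rw [sub_zero] at this
    rw [← this]
    congr 1
    ext τ
    rw [← neg_sub z, div_neg, neg_div, mul_neg, mul_div_assoc]
  rw [h4]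
  exact h3

/-- Plemelj: the Cauchy integral of `k R₊^{3/2}` is `πi k R^{3/2}` up to an entire function. -/
theorem exists_entire_cauchyCut (C : CutContour p n) (k : ℂ[X]) :
    ∃ F : ℂ → ℂ, Differentiable ℂ F ∧ ∀ z ∉ C.J,
      F z = ∑ j, C.cauchyCut k j z - Real.pi * Complex.I * (k.eval z * C.sqrtR z ^ 3) := by
  classical
  have hfarJ : ∀ i, ∀ z ∉ C.J, z ∉ C.Γ '' Icc (C.α i) (C.β i) := fun i z hz h =>
    hz (C.cut_subset_J i h)
  refine exists_entire_extension (Z := range C.pts) C.isClosed_J C.dense_compl_J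
    (finite_range _) ?_ ?_ ?_
  · intro z hz
    refine DifferentiableAt.differentiableWithinAt ?_
    refine (DifferentiableAt.fun_sum fun j _ => C.differentiableAt_cauchyCut k j (hfarJ j z hz)).sub ?_
    exact ((k.differentiable z).mul ((C.differentiableAt_sqrtR hz).pow 3)).const_mul _
  · rintro z ⟨hz, hzZ⟩
    obtain ⟨j, τ₀, hτ₀, rfl⟩ := mem_iUnion.1 hz
    have hτ₀O : τ₀ ∈ Ioo (C.α j) (C.β j) := by
      rcases eq_endpoints_or_mem_Ioo_of_mem_Icc hτ₀ with h | h | h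
      · exact absurd ⟨Sum.inl j, by rw [h]; rfl⟩ hzZ
      · exact absurd ⟨Sum.inr j, by rw [h]; rfl⟩ hzZ
      · exact h
    obtain ⟨Q, G, hQG, hSQ, hsides⟩ := C.exists_sides j hτ₀O
    obtain ⟨ε, hε, hball⟩ := Metric.eventually_nhds_iff_ball.1 hQG
    obtain ⟨u, v, huv, huvs⟩ : ∃ u v, τ₀ ∈ Ioo u v ∧ Icc u v ⊆ Ioo (C.α j) (C.β j) ∩
        {τ | C.sqrtRPlus τ = Q (C.Γ τ)} ∩ C.Γ ⁻¹' Metric.ball (C.Γ τ₀) ε := by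
      have : Ioo (C.α j) (C.β j) ∩ {τ | C.sqrtRPlus τ = Q (C.Γ τ)} ∩
          C.Γ ⁻¹' Metric.ball (C.Γ τ₀) ε ∈ 𝓝 τ₀ :=
        inter_mem (inter_mem (Ioo_mem_nhds hτ₀O.1 hτ₀O.2) hSQ)
          (C.continuous.continuousAt (Metric.ball_mem_nhds _ hε))
      obtain ⟨d, hd, hd'⟩ := Metric.nhds_basis_closedBall.mem_iff.1 this
      rw [Real.closedBall_eq_Icc] at hd'
      exact ⟨τ₀ - d, τ₀ + d, ⟨by linarith, by linarith⟩, hd'⟩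
    have huvl : u ≤ v := (huv.1.trans huv.2).le
    have hu := (huvs (left_mem_Icc.2 huvl)).1.1
    have hv := (huvs (right_mem_Icc.2 huvl)).1.1
    set F : ℂ → ℂ := fun w => k.eval w * Q w ^ 3 with hF
    set D := Metric.ball (C.Γ τ₀) ε with hD
    have hFd : DifferentiableOn ℂ F D := fun w hw =>
      ((k.differentiable w).mul ((hball w hw).1.pow 3)).differentiableWithinAt
    have hfF : ∀ τ ∈ Icc u v, C.density k j τ = F (C.Γ τ) := fun τ hτ => by
      have := huvs hτ
      rw [density, C.cutRoot_of_mem this.1.1, this.1.2]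
    have hfaro : (C.farJ j u v)ᶜ ∈ 𝓝 (C.Γ τ₀) :=
      (C.isClosed_farJ j u v).isOpen_compl.mem_nhds (C.notMem_farJ hu.1.le hv.2.le huv)
    obtain ⟨N, P, -, -, hNU, hPU, hNP, hN, hP, -⟩ := hsides (D ∩ (C.farJ j u v)ᶜ)
      (inter_mem (Metric.ball_mem_nhds _ hε) hfaro)
    set far : ℂ → ℂ := fun w => ∑ i ∈ Finset.univ.erase j, C.cauchyCut k i w with hfar
    set I₁ : ℂ → ℂ := fun w => ∫ τ in (C.α j)..u, C.density k j τ * deriv C.Γ τ / (C.Γ τ - w)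
    set I₃ : ℂ → ℂ := fun w => ∫ τ in v..(C.β j), C.density k j τ * deriv C.Γ τ / (C.Γ τ - w)
    set L₁ : ℂ → ℂ := fun w => ∫ τ in (C.α j)..u, deriv C.Γ τ / (w - C.Γ τ)
    set L₃ : ℂ → ℂ := fun w => ∫ τ in v..(C.β j), deriv C.Γ τ / (w - C.Γ τ)
    -- Subtracting `F w` from the density leaves a difference quotient, so this part is holomorphic
    -- in the whole disc.
    set I₂ : ℂ → ℂ := fun w => ∫ τ in u..v, deriv C.Γ τ * dslope F (C.Γ τ) w
    have hI₂ : DifferentiableOn ℂ I₂ D := by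
      refine differentiableOn_integral_of_holomorphic (ψ := fun τ w => dslope F (C.Γ τ) w) huvl
        Metric.isOpen_ball (C.intervalIntegrable_deriv_of_subset j huvl hu.1.le hv.2.le) ?_ ?_
      · refine (continuousOn_uncurry_dslope Metric.isOpen_ball hFd).comp
          (f := fun x : ℝ × ℂ => (C.Γ x.1, x.2)) ?_ ?_
        · exact ((C.continuous.comp continuous_fst).prodMk continuous_snd).continuousOn
        · exact fun x hx => ⟨(huvs hx.1).2, hx.2⟩
      · intro τ hτ
        exact (Complex.differentiableOn_dslope (Metric.isOpen_ball.mem_nhds (huvs hτ).2)).2 hFd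
    -- All the multivaluedness of the Cauchy integral near the arc is concentrated in the last term,
    -- `F w` times the logarithm.
    have hcut : ∀ w ∈ D, w ∉ C.J → ∑ i, C.cauchyCut k i w =
        far w + (I₁ w + I₂ w + I₃ w + F w * (L₁ w + L₃ w)) - F w * C.cutLog j w := by
      intro w hwD hw
      have hsub : ∀ x y, C.α j ≤ x → y ≤ C.β j → w ∉ C.Γ '' Icc x y := fun x y hx hy h =>
        hw (C.cut_subset_J j (image_mono (Icc_subset_Icc hx hy) h))
      have i1 := C.intervalIntegrable_density_div k j hu.1.le le_rfl hu.2.le (hsub _ _ le_rfl hu.2.le)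
      have i2 := C.intervalIntegrable_density_div k j huvl hu.1.le hv.2.le (hsub _ _ hu.1.le hv.2.le)
      have i3 := C.intervalIntegrable_density_div k j hv.2.le hv.1.le le_rfl (hsub _ _ hv.1.le le_rfl)
      have hl : ∀ x y, x ≤ y → C.α j ≤ x → y ≤ C.β j →
          IntervalIntegrable (fun τ => deriv C.Γ τ / (w - C.Γ τ)) MeasureTheory.volume x y :=
        fun x y hxy hx hy => intervalIntegrable_div_sub hxy C.continuous.continuousOn
          (C.intervalIntegrable_deriv_of_subset j hxy hx hy) fun τ hτ h0 =>
            hsub x y hx hy ⟨τ, hτ, h0.symm⟩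
      have l1 := hl _ _ hu.1.le le_rfl hu.2.le
      have l2 := hl _ _ huvl hu.1.le hv.2.le
      have l3 := hl _ _ hv.2.le hv.1.le le_rfl
      have hmid : ∫ τ in u..v, C.density k j τ * deriv C.Γ τ / (C.Γ τ - w) =
          I₂ w - F w * ∫ τ in u..v, deriv C.Γ τ / (w - C.Γ τ) := by
        rw [eq_sub_iff_add_eq, ← intervalIntegral.integral_const_mul,
          ← intervalIntegral.integral_add i2 (l2.const_mul _)]
        refine intervalIntegral.integral_congr fun τ hτ => ?_
        rw [uIcc_of_le huvl] at hτ
        have hne : w ≠ C.Γ τ := fun h => hsub u v hu.1.le hv.2.le ⟨τ, hτ, h.symm⟩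
        have h1 : w - C.Γ τ ≠ 0 := sub_ne_zero.2 hne
        have h2 : C.Γ τ - w ≠ 0 := sub_ne_zero.2 hne.symm
        rw [hfF τ hτ, dslope_of_ne _ hne, slope_def_field]
        rw [← neg_sub w (C.Γ τ)]
        field_simp
        ring
      rw [← Finset.sum_erase_add _ _ (Finset.mem_univ j), cutLog, cauchyCut,
        ← intervalIntegral.integral_add_adjacent_intervals (i1.trans i2) i3,
        ← intervalIntegral.integral_add_adjacent_intervals i1 i2,
        ← intervalIntegral.integral_add_adjacent_intervals (l1.trans l2) l3,
        ← intervalIntegral.integral_add_adjacent_intervals l1 l2, hmid]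
      ring
    -- The same continuation serves both sides. From left to right the logarithm gains 2πi and the
    -- cube of the root changes sign: `-πi F` becomes `-2πi F + πi F`.
    refine ⟨fun w => far w + (I₁ w + I₂ w + I₃ w + F w * (L₁ w + L₃ w)) - F w * G w -
      Real.pi * Complex.I * F w, ?_, ?_⟩
    · filter_upwards [Metric.ball_mem_nhds _ hε, hfaro] with w hwD hwf
      have hFw := hFd.differentiableAt (Metric.isOpen_ball.mem_nhds hwD)
      have n1 : w ∉ C.Γ '' Icc (C.α j) u := fun h => hwf (Or.inl (Or.inl h))
      have n3 : w ∉ C.Γ '' Icc v (C.β j) := fun h => hwf (Or.inl (Or.inr h))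
      refine (((DifferentiableAt.fun_sum fun i hi => C.differentiableAt_cauchyCut k i
        fun h => hwf (Or.inr (mem_biUnion (Finset.mem_coe.2 hi) h))).add
          (((C.differentiableAt_cauchy_piece k j hu.1.le le_rfl hu.2.le n1).add
            (hI₂.differentiableAt (Metric.isOpen_ball.mem_nhds hwD))).add
            (C.differentiableAt_cauchy_piece k j hv.2.le hv.1.le le_rfl n3) |>.add
          (hFw.mul ((C.differentiableAt_integral_piece j hu.1.le le_rfl hu.2.le n1).add
            (C.differentiableAt_integral_piece j hv.2.le hv.1.le le_rfl n3))))).sub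
          (hFw.mul (hball w hwD).2.1)).sub (hFw.const_mul _)
    · filter_upwards [hNP] with w hw hwJ
      rcases hw hwJ with h | h
      · rw [hcut w (hNU h).1.1 hwJ, (hN w h).1, (hN w h).2]
      · rw [hcut w (hPU h).1.1 hwJ, (hP w h).1, (hP w h).2]
        simp only [hF]
        ring
  · rintro _ ⟨κ, rfl⟩
    -- At a branch point the root tends to zero, so its cube is bounded; the Cauchy integrals were
    -- bounded above.
    have hroot : ∀ᶠ w in 𝓝 (C.pts κ), w ∉ C.J →
        ‖(Real.pi * Complex.I) * (k.eval w * C.sqrtR w ^ 3)‖ ≤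
          Real.pi * ((‖k.eval (C.pts κ)‖ + 1) * 1) := by
      have h1 : ∀ᶠ w in 𝓝 (C.pts κ), ‖k.eval w‖ < ‖k.eval (C.pts κ)‖ + 1 :=
        k.continuous.continuousAt.norm.eventually_lt continuousAt_const (lt_add_one _)
      have h2 : ∀ᶠ w in 𝓝 (C.pts κ), ‖(rootPoly C.pts).eval w‖ < 1 := by
        refine (rootPoly C.pts).continuous.continuousAt.norm.eventually_lt continuousAt_const ?_
        rw [eval_rootPoly_self, norm_zero]; exact one_pos
      filter_upwards [h1, h2] with w h1 h2 hw
      rw [← R_eq, ← C.sqrtR_sq hw, norm_pow] at h2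
      have h3 : ‖C.sqrtR w‖ ≤ 1 := by
        by_contra! h
        nlinarith
      rw [norm_mul, norm_mul, norm_mul, norm_pow, Complex.norm_I, Complex.norm_real,
        Real.norm_eq_abs, abs_of_pos Real.pi_pos, mul_one]
      have := pow_le_one₀ (norm_nonneg _) h3 (n := 3)
      gcongr
    have hterm : ∀ i, ∃ K : ℝ, ∀ᶠ w in 𝓝 (C.pts κ), w ∉ C.J → ‖C.cauchyCut k i w‖ ≤ K := by
      intro i
      by_cases hi : C.pts κ ∈ C.Γ '' Icc (C.α i) (C.β i)
      · rcases κ with j | j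
        · have : i = j := by
            by_contra hne
            exact C.notMem_cut_of_ne hne (left_mem_Icc.2 (C.α_lt_β j).le) hi
          subst this
          exact C.bounded_cauchyCut_α k i
        · have : i = j := by
            by_contra hne
            exact C.notMem_cut_of_ne hne (right_mem_Icc.2 (C.α_lt_β j).le) hi
          subst this
          exact C.bounded_cauchyCut_β k i
      · refine ⟨‖C.cauchyCut k i (C.pts κ)‖ + 1, ?_⟩
        filter_upwards [(C.differentiableAt_cauchyCut k i hi).continuousAt.norm.eventually_lt
          continuousAt_const (lt_add_one _)] with w hw _
        exact hw.le
    choose K hK using hterm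
    refine ⟨∑ i, K i + Real.pi * ((‖k.eval (C.pts κ)‖ + 1) * 1), ?_⟩
    filter_upwards [eventually_all.2 hK, hroot] with w h1 h2 hw
    refine (norm_sub_le _ _).trans (add_le_add ?_ (h2 hw))
    exact (norm_sum_le _ _).trans (Finset.sum_le_sum fun i _ => h1 i hw)

end CutContour

/-! ### Reduction of differentials, and cut integrals as circle integrals. -/

/-- Reduction of a hyperelliptic differential: with `R = rootPoly y` and `S = R^{1/2}`, the
differential `G dz / S` is `d (w S) + k S ^ 3 dz`. -/
theorem exists_reduction {ι : Type*} [Fintype ι] {y : ι → ℂ} (hy : Function.Injective y) (G : ℂ[X]) :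
    ∃ w k : ℂ[X], G = w.derivative * rootPoly y +
      Polynomial.C (1 / 2) * w * (rootPoly y).derivative + k * rootPoly y ^ 2 := by
  obtain ⟨u, v, huv⟩ := isCoprime_rootPoly hy
  set R := rootPoly y
  set w₁ : ℂ[X] := Polynomial.C 2 * (G * v) with hw₁
  set κ : ℂ[X] := G * u - w₁.derivative with hκ
  -- `w₁` removes G modulo R and `w₂ * R` removes the rest modulo R². In the second step R' appears
  -- with the factor 1 + 1/2, from the differentiation of R and of its root, hence 2/3 in place of
  -- 2.
  set w₂ : ℂ[X] := Polynomial.C (2 / 3) * (κ * v) with hw₂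
  refine ⟨w₁ + w₂ * R, κ * u - w₂.derivative, ?_⟩
  have h1 : Polynomial.C (1 / 2 : ℂ) * w₁ = G * v := by
    rw [hw₁, ← mul_assoc, ← Polynomial.C_mul]; norm_num
  have h2 : Polynomial.C (1 / 2 : ℂ) * w₂ + w₂ = κ * v := by
    have : Polynomial.C (1 / 2 : ℂ) * w₂ + w₂ = (Polynomial.C (1 / 2 : ℂ) + Polynomial.C 1) * w₂ := by
      rw [Polynomial.C_1]; ring
    rw [this, ← Polynomial.C_add, hw₂, ← mul_assoc, ← Polynomial.C_mul]; norm_num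
  have h3 : (w₁ + w₂ * R).derivative = w₁.derivative + (w₂.derivative * R + w₂ * R.derivative) := by
    rw [Polynomial.derivative_add, Polynomial.derivative_mul (f := w₂)]
  rw [h3]
  clear_value w₁ w₂ R κ
  linear_combination (-G) * huv - R * κ * huv - R.derivative * h1 - R * R.derivative * h2 - R * hκ

/-- The inverse of a function which vanishes like a square root is integrable. -/
theorem intervalIntegrable_inv_of_sq_ge {g : ℝ → ℂ} {r c : ℝ} (hr : 0 < r) (hc : 0 < c)
    (hg : ContinuousOn g (Icc 0 r)) (h : ∀ s ∈ Ioc 0 r, c * s ≤ ‖g s‖ ^ 2) :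
    IntervalIntegrable (fun s => (g s)⁻¹) MeasureTheory.volume 0 r := by
  have h1 : IntervalIntegrable (fun s : ℝ => (Real.sqrt c)⁻¹ * s ^ (-(1 / 2) : ℝ))
      MeasureTheory.volume 0 r :=
    (intervalIntegral.intervalIntegrable_rpow' (by norm_num)).const_mul _
  refine h1.mono_fun' ?_ ?_
  · have : AEMeasurable g (MeasureTheory.volume.restrict (uIoc 0 r)) := by
      rw [uIoc_of_le hr.le]
      exact (hg.mono Ioc_subset_Icc_self).aemeasurable measurableSet_Ioc
    exact this.inv.aestronglyMeasurable
  · rw [uIoc_of_le hr.le]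
    filter_upwards [MeasureTheory.ae_restrict_mem measurableSet_Ioc] with s hs
    have hs0 : 0 < s := hs.1
    have h2 : Real.sqrt (c * s) ≤ ‖g s‖ := Real.sqrt_le_iff.2 ⟨norm_nonneg _, h s hs⟩
    rw [norm_inv]
    have h3 : (Real.sqrt c)⁻¹ * s ^ (-(1 / 2) : ℝ) = (Real.sqrt (c * s))⁻¹ := by
      rw [Real.rpow_neg hs0.le, ← Real.sqrt_eq_rpow, ← mul_inv, Real.sqrt_mul hc.le]
    rw [h3]
    exact inv_anti₀ (Real.sqrt_pos.2 (by positivity)) h2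

/-- The factor of the branch point itself grows linearly along the arc; the product of the others is
bounded below by compactness. Thus the root vanishes exactly to order 1/2, and its inverse is
integrable. -/
theorem exists_rootPoly_ge {ι : Type*} [Fintype ι] {y : ι → ℂ} {γ : ℝ → ℂ} {r : ℝ} (hr : 0 < r)
    {c : ℂ} (h : NearlyLinear γ c 0 r) {k : ι} (hk : γ 0 = y k)
    (hne : ∀ τ ∈ Icc 0 r, ∀ i, i ≠ k → γ τ ≠ y i) :
    ∃ κ > 0, ∀ s ∈ Ioc 0 r, κ * s ≤ ‖(rootPoly y).eval (γ s)‖ := by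
  classical
  have hc := norm_pos_iff.2 h.1
  have hcont : ContinuousOn (fun s => ‖∏ i ∈ Finset.univ.erase k, (γ s - y i)‖) (Icc 0 r) := by
    refine (continuousOn_finsetProd _ fun i _ => ?_).norm
    exact h.continuousOn.sub continuousOn_const
  obtain ⟨s₀, hs₀, hmin⟩ := isCompact_Icc.exists_isMinOn (nonempty_Icc.2 hr.le) hcont
  set μ := ‖∏ i ∈ Finset.univ.erase k, (γ s₀ - y i)‖ with hμ
  have hμ0 : 0 < μ := norm_pos_iff.2 (Finset.prod_ne_zero_iff.2 fun i hi =>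
    sub_ne_zero.2 (hne s₀ hs₀ i (Finset.ne_of_mem_erase hi)))
  refine ⟨μ * (3 / 4 * ‖c‖), by positivity, fun s hs => ?_⟩
  have hsI := Ioc_subset_Icc_self hs
  have h1 := h.norm_ge hsI (left_mem_Icc.2 hr.le)
  rw [sub_zero, abs_of_pos hs.1, hk] at h1
  have h2 : μ ≤ ‖∏ i ∈ Finset.univ.erase k, (γ s - y i)‖ := hmin hsI
  rw [eval_rootPoly, ← Finset.prod_erase_mul _ _ (Finset.mem_univ k), norm_mul, mul_assoc]
  exact mul_le_mul h2 h1 (by have := hs.1; positivity) (norm_nonneg _)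

namespace CutContour

variable {p n : ℕ}

theorem cutRoot_ne_zero (C : CutContour p n) {j : Fin (n + 1)} {τ : ℝ}
    (hτ : τ ∈ Ioo (C.α j) (C.β j)) : C.cutRoot j τ ≠ 0 := by
  rw [C.cutRoot_of_mem hτ]; exact C.sqrtRPlus_ne_zero hτ

theorem intervalIntegrable_inv_cutRoot (C : CutContour p n) (j : Fin (n + 1)) :
    IntervalIntegrable (fun τ => (C.cutRoot j τ)⁻¹) MeasureTheory.volume (C.α j) (C.β j) := by
  obtain ⟨c₁, r₁, hr₁, hr₁β, hNL₁⟩ := C.exists_nearlyLinear_α j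
  obtain ⟨c₂, r₂, hr₂, hr₂α, hNL₂⟩ := C.exists_nearlyLinear_β j
  have hAB := C.α_lt_β j
  have hleft : IntervalIntegrable (fun τ => (C.cutRoot j τ)⁻¹) MeasureTheory.volume (C.α j)
      (C.α j + r₁) := by
    obtain ⟨κ, hκ, hge⟩ := exists_rootPoly_ge (y := C.pts) (k := Sum.inl j) hr₁ hNL₁
      (by rw [add_zero]; rfl) (fun τ hτ i hi => by
        rcases hτ.1.eq_or_lt with h0 | h0
        · rw [← h0, add_zero]
          exact fun h => hi (C.pts_injective (h.symm.trans rfl))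
        · exact C.ne_pts_of_mem_cut (j := j) ⟨by linarith, by linarith [hτ.2]⟩ i)
    have := intervalIntegrable_inv_of_sq_ge (g := fun s => C.cutRoot j (C.α j + s)) hr₁ hκ
      ((C.continuousOn_cutRoot j).comp (by fun_prop) fun s hs =>
        ⟨by linarith [hs.1], by linarith [hs.2]⟩)
      (fun s hs => by
        rw [← norm_pow, C.cutRoot_sq ⟨by linarith [hs.1], by linarith [hs.2]⟩]
        exact hge s hs)
    have h2 := this.comp_add_left (-C.α j)
    simpa [add_comm] using h2
  have hright : IntervalIntegrable (fun τ => (C.cutRoot j τ)⁻¹) MeasureTheory.volume (C.β j - r₂)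
      (C.β j) := by
    obtain ⟨κ, hκ, hge⟩ := exists_rootPoly_ge (y := C.pts) (k := Sum.inr j) hr₂ hNL₂
      (by rw [sub_zero]; rfl) (fun τ hτ i hi => by
        rcases hτ.1.eq_or_lt with h0 | h0
        · rw [← h0, sub_zero]
          exact fun h => hi (C.pts_injective (h.symm.trans rfl))
        · exact C.ne_pts_of_mem_cut (j := j) ⟨by linarith [hτ.2], by linarith⟩ i)
    have := intervalIntegrable_inv_of_sq_ge (g := fun s => C.cutRoot j (C.β j - s)) hr₂ hκ
      ((C.continuousOn_cutRoot j).comp (by fun_prop) fun s hs =>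
        ⟨by linarith [hs.2], by linarith [hs.1]⟩)
      (fun s hs => by
        rw [← norm_pow, C.cutRoot_sq ⟨by linarith [hs.2], by linarith [hs.1]⟩]
        exact hge s hs)
    have h2 := (this.comp_sub_left (C.β j)).symm
    simpa using h2
  set m := (C.α j + C.β j) / 2 with hm
  have hmid : ∀ x y, x ∈ Ioo (C.α j) (C.β j) → y ∈ Ioo (C.α j) (C.β j) →
      IntervalIntegrable (fun τ => (C.cutRoot j τ)⁻¹) MeasureTheory.volume x y := by
    intro x y hx hy
    have hsub : uIcc x y ⊆ Ioo (C.α j) (C.β j) := by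
      intro z hz
      rw [mem_uIcc] at hz
      rcases hz with hz | hz
      · exact ⟨hx.1.trans_le hz.1, hz.2.trans_lt hy.2⟩
      · exact ⟨hy.1.trans_le hz.1, hz.2.trans_lt hx.2⟩
    exact (((C.continuousOn_cutRoot j).mono (hsub.trans Ioo_subset_Icc_self)).inv₀ fun z hz =>
      C.cutRoot_ne_zero (hsub hz)).intervalIntegrable
  exact (hleft.trans (hmid _ _ ⟨by linarith, hr₁β⟩ ⟨hr₂α, by linarith⟩)).trans hright

/-- Integration by parts on a cut of a reduced differential. -/
theorem integral_cut_reduction (C : CutContour p n) (j : Fin (n + 1)) {G w k : ℂ[X]}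
    (hG : G = w.derivative * rootPoly C.pts +
      Polynomial.C (1 / 2) * w * (rootPoly C.pts).derivative + k * rootPoly C.pts ^ 2) :
    ∫ τ in (C.α j)..(C.β j), G.eval (C.Γ τ) / C.cutRoot j τ * deriv C.Γ τ =
      ∫ τ in (C.α j)..(C.β j), C.density k j τ * deriv C.Γ τ := by
  have hAB := (C.α_lt_β j).le
  have hp : ∀ q : ℂ[X], ContinuousOn (fun τ => q.eval (C.Γ τ)) (Icc (C.α j) (C.β j)) := fun q =>
      (q.continuous.comp C.continuous).continuousOn
  obtain ⟨M, hM0, hM⟩ := C.exists_bound_deriv j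
  have i1 : IntervalIntegrable (fun τ => G.eval (C.Γ τ) / C.cutRoot j τ * deriv C.Γ τ)
      MeasureTheory.volume (C.α j) (C.β j) := by
    have h1 : IntervalIntegrable (fun τ => G.eval (C.Γ τ) / C.cutRoot j τ)
        MeasureTheory.volume (C.α j) (C.β j) := by
      simp only [div_eq_mul_inv]
      exact (C.intervalIntegrable_inv_cutRoot j).continuousOn_mul (by
        rw [uIcc_of_le hAB]; exact hp G)
    rw [intervalIntegrable_iff_integrableOn_Ioo_of_le hAB] at h1 ⊢
    refine h1.mul_bdd (c := M) ?_ ?_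
    · have := (C.intervalIntegrable_deriv_cut j)
      rw [intervalIntegrable_iff_integrableOn_Ioo_of_le hAB] at this
      exact this.aestronglyMeasurable
    · filter_upwards [MeasureTheory.ae_restrict_mem measurableSet_Ioo] with τ hτ
      exact hM τ hτ
  have i2 := C.intervalIntegrable_density k j hAB le_rfl le_rfl
  have key := intervalIntegral.integral_eq_sub_of_hasDerivAt_of_le hAB
    (f := fun τ => w.eval (C.Γ τ) * C.cutRoot j τ)
    (f' := fun τ => G.eval (C.Γ τ) / C.cutRoot j τ * deriv C.Γ τ -
      C.density k j τ * deriv C.Γ τ)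
    ((hp w).mul (C.continuousOn_cutRoot j)) (fun τ hτ => by
      have h1 := C.hasDerivAt_cutRoot hτ
      have h2 := HasDerivAt.comp_of_eq τ (w.hasDerivAt (C.Γ τ)) (C.hasDerivAt_cut hτ) rfl
      have hne := C.cutRoot_ne_zero hτ
      have hsq := C.cutRoot_sq (Ioo_subset_Icc_self hτ)
      refine (h2.mul h1).congr_deriv ?_
      simp only [Function.comp, density]
      rw [hG]
      simp only [Polynomial.eval_add, Polynomial.eval_mul, Polynomial.eval_C, Polynomial.eval_pow,
        ← hsq]
      field_simp
      ring) (i1.sub i2)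
  rw [intervalIntegral.integral_sub i1 i2] at key
  simp only [cutRoot_α, cutRoot_β, mul_zero, sub_zero] at key
  exact sub_eq_zero.1 key

theorem exists_J_subset_ball (C : CutContour p n) : ∃ M : ℝ, 0 < M ∧ ∀ z ∈ C.J, ‖z‖ ≤ M := by
  obtain ⟨M, hM⟩ := C.isCompact_J.isBounded.exists_norm_le
  exact ⟨max M 1, by positivity, fun z hz => (hM z hz).trans (le_max_left _ _)⟩

/-- At infinity the Cauchy integral is minus the total mass of the density divided by z, with an
error of order z⁻². -/
theorem tendsto_circleIntegral_cauchyCut (C : CutContour p n) (k : ℂ[X]) (j : Fin (n + 1)) :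
    Tendsto (fun ρ : ℝ => ∮ z in C(0, ρ), C.cauchyCut k j z) atTop
      (𝓝 (-(2 * Real.pi * Complex.I) * ∫ τ in (C.α j)..(C.β j), C.density k j τ * deriv C.Γ τ)) := by
  obtain ⟨M, hM0, hM⟩ := C.exists_J_subset_ball
  have hAB := (C.α_lt_β j).le
  set I := ∫ τ in (C.α j)..(C.β j), C.density k j τ * deriv C.Γ τ with hI
  have hint := C.intervalIntegrable_density k j hAB le_rfl le_rfl
  have hdecomp : ∀ z, M < ‖z‖ → ‖C.cauchyCut k j z - (-I) * (z - 0)⁻¹‖ ≤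
      ‖z‖⁻¹ * ((∫ τ in (C.α j)..(C.β j), ‖C.density k j τ * deriv C.Γ τ‖) * (M / (‖z‖ - M))) := by
    intro z hz
    have hzJ : z ∉ C.Γ '' Icc (C.α j) (C.β j) := fun h =>
      absurd (hM z (C.cut_subset_J j h)) (not_le.2 hz)
    have hz0 : z ≠ 0 := norm_pos_iff.1 (hM0.trans hz)
    have i1 := C.intervalIntegrable_density_div k j hAB le_rfl le_rfl hzJ
    have h1 : C.cauchyCut k j z - (-I) * (z - 0)⁻¹ = z⁻¹ *
        ∫ τ in (C.α j)..(C.β j), C.density k j τ * deriv C.Γ τ * (C.Γ τ / (C.Γ τ - z)) := by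
      have h2 : C.cauchyCut k j z - (-I) * (z - 0)⁻¹ = C.cauchyCut k j z + z⁻¹ * I := by
        rw [sub_zero]; ring
      rw [h2, cauchyCut, hI, ← intervalIntegral.integral_const_mul, ← intervalIntegral.integral_const_mul,
        ← intervalIntegral.integral_add i1 (hint.const_mul _)]
      refine intervalIntegral.integral_congr fun τ hτ => ?_
      rw [uIcc_of_le hAB] at hτ
      have hne : C.Γ τ - z ≠ 0 := sub_ne_zero.2 fun h => hzJ ⟨τ, hτ, h⟩
      field_simp
      ring
    rw [h1, norm_mul, norm_inv]
    refine mul_le_mul_of_nonneg_left ?_ (by positivity)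
    rw [← intervalIntegral.integral_mul_const]
    refine intervalIntegral.norm_integral_le_of_norm_le hAB (.of_forall fun τ hτ => ?_)
      (hint.norm.mul_const _)
    rw [norm_mul]
    refine mul_le_mul_of_nonneg_left ?_ (norm_nonneg _)
    rw [norm_div]
    have h3 := hM _ (C.cut_subset_J j ⟨τ, Ioc_subset_Icc_self hτ, rfl⟩)
    refine div_le_div₀ hM0.le h3 (sub_pos.2 hz) ?_
    have := norm_sub_norm_le z (C.Γ τ)
    rw [norm_sub_rev] at this
    linarith
  set B := ∫ τ in (C.α j)..(C.β j), ‖C.density k j τ * deriv C.Γ τ‖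
  have hlim : Tendsto (fun ρ : ℝ => 2 * Real.pi * (B * (M / (ρ - M)))) atTop (𝓝 0) := by
    have h1 : Tendsto (fun ρ : ℝ => M / (ρ - M)) atTop (𝓝 0) :=
      Tendsto.div_atTop tendsto_const_nhds (tendsto_atTop_add_const_right _ (-M) tendsto_id)
    simpa using (h1.const_mul B).const_mul (2 * Real.pi)
  rw [tendsto_iff_norm_sub_tendsto_zero]
  refine squeeze_zero' (.of_forall fun _ => norm_nonneg _) ?_ hlim
  filter_upwards [eventually_gt_atTop M] with ρ hρ
  have hρ0 : 0 < ρ := hM0.trans hρ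
  have hsph : ∀ z ∈ Metric.sphere (0 : ℂ) ρ, ‖z‖ = ρ := fun z hz => by simpa using hz
  have hc : ContinuousOn (C.cauchyCut k j) (Metric.sphere 0 ρ) := fun z hz =>
    (C.differentiableAt_cauchyCut k j fun h => absurd (hM z (C.cut_subset_J j h))
      (not_le.2 (by rw [hsph z hz]; exact hρ))).continuousAt.continuousWithinAt
  have hc2 : ContinuousOn (fun z : ℂ => (-I) * (z - 0)⁻¹) (Metric.sphere 0 ρ) := by
    refine continuousOn_const.mul ((continuousOn_id.sub continuousOn_const).inv₀ fun z hz => ?_)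
    refine norm_pos_iff.1 ?_
    simp only [Pi.sub_apply, id, sub_zero, hsph z hz]
    exact hρ0
  have h1 : (∮ z in C(0, ρ), (-I) * (z - 0)⁻¹) = -(2 * Real.pi * Complex.I) * I := by
    rw [circleIntegral.integral_const_mul, circleIntegral.integral_sub_center_inv _ hρ0.ne']
    ring
  rw [← h1, ← circleIntegral.integral_sub (hc.circleIntegrable hρ0.le) (hc2.circleIntegrable hρ0.le)]
  have h2 : 2 * Real.pi * (B * (M / (ρ - M))) = 2 * Real.pi * ρ * (ρ⁻¹ * (B * (M / (ρ - M)))) := by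
    field_simp
  rw [h2]
  refine circleIntegral.norm_integral_le_of_norm_le_const hρ0.le fun z hz => ?_
  have := hdecomp z (by rw [hsph z hz]; exact hρ)
  rwa [hsph z hz] at this

theorem continuousOn_sqrtR_sphere (C : CutContour p n) {M : ℝ} (hM : ∀ z ∈ C.J, ‖z‖ ≤ M) {ρ : ℝ}
    (hρ : M < ρ) : ∀ z ∈ Metric.sphere (0 : ℂ) ρ, z ∉ C.J := fun z hz h => by
  have := hM z h
  rw [mem_sphere_zero_iff_norm] at hz
  linarith

/-- The entire function of the Plemelj formula has zero integral over every circle, which transfers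
the integral of the cube of the root to the Cauchy integrals. -/
theorem tendsto_circleIntegral_sqrtR_cube (C : CutContour p n) (k : ℂ[X]) :
    Tendsto (fun ρ : ℝ => ∮ z in C(0, ρ), k.eval z * C.sqrtR z ^ 3) atTop
      (𝓝 (-2 * ∑ j, ∫ τ in (C.α j)..(C.β j), C.density k j τ * deriv C.Γ τ)) := by
  obtain ⟨F, hF, hFE⟩ := C.exists_entire_cauchyCut k
  obtain ⟨M, hM0, hM⟩ := C.exists_J_subset_ball
  have hsum : Tendsto (fun ρ : ℝ => ∑ j, ∮ z in C(0, ρ), C.cauchyCut k j z) atTop _ :=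
    tendsto_finsetSum Finset.univ fun j _ => C.tendsto_circleIntegral_cauchyCut k j
  have hpi : (Real.pi : ℂ) * Complex.I ≠ 0 :=
    mul_ne_zero (Complex.ofReal_ne_zero.2 Real.pi_ne_zero) Complex.I_ne_zero
  have h1 := hsum.const_mul (Real.pi * Complex.I : ℂ)⁻¹
  have h2 : (Real.pi * Complex.I : ℂ)⁻¹ * ∑ j, -(2 * Real.pi * Complex.I) *
      ∫ τ in (C.α j)..(C.β j), C.density k j τ * deriv C.Γ τ =
      -2 * ∑ j, ∫ τ in (C.α j)..(C.β j), C.density k j τ * deriv C.Γ τ := by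
    rw [← Finset.mul_sum, ← mul_assoc]
    congr 1
    field_simp
  rw [h2] at h1
  refine h1.congr' ?_
  filter_upwards [eventually_gt_atTop M] with ρ hρ
  have hρ0 : 0 < ρ := hM0.trans hρ
  have hsph := C.continuousOn_sqrtR_sphere hM hρ
  have hc : ∀ j, ContinuousOn (C.cauchyCut k j) (Metric.sphere 0 ρ) := fun j z hz =>
    (C.differentiableAt_cauchyCut k j fun h =>
      hsph z hz (C.cut_subset_J j h)).continuousAt.continuousWithinAt
  have hR : ContinuousOn (fun z => k.eval z * C.sqrtR z ^ 3) (Metric.sphere 0 ρ) := fun z hz =>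
    (k.continuous.continuousAt.mul
      ((C.differentiableAt_sqrtR (hsph z hz)).continuousAt.pow 3)).continuousWithinAt
  have hR' : ContinuousOn (fun z => (Real.pi * Complex.I : ℂ) * (k.eval z * C.sqrtR z ^ 3))
    (Metric.sphere 0 ρ) := continuousOn_const.mul hR
  have h3 : (∮ z in C(0, ρ), F z) = 0 :=
    Complex.circleIntegral_eq_zero_of_differentiable_on_off_countable hρ0.le countable_empty
      hF.continuous.continuousOn fun z _ => hF z
  have h4 : (∮ z in C(0, ρ), F z) = ∮ z in C(0, ρ), ((∑ j, C.cauchyCut k j z) -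
      (Real.pi * Complex.I) * (k.eval z * C.sqrtR z ^ 3)) :=
    circleIntegral.integral_congr hρ0.le fun z hz => hFE z (hsph z hz)
  rw [h3, circleIntegral.integral_sub ((continuousOn_finsetSum _ fun j _ => hc j).circleIntegrable
    hρ0.le) (hR'.circleIntegrable hρ0.le),
    circleIntegral.integral_fun_sum fun j _ => (hc j).circleIntegrable hρ0.le,
    circleIntegral.integral_const_mul] at h4
  have h5 := sub_eq_zero.1 h4.symm
  rw [h5, inv_mul_cancel_left₀ hpi]

/-- The difference of the integrands is the derivative of `w` times the root, which is single valued
outside the cuts. -/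
theorem circleIntegral_reduction (C : CutContour p n) {G w k : ℂ[X]}
    (hG : G = w.derivative * rootPoly C.pts +
      Polynomial.C (1 / 2) * w * (rootPoly C.pts).derivative + k * rootPoly C.pts ^ 2) {M ρ : ℝ}
    (hM : ∀ z ∈ C.J, ‖z‖ ≤ M) (hρ : M < ρ) (hρ0 : 0 < ρ) :
    (∮ z in C(0, ρ), G.eval z / C.sqrtR z) = ∮ z in C(0, ρ), k.eval z * C.sqrtR z ^ 3 := by
  have hsph := C.continuousOn_sqrtR_sphere hM hρ
  have hR : ContinuousOn (fun z => k.eval z * C.sqrtR z ^ 3) (Metric.sphere 0 ρ) := fun z hz =>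
    (k.continuous.continuousAt.mul
      ((C.differentiableAt_sqrtR (hsph z hz)).continuousAt.pow 3)).continuousWithinAt
  have hGc : ContinuousOn (fun z => G.eval z / C.sqrtR z) (Metric.sphere 0 ρ) := fun z hz =>
    (G.continuous.continuousAt.div (C.differentiableAt_sqrtR (hsph z hz)).continuousAt
      (C.sqrtR_ne_zero (hsph z hz))).continuousWithinAt
  rw [← sub_eq_zero, ← circleIntegral.integral_sub (hGc.circleIntegrable hρ0.le)
    (hR.circleIntegrable hρ0.le)]
  refine circleIntegral.integral_eq_zero_of_hasDerivWithinAt (f := fun z => w.eval z * C.sqrtR z)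
    hρ0.le fun z hz => ?_
  have hz' := hsph z hz
  have hne := C.sqrtR_ne_zero hz'
  have hsq := C.sqrtR_sq hz'
  rw [R_eq] at hsq
  refine (((w.hasDerivAt z).mul (C.hasDerivAt_sqrtR hz')).congr_deriv ?_).hasDerivWithinAt
  rw [hG]
  simp only [Polynomial.eval_add, Polynomial.eval_mul, Polynomial.eval_C, Polynomial.eval_pow, ← hsq]
  field_simp
  ring

/-- The integral over the cuts of `G / R₊^{1/2}` is `-1/2` times the integral of `G / R^{1/2}` over
a large circle. -/
theorem tendsto_circleIntegral_div_sqrtR (C : CutContour p n) (G : ℂ[X]) :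
    Tendsto (fun ρ : ℝ => ∮ z in C(0, ρ), G.eval z / C.sqrtR z) atTop
      (𝓝 (-2 * ∑ j, ∫ τ in (C.α j)..(C.β j), G.eval (C.Γ τ) / C.cutRoot j τ * deriv C.Γ τ)) := by
  obtain ⟨w, k, hG⟩ := exists_reduction C.pts_injective G
  obtain ⟨M, hM0, hM⟩ := C.exists_J_subset_ball
  simp only [C.integral_cut_reduction _ hG]
  refine (C.tendsto_circleIntegral_sqrtR_cube k).congr' ?_
  filter_upwards [eventually_gt_atTop M] with ρ hρ
  exact (C.circleIntegral_reduction hG hM hρ (hM0.trans hρ)).symm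

theorem moment_eq (C : CutContour p n) (t : Fin (2 * p - 1) → ℂ) (l : ℕ) :
    C.moment t l = ∑ j, ∫ τ in (C.α j)..(C.β j),
      ((potential p t).derivative * Polynomial.X ^ l).eval (C.Γ τ) / C.cutRoot j τ *
        deriv C.Γ τ := by
  refine Finset.sum_congr rfl fun j _ => ?_
  have hAB := (C.α_lt_β j).le
  rw [intervalIntegral.integral_of_le hAB, intervalIntegral.integral_of_le hAB,
    MeasureTheory.integral_Ioc_eq_integral_Ioo, MeasureTheory.integral_Ioc_eq_integral_Ioo]
  refine MeasureTheory.setIntegral_congr_fun measurableSet_Ioo fun τ hτ => ?_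
  simp only [C.cutRoot_of_mem hτ, dPotential, Polynomial.eval_mul, Polynomial.eval_pow,
    Polynomial.eval_X]
  ring

end CutContour

/-! ### Expansion at infinity: moments and h as Laurent coefficients. -/

/-- The power series `(1 - X)^{-1/2}`. -/
noncomputable def invSqrtSeries : PowerSeries ℂ :=
  PowerSeries.rescale (-1) (PowerSeries.binomialSeries ℂ (-(1 / 2) : ℂ))

theorem invSqrtSeries_sq : invSqrtSeries ^ 2 * (1 - PowerSeries.X) = 1 := by
  have h1 : PowerSeries.binomialSeries ℂ (-(1 / 2) : ℂ) ^ 2 * (1 + PowerSeries.X) = 1 := by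
    have h2 := PowerSeries.binomialSeries_nat (R := ℂ) (A := ℂ) 1
    rw [pow_one] at h2
    rw [← h2, sq, ← PowerSeries.binomialSeries_add, ← PowerSeries.binomialSeries_add]
    norm_num
  have := congrArg (PowerSeries.rescale (-1 : ℂ)) h1
  rwa [map_mul, map_pow, map_add, map_one, PowerSeries.rescale_neg_one_X, ← sub_eq_add_neg] at this

/-- The power series `∏ (1 - y_k X)^{-1/2}`. -/
noncomputable def rootSeries {ι : Type*} [Fintype ι] (y : ι → ℂ) : PowerSeries ℂ :=
  ∏ k, PowerSeries.rescale (y k) invSqrtSeries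

/-- The reversed polynomial `∏ (1 - y_k X)` of `rootPoly y`. -/
noncomputable def revRootPoly {ι : Type*} [Fintype ι] (y : ι → ℂ) : ℂ[X] :=
  ∏ k, (1 - Polynomial.C (y k) * Polynomial.X)

theorem rootSeries_sq {ι : Type*} [Fintype ι] (y : ι → ℂ) :
    rootSeries y ^ 2 * (revRootPoly y : PowerSeries ℂ) = 1 := by
  have h1 : (revRootPoly y : PowerSeries ℂ) = ∏ k, (1 - PowerSeries.C (y k) * PowerSeries.X) := by
    rw [revRootPoly, ← Polynomial.coeToPowerSeries.ringHom_apply, map_prod]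
    simp
  rw [h1, rootSeries, ← Finset.prod_pow, ← Finset.prod_mul_distrib]
  refine Finset.prod_eq_one fun k _ => ?_
  have := congrArg (PowerSeries.rescale (y k)) invSqrtSeries_sq
  rwa [map_mul, map_pow, map_sub, map_one, PowerSeries.rescale_X] at this

theorem eval_rootPoly_eq_rev {ι : Type*} [Fintype ι] (y : ι → ℂ) {z : ℂ} (hz : z ≠ 0) :
    (rootPoly y).eval z = z ^ Fintype.card ι * (revRootPoly y).eval z⁻¹ := by
  rw [eval_rootPoly, revRootPoly, Polynomial.eval_prod, ← Finset.card_univ, ← Finset.prod_const,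
    ← Finset.prod_mul_distrib]
  refine Finset.prod_congr rfl fun k _ => ?_
  simp only [Polynomial.eval_sub, Polynomial.eval_one, Polynomial.eval_mul, Polynomial.eval_C,
    Polynomial.eval_X]
  field_simp

theorem eval_derivative_potential (p : ℕ) (hp : 1 ≤ p) (t : Fin (2 * p - 1) → ℂ) (z : ℂ) :
    (potential p t).derivative.eval z = z ^ (2 * p - 1) + ∑ k : Fin (2 * p - 1), t k * z ^ (k : ℕ) := by
  have h2p : ((2 * p : ℕ) : ℂ) ≠ 0 := Nat.cast_ne_zero.2 (by omega)
  rw [potential, Polynomial.derivative_add, Polynomial.derivative_C_mul_X_pow, Polynomial.derivative_sum,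
    Polynomial.eval_add, Polynomial.eval_finsetSum]
  congr 1
  · rw [one_div, inv_mul_cancel₀ h2p]; simp
  · refine Finset.sum_congr rfl fun k _ => ?_
    rw [Polynomial.derivative_C_mul_X_pow, div_mul_cancel₀ _ (Nat.cast_ne_zero.2 (by omega))]
    simp

/-- The reversed polynomial of `V'`. -/
noncomputable def revPotential (p : ℕ) (t : Fin (2 * p - 1) → ℂ) : ℂ[X] :=
  1 + ∑ k : Fin (2 * p - 1), Polynomial.C (t k) * Polynomial.X ^ (2 * p - 1 - (k : ℕ))

theorem eval_potential_eq_rev (p : ℕ) (hp : 1 ≤ p) (t : Fin (2 * p - 1) → ℂ) {z : ℂ} (hz : z ≠ 0) :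
    (potential p t).derivative.eval z = z ^ (2 * p - 1) * (revPotential p t).eval z⁻¹ := by
  rw [eval_derivative_potential p hp, revPotential, Polynomial.eval_add, Polynomial.eval_one,
    Polynomial.eval_finsetSum, mul_add, mul_one, Finset.mul_sum]
  congr 1
  refine Finset.sum_congr rfl fun k _ => ?_
  simp only [Polynomial.eval_mul, Polynomial.eval_C, Polynomial.eval_pow, Polynomial.eval_X]
  have : z ^ (2 * p - 1) = z ^ (k : ℕ) * z ^ (2 * p - 1 - (k : ℕ)) := by
    rw [← pow_add]; congr 1; omega
  rw [this, inv_pow]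
  field_simp

/-- The expansion at infinity of `V' / R^{1/2}` in the variable `1 / z`, up to a power of `z`. -/
noncomputable def fieldSeries {ι : Type*} [Fintype ι] (p : ℕ) (t : Fin (2 * p - 1) → ℂ)
    (y : ι → ℂ) : PowerSeries ℂ :=
  (revPotential p t : PowerSeries ℂ) * rootSeries y

/-- Everything about the expansion is deduced from this root-free identity: it controls the
truncations, and it can be differentiated in the endpoints. -/
theorem fieldSeries_sq {ι : Type*} [Fintype ι] (p : ℕ) (t : Fin (2 * p - 1) → ℂ) (y : ι → ℂ) :
    fieldSeries p t y ^ 2 * (revRootPoly y : PowerSeries ℂ) =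
      (revPotential p t : PowerSeries ℂ) ^ 2 := by
  rw [fieldSeries, mul_pow, mul_assoc, rootSeries_sq, mul_one]

theorem eval_zero_revPotential (p : ℕ) (t : Fin (2 * p - 1) → ℂ) :
    (revPotential p t).eval 0 = 1 := by
  rw [revPotential, Polynomial.eval_add, Polynomial.eval_finsetSum, Finset.sum_eq_zero]
  · simp
  · intro k _
    have : 2 * p - 1 - (k : ℕ) ≠ 0 := by omega
    simp [this]

theorem constantCoeff_fieldSeries {ι : Type*} [Fintype ι] (p : ℕ) (t : Fin (2 * p - 1) → ℂ)
    (y : ι → ℂ) : PowerSeries.coeff 0 (fieldSeries p t y) = 1 := by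
  have h1 : PowerSeries.constantCoeff invSqrtSeries = 1 := by
    rw [invSqrtSeries, ← PowerSeries.coeff_zero_eq_constantCoeff_apply, PowerSeries.coeff_rescale]
    simp
  rw [PowerSeries.coeff_zero_eq_constantCoeff_apply, fieldSeries, map_mul, rootSeries, map_prod]
  have h2 : PowerSeries.constantCoeff (revPotential p t : PowerSeries ℂ) = 1 := by
    rw [Polynomial.constantCoeff_coe, Polynomial.coeff_zero_eq_eval_zero, eval_zero_revPotential]
  rw [h2, Finset.prod_eq_one, mul_one]
  intro k _
  rw [← PowerSeries.coeff_zero_eq_constantCoeff_apply, PowerSeries.coeff_rescale, pow_zero, one_mul,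
    PowerSeries.coeff_zero_eq_constantCoeff_apply, h1]

/-- Each coefficient is a polynomial in the parameters and the endpoints. -/
theorem analyticAt_coeff_fieldSeries {ι : Type*} [Fintype ι] (p m : ℕ)
    (x : (Fin (2 * p - 1) → ℂ) × (ι → ℂ)) :
    AnalyticAt ℂ (fun x : (Fin (2 * p - 1) → ℂ) × (ι → ℂ) =>
      PowerSeries.coeff m (fieldSeries p x.1 x.2)) x := by
  classical
  have hpr : ∀ k : ι, AnalyticAt ℂ (fun x : (Fin (2 * p - 1) → ℂ) × (ι → ℂ) => x.2 k) x := fun k =>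
    ((ContinuousLinearMap.proj (R := ℂ) (φ := fun _ : ι => ℂ) k).comp
      (ContinuousLinearMap.snd ℂ (Fin (2 * p - 1) → ℂ) (ι → ℂ))).analyticAt x
  have hpt : ∀ k, AnalyticAt ℂ (fun x : (Fin (2 * p - 1) → ℂ) × (ι → ℂ) => x.1 k) x := fun k =>
    ((ContinuousLinearMap.proj (R := ℂ) (φ := fun _ : Fin (2 * p - 1) => ℂ) k).comp
      (ContinuousLinearMap.fst ℂ (Fin (2 * p - 1) → ℂ) (ι → ℂ))).analyticAt x
  simp only [fieldSeries, rootSeries, PowerSeries.coeff_mul, PowerSeries.coeff_prod,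
    PowerSeries.coeff_rescale, Polynomial.coeff_coe, revPotential, Polynomial.coeff_add,
    Polynomial.finsetSum_coeff, Polynomial.coeff_C_mul]
  refine Finset.analyticAt_fun_sum _ fun i _ => ?_
  refine (analyticAt_const.add (Finset.analyticAt_fun_sum _ fun k _ =>
    (hpt k).mul analyticAt_const)).mul ?_
  exact Finset.analyticAt_fun_sum _ fun l _ => Finset.analyticAt_fun_prod _ fun k _ =>
    ((hpr k).pow _).mul analyticAt_const

theorem tendsto_inv_pow_eval {B : ℂ[X]} {N : ℕ} (h : (Polynomial.X : ℂ[X]) ^ N ∣ B) :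
    ∃ c, Tendsto (fun z : ℂ => z ^ N * B.eval z⁻¹) (Bornology.cobounded ℂ) (𝓝 c) := by
  obtain ⟨Q, rfl⟩ := h
  refine ⟨Q.eval 0, ((Q.continuous.tendsto 0).comp tendsto_inv₀_cobounded).congr' ?_⟩
  filter_upwards [tendsto_norm_cobounded_atTop.eventually_gt_atTop (0 : ℝ)] with z hz
  have : z ≠ 0 := norm_pos_iff.1 hz
  simp only [Function.comp, Polynomial.eval_mul, Polynomial.eval_pow, Polynomial.eval_X]
  rw [← mul_assoc, ← mul_pow, mul_inv_cancel₀ this, one_pow, one_mul]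

theorem X_pow_dvd_of_coe {B : ℂ[X]} {N : ℕ}
    (h : (PowerSeries.X : PowerSeries ℂ) ^ N ∣ (B : PowerSeries ℂ)) :
    (Polynomial.X : ℂ[X]) ^ N ∣ B := by
  rw [Polynomial.X_pow_dvd_iff]
  rw [PowerSeries.X_pow_dvd_iff] at h
  intro m hm
  rw [← Polynomial.coeff_coe]; exact h m hm

theorem X_pow_dvd_sub_trunc (N : ℕ) (f : PowerSeries ℂ) :
    (PowerSeries.X : PowerSeries ℂ) ^ N ∣ f - (f.trunc N : PowerSeries ℂ) := by
  rw [PowerSeries.X_pow_dvd_iff]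
  intro m hm
  rw [map_sub, PowerSeries.coeff_coe_trunc_of_lt hm, sub_self]

theorem tendsto_circleIntegral_zero {g : ℂ → ℂ}
    (h : Tendsto (fun z => z * g z) (Bornology.cobounded ℂ) (𝓝 0)) :
    Tendsto (fun ρ : ℝ => ∮ z in C(0, ρ), g z) atTop (𝓝 0) := by
  rw [Metric.tendsto_nhds]
  intro ε hε
  have h1 := (Metric.tendsto_nhds.1 h) (ε / (4 * Real.pi)) (by positivity)
  rw [← comap_norm_atTop, eventually_comap, eventually_atTop] at h1
  obtain ⟨M, hM⟩ := h1
  filter_upwards [eventually_ge_atTop M, eventually_gt_atTop 0] with ρ hρ hρ0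
  rw [dist_zero_right]
  refine (circleIntegral.norm_integral_le_of_norm_le_const (C := ε / (4 * Real.pi) / ρ) hρ0.le
    fun z hz => ?_).trans_lt ?_
  · rw [mem_sphere_zero_iff_norm] at hz
    have := hM ρ hρ z hz
    rw [dist_zero_right, norm_mul, hz] at this
    rw [le_div_iff₀ hρ0, mul_comm]; exact this.le
  · have hpi := Real.pi_pos
    have : 2 * Real.pi * ρ * (ε / (4 * Real.pi) / ρ) = ε / 2 := by field_simp; norm_num
    rw [this]; linarith

namespace CutContour

variable {p n : ℕ}

theorem eventually_cobounded_notMem_J (C : CutContour p n) :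
    ∀ᶠ z : ℂ in Bornology.cobounded ℂ, z ≠ 0 ∧ z ∉ C.J := by
  obtain ⟨M, hM0, hM⟩ := C.exists_J_subset_ball
  filter_upwards [tendsto_norm_cobounded_atTop.eventually_gt_atTop M] with z hz
  exact ⟨norm_pos_iff.1 (hM0.trans hz), fun h => absurd (hM z h) (not_le.2 hz)⟩

/-- The truncations of `fieldSeries` approximate `V' / R^{1/2}` at infinity. -/
theorem tendsto_div_sqrtR_sub_trunc (C : CutContour p n) (hp : 1 ≤ p) (t : Fin (2 * p - 1) → ℂ)
    {N : ℕ} (hN : 0 < N) :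
    ∃ c, Tendsto (fun z => z ^ N * ((potential p t).derivative.eval z / C.sqrtR z *
      (z ^ (n + 1) / z ^ (2 * p - 1)) - ((fieldSeries p t C.pts).trunc N).eval z⁻¹))
      (Bornology.cobounded ℂ) (𝓝 c) := by
  set φ := (fieldSeries p t C.pts).trunc N with hφ
  set v := revPotential p t
  set r := revRootPoly C.pts
  -- The squares are compared first: no convergence of the power series is needed, only divisibility
  -- of polynomials.
  have hdvd : (Polynomial.X : ℂ[X]) ^ N ∣ v ^ 2 - φ ^ 2 * r := by
    apply X_pow_dvd_of_coe
    have h1 := X_pow_dvd_sub_trunc N (fieldSeries p t C.pts)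
    rw [Polynomial.coe_sub, Polynomial.coe_mul, Polynomial.coe_pow, Polynomial.coe_pow,
      ← fieldSeries_sq p t C.pts, ← sub_mul, sq_sub_sq]
    exact Dvd.dvd.mul_right (Dvd.dvd.mul_left h1 _) _
  obtain ⟨c, hc⟩ := tendsto_inv_pow_eval hdvd
  have hinv : Tendsto (fun z : ℂ => z⁻¹) (Bornology.cobounded ℂ) (𝓝 0) := tendsto_inv₀_cobounded
  have hσ := C.tendsto_sqrtR
  have hv : Tendsto (fun z : ℂ => v.eval z⁻¹) (Bornology.cobounded ℂ) (𝓝 1) := by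
    have := (v.continuous.tendsto 0).comp hinv
    rwa [eval_zero_revPotential] at this
  have hφ1 : Tendsto (fun z : ℂ => φ.eval z⁻¹) (Bornology.cobounded ℂ) (𝓝 1) := by
    have := (φ.continuous.tendsto 0).comp hinv
    rwa [← Polynomial.coeff_zero_eq_eval_zero, hφ, PowerSeries.coeff_trunc, if_pos hN,
      constantCoeff_fieldSeries] at this
  -- The difference of squares is divided by the sum, which tends to 2. This also excludes the
  -- opposite sign of the root; positivity of `N` is what gives the truncation constant term 1.
  have hden := (hσ.mul (hv.add (hφ1.mul hσ)))
  have hlim := hc.div hden (by norm_num)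
  refine ⟨_, hlim.congr' ?_⟩
  filter_upwards [C.eventually_cobounded_notMem_J, hden.eventually_ne (b₂ := 0) (by norm_num)]
    with z hz hne
  obtain ⟨hz0, hzJ⟩ := hz
  have hs := C.sqrtR_ne_zero hzJ
  have hr : C.sqrtR z ^ 2 = z ^ (2 * n + 2) * r.eval z⁻¹ := by
    rw [C.sqrtR_sq hzJ, R_eq, eval_rootPoly_eq_rev _ hz0]
    congr 2
    simp only [Fintype.card_sum, Fintype.card_fin]; ring
  set σ := C.sqrtR z / z ^ (n + 1) with hσd
  have hσ2 : σ ^ 2 = r.eval z⁻¹ := by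
    rw [hσd, div_pow, hr]
    field_simp
    ring
  have hσ0 : σ ≠ 0 := div_ne_zero hs (pow_ne_zero _ hz0)
  have hV : (potential p t).derivative.eval z / C.sqrtR z * (z ^ (n + 1) / z ^ (2 * p - 1)) =
      v.eval z⁻¹ / σ := by
    rw [eval_potential_eq_rev p hp t hz0, hσd]
    field_simp
    rfl
  rw [hV]
  simp only [Pi.div_apply, Polynomial.eval_sub, Polynomial.eval_mul, Polynomial.eval_pow, ← hσ2]
  rw [div_eq_iff hne]
  field_simp
  ring

end CutContour

/-- The polynomial part of `z ^ d * A (1 / z)`. -/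
noncomputable def polyPart (d : ℕ) (A : PowerSeries ℂ) : ℂ[X] :=
  ∑ m ∈ Finset.range (d + 1), Polynomial.C (PowerSeries.coeff m A) * Polynomial.X ^ (d - m)

theorem eval_trunc (N : ℕ) (A : PowerSeries ℂ) (z : ℂ) :
    (A.trunc N).eval z = ∑ m ∈ Finset.range N, PowerSeries.coeff m A * z ^ m := by
  rw [Polynomial.eval, PowerSeries.eval₂_trunc_eq_sum_range]
  rfl

theorem eval_polyPart (d : ℕ) (A : PowerSeries ℂ) {z : ℂ} (hz : z ≠ 0) :
    (polyPart d A).eval z = z ^ d * (A.trunc (d + 1)).eval z⁻¹ := by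
  rw [polyPart, eval_trunc, Polynomial.eval_finsetSum, Finset.mul_sum]
  refine Finset.sum_congr rfl fun m hm => ?_
  have hmd : z ^ d = z ^ m * z ^ (d - m) := by
    rw [← pow_add]; congr 1; have := Finset.mem_range.1 hm; omega
  simp only [Polynomial.eval_mul, Polynomial.eval_C, Polynomial.eval_pow, Polynomial.eval_X]
  rw [hmd, inv_pow]
  field_simp

/-- The polynomial `h`, as a function of the parameters and the endpoints. -/
noncomputable def hPoly {ι : Type*} [Fintype ι] (p n : ℕ) (t : Fin (2 * p - 1) → ℂ) (y : ι → ℂ) :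
    ℂ[X] :=
  polyPart (2 * p - 1 - (n + 1)) (fieldSeries p t y)

namespace CutContour

variable {p n : ℕ}

/-- Up to O(1/s) the integrand is a polynomial divided by `s - z`: the remainder contributes O(s⁻²),
whose circle integral tends to zero, and Cauchy's formula evaluates the polynomial. -/
theorem h_eq_of_tendsto (C : CutContour p n) (t : Fin (2 * p - 1) → ℂ) (H : ℂ[X]) {c : ℂ}
    (hc : Tendsto (fun s => s * ((potential p t).derivative.eval s / C.sqrtR s - H.eval s))
      (Bornology.cobounded ℂ) (𝓝 c)) (z : ℂ) : C.h t z = H.eval z := by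
  obtain ⟨M, hM0, hM⟩ := C.exists_J_subset_ball
  refine Tendsto.limUnder_eq ?_
  have hinv : Tendsto (fun z : ℂ => z⁻¹) (Bornology.cobounded ℂ) (𝓝 0) := tendsto_inv₀_cobounded
  have h1 : Tendsto (fun s => s * (((potential p t).derivative.eval s / C.sqrtR s - H.eval s) /
      (s - z))) (Bornology.cobounded ℂ) (𝓝 0) := by
    have h2 : Tendsto (fun s : ℂ => (s - z)⁻¹) (Bornology.cobounded ℂ) (𝓝 0) := by
      have h3 : Tendsto (fun s : ℂ => s⁻¹ / (1 - z * s⁻¹)) (Bornology.cobounded ℂ) (𝓝 0) := by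
        have := hinv.div ((hinv.const_mul z).const_sub 1) (by simp)
        rwa [zero_div] at this
      refine h3.congr' ?_
      filter_upwards [C.eventually_cobounded_notMem_J] with s hs
      field_simp [hs.1]
    have := hc.mul h2
    rw [mul_zero] at this
    refine this.congr fun s => ?_
    rw [mul_assoc, div_eq_mul_inv _ (s - z)]
  have h4 := ((tendsto_circleIntegral_zero h1).add_const (2 * Real.pi * Complex.I * H.eval z)).const_mul
    (2 * Real.pi * Complex.I : ℂ)⁻¹
  rw [zero_add, inv_mul_cancel_left₀ Complex.two_pi_I_ne_zero] at h4
  refine h4.congr' ?_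
  filter_upwards [eventually_gt_atTop (max M ‖z‖)] with ρ hρ
  have hρM := (le_max_left _ _).trans_lt hρ
  have hρz := (le_max_right _ _).trans_lt hρ
  have hρ0 : 0 < ρ := hM0.trans hρM
  have hsph := C.continuousOn_sqrtR_sphere hM hρM
  have hne : ∀ s ∈ Metric.sphere (0 : ℂ) ρ, s - z ≠ 0 := fun s hs h => by
    rw [mem_sphere_zero_iff_norm] at hs
    rw [sub_eq_zero.1 h] at hs
    linarith
  have hcs : ContinuousOn (fun s : ℂ => (s - z)⁻¹) (Metric.sphere 0 ρ) :=
    (continuousOn_id.sub continuousOn_const).inv₀ hne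
  have hcV : ContinuousOn (fun s => (potential p t).derivative.eval s / C.sqrtR s / (s - z))
      (Metric.sphere 0 ρ) := by
    refine ContinuousOn.mul (fun s hs => ?_) hcs
    exact ((potential p t).derivative.continuous.continuousAt.div
      (C.differentiableAt_sqrtR (hsph s hs)).continuousAt
      (C.sqrtR_ne_zero (hsph s hs))).continuousWithinAt
  have hcH : ContinuousOn (fun s => (s - z)⁻¹ * H.eval s) (Metric.sphere 0 ρ) :=
    hcs.mul H.continuous.continuousOn
  congr 1
  have hCauchy : (∮ s in C(0, ρ), (s - z)⁻¹ * H.eval s) = 2 * Real.pi * Complex.I * H.eval z :=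
    Complex.circleIntegral_sub_inv_smul_of_differentiable_on_off_countable countable_empty
      (by simpa using hρz) H.continuous.continuousOn fun x _ => H.differentiable x
  rw [← hCauchy]
  refine Eq.trans ?_ (sub_add_cancel (∮ s in C(0, ρ), (potential p t).derivative.eval s /
    C.sqrtR s / (s - z)) (∮ s in C(0, ρ), (s - z)⁻¹ * H.eval s))
  rw [← circleIntegral.integral_sub (hcV.circleIntegrable hρ0.le) (hcH.circleIntegrable hρ0.le)]
  congr 1
  refine circleIntegral.integral_congr hρ0.le fun s _ => ?_
  ring

/-- Here the degree of V' is less than the number of cuts, so V' / R^{1/2} decays and has no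
polynomial part. -/
theorem h_eq_zero (C : CutContour p n) (hp : 1 ≤ p) (t : Fin (2 * p - 1) → ℂ)
    (hn : 2 * p - 1 < n + 1) (z : ℂ) : C.h t z = 0 := by
  obtain ⟨c, hc⟩ := C.tendsto_div_sqrtR_sub_trunc hp t one_pos
  have hinv : Tendsto (fun z : ℂ => z⁻¹) (Bornology.cobounded ℂ) (𝓝 0) := tendsto_inv₀_cobounded
  set φ := (fieldSeries p t C.pts).trunc 1
  have hφ := (φ.continuous.tendsto 0).comp hinv
  have h1 := (hinv.pow (n - (2 * p - 1))).mul ((hinv.mul hc).add hφ)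
  have := C.h_eq_of_tendsto t 0 (h1.congr' ?_) z
  · simpa using this
  · filter_upwards [C.eventually_cobounded_notMem_J] with s hs
    have hs0 := hs.1
    obtain ⟨m, hm⟩ : ∃ m, n = (2 * p - 1) + m := ⟨n - (2 * p - 1), by omega⟩
    have hm' : n - (2 * p - 1) = m := by omega
    rw [hm']
    have hsn : s ^ (n + 1) = s * (s ^ (2 * p - 1) * s ^ m) := by
      rw [hm, pow_succ, pow_add]; ring
    rw [hsn]
    have hR := C.sqrtR_ne_zero hs.2
    simp only [Function.comp, Polynomial.eval_zero, sub_zero, pow_one, inv_pow]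
    field_simp
    ring

theorem h_eq (C : CutContour p n) (hp : 1 ≤ p) (hn : n + 1 ≤ 2 * p - 1)
    (t : Fin (2 * p - 1) → ℂ) (z : ℂ) : C.h t z = (hPoly p n t C.pts).eval z := by
  obtain ⟨d, hd⟩ : ∃ d, 2 * p - 1 = d + (n + 1) := ⟨2 * p - 1 - (n + 1), by omega⟩
  obtain ⟨c, hc⟩ := C.tendsto_div_sqrtR_sub_trunc hp t (Nat.succ_pos d)
  refine C.h_eq_of_tendsto t _ (c := c) (hc.congr' ?_) z
  filter_upwards [C.eventually_cobounded_notMem_J] with s hs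
  have hs0 := hs.1
  have hR := C.sqrtR_ne_zero hs.2
  have hd' : 2 * p - 1 - (n + 1) = d := by omega
  rw [hPoly, eval_polyPart _ _ hs0, hd', hd, pow_add, Nat.succ_eq_add_one, pow_succ]
  field_simp
  ring

/-- The moment is -1/2 times a circle integral, hence -πi times the coefficient of 1/z in V' z^l /
R^{1/2}. The leading power there is z to the `2 * p - 1 - (n + 1) + l`, which places this
coefficient one index further. -/
theorem moment_eq_coeff (C : CutContour p n) (hp : 1 ≤ p) (hn : n + 1 ≤ 2 * p - 1)
    (t : Fin (2 * p - 1) → ℂ) (l : ℕ) : C.moment t l =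
      -(Real.pi * Complex.I) * PowerSeries.coeff (2 * p - 1 - n + l) (fieldSeries p t C.pts) := by
  obtain ⟨d, hd⟩ : ∃ d, 2 * p - 1 = d + (n + 1) := ⟨2 * p - 1 - (n + 1), by omega⟩
  have hd' : 2 * p - 1 - n + l = d + l + 1 := by omega
  rw [hd']
  set f := fieldSeries p t C.pts
  have h1 := C.tendsto_circleIntegral_div_sqrtR ((potential p t).derivative * Polynomial.X ^ l)
  rw [← moment_eq] at h1
  obtain ⟨c, hc⟩ := C.tendsto_div_sqrtR_sub_trunc hp t (Nat.succ_pos (d + l + 1))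
  have hinv : Tendsto (fun z : ℂ => z⁻¹) (Bornology.cobounded ℂ) (𝓝 0) := tendsto_inv₀_cobounded
  set g : ℂ → ℂ := fun z => ∑ m ∈ Finset.range (d + l + 2),
    PowerSeries.coeff m f * (z - 0) ^ ((d + l - m : ℤ)) with hg
  have hgz : ∀ z, z ≠ 0 → g z = z ^ (d + l) * (f.trunc (d + l + 2)).eval z⁻¹ := by
    intro z hz
    rw [hg, eval_trunc, Finset.mul_sum]
    refine Finset.sum_congr rfl fun m _ => ?_
    rw [sub_zero, zpow_sub₀ hz, inv_pow]
    norm_cast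
    field_simp
  have h2 : Tendsto (fun z => z * (((potential p t).derivative * Polynomial.X ^ l).eval z / C.sqrtR z -
      g z)) (Bornology.cobounded ℂ) (𝓝 0) := by
    have := hinv.mul hc
    rw [zero_mul] at this
    refine this.congr' ?_
    filter_upwards [C.eventually_cobounded_notMem_J] with s hs
    have hs0 := hs.1
    have hR := C.sqrtR_ne_zero hs.2
    rw [hgz s hs0, hd]
    simp only [Polynomial.eval_mul, Polynomial.eval_pow, Polynomial.eval_X, Nat.succ_eq_add_one]
    field_simp
    ring
  obtain ⟨M, hM0, hM⟩ := C.exists_J_subset_ball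
  have h3 := tendsto_circleIntegral_zero h2
  have h4 : Tendsto (fun ρ : ℝ => ∮ z in C(0, ρ),
      ((potential p t).derivative * Polynomial.X ^ l).eval z / C.sqrtR z) atTop
      (𝓝 (0 + PowerSeries.coeff (d + l + 1) f * (2 * Real.pi * Complex.I))) := by
    refine (h3.add_const _).congr' ?_
    filter_upwards [eventually_gt_atTop M] with ρ hρ
    have hρ0 : 0 < ρ := hM0.trans hρ
    have hsph := C.continuousOn_sqrtR_sphere hM hρ
    have hne : ∀ z ∈ Metric.sphere (0 : ℂ) ρ, z - 0 ≠ 0 := fun z hz => by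
      rw [sub_zero]; exact ne_zero_of_mem_sphere hρ0.ne' ⟨z, hz⟩
    have hgm : ∀ m, ContinuousOn (fun z : ℂ => PowerSeries.coeff m f * (z - 0) ^ ((d + l - m : ℤ)))
        (Metric.sphere 0 ρ) := fun m => continuousOn_const.mul
      ((continuousOn_id.sub continuousOn_const).zpow₀ _ fun z hz => Or.inl (hne z hz))
    have hgc : ContinuousOn g (Metric.sphere 0 ρ) := continuousOn_finsetSum _ fun m _ => hgm m
    have hVc : ContinuousOn (fun z => ((potential p t).derivative * Polynomial.X ^ l).eval z /
        C.sqrtR z) (Metric.sphere 0 ρ) := fun s hs =>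
      ((Polynomial.continuous _).continuousAt.div
      (C.differentiableAt_sqrtR (hsph s hs)).continuousAt
      (C.sqrtR_ne_zero (hsph s hs))).continuousWithinAt
    rw [circleIntegral.integral_sub (hVc.circleIntegrable hρ0.le) (hgc.circleIntegrable hρ0.le)]
    have hgi : (∮ z in C(0, ρ), g z) = PowerSeries.coeff (d + l + 1) f * (2 * Real.pi * Complex.I) := by
      rw [hg, circleIntegral.integral_fun_sum fun m _ => (hgm m).circleIntegrable hρ0.le,
        Finset.sum_range_succ, Finset.sum_eq_zero, zero_add]
      · rw [circleIntegral.integral_const_mul]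
        congr 1
        have : (d + l - (d + l + 1 : ℕ) : ℤ) = -1 := by push_cast; ring
        simp only [this, zpow_neg_one]
        exact circleIntegral.integral_sub_center_inv _ hρ0.ne'
      · intro m hm
        rw [circleIntegral.integral_const_mul, circleIntegral.integral_sub_zpow_of_ne, mul_zero]
        have := Finset.mem_range.1 hm
        omega
    rw [hgi]
    ring
  have h5 := tendsto_nhds_unique h1 h4
  linear_combination (-1 / 2) * h5

end CutContour

/-! ### First variation of the expansion. -/

/-- Coefficientwise derivative of a family of power series. -/
def HasCoeffDerivAt (A : ℂ → PowerSeries ℂ) (A' : PowerSeries ℂ) (x : ℂ) : Prop :=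
  ∀ m, HasDerivAt (fun l => PowerSeries.coeff m (A l)) (PowerSeries.coeff m A') x

theorem HasCoeffDerivAt.mul {A B : ℂ → PowerSeries ℂ} {A' B' : PowerSeries ℂ} {x : ℂ}
    (hA : HasCoeffDerivAt A A' x) (hB : HasCoeffDerivAt B B' x) :
    HasCoeffDerivAt (fun l => A l * B l) (A' * B x + A x * B') x := by
  intro m
  simp only [PowerSeries.coeff_mul, map_add]
  rw [← Finset.sum_add_distrib]
  exact HasDerivAt.fun_sum fun i _ => (hA i.1).mul (hB i.2)

theorem natDegree_revRootPoly_le {ι : Type*} [Fintype ι] (y : ι → ℂ) :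
    (revRootPoly y).natDegree ≤ Fintype.card ι := by
  rw [revRootPoly]
  refine (Polynomial.natDegree_prod_le _ _).trans ?_
  refine (Finset.sum_le_sum (g := fun _ => 1) fun k _ => ?_).trans (by simp)
  compute_degree

theorem eval_zero_revRootPoly {ι : Type*} [Fintype ι] (y : ι → ℂ) : (revRootPoly y).eval 0 = 1 := by
  rw [revRootPoly, Polynomial.eval_prod]
  simp

theorem differentiable_coeff_revRootPoly {ι : Type*} [Fintype ι] (y v : ι → ℂ) (m : ℕ) :
    Differentiable ℂ fun s : ℂ => (revRootPoly (y + s • v)).coeff m := by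
  classical
  have h2 : ∀ s : ℂ, (revRootPoly (y + s • v) : PowerSeries ℂ) =
      ∏ k, (1 - PowerSeries.C (y k + s * v k) * PowerSeries.X) := fun s => by
    rw [revRootPoly, ← Polynomial.coeToPowerSeries.ringHom_apply, map_prod]
    simp
  simp only [← Polynomial.coeff_coe, h2, PowerSeries.coeff_prod, map_sub, PowerSeries.coeff_C_mul]
  fun_prop

theorem differentiableAt_coeff_fieldSeries {ι : Type*} [Fintype ι] (p m : ℕ)
    (t : Fin (2 * p - 1) → ℂ) (y v : ι → ℂ) : DifferentiableAt ℂ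
      (fun s : ℂ => PowerSeries.coeff m (fieldSeries p t (y + s • v))) 0 := by
  have hline : HasDerivAt (fun s : ℂ => ((t, y + s • v) : (Fin (2 * p - 1) → ℂ) × (ι → ℂ)))
      (0, v) 0 := (hasDerivAt_const 0 t).prodMk (by
    simpa using ((hasDerivAt_id (0 : ℂ)).smul_const v).const_add y)
  generalize hg : (fun x : (Fin (2 * p - 1) → ℂ) × (ι → ℂ) =>
      PowerSeries.coeff m (fieldSeries p x.1 x.2)) = g
  have hd : Differentiable ℂ g := fun x => by
    rw [← hg]; exact (analyticAt_coeff_fieldSeries p m x).differentiableAt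
  have h2 : (fun s : ℂ => PowerSeries.coeff m (fieldSeries p t (y + s • v))) =
      fun s => g (t, y + s • v) := by
    rw [← hg]
  rw [h2]
  exact (hd _).comp (0 : ℂ) hline.differentiableAt

/-- In this form R and h are of the same kind, and `hasDerivAt_polyPart` differentiates both along a
moving point. -/
theorem polyPart_revRootPoly {ι : Type*} [Fintype ι] (y : ι → ℂ) :
    rootPoly y = polyPart (Fintype.card ι) (revRootPoly y) := by
  refine Polynomial.eq_of_infinite_eval_eq _ _ ((finite_singleton (0 : ℂ)).infinite_compl.mono ?_)
  intro z hz
  have hz0 : z ≠ 0 := hz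
  rw [mem_ofPred_eq, eval_polyPart _ _ hz0, eval_rootPoly_eq_rev y hz0]
  congr 2
  rw [PowerSeries.trunc_coe_eq_self]
  exact Nat.lt_succ_of_le (natDegree_revRootPoly_le y)

/-- First variation of `h` and `R` in a direction in which the leading moments do not change. The
polynomial `P = hdot * R + (1/2) * h * Rdot` satisfies `P / R^{1/2} = O(z⁻²)`. -/
theorem exists_variation {ι : Type*} [Fintype ι] {p n : ℕ} (hn : n + 1 ≤ 2 * p - 1)
    (hι : Fintype.card ι = 2 * n + 2) (t : Fin (2 * p - 1) → ℂ) (y v : ι → ℂ)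
    (h0 : ∀ l ≤ n, PowerSeries.coeff (2 * p - 1 - n + l) (fieldSeries p t y) = 0)
    (h1 : ∀ l ≤ n + 1, HasDerivAt (fun s : ℂ =>
      PowerSeries.coeff (2 * p - 1 - n + l) (fieldSeries p t (y + s • v))) 0 0) :
    ∃ f r : PowerSeries ℂ, HasCoeffDerivAt (fun s => fieldSeries p t (y + s • v)) f 0 ∧
      HasCoeffDerivAt (fun s => (revRootPoly (y + s • v) : PowerSeries ℂ)) r 0 ∧
      ∃ c, Tendsto (fun z => z ^ 2 * ((polyPart (2 * p - 1 - (n + 1)) f * rootPoly y +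
        Polynomial.C (1 / 2) * hPoly p n t y * polyPart (2 * n + 2) r).eval z / z ^ (n + 1)))
        (Bornology.cobounded ℂ) (𝓝 c) := by
  obtain ⟨d, hd⟩ : ∃ d, 2 * p - 1 = d + (n + 1) := ⟨2 * p - 1 - (n + 1), by omega⟩
  have hd' : 2 * p - 1 - (n + 1) = d := by omega
  set f := PowerSeries.mk fun m =>
    deriv (fun s : ℂ => PowerSeries.coeff m (fieldSeries p t (y + s • v))) 0
  set r := PowerSeries.mk fun m =>
    deriv (fun s : ℂ => PowerSeries.coeff m (revRootPoly (y + s • v) : PowerSeries ℂ)) 0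
  have hF : HasCoeffDerivAt (fun s => fieldSeries p t (y + s • v)) f 0 := fun m => by
    rw [PowerSeries.coeff_mk]; exact (differentiableAt_coeff_fieldSeries p m t y v).hasDerivAt
  have hR : HasCoeffDerivAt (fun s => (revRootPoly (y + s • v) : PowerSeries ℂ)) r 0 := fun m => by
    rw [PowerSeries.coeff_mk]
    simp only [Polynomial.coeff_coe]
    exact (differentiable_coeff_revRootPoly y v m 0).hasDerivAt
  refine ⟨f, r, hF, hR, ?_⟩
  set F := fieldSeries p t y
  set R := (revRootPoly y : PowerSeries ℂ)
  have hF0 : fieldSeries p t (y + (0 : ℂ) • v) = F := by rw [zero_smul, add_zero]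
  have hR0 : (revRootPoly (y + (0 : ℂ) • v) : PowerSeries ℂ) = R := by rw [zero_smul, add_zero]
  -- Derivative of `F ^ 2 * R`, which does not depend on the endpoints, divided by `F`.
  have key : PowerSeries.C 2 * f * R + F * r = 0 := by
    have hprod := (hF.mul hF).mul hR
    simp only [hF0, hR0] at hprod
    have hzero : (f * F + F * f) * R + F * F * r = 0 := by
      ext m
      rw [map_zero]
      refine (hprod m).unique ?_
      have h3 : ∀ s : ℂ, fieldSeries p t (y + s • v) * fieldSeries p t (y + s • v) *
          (revRootPoly (y + s • v) : PowerSeries ℂ) = (revPotential p t : PowerSeries ℂ) ^ 2 :=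
        fun s => by rw [← fieldSeries_sq p t (y + s • v), sq]
      simp only [h3]
      exact hasDerivAt_const _ _
    have hFne : F ≠ 0 := fun h => by
      have := constantCoeff_fieldSeries p t y
      change PowerSeries.coeff 0 F = 1 at this
      rw [h, map_zero] at this
      exact zero_ne_one this
    refine (mul_eq_zero.1 (show F * (PowerSeries.C 2 * f * R + F * r) = 0 from ?_)).resolve_left hFne
    rw [← hzero]
    have : (PowerSeries.C 2 : PowerSeries ℂ) = 2 := map_ofNat _ 2
    rw [this]; ring
  -- The constant term of the reversed polynomial is always 1. The order gained here makes up for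
  -- the one lost in `hFd`.
  have hrX : (PowerSeries.X : PowerSeries ℂ) ∣ r := by
    rw [PowerSeries.X_dvd_iff, ← PowerSeries.coeff_zero_eq_constantCoeff_apply]
    refine (hR 0).unique ?_
    have h4 : ∀ s : ℂ, PowerSeries.coeff 0 (revRootPoly (y + s • v) : PowerSeries ℂ) = 1 := fun s => by
      rw [Polynomial.coeff_coe, Polynomial.coeff_zero_eq_eval_zero, eval_zero_revRootPoly]
    simp only [h4]
    exact hasDerivAt_const _ _
  -- The coefficients of index `d + 1` to `d + n + 2` are those of the moments, all of which are
  -- stationary.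
  have hfd : (PowerSeries.X : PowerSeries ℂ) ^ (d + n + 3) ∣ f - (f.trunc (d + 1) : PowerSeries ℂ) := by
    rw [PowerSeries.X_pow_dvd_iff]
    intro m hm
    by_cases hmd : m < d + 1
    · rw [map_sub, PowerSeries.coeff_coe_trunc_of_lt hmd, sub_self]
    · rw [map_sub, Polynomial.coeff_coe, PowerSeries.coeff_trunc, if_neg hmd, sub_zero]
      have := h1 (m - (d + 1)) (by omega)
      have hm' : 2 * p - 1 - n + (m - (d + 1)) = m := by omega
      rw [hm'] at this
      exact (hF m).unique this
  -- For the series itself only the moments with `l ≤ n` are assumed to vanish, so the order is one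
  -- less.
  have hFd : (PowerSeries.X : PowerSeries ℂ) ^ (d + n + 2) ∣ F - (F.trunc (d + 1) : PowerSeries ℂ) := by
    rw [PowerSeries.X_pow_dvd_iff]
    intro m hm
    by_cases hmd : m < d + 1
    · rw [map_sub, PowerSeries.coeff_coe_trunc_of_lt hmd, sub_self]
    · rw [map_sub, Polynomial.coeff_coe, PowerSeries.coeff_trunc, if_neg hmd, sub_zero]
      have := h0 (m - (d + 1)) (by omega)
      have hm' : 2 * p - 1 - n + (m - (d + 1)) = m := by omega
      rwa [hm'] at this
  have hrd : (PowerSeries.X : PowerSeries ℂ) ^ (d + n + 3) ∣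
      F * r - F.trunc (d + 1) * (r.trunc (2 * n + 2 + 1)) := by
    have hrr : (r.trunc (2 * n + 2 + 1) : PowerSeries ℂ) = r := by
      ext m
      rw [Polynomial.coeff_coe, PowerSeries.coeff_trunc]
      split_ifs with hm
      · rfl
      · refine ((hR m).unique ?_).symm
        have h5 : ∀ s : ℂ, PowerSeries.coeff m (revRootPoly (y + s • v) : PowerSeries ℂ) = 0 := by
          intro s
          rw [Polynomial.coeff_coe]
          refine Polynomial.coeff_eq_zero_of_natDegree_lt (lt_of_lt_of_le (Nat.lt_succ_of_le ?_)
            (not_lt.1 hm))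
          exact hι ▸ natDegree_revRootPoly_le (y + s • v)
        simp only [h5]
        exact hasDerivAt_const _ _
    rw [hrr, ← sub_mul, show d + n + 3 = d + n + 2 + 1 from rfl, pow_succ]
    exact mul_dvd_mul hFd hrX
  set B : ℂ[X] := f.trunc (d + 1) * revRootPoly y +
    Polynomial.C (1 / 2) * F.trunc (d + 1) * r.trunc (2 * n + 2 + 1) with hB
  clear_value B
  -- Replacing `f` and `F` by their truncations in `key` only costs terms of this order. In the
  -- variable z the polynomial P is z^{d+2n+2} times `B` at 1/z.
  have hBd : (Polynomial.X : ℂ[X]) ^ (d + n + 3) ∣ B := by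
    apply X_pow_dvd_of_coe
    have h6 : (B : PowerSeries ℂ) = -((f - (f.trunc (d + 1) : PowerSeries ℂ)) * R) -
        PowerSeries.C (1 / 2) * (F * r - (F.trunc (d + 1) : PowerSeries ℂ) *
          (r.trunc (2 * n + 2 + 1) : PowerSeries ℂ)) := by
      have h7 : (B : PowerSeries ℂ) = (f.trunc (d + 1) : PowerSeries ℂ) * R +
          PowerSeries.C (1 / 2) * (F.trunc (d + 1) : PowerSeries ℂ) *
            (r.trunc (2 * n + 2 + 1) : PowerSeries ℂ) := by
        rw [hB, Polynomial.coe_add, Polynomial.coe_mul, Polynomial.coe_mul, Polynomial.coe_mul,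
          Polynomial.coe_C]
      have h8 : (PowerSeries.C (1 / 2) : PowerSeries ℂ) * PowerSeries.C 2 = 1 := by
        rw [← map_mul]; norm_num
      rw [h7]
      linear_combination PowerSeries.C (1 / 2) * key - f * R * h8
    rw [h6]
    exact (((hfd.mul_right R)).neg_right).sub (hrd.mul_left _)
  obtain ⟨c, hc⟩ := tendsto_inv_pow_eval hBd
  refine ⟨c, hc.congr' ?_⟩
  filter_upwards [tendsto_norm_cobounded_atTop.eventually_gt_atTop (0 : ℝ)] with z hz
  have hz0 : z ≠ 0 := norm_pos_iff.1 hz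
  rw [hPoly, hd', Polynomial.eval_add, Polynomial.eval_mul, Polynomial.eval_mul, Polynomial.eval_mul,
    eval_polyPart _ _ hz0, eval_polyPart _ _ hz0, eval_polyPart _ _ hz0, eval_rootPoly_eq_rev _ hz0,
    hι, hB]
  simp only [Polynomial.eval_add, Polynomial.eval_mul, Polynomial.eval_C]
  generalize (revRootPoly y).eval z⁻¹ = a₁
  change _ = z ^ 2 * ((z ^ d * _ * _ + 1 / 2 * (z ^ d * (F.trunc (d + 1)).eval z⁻¹) * _) / _)
  generalize (F.trunc (d + 1)).eval z⁻¹ = a₂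
  generalize (f.trunc (d + 1)).eval z⁻¹ = a₃
  generalize (r.trunc (2 * n + 2 + 1)).eval z⁻¹ = a₄
  field_simp
  ring

/-! ### Integrals between branch points, compared on the double cover. -/

/-- A path `z` on `[u, v]` together with a continuous square root `S` of `rootPoly y` along it. -/
structure IsRootPath {ι : Type*} [Fintype ι] (y : ι → ℂ) (u v : ℝ) (z z' S : ℝ → ℂ) : Prop where
  continuousOn : ContinuousOn z (Icc u v)
  continuousOn_root : ContinuousOn S (Icc u v)
  sq : ∀ τ ∈ Icc u v, S τ ^ 2 = (rootPoly y).eval (z τ)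
  ne_zero : ∀ τ ∈ Ioo u v, S τ ≠ 0
  hasDerivAt : ∃ P : Set ℝ, P.Countable ∧ ∀ τ ∈ Ioo u v \ P, HasDerivAt z (z' τ) τ
  integrable : IntervalIntegrable z' MeasureTheory.volume u v

/-- The difference quotient of the square, divided by `f τ + f x`, is that of `f`; a continuous
nonvanishing root of a differentiable function is differentiable. -/
theorem hasDerivAt_of_sq {f g : ℝ → ℂ} {g' : ℂ} {x : ℝ} (hf : ContinuousAt f x) (h0 : f x ≠ 0)
    (hg : HasDerivAt g g' x) (h : ∀ᶠ τ in 𝓝 x, f τ ^ 2 = g τ) :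
    HasDerivAt f (g' / (2 * f x)) x := by
  rw [hasDerivAt_iff_tendsto_slope] at hg ⊢
  have hc : Tendsto (fun τ => f τ + f x) (𝓝[≠] x) (𝓝 (f x + f x)) :=
    (hf.tendsto.mono_left nhdsWithin_le_nhds).add_const _
  have h2 : f x + f x ≠ 0 := by rw [← two_mul]; exact mul_ne_zero two_ne_zero h0
  rw [two_mul]
  refine (hg.div hc h2).congr' ?_
  filter_upwards [hc.eventually_ne h2, h.filter_mono nhdsWithin_le_nhds] with τ hτ hτ2
  rw [Pi.div_apply, div_eq_iff hτ, slope_def_module, slope_def_module, ← hτ2, ← h.self_of_nhds,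
    smul_mul_assoc]
  congr 1
  ring

/-- Relative to the centre every factor is `1 + (z - c) / (c - y i)`, with a correction of modulus
less than 1 when no root lies in the disc. So the principal power is analytic. -/
theorem exists_root_ball {ι : Type*} (s : Finset ι) (y : ι → ℂ) {c : ℂ} {ε : ℝ}
    (h : ∀ i ∈ s, y i ∉ Metric.ball c ε) : ∃ Q : ℂ → ℂ, ∀ z ∈ Metric.ball c ε,
      DifferentiableAt ℂ Q z ∧ Q z ^ 2 = ∏ i ∈ s, (z - y i) := by
  refine ⟨fun z => ∏ i ∈ s, (c - y i) ^ (1 / 2 : ℂ) * ((z - y i) / (c - y i)) ^ (1 / 2 : ℂ),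
    fun z hz => ?_⟩
  have hε : 0 < ε := Metric.pos_of_mem_ball hz
  have hci : ∀ i ∈ s, c - y i ≠ 0 := fun i hi h0 => h i hi (by
    rw [← sub_eq_zero.1 h0]; exact Metric.mem_ball_self hε)
  have hslit : ∀ i ∈ s, (z - y i) / (c - y i) ∈ Complex.slitPlane := fun i hi => by
    have h1 : (z - y i) / (c - y i) = 1 + (z - c) / (c - y i) := by
      field_simp [hci i hi]; ring
    rw [h1]
    apply Complex.mem_slitPlane_of_norm_lt_one
    rw [norm_div, div_lt_one (norm_pos_iff.2 (hci i hi))]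
    have h2 := h i hi
    rw [Metric.mem_ball, dist_eq_norm] at hz h2
    rw [norm_sub_rev] at h2
    exact hz.trans_le (not_lt.1 h2)
  constructor
  · refine DifferentiableAt.fun_finsetProd fun i hi => ?_
    exact (DifferentiableAt.cpow_const (f := fun z => (z - y i) / (c - y i))
      ((differentiableAt_id.sub_const _).div_const _)
      (hslit i hi)).const_mul _
  · rw [← Finset.prod_pow]
    refine Finset.prod_congr rfl fun i hi => ?_
    have h3 : ∀ w : ℂ, (w ^ (1 / 2 : ℂ)) ^ 2 = w := fun w => by
      have := Complex.cpow_nat_inv_pow w two_ne_zero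
      rwa [Nat.cast_ofNat, ← one_div] at this
    rw [mul_pow, h3, h3, mul_div_cancel₀ _ (hci i hi)]

theorem IsRootPath.mono {ι : Type*} [Fintype ι] {y : ι → ℂ} {u v u' v' : ℝ} {z z' S : ℝ → ℂ}
    (H : IsRootPath y u v z z' S) (hu : u ≤ u') (huv : u' ≤ v') (hv : v' ≤ v) :
    IsRootPath y u' v' z z' S := by
  have hs : Icc u' v' ⊆ Icc u v := Icc_subset_Icc hu hv
  obtain ⟨P, hP, hd⟩ := H.hasDerivAt
  exact ⟨H.continuousOn.mono hs, H.continuousOn_root.mono hs, fun τ hτ => H.sq τ (hs hτ),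
    fun τ hτ => H.ne_zero τ ⟨hu.trans_lt hτ.1, hτ.2.trans_le hv⟩,
    ⟨P, hP, fun τ hτ => hd τ ⟨⟨hu.trans_lt hτ.1.1, hτ.1.2.trans_le hv⟩, hτ.2⟩⟩,
    H.integrable.mono_set (by
      rw [uIcc_of_le huv, uIcc_of_le ((hu.trans huv).trans hv)]; exact hs)⟩

theorem IsRootPath.intervalIntegrable {ι : Type*} [Fintype ι] {y : ι → ℂ} {u v : ℝ} {z z' S : ℝ → ℂ}
    (H : IsRootPath y u v z z' S) (huv : u ≤ v) (h : ℂ[X]) :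
    IntervalIntegrable (fun τ => h.eval (z τ) * S τ * z' τ) MeasureTheory.volume u v :=
  H.integrable.continuousOn_mul (by
    rw [uIcc_of_le huv]
    exact (h.continuous.comp_continuousOn H.continuousOn).mul H.continuousOn_root)

/-- Integration along a root path in a set on which the root has an analytic branch. -/
theorem IsRootPath.integral_eq {ι : Type*} [Fintype ι] {y : ι → ℂ} {u v : ℝ} {z z' S : ℝ → ℂ}
    (H : IsRootPath y u v z z' S) (huv : u ≤ v) (h : ℂ[X]) {U : Set ℂ} {Q w : ℂ → ℂ}
    (hU : ∀ z ∈ U, DifferentiableAt ℂ Q z ∧ Q z ^ 2 = (rootPoly y).eval z ∧ Q z ≠ 0 ∧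
      HasDerivAt w (h.eval z * Q z) z) (hz : ∀ τ ∈ Icc u v, z τ ∈ U) :
    S u / Q (z u) = S v / Q (z v) ∧ S u / Q (z u) * ∫ τ in u..v, h.eval (z τ) * S τ * z' τ =
      w (z v) - w (z u) := by
  have hQc : ContinuousOn (fun τ => Q (z τ)) (Icc u v) := fun τ hτ =>
    (hU _ (hz τ hτ)).1.continuousAt.comp_continuousWithinAt (H.continuousOn τ hτ)
  have hQ0 : ∀ τ ∈ Icc u v, Q (z τ) ≠ 0 := fun τ hτ => (hU _ (hz τ hτ)).2.2.1
  -- Two continuous square roots along an interval differ by a constant sign.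
  have hsign : ∃ s : ℂ, s ^ 2 = 1 ∧ ∀ τ ∈ Icc u v, S τ = s * Q (z τ) := by
    rcases isPreconnected_Icc.eq_or_eq_neg_of_sq_eq H.continuousOn_root hQc (fun τ hτ => by
      simp only [Pi.pow_apply]; rw [H.sq τ hτ, (hU _ (hz τ hτ)).2.1]) (fun {τ} hτ => hQ0 τ hτ) with h1 | h1
    · exact ⟨1, by norm_num, fun τ hτ => by rw [h1 hτ, one_mul]⟩
    · exact ⟨-1, by norm_num, fun τ hτ => by rw [h1 hτ, Pi.neg_apply]; ring⟩
  obtain ⟨s, hs, hS⟩ := hsign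
  have hdiv : ∀ τ ∈ Icc u v, S τ / Q (z τ) = s := fun τ hτ => by
    rw [hS τ hτ, mul_div_cancel_right₀ _ (hQ0 τ hτ)]
  rw [hdiv u (left_mem_Icc.2 huv), hdiv v (right_mem_Icc.2 huv)]
  refine ⟨rfl, ?_⟩
  obtain ⟨P, hP, hd⟩ := H.hasDerivAt
  have hwc : ContinuousOn (fun τ => w (z τ)) (Icc u v) := fun τ hτ =>
    (hU _ (hz τ hτ)).2.2.2.continuousAt.comp_continuousWithinAt (H.continuousOn τ hτ)
  rw [← intervalIntegral.integral_const_mul]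
  exact MeasureTheory.integral_eq_of_hasDerivAt_off_countable_of_le _ _ huv hP hwc (fun τ hτ => by
    have hτI := Ioo_subset_Icc_self hτ.1
    refine ((hU _ (hz τ hτI)).2.2.2.comp_of_eq τ (hd τ hτ) rfl).congr_deriv ?_
    rw [hS τ hτI]
    linear_combination (-(h.eval (z τ) * Q (z τ) * z' τ)) * hs)
    ((H.intervalIntegrable huv h).const_mul s)

/-- The primitive `Y` of `h R^{1/2}` in the local coordinate of the double cover at the branch point
`y e`. -/
structure IsEndChart {ι : Type*} [Fintype ι] [DecidableEq ι] (y : ι → ℂ) (e : ι) (ρ : ℝ) (h : ℂ[X])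
    (K Y : ℂ → ℂ) : Prop where
  differentiableAt : ∀ z ∈ Metric.ball (y e) ρ, DifferentiableAt ℂ K z
  sq : ∀ z ∈ Metric.ball (y e) ρ, K z ^ 2 = ∏ i ∈ Finset.univ.erase e, (z - y i)
  ne_zero : ∀ z ∈ Metric.ball (y e) ρ, K z ≠ 0
  hasDerivAt : ∀ v, y e + v ^ 2 ∈ Metric.ball (y e) ρ →
    HasDerivAt Y (2 * v ^ 2 * (h.eval (y e + v ^ 2) * K (y e + v ^ 2))) v
  odd : ∀ v, y e + v ^ 2 ∈ Metric.ball (y e) ρ → Y (-v) = -Y v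

/-- With z = y e + v² the root is v K and dz is 2 v dv: the integrand is even and holomorphic in a
disc, branch point included. The odd part of any primitive is again a primitive, and its oddness
expresses the exchange of sheets. -/
theorem exists_isEndChart {ι : Type*} [Fintype ι] [DecidableEq ι] (y : ι → ℂ) (e : ι) {ρ : ℝ}
    (hy : ∀ i ≠ e, y i ∉ Metric.ball (y e) ρ) (h : ℂ[X]) :
    ∃ K Y, IsEndChart y e ρ h K Y := by
  obtain ⟨K, hK⟩ := exists_root_ball (Finset.univ.erase e) y (c := y e) (ε := ρ)
    fun i hi => hy i (Finset.ne_of_mem_erase hi)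
  have hmem : ∀ v : ℂ, y e + v ^ 2 ∈ Metric.ball (y e) ρ ↔ v ∈ Metric.ball (0 : ℂ) (Real.sqrt ρ) := by
    intro v
    rw [mem_ball_zero_iff, Metric.mem_ball, dist_eq_norm, add_sub_cancel_left, norm_pow,
      Real.lt_sqrt (norm_nonneg _)]
  have hdiff : DifferentiableOn ℂ (fun v => 2 * v ^ 2 * (h.eval (y e + v ^ 2) * K (y e + v ^ 2)))
      (Metric.ball 0 (Real.sqrt ρ)) := fun v hv => by
    have h1 := (hK _ ((hmem v).2 hv)).1
    have h2 : DifferentiableAt ℂ (fun v : ℂ => K (y e + v ^ 2)) v :=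
      DifferentiableAt.comp (g := K) v h1 (by fun_prop)
    exact (DifferentiableAt.mul (by fun_prop) (DifferentiableAt.mul
      (h.differentiable.comp (by fun_prop : Differentiable ℂ fun v : ℂ => y e + v ^ 2) v)
      h2)).differentiableWithinAt
  obtain ⟨Y₀, hY₀⟩ := hdiff.isExactOn_ball
  have hodd : ∀ v ∈ Metric.ball (0 : ℂ) (Real.sqrt ρ), HasDerivAt (fun v => (Y₀ v - Y₀ (-v)) / 2)
      (2 * v ^ 2 * (h.eval (y e + v ^ 2) * K (y e + v ^ 2))) v := fun v hv => by
    have h1 := hY₀ v hv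
    have h2 := hY₀ (-v) (by simpa using hv)
    have h3 := HasDerivAt.scomp v h2 (hasDerivAt_neg v)
    refine ((h1.sub h3).div_const 2).congr_deriv ?_
    simp only [neg_sq, smul_eq_mul]; ring
  refine ⟨K, fun v => (Y₀ v - Y₀ (-v)) / 2, fun z hz => (hK z hz).1, fun z hz => (hK z hz).2,
    fun z hz h0 => ?_, fun v hv => hodd v ((hmem v).1 hv), fun v _ => by rw [neg_neg]; ring⟩
  have h1 := (hK z hz).2
  rw [h0, zero_pow two_ne_zero, eq_comm, Finset.prod_eq_zero_iff] at h1
  obtain ⟨i, hi, hzi⟩ := h1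
  exact hy i (Finset.ne_of_mem_erase hi) (by rwa [← sub_eq_zero.1 hzi])

/-- The quotient `S / K z` is the local coordinate of the double cover at the branch point. -/
theorem IsEndChart.sq_div {ι : Type*} [Fintype ι] [DecidableEq ι] {y : ι → ℂ} {e : ι} {ρ : ℝ}
    {h : ℂ[X]} {K Y : ℂ → ℂ} (E : IsEndChart y e ρ h K Y) {z S : ℂ} (hz : z ∈ Metric.ball (y e) ρ)
    (hS : S ^ 2 = (rootPoly y).eval z) : (S / K z) ^ 2 = z - y e := by
  have h1 := E.sq z hz
  have h2 := pow_ne_zero 2 (E.ne_zero z hz)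
  rw [div_pow, hS, div_eq_iff h2, h1, eval_rootPoly, ← Finset.mul_prod_erase _ _ (Finset.mem_univ e)]

/-- The coordinate `S / K` stays continuous at the branch point, so its composition with `Y` is a
primitive even for a path which begins or ends there. -/
theorem IsEndChart.integral_eq {ι : Type*} [Fintype ι] [DecidableEq ι] {y : ι → ℂ} {e : ι} {ρ : ℝ}
    {h : ℂ[X]} {K Y : ℂ → ℂ} (E : IsEndChart y e ρ h K Y) {u v : ℝ} {z z' S : ℝ → ℂ}
    (H : IsRootPath y u v z z' S) (huv : u ≤ v) (hz : ∀ τ ∈ Icc u v, z τ ∈ Metric.ball (y e) ρ) :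
    ∫ τ in u..v, h.eval (z τ) * S τ * z' τ = Y (S v / K (z v)) - Y (S u / K (z u)) := by
  have hv2 : ∀ τ ∈ Icc u v, (S τ / K (z τ)) ^ 2 = z τ - y e := fun τ hτ =>
    E.sq_div (hz τ hτ) (H.sq τ hτ)
  have hc : ContinuousOn (fun τ => S τ / K (z τ)) (Icc u v) := H.continuousOn_root.div
    (fun τ hτ => (E.differentiableAt _ (hz τ hτ)).continuousAt.comp_continuousWithinAt
      (H.continuousOn τ hτ)) fun τ hτ => E.ne_zero _ (hz τ hτ)
  have hball : ∀ τ ∈ Icc u v, y e + (S τ / K (z τ)) ^ 2 = z τ := fun τ hτ => by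
    rw [hv2 τ hτ]; ring
  have hY : ∀ τ ∈ Icc u v, HasDerivAt Y (2 * (S τ / K (z τ)) ^ 2 * (h.eval (z τ) * K (z τ)))
      (S τ / K (z τ)) := fun τ hτ => by
    have := E.hasDerivAt (S τ / K (z τ)) (by rw [hball τ hτ]; exact hz τ hτ)
    rwa [hball τ hτ] at this
  obtain ⟨P, hP, hd⟩ := H.hasDerivAt
  refine MeasureTheory.integral_eq_of_hasDerivAt_off_countable_of_le
    (fun τ => Y (S τ / K (z τ))) _ huv hP (fun τ hτ =>
      (hY τ hτ).continuousAt.comp_continuousWithinAt (f := fun τ => S τ / K (z τ)) (hc τ hτ))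
    (fun τ hτ => ?_)
    (H.intervalIntegrable huv h)
  have hτI := Ioo_subset_Icc_self hτ.1
  have hnhds := Icc_mem_nhds hτ.1.1 hτ.1.2
  have hK0 := E.ne_zero _ (hz τ hτI)
  have hS0 := H.ne_zero τ hτ.1
  have h1 := hasDerivAt_of_sq (hc.continuousAt hnhds) (div_ne_zero hS0 hK0)
    ((hd τ hτ).sub_const (y e)) (by filter_upwards [hnhds] with x hx using hv2 x hx)
  refine ((hY τ hτI).comp_of_eq τ h1 rfl).congr_deriv ?_
  field_simp

/-- The integrals `I₁`, `I₂` of `h R^{1/2}` along two paths ending at `(z₁, S₁)` and `(z₂, S₂)` on the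
double cover differ, up to sign, by the integral along the segment between `z₁` and `z₂`. -/
def Matched {ι : Type*} [Fintype ι] (y : ι → ℂ) (h : ℂ[X]) (z₁ S₁ I₁ z₂ S₂ I₂ : ℂ) : Prop :=
  ∀ (U : Set ℂ) (Q w : ℂ → ℂ), IsOpen U → Convex ℝ U → z₁ ∈ U → z₂ ∈ U →
    (∀ z ∈ U, DifferentiableAt ℂ Q z ∧ Q z ^ 2 = (rootPoly y).eval z ∧ Q z ≠ 0 ∧
      HasDerivAt w (h.eval z * Q z) z) →
    S₁ / Q z₁ * I₁ - S₂ / Q z₂ * I₂ = w z₁ - w z₂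

theorem sub_eq_sub_of_hasDerivAt {U : Set ℂ} {f g f' : ℂ → ℂ} (hU : IsOpen U) (hc : Convex ℝ U)
    (hf : ∀ z ∈ U, HasDerivAt f (f' z) z) (hg : ∀ z ∈ U, HasDerivAt g (f' z) z) {z₁ z₂ : ℂ}
    (h₁ : z₁ ∈ U) (h₂ : z₂ ∈ U) : f z₁ - f z₂ = g z₁ - g z₂ := by
  have := hU.is_const_of_deriv_eq_zero (f := fun z => f z - g z) hc.isPreconnected
    (fun z hz => ((hf z hz).sub (hg z hz)).differentiableAt.differentiableWithinAt)
    (fun z hz => by rw [((hf z hz).fun_sub (hg z hz)).deriv, sub_self]; rfl) h₁ h₂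
  linear_combination this

/-- One convex set with one branch is enough: on a convex intersection two branches differ by a
constant sign, and the primitives by that sign and a constant, which drops out of the difference. -/
theorem matched_of_eq {ι : Type*} [Fintype ι] {y : ι → ℂ} {h : ℂ[X]} {z₁ S₁ I₁ z₂ S₂ I₂ : ℂ}
    {U : Set ℂ} {Q w : ℂ → ℂ} (hU : IsOpen U) (hc : Convex ℝ U) (h₁ : z₁ ∈ U) (h₂ : z₂ ∈ U)
    (hQ : ∀ z ∈ U, DifferentiableAt ℂ Q z ∧ Q z ^ 2 = (rootPoly y).eval z ∧ Q z ≠ 0 ∧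
      HasDerivAt w (h.eval z * Q z) z)
    (heq : S₁ / Q z₁ * I₁ - S₂ / Q z₂ * I₂ = w z₁ - w z₂) : Matched y h z₁ S₁ I₁ z₂ S₂ I₂ := by
  intro U' Q' w' hU' hc' h₁' h₂' hQ'
  have hV := hU.inter hU'
  have hcV := hc.inter hc'
  have hsign : ∃ s : ℂ, s ^ 2 = 1 ∧ ∀ z ∈ U ∩ U', Q' z = s * Q z := by
    rcases hcV.isPreconnected.eq_or_eq_neg_of_sq_eq (f := Q') (g := Q)
      (fun z hz => (hQ' z hz.2).1.continuousAt.continuousWithinAt)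
      (fun z hz => (hQ z hz.1).1.continuousAt.continuousWithinAt) (fun z hz => by
      simp only [Pi.pow_apply]; rw [(hQ z hz.1).2.1, (hQ' z hz.2).2.1])
      (fun {z} hz => (hQ z hz.1).2.2.1) with h1 | h1
    · exact ⟨1, by norm_num, fun τ hτ => by rw [h1 hτ, one_mul]⟩
    · exact ⟨-1, by norm_num, fun τ hτ => by rw [h1 hτ, Pi.neg_apply]; ring⟩
  obtain ⟨s, hs, hS⟩ := hsign
  have hinv : s⁻¹ = s := inv_eq_of_mul_eq_one_left (by rw [← sq, hs])
  have h3 := sub_eq_sub_of_hasDerivAt hV hcV (f := w') (g := fun z => s * w z)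
    (fun z hz => (hQ' z hz.2).2.2.2) (fun z hz => ((hQ z hz.1).2.2.2.const_mul s).congr_deriv (by
      rw [hS z hz]; ring)) ⟨h₁, h₁'⟩ ⟨h₂, h₂'⟩
  rw [h3, hS _ ⟨h₁, h₁'⟩, hS _ ⟨h₂, h₂'⟩, ← mul_sub, ← heq, div_mul_eq_div_div, div_mul_eq_div_div,
    div_eq_mul_inv S₁ s, div_eq_mul_inv S₂ s, hinv]
  ring

/-- Where a branch `Q` exists, `Y (Q / K)` is a primitive of `h` times `Q`. If a given root is `-Q`,
the oddness of `Y` compensates the sign. -/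
theorem IsEndChart.matched {ι : Type*} [Fintype ι] [DecidableEq ι] {y : ι → ℂ} {e : ι} {ρ : ℝ}
    {h : ℂ[X]} {K Y : ℂ → ℂ} (E : IsEndChart y e ρ h K Y) {z₁ S₁ z₂ S₂ : ℂ}
    (hz₁ : z₁ ∈ Metric.ball (y e) ρ) (hS₁ : S₁ ^ 2 = (rootPoly y).eval z₁)
    (hz₂ : z₂ ∈ Metric.ball (y e) ρ) (hS₂ : S₂ ^ 2 = (rootPoly y).eval z₂) :
    Matched y h z₁ S₁ (Y (S₁ / K z₁)) z₂ S₂ (Y (S₂ / K z₂)) := by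
  intro U Q w hU hc h₁ h₂ hQ
  have hv2 : ∀ z ∈ U ∩ Metric.ball (y e) ρ, (Q z / K z) ^ 2 = z - y e := fun z hz =>
    E.sq_div hz.2 (hQ z hz.1).2.1
  have hV := hU.inter (Metric.isOpen_ball (x := y e) (ε := ρ))
  have key := sub_eq_sub_of_hasDerivAt hV (hc.inter (convex_ball (y e) ρ)) (f := w)
    (g := fun z => Y (Q z / K z)) (fun z hz => (hQ z hz.1).2.2.2) (fun z hz => by
      have hQ0 := (hQ z hz.1).2.2.1
      have hK0 := E.ne_zero z hz.2
      have hd : HasDerivAt (fun z => Q z / K z) _ z :=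
        ((hQ z hz.1).1.div (E.differentiableAt z hz.2) hK0).hasDerivAt
      have hsq : HasDerivAt (fun z => (Q z / K z) ^ 2) 1 z := by
        refine ((hasDerivAt_id z).sub_const (y e)).congr_of_eventuallyEq ?_
        filter_upwards [hV.mem_nhds hz] with x hx using hv2 x hx
      have huniq := (hd.pow 2).unique hsq
      have hye : y e + (Q z / K z) ^ 2 = z := by rw [hv2 z hz]; ring
      have hY := E.hasDerivAt (Q z / K z) (by rw [hye]; exact hz.2)
      rw [hye] at hY
      refine (hY.comp z hd).congr_deriv ?_
      generalize deriv (Q / K) z = D at *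
      have : (2 : ℂ) * (Q z / K z) * D = 1 := by
        rw [← huniq]; norm_num
      calc _ = (Q z / K z) * (h.eval z * K z) * (2 * (Q z / K z) * D) := by ring
        _ = _ := by rw [this]; field_simp) ⟨h₁, hz₁⟩ ⟨h₂, hz₂⟩
  have hsgn : ∀ z S, z ∈ U → z ∈ Metric.ball (y e) ρ → S ^ 2 = (rootPoly y).eval z →
      S / Q z * Y (S / K z) = Y (Q z / K z) := fun z S hzU hzb hS => by
    have hQ0 := (hQ z hzU).2.2.1
    rw [← (hQ z hzU).2.1] at hS
    rcases sq_eq_sq_iff_eq_or_eq_neg.1 hS with h5 | h5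
    · rw [h5, div_self hQ0, one_mul]
    · rw [h5, neg_div, neg_div, div_self hQ0, E.odd]
      · ring
      · rw [hv2 z ⟨hzU, hzb⟩]; simpa using hzb
  rw [hsgn z₁ S₁ h₁ hz₁ hS₁, hsgn z₂ S₂ h₂ hz₂ hS₂, ← key]

theorem IsEndChart.apply_zero {ι : Type*} [Fintype ι] [DecidableEq ι] {y : ι → ℂ} {e : ι} {ρ : ℝ}
    {h : ℂ[X]} {K Y : ℂ → ℂ} (E : IsEndChart y e ρ h K Y) (hρ : 0 < ρ) : Y 0 = 0 := by
  have := E.odd 0 (by simpa using hρ)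
  rw [neg_zero] at this
  linear_combination (1 / 2) * this

theorem exists_root_primitive {ι : Type*} [Fintype ι] (y : ι → ℂ) (h : ℂ[X]) {c : ℂ} {ε : ℝ}
    (hc : ∀ i, y i ∉ Metric.ball c ε) : ∃ Q w : ℂ → ℂ, ∀ z ∈ Metric.ball c ε,
      DifferentiableAt ℂ Q z ∧ Q z ^ 2 = (rootPoly y).eval z ∧ Q z ≠ 0 ∧
        HasDerivAt w (h.eval z * Q z) z := by
  obtain ⟨Q, hQ⟩ := exists_root_ball Finset.univ y fun i _ => hc i
  have hd : DifferentiableOn ℂ (fun z => h.eval z * Q z) (Metric.ball c ε) := fun z hz =>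
    (h.differentiable.differentiableAt.mul (hQ z hz).1).differentiableWithinAt
  obtain ⟨w, hw⟩ := hd.isExactOn_ball
  refine ⟨Q, w, fun z hz => ⟨(hQ z hz).1, by rw [eval_rootPoly]; exact (hQ z hz).2, fun h0 => ?_,
    hw z hz⟩⟩
  have h1 := (hQ z hz).2
  rw [h0, zero_pow two_ne_zero, eq_comm, Finset.prod_eq_zero_iff] at h1
  obtain ⟨i, _, hzi⟩ := h1
  exact hc i (by rwa [← sub_eq_zero.1 hzi])

/-- Over a convex set which carries a branch, both integrals grow by increments of one primitive,
each with its own sign. The argument is reversible, as the propagation along an interval requires.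
-/
theorem Matched.of_interval {ι : Type*} [Fintype ι] {y : ι → ℂ} {h : ℂ[X]} {u v a b : ℝ}
    {z₁ z₁' S₁ z₂ z₂' S₂ : ℝ → ℂ} (H₁ : IsRootPath y u v z₁ z₁' S₁) (H₂ : IsRootPath y u v z₂ z₂' S₂)
    (hua : u ≤ a) (hab : a ≤ b) (hbv : b ≤ v) {U : Set ℂ} {Q w : ℂ → ℂ} (hU : IsOpen U)
    (hc : Convex ℝ U) (hQ : ∀ z ∈ U, DifferentiableAt ℂ Q z ∧ Q z ^ 2 = (rootPoly y).eval z ∧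
      Q z ≠ 0 ∧ HasDerivAt w (h.eval z * Q z) z) (h₁ : ∀ τ ∈ Icc a b, z₁ τ ∈ U)
    (h₂ : ∀ τ ∈ Icc a b, z₂ τ ∈ U) :
    Matched y h (z₁ a) (S₁ a) (∫ τ in u..a, h.eval (z₁ τ) * S₁ τ * z₁' τ) (z₂ a) (S₂ a)
      (∫ τ in u..a, h.eval (z₂ τ) * S₂ τ * z₂' τ) ↔
    Matched y h (z₁ b) (S₁ b) (∫ τ in u..b, h.eval (z₁ τ) * S₁ τ * z₁' τ) (z₂ b) (S₂ b)
      (∫ τ in u..b, h.eval (z₂ τ) * S₂ τ * z₂' τ) := by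
  have hadd : ∀ {z z' S : ℝ → ℂ}, IsRootPath y u v z z' S →
      (∫ τ in u..b, h.eval (z τ) * S τ * z' τ) = (∫ τ in u..a, h.eval (z τ) * S τ * z' τ) +
        ∫ τ in a..b, h.eval (z τ) * S τ * z' τ := fun H =>
    (intervalIntegral.integral_add_adjacent_intervals
      ((H.mono le_rfl hua (hab.trans hbv)).intervalIntegrable hua h)
      ((H.mono hua hab hbv).intervalIntegrable hab h)).symm
  obtain ⟨s₁, e₁⟩ := (H₁.mono hua hab hbv).integral_eq hab h hQ h₁
  obtain ⟨s₂, e₂⟩ := (H₂.mono hua hab hbv).integral_eq hab h hQ h₂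
  have ha := left_mem_Icc.2 hab
  have hb := right_mem_Icc.2 hab
  rw [hadd H₁, hadd H₂]
  constructor
  · intro M
    have := M U Q w hU hc (h₁ a ha) (h₂ a ha) hQ
    refine matched_of_eq hU hc (h₁ b hb) (h₂ b hb) hQ ?_
    rw [← s₁, ← s₂]
    linear_combination this + e₁ - e₂
  · intro M
    have := M U Q w hU hc (h₁ b hb) (h₂ b hb) hQ
    refine matched_of_eq hU hc (h₁ a ha) (h₂ a ha) hQ ?_
    rw [← s₁, ← s₂] at this
    linear_combination this - e₁ + e₂

/-- Two root paths with the same ends which are close to each other have the same integrals of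
`h R^{1/2}`, up to sign. -/
theorem exists_integral_comparison {ι : Type*} [Fintype ι] {y₀ : ι → ℂ}
    (hinj : Function.Injective y₀) {u v : ℝ} (huv : u < v) {γ : ℝ → ℂ}
    (hγ : ContinuousOn γ (Icc u v)) {e₁ e₂ : ι} (he₁ : γ u = y₀ e₁) (he₂ : γ v = y₀ e₂)
    (hne : ∀ τ ∈ Ioo u v, ∀ k, γ τ ≠ y₀ k) :
    ∃ δ > 0, ∀ y : ι → ℂ, (∀ k, ‖y k - y₀ k‖ < δ) → ∀ (h : ℂ[X]) (z₁ z₁' S₁ z₂ z₂' S₂ : ℝ → ℂ),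
      IsRootPath y u v z₁ z₁' S₁ → IsRootPath y u v z₂ z₂' S₂ →
      (∀ τ ∈ Icc u v, ‖z₁ τ - γ τ‖ < δ) → (∀ τ ∈ Icc u v, ‖z₂ τ - γ τ‖ < δ) →
      z₁ u = y e₁ → z₂ u = y e₁ → z₁ v = y e₂ → z₂ v = y e₂ →
      (∫ τ in u..v, h.eval (z₁ τ) * S₁ τ * z₁' τ) = (∫ τ in u..v, h.eval (z₂ τ) * S₂ τ * z₂' τ) ∨
      (∫ τ in u..v, h.eval (z₁ τ) * S₁ τ * z₁' τ) = -∫ τ in u..v, h.eval (z₂ τ) * S₂ τ * z₂' τ := by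
  classical
  obtain ⟨ρ, hρ, hsep⟩ : ∃ ρ > 0, ∀ i k, i ≠ k → 2 * ρ ≤ ‖y₀ i - y₀ k‖ := by
    have : ∀ᶠ ρ : ℝ in 𝓝[>] 0, ∀ i k, i ≠ k → 2 * ρ ≤ ‖y₀ i - y₀ k‖ := by
      refine eventually_all.2 fun i => eventually_all.2 fun k => ?_
      by_cases hik : i = k
      · exact .of_forall fun _ h => absurd hik h
      · have h1 : 0 < ‖y₀ i - y₀ k‖ / 2 := half_pos (norm_pos_iff.2 (sub_ne_zero.2 fun h => hik (hinj h)))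
        filter_upwards [Ioo_mem_nhdsGT h1] with ρ hρ _
        linarith [hρ.2]
    obtain ⟨ρ, h1, h2⟩ := (this.and self_mem_nhdsWithin).exists
    exact ⟨ρ, h2, h1⟩
  obtain ⟨τa, hτa, hτa'⟩ : ∃ τa ∈ Ioo u ((u + v) / 2), ∀ τ ∈ Icc u τa, ‖γ τ - y₀ e₁‖ < ρ / 4 := by
    have h1 := hγ u (left_mem_Icc.2 huv.le)
    rw [Metric.continuousWithinAt_iff] at h1
    obtain ⟨η, hη, h2⟩ := h1 (ρ / 4) (by linarith)
    refine ⟨u + min (η / 2) ((v - u) / 4), ⟨by have : 0 < v - u := by linarith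
                                               have : 0 < min (η / 2) ((v - u) / 4) := by positivity
                                               linarith, ?_⟩, fun τ hτ => ?_⟩
    · have := min_le_right (η / 2) ((v - u) / 4); linarith
    · have h3 := min_le_right (η / 2) ((v - u) / 4)
      have h4 := min_le_left (η / 2) ((v - u) / 4)
      have := h2 (x := τ) ⟨hτ.1, by linarith [hτ.2]⟩ (by
        rw [Real.dist_eq, abs_of_nonneg (by linarith [hτ.1])]; linarith [hτ.2])
      rwa [dist_eq_norm, he₁] at this
  obtain ⟨τb, hτb, hτb'⟩ : ∃ τb ∈ Ioo ((u + v) / 2) v, ∀ τ ∈ Icc τb v, ‖γ τ - y₀ e₂‖ < ρ / 4 := by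
    have h1 := hγ v (right_mem_Icc.2 huv.le)
    rw [Metric.continuousWithinAt_iff] at h1
    obtain ⟨η, hη, h2⟩ := h1 (ρ / 4) (by linarith)
    refine ⟨v - min (η / 2) ((v - u) / 4), ⟨?_, by have : 0 < v - u := by linarith
                                                   have : 0 < min (η / 2) ((v - u) / 4) := by positivity
                                                   linarith⟩, fun τ hτ => ?_⟩
    · have := min_le_right (η / 2) ((v - u) / 4); linarith
    · have h3 := min_le_right (η / 2) ((v - u) / 4)
      have h4 := min_le_left (η / 2) ((v - u) / 4)
      have := h2 (x := τ) ⟨by linarith [hτ.1], hτ.2⟩ (by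
        rw [Real.dist_eq, abs_sub_comm, abs_of_nonneg (by linarith [hτ.2])]; linarith [hτ.1])
      rwa [dist_eq_norm, he₂] at this
  have hab : τa ≤ τb := (hτa.2.trans hτb.1).le
  have hsub : Icc τa τb ⊆ Icc u v := Icc_subset_Icc hτa.1.le hτb.2.le
  obtain ⟨ε, hε, hfar⟩ : ∃ ε > 0, ∀ k, ∀ τ ∈ Icc τa τb, 2 * ε ≤ ‖γ τ - y₀ k‖ := by
    have : ∀ᶠ ε : ℝ in 𝓝[>] 0, ∀ k, ∀ τ ∈ Icc τa τb, 2 * ε ≤ ‖γ τ - y₀ k‖ := by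
      refine eventually_all.2 fun k => ?_
      obtain ⟨τ₀, hτ₀, hmin⟩ := isCompact_Icc.exists_isMinOn (nonempty_Icc.2 hab)
        ((hγ.mono hsub).sub (continuousOn_const (c := y₀ k))).norm
      have h1 : 0 < ‖γ τ₀ - y₀ k‖ / 2 := half_pos (norm_pos_iff.2 (sub_ne_zero.2
        (hne τ₀ ⟨hτa.1.trans_le hτ₀.1, hτ₀.2.trans_lt hτb.2⟩ k)))
      filter_upwards [Ioo_mem_nhdsGT h1] with ε hε τ hτ
      have : ‖γ τ₀ - y₀ k‖ ≤ ‖γ τ - y₀ k‖ := hmin hτ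
      linarith [hε.2]
    obtain ⟨ρ, h1, h2⟩ := (this.and self_mem_nhdsWithin).exists
    exact ⟨ρ, h2, h1⟩
  -- With this closeness the outer pieces of the paths lie in the end charts of the moved branch
  -- points, and on the middle piece discs of radius `ε` around `γ` contain no moved branch point.
  refine ⟨min (ρ / 4) (ε / 2), by positivity, ?_⟩
  intro y hy h z₁ z₁' S₁ z₂ z₂' S₂ H₁ H₂ hz₁ hz₂ hu₁ hu₂ hv₁ hv₂
  have hyρ : ∀ k, ‖y k - y₀ k‖ < ρ / 4 := fun k => (hy k).trans_le (min_le_left _ _)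
  have hyε : ∀ k, ‖y k - y₀ k‖ < ε / 2 := fun k => (hy k).trans_le (min_le_right _ _)
  have hchart : ∀ e, ∀ i ≠ e, y i ∉ Metric.ball (y e) ρ := fun e i hi hmem => by
    rw [Metric.mem_ball, dist_eq_norm] at hmem
    have h1 := hsep i e hi
    have h2 : ‖y₀ i - y₀ e‖ ≤ ‖y i - y e‖ + ‖y i - y₀ i‖ + ‖y e - y₀ e‖ := by
      calc ‖y₀ i - y₀ e‖ = ‖(y i - y e) - (y i - y₀ i) + (y e - y₀ e)‖ := by ring_nf
        _ ≤ ‖(y i - y e) - (y i - y₀ i)‖ + ‖y e - y₀ e‖ := norm_add_le _ _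
        _ ≤ _ := add_le_add_left (norm_sub_le _ _) _
    linarith [hyρ i, hyρ e]
  have hball : ∀ {z : ℂ} {e τ}, ‖z - γ τ‖ < min (ρ / 4) (ε / 2) → ‖γ τ - y₀ e‖ < ρ / 4 →
      z ∈ Metric.ball (y e) ρ := fun {z e τ} h1 h2 => by
    rw [Metric.mem_ball, dist_eq_norm]
    have h3 : ‖z - y e‖ ≤ ‖z - γ τ‖ + ‖γ τ - y₀ e‖ + ‖y e - y₀ e‖ := by
      calc ‖z - y e‖ = ‖(z - γ τ) + (γ τ - y₀ e) - (y e - y₀ e)‖ := by ring_nf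
        _ ≤ ‖(z - γ τ) + (γ τ - y₀ e)‖ + ‖y e - y₀ e‖ := norm_sub_le _ _
        _ ≤ _ := add_le_add_left (norm_add_le _ _) _
    linarith [hyρ e, h1.trans_le (min_le_left _ _)]
  obtain ⟨K₁, Y₁, E₁⟩ := exists_isEndChart y e₁ (hchart e₁) h
  obtain ⟨K₂, Y₂, E₂⟩ := exists_isEndChart y e₂ (hchart e₂) h
  have hua := hτa.1.le
  have hbv := hτb.2.le
  have hzero : ∀ {z z' S : ℝ → ℂ} {τ e}, IsRootPath y u v z z' S → τ ∈ Icc u v → z τ = y e →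
      S τ = 0 := fun H hτ hz => by
    have := H.sq _ hτ
    rwa [hz, eval_rootPoly_self, sq_eq_zero_iff] at this
  have hI : ∀ {z z' S : ℝ → ℂ}, IsRootPath y u v z z' S →
      (∀ τ ∈ Icc u v, ‖z τ - γ τ‖ < min (ρ / 4) (ε / 2)) → z u = y e₁ →
      (∫ τ in u..τa, h.eval (z τ) * S τ * z' τ) = Y₁ (S τa / K₁ (z τa)) := fun H hz hu => by
    rw [E₁.integral_eq (H.mono le_rfl hua (hab.trans hbv)) hua fun τ hτ =>
      hball (hz τ ⟨hτ.1, hτ.2.trans (hab.trans hbv)⟩) (hτa' τ hτ),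
      hzero H (left_mem_Icc.2 huv.le) hu, zero_div, E₁.apply_zero hρ, sub_zero]
  have hJ : ∀ {z z' S : ℝ → ℂ}, IsRootPath y u v z z' S →
      (∀ τ ∈ Icc u v, ‖z τ - γ τ‖ < min (ρ / 4) (ε / 2)) → z v = y e₂ →
      (∫ τ in τb..v, h.eval (z τ) * S τ * z' τ) = -Y₂ (S τb / K₂ (z τb)) := fun H hz hu => by
    rw [E₂.integral_eq (H.mono (hua.trans hab) hbv le_rfl) hbv fun τ hτ =>
      hball (hz τ ⟨(hua.trans hab).trans hτ.1, hτ.2⟩) (hτb' τ hτ),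
      hzero H (right_mem_Icc.2 huv.le) hu, zero_div, E₂.apply_zero hρ, zero_sub]
  have hTot : ∀ {z z' S : ℝ → ℂ}, IsRootPath y u v z z' S →
      (∫ τ in u..v, h.eval (z τ) * S τ * z' τ) = (∫ τ in u..τb, h.eval (z τ) * S τ * z' τ) +
        ∫ τ in τb..v, h.eval (z τ) * S τ * z' τ := fun H =>
    (intervalIntegral.integral_add_adjacent_intervals
      ((H.mono le_rfl (hua.trans hab) hbv).intervalIntegrable (hua.trans hab) h)
      ((H.mono (hua.trans hab) hbv le_rfl).intervalIntegrable hbv h)).symm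
  have hma : τa ∈ Icc u v := hsub (left_mem_Icc.2 hab)
  have hmb : τb ∈ Icc u v := hsub (right_mem_Icc.2 hab)
  have ha' := hτa' τa (right_mem_Icc.2 hua)
  have hb' := hτb' τb (left_mem_Icc.2 hbv)
  set M : ℝ → Prop := fun x => Matched y h (z₁ x) (S₁ x) (∫ τ in u..x, h.eval (z₁ τ) * S₁ τ * z₁' τ)
    (z₂ x) (S₂ x) (∫ τ in u..x, h.eval (z₂ τ) * S₂ τ * z₂' τ) with hM
  have hMa : M τa := by
    rw [hM]
    simp only
    rw [hI H₁ hz₁ hu₁, hI H₂ hz₂ hu₂]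
    exact E₁.matched (hball (hz₁ _ hma) ha') (H₁.sq _ hma) (hball (hz₂ _ hma) ha') (H₂.sq _ hma)
  have hroot : ∀ x ∈ Icc τa τb, ∃ Q w : ℂ → ℂ, ∀ z ∈ Metric.ball (γ x) ε,
      DifferentiableAt ℂ Q z ∧ Q z ^ 2 = (rootPoly y).eval z ∧ Q z ≠ 0 ∧
        HasDerivAt w (h.eval z * Q z) z := fun x hx =>
    exists_root_primitive y h fun i hi => by
      rw [Metric.mem_ball, dist_eq_norm] at hi
      have h1 := hfar i x hx
      have h2 : ‖γ x - y₀ i‖ ≤ ‖y i - γ x‖ + ‖y i - y₀ i‖ := by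
        rw [norm_sub_rev (y i)]
        calc ‖γ x - y₀ i‖ = ‖(γ x - y i) + (y i - y₀ i)‖ := by ring_nf
          _ ≤ _ := norm_add_le _ _
      linarith [hyε i]
  -- Nearby parameters keep both paths in a disc around `γ x` where the root has a branch, so the
  -- matching is locally constant in `x`.
  have hstep : ∀ x ∈ Icc τa τb, ∀ᶠ x' in 𝓝[Icc τa τb] x, (M x → M x') ∧ (M x' → M x) := by
    intro x hx
    obtain ⟨Q, w, hQ⟩ := hroot x hx
    have h1 := hγ x (hsub hx)
    rw [Metric.continuousWithinAt_iff] at h1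
    obtain ⟨η, hη, h2⟩ := h1 (ε / 2) (by linarith)
    have hin : ∀ {z z' S : ℝ → ℂ}, IsRootPath y u v z z' S →
        (∀ τ ∈ Icc u v, ‖z τ - γ τ‖ < min (ρ / 4) (ε / 2)) → ∀ τ ∈ Icc u v, |τ - x| < η →
        z τ ∈ Metric.ball (γ x) ε := fun {z z' S} H hz τ hτ hτx => by
      have h3 := h2 hτ (by rwa [Real.dist_eq])
      rw [Metric.mem_ball]
      have h4 := (hz τ hτ).trans_le (min_le_right _ _)
      rw [← dist_eq_norm] at h4
      linarith [dist_triangle (z τ) (γ τ) (γ x)]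
    filter_upwards [self_mem_nhdsWithin, mem_nhdsWithin_of_mem_nhds (Metric.ball_mem_nhds x hη)]
      with x' hx' hxη
    rw [Metric.mem_ball, Real.dist_eq, abs_lt] at hxη
    rcases le_total x x' with hle | hle
    · have hs : ∀ τ ∈ Icc x x', τ ∈ Icc u v ∧ |τ - x| < η := fun τ hτ =>
        ⟨hsub ⟨hx.1.trans hτ.1, hτ.2.trans hx'.2⟩, by
          rw [abs_lt]; constructor <;> linarith [hτ.1, hτ.2]⟩
      have := Matched.of_interval H₁ H₂ (hua.trans hx.1) hle (hx'.2.trans hbv) Metric.isOpen_ball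
        (convex_ball _ _) hQ (fun τ hτ => hin H₁ hz₁ τ (hs τ hτ).1 (hs τ hτ).2)
        (fun τ hτ => hin H₂ hz₂ τ (hs τ hτ).1 (hs τ hτ).2)
      exact ⟨this.1, this.2⟩
    · have hs : ∀ τ ∈ Icc x' x, τ ∈ Icc u v ∧ |τ - x| < η := fun τ hτ =>
        ⟨hsub ⟨hx'.1.trans hτ.1, hτ.2.trans hx.2⟩, by
          rw [abs_lt]; constructor <;> linarith [hτ.1, hτ.2]⟩
      have := Matched.of_interval H₁ H₂ (hua.trans hx'.1) hle (hx.2.trans hbv) Metric.isOpen_ball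
        (convex_ball _ _) hQ (fun τ hτ => hin H₁ hz₁ τ (hs τ hτ).1 (hs τ hτ).2)
        (fun τ hτ => hin H₂ hz₂ τ (hs τ hτ).1 (hs τ hτ).2)
      exact ⟨this.2, this.1⟩
  have hMb : M τb := isPreconnected_Icc.induction₂' (fun x x' => M x → M x') hstep
    (fun _ _ _ _ _ _ h1 h2 h3 => h2 (h1 h3)) (left_mem_Icc.2 hab) (right_mem_Icc.2 hab) hMa
  obtain ⟨Q, w, hQ⟩ := hroot τb (right_mem_Icc.2 hab)
  have hin : ∀ {z : ℂ}, ‖z - γ τb‖ < min (ρ / 4) (ε / 2) → z ∈ Metric.ball (γ τb) ε := fun hz => by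
    rw [Metric.mem_ball, dist_eq_norm]; linarith [hz.trans_le (min_le_right _ _)]
  -- The end chart at the second branch point matches the two tails as well. In the difference of
  -- the two relations the primitive cancels, and only the signs of the two roots at `τb` remain.
  have hN := E₂.matched (hball (hz₁ _ hmb) hb') (H₁.sq _ hmb) (hball (hz₂ _ hmb) hb') (H₂.sq _ hmb)
  have q₁ := hMb _ Q w Metric.isOpen_ball (convex_ball _ _) (hin (hz₁ _ hmb)) (hin (hz₂ _ hmb)) hQ
  have q₂ := hN _ Q w Metric.isOpen_ball (convex_ball _ _) (hin (hz₁ _ hmb)) (hin (hz₂ _ hmb)) hQ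
  have hsg : ∀ {z z' S : ℝ → ℂ}, IsRootPath y u v z z' S → ‖z τb - γ τb‖ < min (ρ / 4) (ε / 2) →
      S τb / Q (z τb) = 1 ∨ S τb / Q (z τb) = -1 := fun {z z' S} H hz => by
    have h0 := (hQ _ (hin hz)).2.2.1
    have := H.sq _ hmb
    rw [← (hQ _ (hin hz)).2.1] at this
    rcases sq_eq_sq_iff_eq_or_eq_neg.1 this with h5 | h5
    · left; rw [h5, div_self h0]
    · right; rw [h5, neg_div, div_self h0]
  rw [hTot H₁, hTot H₂, hJ H₁ hz₁ hv₁, hJ H₂ hz₂ hv₂]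
  rcases hsg H₁ (hz₁ _ hmb) with s₁ | s₁ <;> rcases hsg H₂ (hz₂ _ hmb) with s₂ | s₂ <;>
    rw [s₁, s₂] at q₁ q₂
  · left; linear_combination q₁ - q₂
  · right; linear_combination q₁ - q₂
  · right; linear_combination q₂ - q₁
  · left; linear_combination q₂ - q₁

/-! ### Analytic dependence of the integrals on the branch points. -/

/-- Analytic square roots near the unit of a commutative Banach algebra. -/
theorem exists_analytic_root (E : Type*) [NormedCommRing E] [NormedAlgebra ℂ E] [CompleteSpace E] :
    ∃ s : E → E, AnalyticAt ℂ s 1 ∧ s 1 = 1 ∧ ∀ᶠ g in 𝓝 1, s g ^ 2 = g := by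
  have han : AnalyticAt ℂ (fun g : E => g ^ 2) 1 := analyticAt_id.pow 2
  -- The derivative of squaring at the unit is multiplication by 2, so the inverse function theorem
  -- applies.
  set i : E ≃L[ℂ] E := ContinuousLinearEquiv.smulLeft (Units.mk0 (2 : ℂ) two_ne_zero) with hi
  have hd : HasStrictFDerivAt (fun g : E => g ^ 2) (i : E →L[ℂ] E) 1 := by
    have h1 := (hasStrictFDerivAt_id (𝕜 := ℂ) (1 : E)).mul' (hasStrictFDerivAt_id (1 : E))
    refine (h1.congr_of_eventuallyEq (.of_forall fun g => (sq g).symm)).congr_fderiv ?_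
    ext g
    simp [hi, two_smul]
  refine ⟨hd.localInverse _ _ _, ?_, ?_, ?_⟩
  · have := (hd.toOpenPartialHomeomorph _).analyticAt_symm' (i := i)
      hd.mem_toOpenPartialHomeomorph_source han hd.hasFDerivAt.fderiv
    simpa [HasStrictFDerivAt.localInverse_def] using this
  · simpa using hd.localInverse_apply_image
  · simpa using hd.eventually_right_inverse

/-- Through this functional, analyticity of an integral in parameters follows from that of the
integrand as a map into the space of continuous functions, with no domination argument. The weight
`m` need only be integrable. -/
theorem exists_integral_clm {u v : ℝ} (huv : u ≤ v) {m : ℝ → ℂ}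
    (hm : IntervalIntegrable m MeasureTheory.volume u v) :
    ∃ L : C(Icc u v, ℂ) →L[ℂ] ℂ, ∀ φ, L φ = ∫ τ in u..v, φ (projIcc u v huv τ) * m τ := by
  have hint : ∀ φ : C(Icc u v, ℂ), IntervalIntegrable (fun τ => φ (projIcc u v huv τ) * m τ)
      MeasureTheory.volume u v := fun φ =>
    hm.continuousOn_mul ((φ.continuous.comp continuous_projIcc).continuousOn)
  refine ⟨LinearMap.mkContinuous
    { toFun := fun φ => ∫ τ in u..v, φ (projIcc u v huv τ) * m τ
      map_add' := fun φ ψ => ?_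
      map_smul' := fun c φ => ?_ } (∫ τ in u..v, ‖m τ‖) fun φ => ?_, fun φ => rfl⟩
  · rw [← intervalIntegral.integral_add (hint φ) (hint ψ)]
    simp only [ContinuousMap.add_apply, add_mul]
  · rw [RingHom.id_apply, smul_eq_mul, ← intervalIntegral.integral_const_mul]
    simp only [ContinuousMap.smul_apply, smul_eq_mul, mul_assoc]
  · rw [mul_comm, ← intervalIntegral.integral_const_mul]
    refine intervalIntegral.norm_integral_le_of_norm_le huv (.of_forall fun τ _ => ?_)
      (hm.norm.const_mul _)
    rw [norm_mul]
    exact mul_le_mul_of_nonneg_right (φ.norm_coe_le_norm _) (norm_nonneg _)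

theorem hasDerivAt_polyPart {A : ℂ → PowerSeries ℂ} {A' : PowerSeries ℂ} {x : ℂ}
    (hA : HasCoeffDerivAt A A' x) (d : ℕ) {z : ℂ → ℂ} {z' : ℂ} (hz : HasDerivAt z z' x) :
    HasDerivAt (fun l => (polyPart d (A l)).eval (z l))
      ((polyPart d A').eval (z x) + (polyPart d (A x)).derivative.eval (z x) * z') x := by
  simp only [polyPart, Polynomial.eval_finsetSum, Polynomial.derivative_sum, Finset.sum_mul]
  rw [← Finset.sum_add_distrib]
  refine HasDerivAt.fun_sum fun m _ => ?_
  simp only [Polynomial.eval_mul, Polynomial.eval_C, Polynomial.eval_pow, Polynomial.eval_X,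
    Polynomial.derivative_C_mul_X_pow]
  refine ((hA m).mul (hz.fun_pow (d - m))).congr_deriv ?_
  ring

section Family

variable {ι : Type*} [Fintype ι] {u v : ℝ}

/-- The ratio of the affine map which sends `y₀ e₁` to `y e₁` and `y₀ e₂` to `y e₂`. -/
noncomputable def affineScale (y₀ : ι → ℂ) (e₁ e₂ : ι) (y : ι → ℂ) : ℂ :=
  (y e₂ - y e₁) / (y₀ e₂ - y₀ e₁)

/-- The image of a path under the affine map which sends `y₀ e₁` to `y e₁` and `y₀ e₂` to `y e₂`. -/
noncomputable def pathFamily (G : C(Icc u v, ℂ)) (y₀ : ι → ℂ) (e₁ e₂ : ι) (y : ι → ℂ) :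
    C(Icc u v, ℂ) :=
  y e₁ • 1 + affineScale y₀ e₁ e₂ y • (G - y₀ e₁ • 1)

/-- The ratio of the values of `rootPoly` along the moved and the original path, up to the factors
that belong to the ends. -/
noncomputable def ratioFamily [DecidableEq ι] (G : C(Icc u v, ℂ)) (D : ι → C(Icc u v, ℂ)) (y₀ : ι → ℂ)
    (e₁ e₂ : ι) (y : ι → ℂ) : C(Icc u v, ℂ) :=
  ∏ k ∈ (Finset.univ.erase e₁).erase e₂, (pathFamily G y₀ e₁ e₂ y - y k • 1) * D k

/-- The integrand `h R^{1/2}` along the moved path. -/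
noncomputable def integrandFamily [DecidableEq ι] (p n : ℕ) (s : C(Icc u v, ℂ) → C(Icc u v, ℂ))
    (G : C(Icc u v, ℂ)) (D : ι → C(Icc u v, ℂ)) (y₀ : ι → ℂ) (e₁ e₂ : ι)
    (x : (Fin (2 * p - 1) → ℂ) × (ι → ℂ)) : C(Icc u v, ℂ) :=
  affineScale y₀ e₁ e₂ x.2 ^ 2 • ((∑ m ∈ Finset.range (2 * p - 1 - (n + 1) + 1),
    PowerSeries.coeff m (fieldSeries p x.1 x.2) •
      pathFamily G y₀ e₁ e₂ x.2 ^ (2 * p - 1 - (n + 1) - m)) * s (ratioFamily G D y₀ e₁ e₂ x.2))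

theorem analyticAt_eval (k : ι) (y : ι → ℂ) : AnalyticAt ℂ (fun y : ι → ℂ => y k) y :=
  (ContinuousLinearMap.proj (R := ℂ) (φ := fun _ : ι => ℂ) k).analyticAt y

theorem analyticAt_affineScale (y₀ : ι → ℂ) (e₁ e₂ : ι) (y : ι → ℂ) :
    AnalyticAt ℂ (affineScale y₀ e₁ e₂) y :=
  ((analyticAt_eval e₂ y).sub (analyticAt_eval e₁ y)).mul analyticAt_const

theorem analyticAt_pathFamily (G : C(Icc u v, ℂ)) (y₀ : ι → ℂ) (e₁ e₂ : ι) (y : ι → ℂ) :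
    AnalyticAt ℂ (pathFamily G y₀ e₁ e₂) y :=
  ((analyticAt_eval e₁ y).smul analyticAt_const).add
    ((analyticAt_affineScale y₀ e₁ e₂ y).smul analyticAt_const)

theorem analyticAt_ratioFamily [DecidableEq ι] (G : C(Icc u v, ℂ)) (D : ι → C(Icc u v, ℂ))
    (y₀ : ι → ℂ) (e₁ e₂ : ι) (y : ι → ℂ) : AnalyticAt ℂ (ratioFamily G D y₀ e₁ e₂) y :=
  Finset.analyticAt_fun_prod _ fun k _ => ((analyticAt_pathFamily G y₀ e₁ e₂ y).sub
    ((analyticAt_eval k y).smul analyticAt_const)).mul analyticAt_const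

theorem affineScale_self {y₀ : ι → ℂ} {e₁ e₂ : ι} (h : y₀ e₁ ≠ y₀ e₂) :
    affineScale y₀ e₁ e₂ y₀ = 1 := div_self (sub_ne_zero.2 h.symm)

theorem pathFamily_self (G : C(Icc u v, ℂ)) {y₀ : ι → ℂ} {e₁ e₂ : ι} (h : y₀ e₁ ≠ y₀ e₂) :
    pathFamily G y₀ e₁ e₂ y₀ = G := by
  rw [pathFamily, affineScale_self h, one_smul]; abel

theorem ratioFamily_self [DecidableEq ι] {G : C(Icc u v, ℂ)} {D : ι → C(Icc u v, ℂ)}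
    {y₀ : ι → ℂ} {e₁ e₂ : ι} (h : y₀ e₁ ≠ y₀ e₂)
    (hD : ∀ k, k ≠ e₁ → k ≠ e₂ → (G - y₀ k • 1) * D k = 1) : ratioFamily G D y₀ e₁ e₂ y₀ = 1 := by
  rw [ratioFamily, pathFamily_self G h]
  refine Finset.prod_eq_one fun k hk => ?_
  rw [Finset.mem_erase, Finset.mem_erase] at hk
  exact hD k hk.2.1 hk.1

/-- The family is built from the coordinates by sums and products in a Banach algebra and by the
root `s`, which is analytic at the unit; at the base point its argument is the unit. -/
theorem analyticAt_integrandFamily [DecidableEq ι] (p n : ℕ) {s : C(Icc u v, ℂ) → C(Icc u v, ℂ)}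
    (hs : AnalyticAt ℂ s 1) {G : C(Icc u v, ℂ)} {D : ι → C(Icc u v, ℂ)} {y₀ : ι → ℂ} {e₁ e₂ : ι}
    (h : y₀ e₁ ≠ y₀ e₂) (hD : ∀ k, k ≠ e₁ → k ≠ e₂ → (G - y₀ k • 1) * D k = 1)
    (t₀ : Fin (2 * p - 1) → ℂ) :
    AnalyticAt ℂ (integrandFamily p n s G D y₀ e₁ e₂) (t₀, y₀) := by
  have hsnd : AnalyticAt ℂ (fun x : (Fin (2 * p - 1) → ℂ) × (ι → ℂ) => x.2) (t₀, y₀) :=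
    analyticAt_snd
  have h1 := AnalyticAt.fun_comp (analyticAt_affineScale y₀ e₁ e₂ y₀) hsnd
  have h2 := AnalyticAt.fun_comp (analyticAt_pathFamily G y₀ e₁ e₂ y₀) hsnd
  have h3 := AnalyticAt.fun_comp (analyticAt_ratioFamily G D y₀ e₁ e₂ y₀) hsnd
  have h4 : AnalyticAt ℂ (fun x : (Fin (2 * p - 1) → ℂ) × (ι → ℂ) =>
      s (ratioFamily G D y₀ e₁ e₂ x.2)) (t₀, y₀) :=
    AnalyticAt.fun_comp (by rwa [ratioFamily_self h hD]) h3
  exact (h1.pow 2).smul ((Finset.analyticAt_fun_sum _ fun m _ =>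
    (analyticAt_coeff_fieldSeries p m (t₀, y₀)).smul (h2.pow _)).mul h4)

/-- Of the two factors `affineScale`, one belongs to the root and one to dz. -/
theorem integrandFamily_apply [DecidableEq ι] (p n : ℕ) (s : C(Icc u v, ℂ) → C(Icc u v, ℂ))
    (G : C(Icc u v, ℂ)) (D : ι → C(Icc u v, ℂ)) (y₀ : ι → ℂ) (e₁ e₂ : ι)
    (x : (Fin (2 * p - 1) → ℂ) × (ι → ℂ)) (τ : Icc u v) :
    integrandFamily p n s G D y₀ e₁ e₂ x τ =
      (hPoly p n x.1 x.2).eval (pathFamily G y₀ e₁ e₂ x.2 τ) *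
        (affineScale y₀ e₁ e₂ x.2 * s (ratioFamily G D y₀ e₁ e₂ x.2) τ) *
          affineScale y₀ e₁ e₂ x.2 := by
  rw [integrandFamily, hPoly, polyPart, Polynomial.eval_finsetSum]
  simp only [ContinuousMap.smul_apply, ContinuousMap.mul_apply, ContinuousMap.sum_apply,
    ContinuousMap.pow_apply, smul_eq_mul, Polynomial.eval_mul, Polynomial.eval_C,
    Polynomial.eval_pow, Polynomial.eval_X]
  ring

theorem pathFamily_apply (G : C(Icc u v, ℂ)) (y₀ : ι → ℂ) (e₁ e₂ : ι) (y : ι → ℂ) (τ : Icc u v) :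
    pathFamily G y₀ e₁ e₂ y τ = y e₁ + affineScale y₀ e₁ e₂ y * (G τ - y₀ e₁) := by
  simp [pathFamily]

/-- The square of the root along the moved path. -/
theorem eval_rootPoly_pathFamily [DecidableEq ι] {G : C(Icc u v, ℂ)} {D : ι → C(Icc u v, ℂ)}
    {y₀ : ι → ℂ} {e₁ e₂ : ι} (he : e₁ ≠ e₂) (h : y₀ e₁ ≠ y₀ e₂)
    (hD : ∀ k, k ≠ e₁ → k ≠ e₂ → (G - y₀ k • 1) * D k = 1) (y : ι → ℂ) (τ : Icc u v) :
    (rootPoly y).eval (pathFamily G y₀ e₁ e₂ y τ) = (rootPoly y₀).eval (G τ) *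
      affineScale y₀ e₁ e₂ y ^ 2 * ratioFamily G D y₀ e₁ e₂ y τ := by
  have hne : y₀ e₂ - y₀ e₁ ≠ 0 := sub_ne_zero.2 h.symm
  have hmem : e₂ ∈ Finset.univ.erase e₁ := Finset.mem_erase.2 ⟨he.symm, Finset.mem_univ _⟩
  rw [eval_rootPoly, eval_rootPoly, ← Finset.mul_prod_erase _ _ (Finset.mem_univ e₁),
    ← Finset.mul_prod_erase _ _ hmem, ← Finset.mul_prod_erase _ (fun k => G τ - y₀ k) (Finset.mem_univ e₁),
    ← Finset.mul_prod_erase _ (fun k => G τ - y₀ k) hmem, ratioFamily, ContinuousMap.prod_apply]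
  have h1 : ∏ k ∈ (Finset.univ.erase e₁).erase e₂, (pathFamily G y₀ e₁ e₂ y τ - y k) =
      (∏ k ∈ (Finset.univ.erase e₁).erase e₂, (G τ - y₀ k)) *
        ∏ k ∈ (Finset.univ.erase e₁).erase e₂,
          ((pathFamily G y₀ e₁ e₂ y - y k • (1 : C(Icc u v, ℂ))) * D k) τ := by
    rw [← Finset.prod_mul_distrib]
    refine Finset.prod_congr rfl fun k hk => ?_
    rw [Finset.mem_erase, Finset.mem_erase] at hk
    have := DFunLike.congr_fun (hD k hk.2.1 hk.1) τ
    simp only [ContinuousMap.mul_apply, ContinuousMap.sub_apply, ContinuousMap.smul_apply,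
      ContinuousMap.one_apply, smul_eq_mul, mul_one] at this ⊢
    linear_combination (-(pathFamily G y₀ e₁ e₂ y τ - y k)) * this
  rw [h1]
  have h2 : pathFamily G y₀ e₁ e₂ y τ - y e₁ = affineScale y₀ e₁ e₂ y * (G τ - y₀ e₁) := by
    rw [pathFamily_apply]; ring
  have h3 : pathFamily G y₀ e₁ e₂ y τ - y e₂ = affineScale y₀ e₁ e₂ y * (G τ - y₀ e₂) := by
    rw [pathFamily_apply, affineScale]; field_simp; ring
  rw [h2, h3]
  ring

end Family

theorem IsRootPath.ne_pts {ι : Type*} [Fintype ι] {y : ι → ℂ} {u v : ℝ} {z z' S : ℝ → ℂ}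
    (H : IsRootPath y u v z z' S) {τ : ℝ} (hτ : τ ∈ Ioo u v) (k : ι) : z τ ≠ y k := fun h0 => by
  have := H.sq τ (Ioo_subset_Icc_self hτ)
  rw [h0, eval_rootPoly_self, sq_eq_zero_iff] at this
  exact H.ne_zero τ hτ this

theorem IsRootPath.eq_zero {ι : Type*} [Fintype ι] {y : ι → ℂ} {u v : ℝ} {z z' S : ℝ → ℂ}
    (H : IsRootPath y u v z z' S) {τ : ℝ} (hτ : τ ∈ Icc u v) {k : ι} (h0 : z τ = y k) : S τ = 0 := by
  have := H.sq τ hτ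
  rwa [h0, eval_rootPoly_self, sq_eq_zero_iff] at this

theorem IsRootPath.hasDerivAt_root {ι : Type*} [Fintype ι] {y : ι → ℂ} {u v : ℝ} {z z' S : ℝ → ℂ}
    (H : IsRootPath y u v z z' S) {τ : ℝ} (hτ : τ ∈ Ioo u v) (hd : HasDerivAt z (z' τ) τ) :
    HasDerivAt S ((rootPoly y).derivative.eval (z τ) * z' τ / (2 * S τ)) τ :=
  hasDerivAt_of_sq (H.continuousOn_root.continuousAt (Icc_mem_nhds hτ.1 hτ.2)) (H.ne_zero τ hτ)
    (((rootPoly y).hasDerivAt (z τ)).comp_of_eq τ hd rfl)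
    (by filter_upwards [Icc_mem_nhds hτ.1 hτ.2] with x hx using H.sq x hx)

/-- The path meets branch points only at its two ends, so for every other index the factor of
`rootPoly` along it is invertible as a continuous function. -/
theorem exists_path_inverses {ι : Type*} [Fintype ι] {y₀ : ι → ℂ} (hinj : Function.Injective y₀)
    {u v : ℝ} {γ γ' S₀ : ℝ → ℂ} (H : IsRootPath y₀ u v γ γ' S₀) {e₁ e₂ : ι} (he₁ : γ u = y₀ e₁)
    (he₂ : γ v = y₀ e₂) : ∃ (G : C(Icc u v, ℂ)) (D : ι → C(Icc u v, ℂ)), (∀ τ, G τ = γ τ) ∧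
      ∀ k, k ≠ e₁ → k ≠ e₂ → (G - y₀ k • 1) * D k = 1 := by
  classical
  set G : C(Icc u v, ℂ) := ⟨fun τ => γ τ, H.continuousOn.domRestrict⟩ with hG
  have hne : ∀ k, k ≠ e₁ → k ≠ e₂ → ∀ τ : Icc u v, γ τ - y₀ k ≠ 0 := fun k h1 h2 τ => by
    refine sub_ne_zero.2 fun h0 => ?_
    rcases τ.2.1.eq_or_lt with h3 | h3
    · rw [← h3, he₁] at h0; exact h1 (hinj h0).symm
    rcases τ.2.2.eq_or_lt with h4 | h4
    · rw [h4, he₂] at h0; exact h2 (hinj h0).symm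
    exact H.ne_pts ⟨h3, h4⟩ k h0
  have hex : ∀ k, ∃ D : C(Icc u v, ℂ), k ≠ e₁ → k ≠ e₂ → (G - y₀ k • 1) * D = 1 := fun k => by
    by_cases hk : k ≠ e₁ ∧ k ≠ e₂
    · refine ⟨⟨fun τ => (γ τ - y₀ k)⁻¹, (H.continuousOn.domRestrict.sub continuous_const).inv₀
        (hne k hk.1 hk.2)⟩, fun _ _ => ?_⟩
      ext τ
      have := mul_inv_cancel₀ (hne k hk.1 hk.2 τ)
      simp only [ContinuousMap.mul_apply, ContinuousMap.sub_apply, ContinuousMap.smul_apply,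
        ContinuousMap.one_apply, smul_eq_mul, mul_one]
      exact this
    · exact ⟨0, fun h1 h2 => absurd ⟨h1, h2⟩ hk⟩
  choose D hD using hex
  exact ⟨G, D, fun τ => rfl, hD⟩

/-- The first variation of an integral of `h R^{1/2}` between two branch points. -/
theorem integral_variation {ι : Type*} [Fintype ι] {y₀ : ι → ℂ} {u v : ℝ} (huv : u < v)
    {γ γ' S₀ : ℝ → ℂ} (H : IsRootPath y₀ u v γ γ' S₀) {e₁ e₂ : ι} (he₁ : γ u = y₀ e₁)
    (he₂ : γ v = y₀ e₂) {h P w k : ℂ[X]} {δ : ℂ[X]} {N : ℝ → ℂ} (hN : ContinuousOn N (Icc u v))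
    (hP : P = w.derivative * rootPoly y₀ + Polynomial.C (1 / 2) * w * (rootPoly y₀).derivative +
      k * rootPoly y₀ ^ 2)
    (hNP : ∀ τ ∈ Ioo u v, N τ * S₀ τ ^ 2 = P.eval (γ τ) +
      (h.derivative * δ * rootPoly y₀ + Polynomial.C (1 / 2) * h * δ * (rootPoly y₀).derivative +
        h * δ.derivative * rootPoly y₀).eval (γ τ)) :
    ∫ τ in u..v, N τ * (S₀ τ * γ' τ) = ∫ τ in u..v, k.eval (γ τ) * S₀ τ ^ 3 * γ' τ := by
  obtain ⟨Z, hZ, hd⟩ := H.hasDerivAt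
  have i1 : IntervalIntegrable (fun τ => N τ * (S₀ τ * γ' τ)) MeasureTheory.volume u v := by
    have := H.integrable.continuousOn_mul (g := fun τ => N τ * S₀ τ)
      (by rw [uIcc_of_le huv.le]; exact hN.mul H.continuousOn_root)
    simpa only [mul_assoc] using this
  have i2 : IntervalIntegrable (fun τ => k.eval (γ τ) * S₀ τ ^ 3 * γ' τ) MeasureTheory.volume u v :=
    H.integrable.continuousOn_mul (by
      rw [uIcc_of_le huv.le]
      exact (k.continuous.comp_continuousOn H.continuousOn).mul (H.continuousOn_root.pow 3))
  -- The reduction contributes the exact part `w` times the root, the motion of the path contributes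
  -- `h * δ` times the root. Both vanish at the ends, where the root is zero.
  have key := MeasureTheory.integral_eq_of_hasDerivAt_off_countable_of_le
    (fun τ => (w + h * δ).eval (γ τ) * S₀ τ)
    (fun τ => N τ * (S₀ τ * γ' τ) - k.eval (γ τ) * S₀ τ ^ 3 * γ' τ) huv.le hZ
    (((w + h * δ).continuous.comp_continuousOn H.continuousOn).mul H.continuousOn_root)
    (fun τ hτ => by
      have h1 := ((w + h * δ).hasDerivAt (γ τ)).comp_of_eq τ (hd τ hτ) rfl
      have h2 := h1.mul (H.hasDerivAt_root hτ.1 (hd τ hτ))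
      refine h2.congr_deriv ?_
      have h0 := H.ne_zero τ hτ.1
      have hsq := H.sq τ (Ioo_subset_Icc_self hτ.1)
      have h3 := hNP τ hτ.1
      rw [hP] at h3
      have h4 : (w + h * δ).derivative = w.derivative + (h.derivative * δ + h * δ.derivative) := by
        rw [Polynomial.derivative_add, Polynomial.derivative_mul]
      rw [h4]
      simp only [Function.comp, Polynomial.eval_add, Polynomial.eval_mul, Polynomial.eval_C,
        Polynomial.eval_pow, ← hsq] at h3 ⊢
      field_simp
      linear_combination (-2 * γ' τ) * h3) (i1.sub i2)
  rw [intervalIntegral.integral_sub i1 i2, H.eq_zero (left_mem_Icc.2 huv.le) he₁,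
    H.eq_zero (right_mem_Icc.2 huv.le) he₂, mul_zero, mul_zero, sub_zero] at key
  exact sub_eq_zero.1 key

/-- The integral of `h R^{1/2}` between two branch points as an analytic function of the parameters
and of the branch points. -/
theorem exists_reference_integral {ι : Type*} [Fintype ι] (p n : ℕ) (t₀ : Fin (2 * p - 1) → ℂ)
    {y₀ : ι → ℂ} (hinj : Function.Injective y₀) {u v : ℝ} (huv : u < v) {γ γ' S₀ : ℝ → ℂ}
    (H : IsRootPath y₀ u v γ γ' S₀) {e₁ e₂ : ι} (he₁ : γ u = y₀ e₁) (he₂ : γ v = y₀ e₂)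
    (he : e₁ ≠ e₂) (hι : Fintype.card ι = 2 * n + 2) :
    ∃ I : (Fin (2 * p - 1) → ℂ) × (ι → ℂ) → ℂ, AnalyticAt ℂ I (t₀, y₀) ∧
      (∀ δ > 0, ∀ᶠ x in 𝓝 (t₀, y₀), ∃ z z' S, IsRootPath x.2 u v z z' S ∧
        (∀ τ ∈ Icc u v, ‖z τ - γ τ‖ < δ) ∧ z u = x.2 e₁ ∧ z v = x.2 e₂ ∧
        I x = ∫ τ in u..v, (hPoly p n x.1 x.2).eval (z τ) * S τ * z' τ) ∧
      ∀ (d : ι → ℂ) (f r : PowerSeries ℂ),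
        HasCoeffDerivAt (fun s => fieldSeries p t₀ (y₀ + s • d)) f 0 →
        HasCoeffDerivAt (fun s => (revRootPoly (y₀ + s • d) : PowerSeries ℂ)) r 0 → ∀ w k : ℂ[X],
        polyPart (2 * p - 1 - (n + 1)) f * rootPoly y₀ +
            Polynomial.C (1 / 2) * hPoly p n t₀ y₀ * polyPart (2 * n + 2) r =
          w.derivative * rootPoly y₀ + Polynomial.C (1 / 2) * w * (rootPoly y₀).derivative +
            k * rootPoly y₀ ^ 2 →
        HasDerivAt (fun s : ℂ => I (t₀, y₀ + s • d))
          (∫ τ in u..v, k.eval (γ τ) * S₀ τ ^ 3 * γ' τ) 0 := by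
  classical
  have hy : y₀ e₁ ≠ y₀ e₂ := fun h0 => he (hinj h0)
  obtain ⟨G, D, hG, hD⟩ := exists_path_inverses hinj H he₁ he₂
  obtain ⟨s, hsan, hs1, hsq⟩ := exists_analytic_root C(Icc u v, ℂ)
  have hm : IntervalIntegrable (fun τ => S₀ τ * γ' τ) MeasureTheory.volume u v :=
    H.integrable.continuousOn_mul (by rw [uIcc_of_le huv.le]; exact H.continuousOn_root)
  obtain ⟨L, hL⟩ := exists_integral_clm huv.le hm
  have hFan := analyticAt_integrandFamily p n hsan hy hD t₀
  have hratc : ContinuousAt (ratioFamily G D y₀ e₁ e₂) y₀ :=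
    (analyticAt_ratioFamily G D y₀ e₁ e₂ y₀).continuousAt
  have hrat1 := ratioFamily_self hy hD
  refine ⟨fun x => L (integrandFamily p n s G D y₀ e₁ e₂ x),
    (L.analyticAt _).comp_of_eq hFan rfl, ?_, ?_⟩
  · intro δ hδ
    have c2 : ContinuousAt (fun x : (Fin (2 * p - 1) → ℂ) × (ι → ℂ) => x.2) (t₀, y₀) :=
      continuousAt_snd
    have e1 : ∀ᶠ y in 𝓝 y₀, s (ratioFamily G D y₀ e₁ e₂ y) ^ 2 = ratioFamily G D y₀ e₁ e₂ y :=
      hratc.eventually (by rwa [hrat1])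
    have e2 : ∀ᶠ y in 𝓝 y₀, ratioFamily G D y₀ e₁ e₂ y ∈ Metric.ball 1 1 :=
      hratc.eventually (by rw [hrat1]; exact Metric.ball_mem_nhds 1 one_pos)
    have e3 : ∀ᶠ y in 𝓝 y₀, affineScale y₀ e₁ e₂ y ≠ 0 :=
      (analyticAt_affineScale y₀ e₁ e₂ y₀).continuousAt.eventually_ne (by
        rw [affineScale_self hy]; exact one_ne_zero)
    have e4 : ∀ᶠ y in 𝓝 y₀, pathFamily G y₀ e₁ e₂ y ∈ Metric.ball G δ :=
      (analyticAt_pathFamily G y₀ e₁ e₂ y₀).continuousAt.eventually (by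
        rw [pathFamily_self G hy]; exact Metric.ball_mem_nhds G hδ)
    filter_upwards [c2.eventually (((e1.and e2).and e3).and e4)] with x hx
    obtain ⟨⟨⟨h1, h2⟩, h3⟩, h4⟩ := hx
    set μ := affineScale y₀ e₁ e₂ x.2 with hμ
    have hproj : ∀ τ (hτ : τ ∈ Icc u v), projIcc u v huv.le τ = ⟨τ, hτ⟩ := fun τ hτ =>
      projIcc_of_mem _ hτ
    have hz : ∀ τ (hτ : τ ∈ Icc u v), x.2 e₁ + μ * (γ τ - y₀ e₁) =
        pathFamily G y₀ e₁ e₂ x.2 ⟨τ, hτ⟩ := fun τ hτ => by rw [pathFamily_apply, hG]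
    have hsqτ : ∀ τ : Icc u v, s (ratioFamily G D y₀ e₁ e₂ x.2) τ ^ 2 =
        ratioFamily G D y₀ e₁ e₂ x.2 τ := fun τ => by
      have := DFunLike.congr_fun h1 τ
      rwa [ContinuousMap.pow_apply] at this
    -- Along the moved path R is its old value times the square of the scale times the ratio, so the
    -- old root is multiplied by the scale and by a root of the ratio. The ratio is within distance
    -- 1 of the unit and hence has no zero.
    refine ⟨fun τ => x.2 e₁ + μ * (γ τ - y₀ e₁), fun τ => μ * γ' τ,
      fun τ => S₀ τ * (μ * s (ratioFamily G D y₀ e₁ e₂ x.2) (projIcc u v huv.le τ)), ?_, ?_, ?_, ?_,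
      ?_⟩
    · obtain ⟨Z, hZ, hd⟩ := H.hasDerivAt
      refine ⟨continuousOn_const.add (continuousOn_const.mul (H.continuousOn.sub continuousOn_const)),
        H.continuousOn_root.mul (continuousOn_const.mul
          ((ContinuousMap.continuous _).comp continuous_projIcc).continuousOn), fun τ hτ => ?_,
        fun τ hτ => ?_, ⟨Z, hZ, fun τ hτ => ?_⟩, H.integrable.const_mul _⟩
      · rw [hz τ hτ, eval_rootPoly_pathFamily he hy hD, hproj τ hτ, ← hsqτ, hG, ← H.sq τ hτ]
        ring
      · refine mul_ne_zero (H.ne_zero τ hτ) (mul_ne_zero h3 fun h0 => ?_)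
        have h5 := hsqτ (projIcc u v huv.le τ)
        rw [h0, zero_pow two_ne_zero] at h5
        rw [Metric.mem_ball, dist_eq_norm] at h2
        have h6 := (ContinuousMap.norm_coe_le_norm (ratioFamily G D y₀ e₁ e₂ x.2 - 1)
          (projIcc u v huv.le τ)).trans_lt h2
        rw [ContinuousMap.sub_apply, ← h5] at h6
        simp at h6
      · exact (((hd τ hτ).sub_const _).const_mul μ).const_add _
    · intro τ hτ
      simp only
      rw [hz τ hτ, ← hG ⟨τ, hτ⟩]
      rw [Metric.mem_ball, dist_eq_norm] at h4
      exact (ContinuousMap.norm_coe_le_norm (pathFamily G y₀ e₁ e₂ x.2 - G) ⟨τ, hτ⟩).trans_lt h4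
    · simp only [he₁]; ring
    · have : y₀ e₂ - y₀ e₁ ≠ 0 := sub_ne_zero.2 hy.symm
      simp only [he₂, hμ, affineScale]; field_simp; ring
    · simp only [hL]
      refine intervalIntegral.integral_congr fun τ hτ => ?_
      rw [uIcc_of_le huv.le] at hτ
      rw [integrandFamily_apply, hproj τ hτ, ← hz τ hτ]
      ring
  · intro d f r hf hr w k hP
    have hline : HasDerivAt (fun s : ℂ => y₀ + s • d) d 0 := by
      simpa using ((hasDerivAt_id (0 : ℂ)).smul_const d).const_add y₀
    have hl0 : y₀ + (0 : ℂ) • d = y₀ := by rw [zero_smul, add_zero]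
    have hx0 : ((t₀, y₀ + (0 : ℂ) • d) : (Fin (2 * p - 1) → ℂ) × (ι → ℂ)) = (t₀, y₀) := by rw [hl0]
    have hF : HasDerivAt (fun s' : ℂ => integrandFamily p n s G D y₀ e₁ e₂ (t₀, y₀ + s' • d))
        (deriv (fun s' : ℂ => integrandFamily p n s G D y₀ e₁ e₂ (t₀, y₀ + s' • d)) 0) 0 := by
      refine DifferentiableAt.hasDerivAt ?_
      have h1 : DifferentiableAt ℂ (fun s : ℂ => ((t₀, y₀ + s • d) :
        (Fin (2 * p - 1) → ℂ) × (ι → ℂ))) 0 := (differentiableAt_const t₀).prodMk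
          hline.differentiableAt
      exact DifferentiableAt.comp (g := integrandFamily p n s G D y₀ e₁ e₂) (0 : ℂ)
        (by rw [hx0]; exact hFan.differentiableAt) h1
    set N := deriv (fun s' : ℂ => integrandFamily p n s G D y₀ e₁ e₂ (t₀, y₀ + s' • d)) 0
    have hLF := L.hasFDerivAt.comp_hasDerivAt (0 : ℂ) hF
    refine hLF.congr_deriv ?_
    rw [hL]
    have hμ0 := affineScale_self hy
    have hμd : HasDerivAt (fun s : ℂ => affineScale y₀ e₁ e₂ (y₀ + s • d))
        (affineScale y₀ e₁ e₂ d) 0 := by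
      have h1 : ∀ k, HasDerivAt (fun s : ℂ => (y₀ + s • d) k) (d k) 0 := fun k => hasDerivAt_pi.1 hline k
      exact ((h1 e₂).sub (h1 e₁)).div_const _
    set μ' := affineScale y₀ e₁ e₂ d
    -- The velocity of the affine motion, as a polynomial in the position.
    set δ : ℂ[X] := Polynomial.C (d e₁) + Polynomial.C μ' * (Polynomial.X - Polynomial.C (y₀ e₁))
      with hδ
    refine integral_variation huv H he₁ he₂ (h := hPoly p n t₀ y₀) (δ := δ)
      ((ContinuousMap.continuous N).comp continuous_projIcc).continuousOn hP fun τ hτ => ?_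
    have hτI := Ioo_subset_Icc_self hτ
    set τ' : Icc u v := projIcc u v huv.le τ with hτ'
    have hττ : τ' = ⟨τ, hτI⟩ := projIcc_of_mem _ hτI
    have hGτ : G τ' = γ τ := by rw [hττ, hG]
    have hNτ := (ContinuousMap.evalCLM ℂ τ').hasFDerivAt.comp_hasDerivAt (0 : ℂ) hF
    change HasDerivAt (fun s' : ℂ => integrandFamily p n s G D y₀ e₁ e₂ (t₀, y₀ + s' • d) τ')
      (N τ') 0 at hNτ
    simp only [integrandFamily_apply] at hNτ
    have hzd : HasDerivAt (fun s : ℂ => pathFamily G y₀ e₁ e₂ (y₀ + s • d) τ') (δ.eval (γ τ)) 0 := by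
      simp only [pathFamily_apply, hGτ]
      refine ((hasDerivAt_pi.1 hline e₁).add (hμd.mul_const _)).congr_deriv ?_
      simp [hδ]
    have hz0 : pathFamily G y₀ e₁ e₂ (y₀ + (0 : ℂ) • d) τ' = γ τ := by
      rw [hl0, pathFamily_self G hy, hGτ]
    have hTd : DifferentiableAt ℂ (fun s' : ℂ => affineScale y₀ e₁ e₂ (y₀ + s' • d) *
        s (ratioFamily G D y₀ e₁ e₂ (y₀ + s' • d)) τ') 0 := by
      have h1 : DifferentiableAt ℂ (ratioFamily G D y₀ e₁ e₂) (y₀ + (0 : ℂ) • d) :=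
        (analyticAt_ratioFamily G D y₀ e₁ e₂ _).differentiableAt
      have h2 : DifferentiableAt ℂ (fun s' : ℂ => ratioFamily G D y₀ e₁ e₂ (y₀ + s' • d)) 0 :=
        DifferentiableAt.comp (g := ratioFamily G D y₀ e₁ e₂) (0 : ℂ) h1 hline.differentiableAt
      have h3 : DifferentiableAt ℂ (fun s' : ℂ => s (ratioFamily G D y₀ e₁ e₂ (y₀ + s' • d))) 0 :=
        DifferentiableAt.comp (g := s) (0 : ℂ) (by rw [hl0, hrat1]; exact hsan.differentiableAt) h2
      have h4 := ((ContinuousMap.evalCLM ℂ τ').hasFDerivAt.comp_hasDerivAt (0 : ℂ)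
        h3.hasDerivAt).differentiableAt
      exact hμd.differentiableAt.mul h4
    have hT0 : affineScale y₀ e₁ e₂ (y₀ + (0 : ℂ) • d) *
        s (ratioFamily G D y₀ e₁ e₂ (y₀ + (0 : ℂ) • d)) τ' = 1 := by
      rw [hl0, hμ0, hrat1, hs1, one_mul, ContinuousMap.one_apply]
    obtain ⟨T', hT'⟩ : ∃ T', HasDerivAt (fun s' : ℂ => affineScale y₀ e₁ e₂ (y₀ + s' • d) *
        s (ratioFamily G D y₀ e₁ e₂ (y₀ + s' • d)) τ') T' 0 := ⟨_, hTd.hasDerivAt⟩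
    have hRd : HasDerivAt (fun s : ℂ => (rootPoly (y₀ + s • d)).eval
        (pathFamily G y₀ e₁ e₂ (y₀ + s • d) τ'))
        ((polyPart (2 * n + 2) r).eval (γ τ) + (rootPoly y₀).derivative.eval (γ τ) * δ.eval (γ τ)) 0 := by
      have := hasDerivAt_polyPart hr (2 * n + 2) hzd
      rw [hz0] at this
      simp only [hl0] at this
      simpa only [polyPart_revRootPoly, hι] using this
    -- Differentiating R along the moving path in two ways determines the derivative of the root
    -- factor, without differentiating the root `s` explicitly.
    have hrel : ∀ᶠ s' in 𝓝 (0 : ℂ), (rootPoly (y₀ + s' • d)).eval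
        (pathFamily G y₀ e₁ e₂ (y₀ + s' • d) τ') = S₀ τ ^ 2 * (affineScale y₀ e₁ e₂ (y₀ + s' • d) *
        s (ratioFamily G D y₀ e₁ e₂ (y₀ + s' • d)) τ') ^ 2 := by
      have hc : ContinuousAt (fun s' : ℂ => ratioFamily G D y₀ e₁ e₂ (y₀ + s' • d)) 0 :=
        ContinuousAt.comp (g := ratioFamily G D y₀ e₁ e₂) (by rwa [hl0]) hline.continuousAt
      filter_upwards [hc.eventually (p := fun g => s g ^ 2 = g) (by simpa only [hl0, hrat1] using hsq)]
        with s' hs'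
      have h1 := DFunLike.congr_fun hs' τ'
      rw [ContinuousMap.pow_apply] at h1
      rw [eval_rootPoly_pathFamily he hy hD, ← h1, hGτ, ← H.sq τ hτI]
      ring
    have hR2 := ((hT'.fun_pow 2).const_mul (S₀ τ ^ 2)).congr_of_eventuallyEq hrel
    have e1 := hRd.unique hR2
    rw [hT0] at e1
    have hhd := hasDerivAt_polyPart hf (2 * p - 1 - (n + 1)) hzd
    rw [hz0] at hhd
    simp only [hl0] at hhd
    have e2 := hNτ.unique ((hhd.fun_mul hT').fun_mul hμd)
    rw [hT0, hz0] at e2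
    simp only [hl0, hμ0] at e2
    have hδ' : δ.derivative = Polynomial.C μ' := by simp [hδ]
    rw [e2, hδ']
    simp only [Polynomial.eval_add, Polynomial.eval_mul, Polynomial.eval_C, ← H.sq τ hτI]
    rw [← hPoly]
    linear_combination (-(1 / 2) * (hPoly p n t₀ y₀).eval (γ τ)) * e1

/-! ### The endpoint equations in terms of root paths and coefficients. -/

namespace CutContour

variable {p n : ℕ}

theorem Γ_mem_J_iff (C : CutContour p n) {τ : ℝ} :
    C.Γ τ ∈ C.J ↔ ∃ j, τ ∈ Icc (C.α j) (C.β j) := by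
  simp only [J, mem_iUnion, Γ_mem_cut_iff]

theorem Γ_notMem_J_of_mem_gap (C : CutContour p n) {j : Fin n} {τ : ℝ}
    (hτ : τ ∈ Ioo (C.β j.castSucc) (C.α j.succ)) : C.Γ τ ∉ C.J := by
  rw [Γ_mem_J_iff]
  rintro ⟨i, h1, h2⟩
  rcases le_or_gt i j.castSucc with h | h
  · linarith [C.strictMono_β.monotone h, hτ.1]
  · linarith [C.strictMono_α.monotone (Fin.castSucc_lt_iff_succ_le.1 h), hτ.2]

/-- Induction on the finitely many break points; on an interval without break points the derivative
extends continuously to the ends. -/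
theorem intervalIntegrable_deriv (C : CutContour p n) {x y : ℝ} (hxy : x < y) :
    IntervalIntegrable (deriv C.Γ) MeasureTheory.volume x y := by
  obtain ⟨P, hP, hC⟩ := C.piecewise_C1
  suffices H : ∀ (s : Finset ℝ) (x y : ℝ), x < y → P ∩ Ioo x y ⊆ s →
      IntervalIntegrable (deriv C.Γ) MeasureTheory.volume x y from
    H hP.toFinset x y hxy (by simp)
  intro s
  induction s using Finset.induction_on with
  | empty =>
    intro x y hxy hs
    have hd : Disjoint (Ioo x y) P := by
      rw [disjoint_comm, disjoint_iff_inter_eq_empty]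
      simpa using hs
    have h1 : IntervalIntegrable (derivWithin C.Γ (Icc x y)) MeasureTheory.volume x y := by
      apply ContinuousOn.intervalIntegrable
      rw [uIcc_of_le hxy.le]
      exact (hC x y hxy hd).1.continuousOn_derivWithin (uniqueDiffOn_Icc hxy) le_rfl
    rw [intervalIntegrable_iff_integrableOn_Ioo_of_le hxy.le] at h1 ⊢
    exact h1.congr_fun (fun τ hτ => derivWithin_of_mem_nhds (Icc_mem_nhds hτ.1 hτ.2))
      measurableSet_Ioo
  | insert a s _ ih =>
    intro x y hxy hs
    by_cases ha : a ∈ Ioo x y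
    · refine (ih x a ha.1 fun τ hτ => ?_).trans (ih a y ha.2 fun τ hτ => ?_)
      · have := hs ⟨hτ.1, hτ.2.1, hτ.2.2.trans ha.2⟩
        rw [Finset.coe_insert] at this
        exact this.resolve_left hτ.2.2.ne
      · have := hs ⟨hτ.1, ha.1.trans hτ.2.1, hτ.2.2⟩
        rw [Finset.coe_insert] at this
        exact this.resolve_left hτ.2.1.ne'
    · refine ih x y hxy fun τ hτ => ?_
      have := hs hτ
      rw [Finset.coe_insert] at this
      exact this.resolve_left fun h => ha (h ▸ hτ.2)

theorem exists_countable_hasDerivAt (C : CutContour p n) :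
    ∃ P : Set ℝ, P.Finite ∧ ∀ τ ∉ P, HasDerivAt C.Γ (deriv C.Γ τ) τ := by
  obtain ⟨P, hP, hC⟩ := C.piecewise_C1
  refine ⟨P, hP, fun τ hτ => ?_⟩
  obtain ⟨r, hr, hball⟩ := Metric.isOpen_iff.1 hP.isClosed.isOpen_compl τ hτ
  rw [Real.ball_eq_Ioo] at hball
  have h1 := (hC (τ - r) (τ + r) (by linarith) (disjoint_left.2 fun _ h => hball h)).1
  exact ((h1.differentiableOn one_ne_zero τ ⟨by linarith, by linarith⟩).differentiableAt
    (Icc_mem_nhds (by linarith) (by linarith))).hasDerivAt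

theorem isRootPath_cut (C : CutContour p n) (j : Fin (n + 1)) :
    IsRootPath C.pts (C.α j) (C.β j) C.Γ (deriv C.Γ) (C.cutRoot j) where
  continuousOn := C.continuous.continuousOn
  continuousOn_root := C.continuousOn_cutRoot j
  sq _ hτ := C.cutRoot_sq hτ
  ne_zero τ hτ := by rw [cutRoot_of_mem C hτ]; exact C.sqrtRPlus_ne_zero hτ
  hasDerivAt := ⟨∅, countable_empty, fun _ hτ => C.hasDerivAt_cut hτ.1⟩
  integrable := C.intervalIntegrable_deriv_cut j

open Classical in
/-- The branch `sqrtR` along the `j`-th gap, extended by zero. -/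
noncomputable def gapRoot (C : CutContour p n) (j : Fin n) (τ : ℝ) : ℂ :=
  if τ ∈ Ioo (C.β j.castSucc) (C.α j.succ) then C.sqrtR (C.Γ τ) else 0

theorem gapRoot_of_mem (C : CutContour p n) {j : Fin n} {τ : ℝ}
    (hτ : τ ∈ Ioo (C.β j.castSucc) (C.α j.succ)) : C.gapRoot j τ = C.sqrtR (C.Γ τ) := if_pos hτ

theorem gapRoot_β (C : CutContour p n) (j : Fin n) : C.gapRoot j (C.β j.castSucc) = 0 :=
  if_neg (by simp)

theorem gapRoot_α (C : CutContour p n) (j : Fin n) : C.gapRoot j (C.α j.succ) = 0 :=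
  if_neg (by simp)

theorem gapRoot_sq (C : CutContour p n) {j : Fin n} {τ : ℝ}
    (hτ : τ ∈ Icc (C.β j.castSucc) (C.α j.succ)) :
    C.gapRoot j τ ^ 2 = (rootPoly C.pts).eval (C.Γ τ) := by
  rcases eq_endpoints_or_mem_Ioo_of_mem_Icc hτ with rfl | rfl | h
  · rw [gapRoot_β, zero_pow two_ne_zero]
    exact (eval_rootPoly_self C.pts (Sum.inr j.castSucc)).symm
  · rw [gapRoot_α, zero_pow two_ne_zero]
    exact (eval_rootPoly_self C.pts (Sum.inl j.succ)).symm
  · rw [gapRoot_of_mem C h, C.sqrtR_sq (C.Γ_notMem_J_of_mem_gap h), R_eq]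

theorem continuousOn_gapRoot (C : CutContour p n) (j : Fin n) :
    ContinuousOn (C.gapRoot j) (Icc (C.β j.castSucc) (C.α j.succ)) := by
  intro τ hτ
  have hg : ContinuousWithinAt (fun x => (rootPoly C.pts).eval (C.Γ x))
      (Icc (C.β j.castSucc) (C.α j.succ)) τ :=
    ((rootPoly C.pts).continuous.comp C.continuous).continuousWithinAt
  rcases eq_endpoints_or_mem_Ioo_of_mem_Icc hτ with rfl | rfl | h
  · exact continuousWithinAt_of_sq hτ hg (fun x hx => C.gapRoot_sq hx) (C.gapRoot_β j)
  · exact continuousWithinAt_of_sq hτ hg (fun x hx => C.gapRoot_sq hx) (C.gapRoot_α j)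
  · refine ContinuousAt.continuousWithinAt (ContinuousAt.congr (f := fun x => C.sqrtR (C.Γ x)) ?_ ?_)
    · exact ContinuousAt.comp (g := C.sqrtR)
        (C.differentiableAt_sqrtR (C.Γ_notMem_J_of_mem_gap h)).continuousAt C.continuous.continuousAt
    · filter_upwards [Ioo_mem_nhds h.1 h.2] with x hx
      exact (C.gapRoot_of_mem hx).symm

theorem isRootPath_gap (C : CutContour p n) (j : Fin n) :
    IsRootPath C.pts (C.β j.castSucc) (C.α j.succ) C.Γ (deriv C.Γ) (C.gapRoot j) where
  continuousOn := C.continuous.continuousOn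
  continuousOn_root := C.continuousOn_gapRoot j
  sq _ hτ := C.gapRoot_sq hτ
  ne_zero τ hτ := by
    rw [gapRoot_of_mem C hτ]; exact C.sqrtR_ne_zero (C.Γ_notMem_J_of_mem_gap hτ)
  hasDerivAt := by
    obtain ⟨P, hP, h⟩ := C.exists_countable_hasDerivAt
    exact ⟨P, hP.countable, fun _ hτ => h _ hτ.2⟩
  integrable := C.intervalIntegrable_deriv (C.β_lt_α j)

theorem ne_pts_of_mem_gap (C : CutContour p n) {j : Fin n} {τ : ℝ}
    (hτ : τ ∈ Ioo (C.β j.castSucc) (C.α j.succ)) (k : Fin (n + 1) ⊕ Fin (n + 1)) :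
    C.Γ τ ≠ C.pts k := C.ne_pts_of_notMem_J (C.Γ_notMem_J_of_mem_gap hτ) k

/-- Extending the roots by zero at the ends does not affect the integrals, and turns cuts and gaps
alike into root paths. -/
theorem endpointMap_eq_zero_iff (C : CutContour p n) (hp : 1 ≤ p) (hn : n + 1 ≤ 2 * p - 1)
    (t : Fin (2 * p - 1) → ℂ) :
    C.endpointMap t = 0 ↔
      (∀ l ≤ n + 1, PowerSeries.coeff (2 * p - 1 - n + l) (fieldSeries p t C.pts) =
        if l = n + 1 then 2 else 0) ∧
      ∀ j : Fin n, (∫ τ in (C.α j.castSucc)..(C.β j.castSucc),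
          (hPoly p n t C.pts).eval (C.Γ τ) * C.cutRoot j.castSucc τ * deriv C.Γ τ).re = 0 ∧
        (∫ τ in (C.β j.castSucc)..(C.α j.succ),
          (hPoly p n t C.pts).eval (C.Γ τ) * C.gapRoot j τ * deriv C.Γ τ).re = 0 := by
  have hcut : ∀ j : Fin (n + 1), (∫ τ in (C.α j)..(C.β j),
      C.h t (C.Γ τ) * C.sqrtRPlus τ * deriv C.Γ τ) = ∫ τ in (C.α j)..(C.β j),
      (hPoly p n t C.pts).eval (C.Γ τ) * C.cutRoot j τ * deriv C.Γ τ := by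
    intro j
    rw [intervalIntegral.integral_of_le (C.α_lt_β j).le,
      intervalIntegral.integral_of_le (C.α_lt_β j).le, MeasureTheory.integral_Ioc_eq_integral_Ioo,
      MeasureTheory.integral_Ioc_eq_integral_Ioo]
    refine MeasureTheory.setIntegral_congr_fun measurableSet_Ioo fun τ hτ => ?_
    simp only [C.h_eq hp hn, C.cutRoot_of_mem hτ]
  have hgap : ∀ j : Fin n, (∫ τ in (C.β j.castSucc)..(C.α j.succ),
      C.h t (C.Γ τ) * C.sqrtR (C.Γ τ) * deriv C.Γ τ) = ∫ τ in (C.β j.castSucc)..(C.α j.succ),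
      (hPoly p n t C.pts).eval (C.Γ τ) * C.gapRoot j τ * deriv C.Γ τ := by
    intro j
    rw [intervalIntegral.integral_of_le (C.β_lt_α j).le,
      intervalIntegral.integral_of_le (C.β_lt_α j).le, MeasureTheory.integral_Ioc_eq_integral_Ioo,
      MeasureTheory.integral_Ioc_eq_integral_Ioo]
    refine MeasureTheory.setIntegral_congr_fun measurableSet_Ioo fun τ hτ => ?_
    simp only [C.h_eq hp hn, C.gapRoot_of_mem hτ]
  -- Because of the factor -πi, the value -2πi of the last moment means a coefficient 2.
  have hm : ∀ l : ℕ, (C.moment t l + if l = n + 1 then 2 * Real.pi * Complex.I else 0) = 0 ↔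
      PowerSeries.coeff (2 * p - 1 - n + l) (fieldSeries p t C.pts) =
        if l = n + 1 then 2 else 0 := by
    intro l
    have hπ : (Real.pi : ℂ) * Complex.I ≠ 0 :=
      mul_ne_zero (by exact_mod_cast Real.pi_ne_zero) Complex.I_ne_zero
    rw [C.moment_eq_coeff hp hn]
    split_ifs
    · constructor
      · intro h
        refine mul_left_cancel₀ hπ ?_
        linear_combination -h
      · intro h
        rw [h]; ring
    · rw [add_zero, mul_eq_zero, neg_eq_zero, or_iff_right hπ]
  simp only [endpointMap, Prod.mk_eq_zero, hcut, hgap, funext_iff, hm, Pi.zero_apply, forall_and]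
  refine and_congr_left' ⟨fun h l hl => h ⟨l, by omega⟩, fun h l => h l (by omega)⟩

/-- With too many cuts h would vanish identically, in particular on the cuts. -/
theorem le_of_h_ne_zero (C : CutContour p n) (hp : 1 ≤ p) {t : Fin (2 * p - 1) → ℂ}
    (h : ∀ z ∈ C.J, C.h t z ≠ 0) : n + 1 ≤ 2 * p - 1 := by
  by_contra! hn
  exact h _ (C.pts_mem_J (Sum.inl 0)) (C.h_eq_zero hp t hn _)

end CutContour

/-! ### A maximum principle on the Riemann sphere. -/

/-- The differential of `u` at `z` is that of the real part of a function with derivative `c`. -/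
def HasReDeriv (u : ℂ → ℝ) (c z : ℂ) : Prop :=
  HasFDerivAt u (Complex.reCLM.comp ((ContinuousLinearMap.toSpanSingleton ℂ c).restrictScalars ℝ)) z

theorem HasDerivAt.hasReDeriv {H : ℂ → ℂ} {c z : ℂ} (h : HasDerivAt H c z) :
    HasReDeriv (fun w => (H w).re) c z :=
  HasFDerivAt.comp (g := Complex.re) z Complex.reCLM.hasFDerivAt (h.hasFDerivAt.restrictScalars ℝ)

theorem HasReDeriv.neg {u : ℂ → ℝ} {c z : ℂ} (h : HasReDeriv u c z) :
    HasReDeriv (fun w => -u w) (-c) z := by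
  refine (HasFDerivAt.fun_neg h).congr_fderiv ?_
  ext v; simp

theorem HasReDeriv.continuousAt {u : ℂ → ℝ} {c z : ℂ} (h : HasReDeriv u c z) :
    ContinuousAt u z := HasFDerivAt.continuousAt h

theorem HasReDeriv.comp {u : ℂ → ℝ} {c z : ℂ} (h : HasReDeriv u c z) {γ : ℝ → ℂ} {γ' : ℂ} {τ : ℝ}
    (hγ : HasDerivAt γ γ' τ) (hz : γ τ = z) : HasDerivAt (fun τ => u (γ τ)) (c * γ').re τ := by
  subst hz
  have := HasFDerivAt.comp_hasDerivAt τ h hγ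
  refine this.congr_deriv ?_
  simp [mul_comm]

theorem IsPreconnected.sub_eq_of_hasReDeriv {N : Set ℂ} (hN : IsPreconnected N) {u v : ℂ → ℝ}
    (h : ∀ z ∈ N, ∀ᶠ w in 𝓝 z, ∃ c, HasReDeriv u c w ∧ HasReDeriv v c w) {x y : ℂ} (hx : x ∈ N)
    (hy : y ∈ N) : u x - v x = u y - v y := by
  refine hN.induction₂' (fun x y => u x - v x = u y - v y) (fun z hz => ?_)
    (fun _ _ _ _ _ _ h1 h2 => h1.trans h2) hx hy
  obtain ⟨r, hr, hball⟩ := Metric.eventually_nhds_iff_ball.1 (h z hz)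
  refine nhdsWithin_le_nhds ?_
  filter_upwards [Metric.ball_mem_nhds z hr] with w hw
  have hd : ∀ x ∈ Metric.ball z r, HasFDerivAt (fun x => u x - v x) (0 : ℂ →L[ℝ] ℝ) x := by
    intro x hx
    obtain ⟨c, h1, h2⟩ := hball x hx
    exact (HasFDerivAt.fun_sub h1 h2).congr_fderiv (sub_self _)
  have := (convex_ball z r).is_const_of_fderivWithin_eq_zero (𝕜 := ℝ)
    (f := fun x => u x - v x) (fun x hx => (hd x hx).differentiableAt.differentiableWithinAt)
    (fun x hx => by
      rw [fderivWithin_of_isOpen Metric.isOpen_ball hx, (hd x hx).fderiv])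
    (Metric.mem_ball_self hr) hw
  exact ⟨this, this.symm⟩

/-- Along the filter `l`, the function `|u|` on `s` is modelled by `|Re g|` near `0`. -/
structure IsLocalModel (u : ℂ → ℝ) (s : Set ℂ) (l : Filter ℂ) (g : ℂ → ℂ) : Prop where
  differentiableAt : ∀ᶠ ζ in 𝓝 0, DifferentiableAt ℂ g ζ
  near : ∀ ε > 0, ∀ᶠ z in l, z ∈ s → ∃ ζ, ‖ζ‖ < ε ∧ |u z| = |(g ζ).re|
  mem_closure : ∀ᶠ ζ in 𝓝 0, ζ ∈ closure {ζ' | ∃ z ∈ s, |u z| = |(g ζ').re|}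

/-- Compactness of the sphere: local bounds near every point and near infinity are combined by
taking maxima. The condition `q` is used with no content, for boundedness, and as `c < M`, for
strict inequality. -/
theorem exists_uniform_bound {f : ℂ → ℝ} {s : Set ℂ} {q : ℝ → Prop} (hq₀ : ∃ c, q c)
    (hq : ∀ c d, q c → q d → q (max c d)) (h : ∀ l, (l = Bornology.cobounded ℂ ∨ ∃ z, l = 𝓝 z) →
      ∃ c, q c ∧ ∀ᶠ z in l, z ∈ s → f z ≤ c) : ∃ c, q c ∧ ∀ z ∈ s, f z ≤ c := by
  obtain ⟨c₁, hc₁, h₁⟩ := h _ (Or.inl rfl)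
  obtain ⟨r, hr⟩ := (Metric.hasBasis_cobounded_compl_closedBall (0 : ℂ)).eventually_iff.1 h₁
  have h₂ : ∃ c, q c ∧ ∀ z ∈ Metric.closedBall (0 : ℂ) r, z ∈ s → f z ≤ c := by
    refine (isCompact_closedBall (0 : ℂ) r).induction_on
      (p := fun K => ∃ c, q c ∧ ∀ z ∈ K, z ∈ s → f z ≤ c) ?_ ?_ ?_ ?_
    · obtain ⟨c, hc⟩ := hq₀
      exact ⟨c, hc, fun z hz => absurd hz (notMem_empty z)⟩
    · rintro K L hKL ⟨c, hc, h⟩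
      exact ⟨c, hc, fun z hz => h z (hKL hz)⟩
    · rintro K L ⟨c, hc, h⟩ ⟨d, hd, h'⟩
      refine ⟨_, hq c d hc hd, fun z hz hs => ?_⟩
      rcases hz with hz | hz
      · exact (h z hz hs).trans (le_max_left _ _)
      · exact (h' z hz hs).trans (le_max_right _ _)
    · intro z _
      obtain ⟨c, hc, h⟩ := h _ (Or.inr ⟨z, rfl⟩)
      exact ⟨_, nhdsWithin_le_nhds h, c, hc, fun z hz => hz⟩
  obtain ⟨c₂, hc₂, h₂⟩ := h₂
  refine ⟨_, hq c₁ c₂ hc₁ hc₂, fun z hz => ?_⟩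
  by_cases hzr : z ∈ Metric.closedBall (0 : ℂ) r
  · exact (h₂ z hzr hz).trans (le_max_right _ _)
  · exact (hr.2 hzr hz).trans (le_max_left _ _)

/-- The exponential of `g` attains its maximal modulus at 0 and is locally constant by the maximum
modulus principle. -/
theorem eventually_deriv_eq_zero_of_re_le {g : ℂ → ℂ} {M : ℝ}
    (hd : ∀ᶠ ζ in 𝓝 0, DifferentiableAt ℂ g ζ) (hle : ∀ᶠ ζ in 𝓝 0, (g ζ).re ≤ M)
    (h0 : (g 0).re = M) : ∀ᶠ ζ in 𝓝 0, deriv g ζ = 0 := by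
  have h1 : ∀ᶠ ζ in 𝓝 0, Complex.exp (g ζ) = Complex.exp (g 0) := by
    refine Complex.eventually_eq_of_isLocalMax_norm (f := fun ζ => Complex.exp (g ζ)) (c := 0)
      (hd.mono fun ζ h => h.cexp) ?_
    filter_upwards [hle] with ζ hζ
    simp only [Function.comp_apply, Complex.norm_exp, Real.exp_le_exp, h0, hζ]
  filter_upwards [h1.eventually_nhds, hd] with ζ hζ hdζ
  have h2 : HasDerivAt (fun ζ => Complex.exp (g ζ)) 0 ζ :=
    (hasDerivAt_const ζ (Complex.exp (g 0))).congr_of_eventuallyEq hζ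
  have h3 := hdζ.hasDerivAt.cexp.unique h2
  exact (mul_eq_zero.1 h3).resolve_left (Complex.exp_ne_zero _)

/-- The bound holds at those points of the chart where the model is attained; they are dense near 0,
and `g` is continuous. -/
theorem IsLocalModel.abs_re_le {u : ℂ → ℝ} {s : Set ℂ} {l : Filter ℂ} {g : ℂ → ℂ}
    (h : IsLocalModel u s l g) {M : ℝ} (hM : ∀ z ∈ s, |u z| ≤ M) :
    ∀ᶠ ζ in 𝓝 0, |(g ζ).re| ≤ M := by
  filter_upwards [h.differentiableAt, h.mem_closure] with ζ hd hζ
  have hc : ContinuousAt (fun ζ => |(g ζ).re|) ζ :=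
    (Complex.continuous_re.continuousAt.comp hd.continuousAt).abs
  have := mem_closure_iff_nhdsWithin_neBot.1 hζ
  refine le_of_tendsto (hc.tendsto.mono_left (nhdsWithin_le_nhds
    (s := {ζ' | ∃ z ∈ s, |u z| = |(g ζ').re|}))) ?_
  filter_upwards [self_mem_nhdsWithin] with ζ' ⟨z, hz, hζ'⟩
  exact hζ' ▸ hM z hz

/-- **Maximum principle**: no function on `s` has nonconstant local models along every filter `𝓝 z` and
at infinity. -/
theorem not_forall_isLocalModel {u : ℂ → ℝ} {s : Set ℂ} (hs : s.Nonempty)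
    (h : ∀ l, (l = Bornology.cobounded ℂ ∨ ∃ z, l = 𝓝 z) →
      ∃ g, IsLocalModel u s l g ∧ ¬∀ᶠ ζ in 𝓝 0, deriv g ζ = 0) : False := by
  have hnear : ∀ l g c, IsLocalModel u s l g → |(g 0).re| < c → ∀ᶠ z in l, z ∈ s → |u z| ≤ c := by
    intro l g c hg hc
    have hc' : ContinuousAt (fun ζ => |(g ζ).re|) 0 :=
      (Complex.continuous_re.continuousAt.comp
        hg.differentiableAt.self_of_nhds.continuousAt).abs
    obtain ⟨ε, hε, hball⟩ := Metric.eventually_nhds_iff_ball.1 (hc'.eventually_lt_const hc)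
    filter_upwards [hg.near ε hε] with z hz hzs
    obtain ⟨ζ, hζ, he⟩ := hz hzs
    rw [he]
    exact (hball ζ (mem_ball_zero_iff.2 hζ)).le
  obtain ⟨c₀, -, hc₀⟩ := exists_uniform_bound (f := fun z => |u z|) (s := s) (q := fun _ => True)
    ⟨0, trivial⟩ (fun _ _ _ _ => trivial) fun l hl => by
      obtain ⟨g, hg, -⟩ := h l hl
      exact ⟨_, trivial, hnear l g _ hg (lt_add_one _)⟩
  have hne := hs.image fun z => |u z|
  have hbdd : BddAbove ((fun z => |u z|) '' s) := ⟨c₀, by rintro _ ⟨z, hz, rfl⟩; exact hc₀ z hz⟩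
  set M := sSup ((fun z => |u z|) '' s) with hMdef
  have hM : ∀ z ∈ s, |u z| ≤ M := fun z hz => le_csSup hbdd ⟨z, hz, rfl⟩
  -- A nonconstant model stays strictly below the supremum at its centre, hence nearby. By
  -- compactness one bound less than the supremum holds everywhere, which is absurd.
  obtain ⟨c, hcM, hc⟩ := exists_uniform_bound (f := fun z => |u z|) (s := s) (q := fun c => c < M)
    ⟨M - 1, by linarith⟩ (fun _ _ => max_lt) fun l hl => by
      obtain ⟨g, hg, hg'⟩ := h l hl
      have hle := hg.abs_re_le hM
      have hlt : |(g 0).re| < M := by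
        refine lt_of_le_of_ne hle.self_of_nhds fun heq => hg' ?_
        rcases abs_choice (g 0).re with h1 | h1 <;> rw [h1] at heq
        · exact eventually_deriv_eq_zero_of_re_le hg.differentiableAt
            (hle.mono fun ζ hζ => (le_abs_self _).trans hζ) heq
        · have := eventually_deriv_eq_zero_of_re_le (g := fun ζ => -g ζ) (M := M)
            (hg.differentiableAt.mono fun ζ hζ => hζ.neg)
            (hle.mono fun ζ hζ => (neg_le_abs _).trans hζ) heq
          refine this.mono fun ζ hζ => ?_
          rwa [deriv.fun_neg, neg_eq_zero] at hζ
      obtain ⟨c, h1, h2⟩ := exists_between hlt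
      exact ⟨c, h2, hnear l g c hg h1⟩
  refine absurd (csSup_le hne ?_) (not_le.2 hcM)
  rintro _ ⟨z, hz, rfl⟩
  exact hc z hz

/-! ### The real part of the integral of P dz / R^{1/2} on the cut plane. -/

namespace CutContour

variable {p n : ℕ}

theorem hasDerivAt_integral_density (C : CutContour p n) (k : ℂ[X]) (j : Fin (n + 1)) {τ : ℝ}
    (hτ : τ ∈ Ioo (C.α j) (C.β j)) :
    HasDerivAt (fun x => ∫ s in (C.α j)..x, C.density k j s * deriv C.Γ s)
      (C.density k j τ * deriv C.Γ τ) τ := by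
  have hc : ContinuousOn (fun s => C.density k j s * deriv C.Γ s) (Ioo (C.α j) (C.β j)) :=
    ((C.continuousOn_density k j).mono Ioo_subset_Icc_self).mul
      (((C.continuousOn_derivWithin_cut j).mono Ioo_subset_Icc_self).congr (C.deriv_eqOn_cut j))
  exact intervalIntegral.integral_hasDerivAt_right
    (C.intervalIntegrable_density k j hτ.1.le le_rfl hτ.2.le)
    (hc.stronglyMeasurableAtFilter isOpen_Ioo τ hτ) (hc.continuousAt (Ioo_mem_nhds hτ.1 hτ.2))

theorem continuousOn_integral_density (C : CutContour p n) (k : ℂ[X]) (j : Fin (n + 1)) :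
    ContinuousOn (fun x => ∫ s in (C.α j)..x, C.density k j s * deriv C.Γ s)
      (Icc (C.α j) (C.β j)) := by
  have := intervalIntegral.continuousOn_primitive_interval'
    (C.intervalIntegrable_density k j (C.α_lt_β j).le le_rfl le_rfl) left_mem_uIcc
  rwa [uIcc_of_le (C.α_lt_β j).le] at this

/-- A primitive of `cauchyCut`, up to a logarithm at an endpoint. -/
theorem exists_hasDerivAt_cauchyCut (C : CutContour p n) (k : ℂ[X]) (j : Fin (n + 1)) :
    ∃ A : ℂ → ℂ, ∀ z ∉ C.J, HasDerivAt A (C.cauchyCut k j z +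
      (∫ τ in (C.α j)..(C.β j), C.density k j τ * deriv C.Γ τ) / (z - C.b j)) z := by
  have hAB := (C.α_lt_β j).le
  set P : ℝ → ℂ := fun x => ∫ s in (C.α j)..x, C.density k j s * deriv C.Γ s with hP
  have hPc : ContinuousOn P (Icc (C.α j) (C.β j)) := C.continuousOn_integral_density k j
  have hm : IntervalIntegrable (fun τ => P τ * deriv C.Γ τ) MeasureTheory.volume (C.α j) (C.β j) :=
    (C.intervalIntegrable_deriv_cut j).continuousOn_mul (by rwa [uIcc_of_le hAB])
  refine ⟨fun z => ∫ τ in (C.α j)..(C.β j), P τ * deriv C.Γ τ / (C.Γ τ - z), fun z hz => ?_⟩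
  have hzj : z ∉ C.Γ '' Icc (C.α j) (C.β j) := fun h => hz (C.cut_subset_J j h)
  have hne : ∀ τ ∈ Icc (C.α j) (C.β j), C.Γ τ - z ≠ 0 := fun τ hτ h0 =>
    hzj ⟨τ, hτ, sub_eq_zero.1 h0⟩
  refine (hasDerivAt_cauchyIntegral hAB C.continuous.continuousOn hm hzj).congr_deriv ?_
  have hGc : ContinuousOn (fun τ => C.Γ τ - z) (Icc (C.α j) (C.β j)) :=
    C.continuous.continuousOn.sub continuousOn_const
  have i1 := C.intervalIntegrable_density_div k j hAB le_rfl le_rfl hzj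
  have i2 : IntervalIntegrable (fun τ => P τ * deriv C.Γ τ / (C.Γ τ - z) ^ 2)
      MeasureTheory.volume (C.α j) (C.β j) := by
    have : ContinuousOn (fun τ => P τ / (C.Γ τ - z) ^ 2) (uIcc (C.α j) (C.β j)) := by
      rw [uIcc_of_le hAB]
      exact hPc.div (hGc.pow 2) fun τ hτ => pow_ne_zero 2 (hne τ hτ)
    refine ((C.intervalIntegrable_deriv_cut j).continuousOn_mul this).congr
      fun τ _ => ?_
    ring
  -- Integration by parts along the cut. The boundary term at the initial end vanishes, and that at
  -- `b j` carries the total mass.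
  have key := MeasureTheory.integral_eq_of_hasDerivAt_off_countable_of_le
    (fun τ => P τ / (C.Γ τ - z)) (fun τ => C.density k j τ * deriv C.Γ τ / (C.Γ τ - z) -
      P τ * deriv C.Γ τ / (C.Γ τ - z) ^ 2) hAB countable_empty (hPc.div hGc hne)
    (fun τ hτ => by
      have h0 := hne τ (Ioo_subset_Icc_self hτ.1)
      refine ((C.hasDerivAt_integral_density k j hτ.1).fun_div
        ((C.hasDerivAt_cut hτ.1).sub_const z) h0).congr_deriv ?_
      field_simp
      rfl) (i1.sub i2)
  rw [intervalIntegral.integral_sub i1 i2] at key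
  have hPα : P (C.α j) = 0 := intervalIntegral.integral_same
  have hPβ : P (C.β j) = ∫ τ in (C.α j)..(C.β j), C.density k j τ * deriv C.Γ τ := rfl
  have hcc : C.cauchyCut k j z =
    ∫ τ in (C.α j)..(C.β j), C.density k j τ * deriv C.Γ τ / (C.Γ τ - z) := rfl
  rw [hPα, zero_div, sub_zero, hPβ, ← hcc] at key
  have hflip : (∫ τ in (C.α j)..(C.β j), C.density k j τ * deriv C.Γ τ) / (z - C.b j) =
      -((∫ τ in (C.α j)..(C.β j), C.density k j τ * deriv C.Γ τ) / (C.Γ (C.β j) - z)) := by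
    rw [← div_neg, neg_sub]; rfl
  rw [hflip]
  linear_combination -key

/-- By the Plemelj formula a primitive is elementary up to terms (m_j / πi) log(z - b_j), m_j being
the integral of the density over the j-th cut. When m_j is purely imaginary the coefficient is real,
and the real part of the logarithm is single valued. -/
theorem exists_re_primitive (C : CutContour p n) {P w k : ℂ[X]}
    (hP : P = w.derivative * rootPoly C.pts +
      Polynomial.C (1 / 2) * w * (rootPoly C.pts).derivative + k * rootPoly C.pts ^ 2)
    (hre : ∀ j, (∫ τ in (C.α j)..(C.β j), C.density k j τ * deriv C.Γ τ).re = 0) :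
    ∃ u : ℂ → ℝ, ∀ z ∉ C.J, HasReDeriv u (P.eval z / C.sqrtR z) z := by
  obtain ⟨F, hF, hFE⟩ := C.exists_entire_cauchyCut k
  obtain ⟨E, hE⟩ := hF.isExactOn_univ
  choose A hA using C.exists_hasDerivAt_cauchyCut k
  set m : Fin (n + 1) → ℂ := fun j => ∫ τ in (C.α j)..(C.β j), C.density k j τ * deriv C.Γ τ with hm
  set πI : ℂ := Real.pi * Complex.I with hπ
  have hπ0 : πI ≠ 0 := mul_ne_zero (by exact_mod_cast Real.pi_ne_zero) Complex.I_ne_zero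
  refine ⟨fun z => (w.eval z * C.sqrtR z + πI⁻¹ * (∑ j, A j z - E z)).re -
    ∑ j, (m j).im / Real.pi * Real.log ‖z - C.b j‖, fun z hz => ?_⟩
  have hb : ∀ j, z - C.b j ≠ 0 := fun j => sub_ne_zero.2 (C.ne_pts_of_notMem_J hz (Sum.inr j))
  have hS := C.sqrtR_ne_zero hz
  -- The logarithm is normalized at the current point `z`, so no global branch has to be chosen.
  have hlog : ∀ j, HasDerivAt (fun x => Complex.log ((x - C.b j) / (z - C.b j)) +
      (Real.log ‖z - C.b j‖ : ℝ)) (z - C.b j)⁻¹ z := fun j => by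
    have := (((hasDerivAt_id z).sub_const (C.b j)).div_const (z - C.b j)).clog (by
      simp only [id]
      rw [div_self (hb j)]; exact Complex.one_mem_slitPlane)
    refine (this.add_const _).congr_deriv ?_
    simp [div_self (hb j)]
  have hsum : HasDerivAt (fun x => ∑ j, A j x) (∑ j, (C.cauchyCut k j z + m j / (z - C.b j))) z :=
    HasDerivAt.fun_sum fun j _ => hA j z hz
  have hH := (((w.hasDerivAt z).fun_mul (C.hasDerivAt_sqrtR hz)).fun_add
    ((hsum.fun_sub (hE z (mem_univ _))).const_mul πI⁻¹)).fun_sub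
    (HasDerivAt.fun_sum fun j (_ : j ∈ Finset.univ) =>
      (hlog j).const_mul (((m j).im / Real.pi : ℝ) : ℂ))
  have hmj : ∀ j, (((m j).im / Real.pi : ℝ) : ℂ) = πI⁻¹ * m j := fun j => by
    have h1 : m j = (m j).im * Complex.I := by
      refine Complex.ext ?_ ?_ <;> simp [hm, hre j]
    have h2 : (Real.pi : ℂ) ≠ 0 := by exact_mod_cast Real.pi_ne_zero
    conv_rhs => rw [h1]
    rw [hπ]
    push_cast
    field_simp [Complex.I_ne_zero]
  have hval : P.eval z / C.sqrtR z = w.derivative.eval z * C.sqrtR z + w.eval z *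
      ((rootPoly C.pts).derivative.eval z / (2 * C.sqrtR z)) + πI⁻¹ *
      (∑ j, (C.cauchyCut k j z + m j / (z - C.b j)) - F z) -
      ∑ j, (((m j).im / Real.pi : ℝ) : ℂ) * (z - C.b j)⁻¹ := by
    have hR : (rootPoly C.pts).eval z = C.sqrtR z ^ 2 := by rw [C.sqrtR_sq hz, R_eq]
    have h1 : P.eval z / C.sqrtR z = w.derivative.eval z * C.sqrtR z + w.eval z *
        ((rootPoly C.pts).derivative.eval z / (2 * C.sqrtR z)) + k.eval z * C.sqrtR z ^ 3 := by
      rw [hP]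
      simp only [Polynomial.eval_add, Polynomial.eval_mul, Polynomial.eval_C, Polynomial.eval_pow, hR]
      field_simp
    have h2 : ∑ j, (((m j).im / Real.pi : ℝ) : ℂ) * (z - C.b j)⁻¹ =
        πI⁻¹ * ∑ j, m j / (z - C.b j) := by
      rw [Finset.mul_sum]
      exact Finset.sum_congr rfl fun j _ => by rw [hmj, div_eq_mul_inv, mul_assoc]
    rw [h1, h2, hFE z hz, Finset.sum_add_distrib]
    field_simp
    ring
  rw [hval]
  refine HasFDerivAt.congr_of_eventuallyEq hH.hasReDeriv ?_
  have hev : ∀ᶠ x in 𝓝 z, ∀ j, x - C.b j ≠ 0 := eventually_all.2 fun j =>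
    (continuousAt_id.sub continuousAt_const).eventually_ne (hb j)
  filter_upwards [hev] with x hx
  simp only [Complex.sub_re, Complex.re_sum, Complex.re_ofReal_mul, Complex.add_re,
    Complex.ofReal_re, Complex.log_re]
  congr 1
  refine Finset.sum_congr rfl fun j _ => ?_
  rw [norm_div, Real.log_div (norm_ne_zero_iff.2 (hx j)) (norm_ne_zero_iff.2 (hb j)), sub_add_cancel]

end CutContour

theorem NearlyLinear.exists_slit_nhds_of_subset {γ : ℝ → ℂ} {c : ℂ} {r : ℝ} (hr : 0 < r)
    (h : NearlyLinear γ c 0 r) {J K : Set ℂ} (hJ : γ '' Icc 0 r ⊆ J) (hJK : J ⊆ γ '' Icc 0 r ∪ K)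
    (hK : IsClosed K) (h0 : γ 0 ∉ K) {ε : ℝ} (hε : 0 < ε) :
    ∃ N : Set ℂ, IsPreconnected N ∧ N ⊆ Metric.ball (γ 0) ε \ J ∧
      ∃ ε' > 0, Metric.ball (γ 0) ε' \ J ⊆ N := by
  obtain ⟨ρ, hρ, hball⟩ := Metric.isOpen_iff.1 hK.isOpen_compl _ h0
  obtain ⟨N, hN, hsub, ε', hε', hsup⟩ := h.exists_slit_nhds hr (lt_min hε hρ)
  refine ⟨N, hN, fun z hz => ⟨Metric.ball_subset_ball (min_le_left _ _) (hsub hz).1, fun hzJ => ?_⟩,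
    ε', hε', fun z hz => hsup ⟨hz.1, fun h => hz.2 (hJ h)⟩⟩
  rcases hJK hzJ with h | h
  · exact (hsub hz).2 h
  · exact hball (Metric.ball_subset_ball (min_le_right _ _) (hsub hz).1) h

namespace CutContour

variable {p n : ℕ}

/-- The window `[u, v]` may stick out of the cut, as it does around an end. -/
theorem J_subset_inter (C : CutContour p n) (j : Fin (n + 1)) (u v : ℝ) :
    C.J ⊆ C.Γ '' (Icc (C.α j) (C.β j) ∩ Icc u v) ∪ C.farJ j u v := by
  intro z hz
  obtain ⟨i, hi⟩ := mem_iUnion.1 hz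
  by_cases hij : i = j
  · subst hij
    obtain ⟨τ, hτ, rfl⟩ := hi
    rcases le_total τ u with h | h
    · exact Or.inr (Or.inl (Or.inl ⟨τ, ⟨hτ.1, h⟩, rfl⟩))
    · rcases le_total v τ with h' | h'
      · exact Or.inr (Or.inl (Or.inr ⟨τ, ⟨h', hτ.2⟩, rfl⟩))
      · exact Or.inl ⟨τ, ⟨hτ, h, h'⟩, rfl⟩
  · refine Or.inr (Or.inr (mem_biUnion (Finset.mem_coe.2 (Finset.mem_erase.2 ⟨hij, Finset.mem_univ i⟩)) hi))

theorem notMem_farJ_of_mem_Icc (C : CutContour p n) {j : Fin (n + 1)} {u v τ : ℝ}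
    (hτj : τ ∈ Icc (C.α j) (C.β j)) (hτ : τ ∈ Ioo u v) : C.Γ τ ∉ C.farJ j u v := by
  rintro ((⟨τ', hτ', h⟩ | ⟨τ', hτ', h⟩) | h)
  · have := C.injective h
    linarith [hτ.1, hτ'.2]
  · have := C.injective h
    linarith [hτ.2, hτ'.1]
  · obtain ⟨i, hi, hi'⟩ := mem_iUnion₂.1 h
    exact C.notMem_cut_of_ne (Finset.ne_of_mem_erase hi) hτj hi'

/-- Connectedness of slit neighbourhoods of a branch point is what leaves a single additive constant
for u there. -/
theorem exists_slit_nhds (C : CutContour p n) (e : Fin (n + 1) ⊕ Fin (n + 1)) {ε : ℝ} (hε : 0 < ε) :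
    ∃ N : Set ℂ, IsPreconnected N ∧ N ⊆ Metric.ball (C.pts e) ε \ C.J ∧
      ∃ ε' > 0, Metric.ball (C.pts e) ε' \ C.J ⊆ N := by
  rcases e with j | j
  · have hAB := C.α_lt_β j
    obtain ⟨c, r, hr, hrβ, hNL⟩ := C.exists_nearlyLinear_α j
    have := hNL.exists_slit_nhds_of_subset hr (J := C.J) (K := C.farJ j (C.α j - 1) (C.α j + r))
      ?_ ?_ (C.isClosed_farJ _ _ _) ?_ hε
    · simpa only [add_zero] using! this
    · rintro _ ⟨τ, hτ, rfl⟩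
      exact C.cut_subset_J j ⟨_, ⟨by linarith [hτ.1], by linarith [hτ.2]⟩, rfl⟩
    · refine (C.J_subset_inter j _ _).trans (union_subset_union_left _ ?_)
      rintro _ ⟨τ, hτ, rfl⟩
      exact ⟨τ - C.α j, ⟨by linarith [hτ.1.1], by linarith [hτ.2.2]⟩, by simp⟩
    · simp only [add_zero]
      exact C.notMem_farJ_of_mem_Icc ⟨le_rfl, hAB.le⟩ ⟨by linarith, by linarith⟩
  · have hAB := C.α_lt_β j
    obtain ⟨c, r, hr, hrβ, hNL⟩ := C.exists_nearlyLinear_β j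
    have := hNL.exists_slit_nhds_of_subset hr (J := C.J) (K := C.farJ j (C.β j - r) (C.β j + 1))
      ?_ ?_ (C.isClosed_farJ _ _ _) ?_ hε
    · simpa only [sub_zero] using! this
    · rintro _ ⟨τ, hτ, rfl⟩
      exact C.cut_subset_J j ⟨_, ⟨by linarith [hτ.2], by linarith [hτ.1]⟩, rfl⟩
    · refine (C.J_subset_inter j _ _).trans (union_subset_union_left _ ?_)
      rintro _ ⟨τ, hτ, rfl⟩
      exact ⟨C.β j - τ, ⟨by linarith [hτ.1.2], by linarith [hτ.2.1]⟩, by simp⟩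
    · simp only [sub_zero]
      exact C.notMem_farJ_of_mem_Icc ⟨hAB.le, le_rfl⟩ ⟨by linarith, by linarith⟩

variable {P : ℂ[X]} {u : ℂ → ℝ}

/-- Near an interior point of a cut, `u` is `κ ± Re H` on the two sides. -/
theorem exists_side_value (C : CutContour p n)
    (hu : ∀ z ∉ C.J, HasReDeriv u (P.eval z / C.sqrtR z) z) {j : Fin (n + 1)} {τ₀ : ℝ}
    (hτ₀ : τ₀ ∈ Ioo (C.α j) (C.β j)) :
    ∃ (κ : ℝ) (H : ℂ → ℂ), (∀ᶠ w in 𝓝 (C.Γ τ₀), ∃ c ≠ 0, HasDerivAt H (c * P.eval w) w) ∧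
      (∀ᶠ w in 𝓝 (C.Γ τ₀), w ∉ C.J → |u w - κ| = |(H w).re|) ∧
      ∀ᶠ τ in 𝓝 τ₀, (∀ᶠ s : ℝ in 𝓝[>] 0, C.Γ τ + s * (Complex.I * deriv C.Γ τ) ∉ C.J ∧
        C.Γ τ - s * (Complex.I * deriv C.Γ τ) ∉ C.J) ∧
        Tendsto (fun s : ℝ => u (C.Γ τ + s * (Complex.I * deriv C.Γ τ)) +
          u (C.Γ τ - s * (Complex.I * deriv C.Γ τ))) (𝓝[>] 0) (𝓝 (2 * κ)) := by
  obtain ⟨Q, G, hQ, -, hside⟩ := C.exists_sides j hτ₀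
  have hQ0 : Q (C.Γ τ₀) ≠ 0 := fun h0 => by
    have := hQ.self_of_nhds.2.2
    rw [h0, zero_pow two_ne_zero, R_eq] at this
    exact eval_rootPoly_ne_zero (C.ne_pts_of_mem_cut hτ₀) this.symm
  obtain ⟨ε, hε, hball⟩ := Metric.eventually_nhds_iff_ball.1
    (hQ.and (hQ.self_of_nhds.1.continuousAt.eventually_ne hQ0))
  have hd : DifferentiableOn ℂ (fun w => P.eval w / Q w) (Metric.ball (C.Γ τ₀) ε) := fun w hw =>
    (P.differentiableAt.fun_div (hball w hw).1.1 (hball w hw).2).differentiableWithinAt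
  obtain ⟨H₀, hH₀⟩ := hd.isExactOn_ball
  obtain ⟨N, L, hN, hL, hNs, hLs, hcov, hNv, hLv, hev⟩ := hside _ (Metric.ball_mem_nhds _ hε)
  have hnhds : ∀ w ∈ Metric.ball (C.Γ τ₀) ε \ C.J, Metric.ball (C.Γ τ₀) ε \ C.J ∈ 𝓝 w :=
    fun w hw => (Metric.isOpen_ball.sdiff C.isClosed_J).mem_nhds hw
  have hsq : ∀ w ∈ Metric.ball (C.Γ τ₀) ε \ C.J, C.sqrtR w = Q w ∨ C.sqrtR w = -Q w := fun w hw =>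
    sq_eq_sq_iff_eq_or_eq_neg.1 (by rw [C.sqrtR_sq hw.2, (hball w hw.1).1.2.2])
  obtain ⟨s₁, hs₁, hs₁'⟩ := hev.self_of_nhds.exists
  have hNe : ∀ z ∈ N, u z - (H₀ z).re =
      u (C.Γ τ₀ + s₁ * (Complex.I * deriv C.Γ τ₀)) -
        (H₀ (C.Γ τ₀ + s₁ * (Complex.I * deriv C.Γ τ₀))).re := fun z hz => by
    refine hN.sub_eq_of_hasReDeriv (v := fun z => (H₀ z).re) (fun w hw => ?_) hz hs₁
    have hw' := hNs hw
    have hc := ((C.differentiableAt_sqrtR hw'.2).continuousAt.add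
      (hball w hw'.1).1.1.continuousAt).eventually_ne (by
        simp only [Pi.add_apply]
        rw [(hNv w hw).1, ← two_mul]
        exact mul_ne_zero two_ne_zero (hball w hw'.1).2)
    filter_upwards [hnhds w hw', hc] with x hx hx0
    have he : C.sqrtR x = Q x := (hsq x hx).resolve_right fun h => hx0 (by simp [h])
    refine ⟨_, hu x hx.2, ?_⟩
    rw [he]
    exact (hH₀ x hx.1).hasReDeriv
  have hLe : ∀ z ∈ L, u z - -(H₀ z).re =
      u (C.Γ τ₀ - s₁ * (Complex.I * deriv C.Γ τ₀)) -
        -(H₀ (C.Γ τ₀ - s₁ * (Complex.I * deriv C.Γ τ₀))).re := fun z hz => by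
    refine hL.sub_eq_of_hasReDeriv (v := fun z => -(H₀ z).re) (fun w hw => ?_) hz hs₁'
    have hw' := hLs hw
    have hc := ((C.differentiableAt_sqrtR hw'.2).continuousAt.sub
      (hball w hw'.1).1.1.continuousAt).eventually_ne (by
        simp only [Pi.sub_apply]
        rw [(hLv w hw).1, ← neg_add', ← two_mul]
        exact neg_ne_zero.2 (mul_ne_zero two_ne_zero (hball w hw'.1).2))
    filter_upwards [hnhds w hw', hc] with x hx hx0
    have he : C.sqrtR x = -Q x := (hsq x hx).resolve_left fun h => hx0 (by simp [h])
    refine ⟨_, hu x hx.2, ?_⟩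
    rw [he, div_neg]
    exact (hH₀ x hx.1).hasReDeriv.neg
  generalize u (C.Γ τ₀ + s₁ * (Complex.I * deriv C.Γ τ₀)) -
        (H₀ (C.Γ τ₀ + s₁ * (Complex.I * deriv C.Γ τ₀))).re = κ₁ at hNe
  generalize u (C.Γ τ₀ - s₁ * (Complex.I * deriv C.Γ τ₀)) -
        -(H₀ (C.Γ τ₀ - s₁ * (Complex.I * deriv C.Γ τ₀))).re = κ₂ at hLe
  -- On the left u is Re H₀ + κ₁, on the right -Re H₀ + κ₂. Subtracting the mean and adding half the
  -- difference to H₀ gives values opposite in sign.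
  refine ⟨(κ₁ + κ₂) / 2, fun w => H₀ w + (((κ₁ - κ₂) / 2 : ℝ) : ℂ), ?_, ?_, ?_⟩
  · filter_upwards [Metric.ball_mem_nhds _ hε] with w hw
    refine ⟨(Q w)⁻¹, inv_ne_zero (hball w hw).2, ((hH₀ w hw).add_const _).congr_deriv ?_⟩
    simp only [div_eq_mul_inv, mul_comm]
  · filter_upwards [hcov] with w hw hwJ
    simp only [Complex.add_re, Complex.ofReal_re]
    rcases hw hwJ with h | h
    · rw [show u w - (κ₁ + κ₂) / 2 = (H₀ w).re + (κ₁ - κ₂) / 2 by linarith [hNe w h]]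
    · rw [show u w - (κ₁ + κ₂) / 2 = -((H₀ w).re + (κ₁ - κ₂) / 2) by linarith [hLe w h], abs_neg]
  · filter_upwards [hev, C.continuous.continuousAt.eventually (Metric.ball_mem_nhds _ hε)]
      with τ hτ hτb
    refine ⟨hτ.mono fun s hs => ⟨(hNs hs.1).2, (hLs hs.2).2⟩, ?_⟩
    have hc : ContinuousAt (fun w => (H₀ w).re) (C.Γ τ) :=
      Complex.continuous_re.continuousAt.comp (hH₀ _ hτb).continuousAt
    have hp : Tendsto (fun s : ℝ => C.Γ τ + s * (Complex.I * deriv C.Γ τ)) (𝓝[>] 0) (𝓝 (C.Γ τ)) := by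
      have : Continuous fun s : ℝ => C.Γ τ + s * (Complex.I * deriv C.Γ τ) := by fun_prop
      have h2 := this.tendsto 0
      simp only [Complex.ofReal_zero, zero_mul, add_zero] at h2
      exact h2.mono_left nhdsWithin_le_nhds
    have hm : Tendsto (fun s : ℝ => C.Γ τ - s * (Complex.I * deriv C.Γ τ)) (𝓝[>] 0) (𝓝 (C.Γ τ)) := by
      have : Continuous fun s : ℝ => C.Γ τ - s * (Complex.I * deriv C.Γ τ) := by fun_prop
      have h2 := this.tendsto 0
      simp only [Complex.ofReal_zero, zero_mul, sub_zero] at h2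
      exact h2.mono_left nhdsWithin_le_nhds
    have hlim := ((hc.tendsto.comp hp).sub (hc.tendsto.comp hm)).add_const (κ₁ + κ₂)
    rw [show 2 * ((κ₁ + κ₂) / 2) = (H₀ (C.Γ τ)).re - (H₀ (C.Γ τ)).re + (κ₁ + κ₂) by ring]
    refine hlim.congr' ?_
    filter_upwards [hτ] with s hs
    simp only [Function.comp_apply]
    linarith [hNe _ hs.1, hLe _ hs.2]

/-- The constant is half the limit of the sum of the values on the two sides, which determines it
uniquely. It is therefore locally constant along the cut, hence constant. -/
theorem exists_cut_value (C : CutContour p n)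
    (hu : ∀ z ∉ C.J, HasReDeriv u (P.eval z / C.sqrtR z) z) (j : Fin (n + 1)) :
    ∃ κ : ℝ, ∀ τ ∈ Ioo (C.α j) (C.β j),
      (∃ H : ℂ → ℂ, (∀ᶠ w in 𝓝 (C.Γ τ), ∃ c ≠ 0, HasDerivAt H (c * P.eval w) w) ∧
        ∀ᶠ w in 𝓝 (C.Γ τ), w ∉ C.J → |u w - κ| = |(H w).re|) ∧
      (∀ᶠ s : ℝ in 𝓝[>] 0, C.Γ τ + s * (Complex.I * deriv C.Γ τ) ∉ C.J ∧
        C.Γ τ - s * (Complex.I * deriv C.Γ τ) ∉ C.J) ∧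
      Tendsto (fun s : ℝ => u (C.Γ τ + s * (Complex.I * deriv C.Γ τ)) +
          u (C.Γ τ - s * (Complex.I * deriv C.Γ τ))) (𝓝[>] 0) (𝓝 (2 * κ)) := by
  have hne := nonempty_Ioo.2 (C.α_lt_β j)
  choose! κ H hH₁ hH₂ hH₃ using fun τ (hτ : τ ∈ Ioo (C.α j) (C.β j)) => C.exists_side_value hu hτ
  have hconst : ∀ x ∈ Ioo (C.α j) (C.β j), ∀ y ∈ Ioo (C.α j) (C.β j), κ x = κ y := by
    intro x hx y hy
    refine isPreconnected_Ioo.induction₂' (fun x y => κ x = κ y) (fun x hx => ?_)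
      (fun _ _ _ _ _ _ h1 h2 => h1.trans h2) hx hy
    filter_upwards [nhdsWithin_le_nhds (hH₃ x hx), self_mem_nhdsWithin] with y hy hyI
    have := tendsto_nhds_unique hy.2 (hH₃ y hyI).self_of_nhds.2
    exact ⟨by linarith, by linarith⟩
  obtain ⟨x, hx⟩ := hne
  refine ⟨κ x, fun τ hτ => ?_⟩
  rw [hconst x hx τ hτ]
  exact ⟨⟨H τ, hH₁ τ hτ, hH₂ τ hτ⟩, (hH₃ τ hτ).self_of_nhds⟩

/-- In the coordinate v = R^{1/2} / K of the double cover the differential is holomorphic with an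
odd primitive `Y`, and u = κ + Re Y(v). As Y(0) = 0, the constant κ is the limit of u at the branch
point. -/
theorem exists_end_value (C : CutContour p n)
    (hu : ∀ z ∉ C.J, HasReDeriv u (P.eval z / C.sqrtR z) z) (e : Fin (n + 1) ⊕ Fin (n + 1)) :
    ∃ (κ : ℝ) (Y : ℂ → ℂ), Tendsto u (𝓝[C.Jᶜ] (C.pts e)) (𝓝 κ) ∧
      (∀ᶠ v in 𝓝 0, ∃ c ≠ 0, HasDerivAt Y (c * P.eval (C.pts e + v ^ 2)) v) ∧
      ∀ᶠ v in 𝓝 0, C.pts e + v ^ 2 ∉ C.J → |u (C.pts e + v ^ 2) - κ| = |(Y v).re| := by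
  classical
  obtain ⟨ρ, hρ, hsep⟩ : ∃ ρ > 0, ∀ i ≠ e, C.pts i ∉ Metric.ball (C.pts e) ρ := by
    have : ∀ᶠ ρ : ℝ in 𝓝[>] 0, ∀ i, i ≠ e → C.pts i ∉ Metric.ball (C.pts e) ρ := by
      refine eventually_all.2 fun i => ?_
      by_cases hi : i = e
      · exact .of_forall fun _ h => absurd hi h
      · have h1 : 0 < dist (C.pts i) (C.pts e) := dist_pos.2 fun h => hi (C.pts_injective h)
        filter_upwards [Ioo_mem_nhdsGT h1] with ρ hρ _
        rw [Metric.mem_ball, not_lt]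
        exact hρ.2.le
    obtain ⟨ρ, h1, h2⟩ := (this.and self_mem_nhdsWithin).exists
    exact ⟨ρ, h2, h1⟩
  obtain ⟨K, hK⟩ := exists_root_ball (Finset.univ.erase e) C.pts (c := C.pts e) (ε := ρ)
    fun i hi => hsep i (Finset.ne_of_mem_erase hi)
  have hK0 : ∀ z ∈ Metric.ball (C.pts e) ρ, K z ≠ 0 := fun z hz h0 => by
    have h1 := (hK z hz).2
    rw [h0, zero_pow two_ne_zero, eq_comm, Finset.prod_eq_zero_iff] at h1
    obtain ⟨i, hi, hzi⟩ := h1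
    exact hsep i (Finset.ne_of_mem_erase hi) (by rwa [← sub_eq_zero.1 hzi])
  have hRK : ∀ z ∈ Metric.ball (C.pts e) ρ, (rootPoly C.pts).eval z = (z - C.pts e) * K z ^ 2 := by
    intro z hz
    rw [eval_rootPoly, (hK z hz).2, Finset.mul_prod_erase _ (fun i => z - C.pts i) (Finset.mem_univ e)]
  have hmem : ∀ v : ℂ, C.pts e + v ^ 2 ∈ Metric.ball (C.pts e) ρ ↔
      v ∈ Metric.ball (0 : ℂ) (Real.sqrt ρ) := by
    intro v
    rw [mem_ball_zero_iff, Metric.mem_ball, dist_eq_norm, add_sub_cancel_left, norm_pow,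
      Real.lt_sqrt (norm_nonneg _)]
  have hdiff : DifferentiableOn ℂ (fun v => 2 * P.eval (C.pts e + v ^ 2) / K (C.pts e + v ^ 2))
      (Metric.ball 0 (Real.sqrt ρ)) := fun v hv => by
    have h2 : DifferentiableAt ℂ (fun v : ℂ => K (C.pts e + v ^ 2)) v :=
      DifferentiableAt.comp (g := K) v (hK _ ((hmem v).2 hv)).1 (by fun_prop)
    exact (((P.differentiable.comp (by fun_prop : Differentiable ℂ fun v : ℂ =>
      C.pts e + v ^ 2) v).const_mul 2).fun_div h2 (hK0 _ ((hmem v).2 hv))).differentiableWithinAt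
  obtain ⟨Y₀, hY₀⟩ := hdiff.isExactOn_ball
  set Y : ℂ → ℂ := fun v => (Y₀ v - Y₀ (-v)) / 2 with hY
  have hYd : ∀ v ∈ Metric.ball (0 : ℂ) (Real.sqrt ρ),
      HasDerivAt Y (2 * P.eval (C.pts e + v ^ 2) / K (C.pts e + v ^ 2)) v := fun v hv => by
    have h1 := hY₀ v hv
    have h2 := HasDerivAt.comp_of_eq v (hY₀ (-v) (by simpa using hv)) (hasDerivAt_neg v) rfl
    refine ((h1.fun_sub h2).div_const 2).congr_deriv ?_
    simp only [neg_sq]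
    ring
  have hodd : ∀ v, Y (-v) = -Y v := fun v => by simp only [hY, neg_neg]; ring
  set V : ℂ → ℂ := fun z => C.sqrtR z / K z with hV
  have hVsq : ∀ z ∈ Metric.ball (C.pts e) ρ \ C.J, V z ^ 2 = z - C.pts e := fun z hz => by
    have := hK0 z hz.1
    rw [hV, div_pow, C.sqrtR_sq hz.2, R_eq, hRK z hz.1]
    field_simp
  have hVb : ∀ z ∈ Metric.ball (C.pts e) ρ \ C.J, V z ∈ Metric.ball (0 : ℂ) (Real.sqrt ρ) :=
    fun z hz => by rw [← hmem, hVsq z hz, add_sub_cancel]; exact hz.1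
  have hYV : ∀ z ∈ Metric.ball (C.pts e) ρ \ C.J,
      HasDerivAt (fun z => Y (V z)) (P.eval z / C.sqrtR z) z := fun z hz => by
    have hVd : DifferentiableAt ℂ V z := (C.differentiableAt_sqrtR hz.2).fun_div (hK z hz.1).1 (hK0 z hz.1)
    have h1 : HasDerivAt (fun z => V z ^ 2) 1 z := by
      refine ((hasDerivAt_id z).sub_const (C.pts e)).congr_of_eventuallyEq ?_
      filter_upwards [(Metric.isOpen_ball.sdiff C.isClosed_J).mem_nhds hz] with x hx
      exact hVsq x hx
    have h2 := (hVd.hasDerivAt.fun_pow 2).unique h1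
    have h3 := HasDerivAt.comp z (hYd _ (hVb z hz)) hVd.hasDerivAt
    refine h3.congr_deriv ?_
    have hS := C.sqrtR_ne_zero hz.2
    have hKz := hK0 z hz.1
    rw [hVsq z hz, add_sub_cancel]
    have h4 : 2 * C.sqrtR z * deriv V z = K z := by
      have h5 : V z * K z = C.sqrtR z := div_mul_cancel₀ _ hKz
      rw [← h5]
      norm_num at h2
      linear_combination K z * h2
    field_simp
    linear_combination P.eval z * h4
  obtain ⟨N, hN, hNs, ε', hε', hsup⟩ := C.exists_slit_nhds e hρ
  have hconst : ∃ κ, ∀ z ∈ N, u z - (Y (V z)).re = κ := by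
    rcases N.eq_empty_or_nonempty with h | ⟨z₀, hz₀⟩
    · exact ⟨0, fun z hz => absurd hz (by simp [h])⟩
    · refine ⟨_, fun z hz => hN.sub_eq_of_hasReDeriv (v := fun z => (Y (V z)).re) (fun w hw => ?_)
        hz hz₀⟩
      filter_upwards [(Metric.isOpen_ball.sdiff C.isClosed_J).mem_nhds (hNs hw)] with x hx
      exact ⟨_, hu x hx.2, (hYV x hx).hasReDeriv⟩
  obtain ⟨κ, hκ⟩ := hconst
  have hY0 : Y 0 = 0 := by simp [hY]
  refine ⟨κ, Y, ?_, ?_, ?_⟩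
  · have hVlim : Tendsto V (𝓝[C.Jᶜ] (C.pts e)) (𝓝 0) := by
      have h1 : Tendsto (fun z : ℂ => Real.sqrt ‖z - C.pts e‖) (𝓝[C.Jᶜ] (C.pts e)) (𝓝 0) := by
        have : Continuous fun z : ℂ => Real.sqrt ‖z - C.pts e‖ := by fun_prop
        have h2 := this.tendsto (C.pts e)
        simp only [sub_self, norm_zero, Real.sqrt_zero] at h2
        exact h2.mono_left nhdsWithin_le_nhds
      refine squeeze_zero_norm' ?_ h1
      filter_upwards [self_mem_nhdsWithin, nhdsWithin_le_nhds (Metric.ball_mem_nhds _ hρ)] with z hz hzb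
      rw [← hVsq z ⟨hzb, hz⟩, norm_pow, Real.sqrt_sq (norm_nonneg _)]
    have hYc : ContinuousAt (fun v => (Y v).re) 0 := Complex.continuous_re.continuousAt.comp
      (hYd 0 (Metric.mem_ball_self (Real.sqrt_pos.2 hρ))).continuousAt
    have h3 := (hYc.tendsto.comp hVlim).const_add κ
    simp only [hY0, Complex.zero_re, add_zero] at h3
    refine h3.congr' ?_
    filter_upwards [self_mem_nhdsWithin, nhdsWithin_le_nhds (Metric.ball_mem_nhds _ hε')] with z hz hzb
    have := hκ z (hsup ⟨hzb, hz⟩)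
    simp only [Function.comp_apply]
    linarith
  · filter_upwards [Metric.ball_mem_nhds (0 : ℂ) (Real.sqrt_pos.2 hρ)] with v hv
    refine ⟨2 / K (C.pts e + v ^ 2), div_ne_zero two_ne_zero (hK0 _ ((hmem v).2 hv)),
      (hYd v hv).congr_deriv (by ring)⟩
  · have hcont : Tendsto (fun v : ℂ => C.pts e + v ^ 2) (𝓝 0) (𝓝 (C.pts e)) := by
      have : Continuous fun v : ℂ => C.pts e + v ^ 2 := by fun_prop
      simpa using this.tendsto 0
    filter_upwards [hcont (Metric.ball_mem_nhds _ hε')] with v hv hvJ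
    have hvN := hsup ⟨hv, hvJ⟩
    have h1 := hκ _ hvN
    have h2 := hVsq _ (hNs hvN)
    rw [add_sub_cancel_left, sq_eq_sq_iff_eq_or_eq_neg] at h2
    rw [sub_eq_iff_eq_add'.1 h1]
    -- The coordinate of the point is `v` or `-v`; by oddness the absolute value is the same.
    rcases h2 with h | h
    · rw [h]; ring_nf
    · rw [h, hodd, Complex.neg_re]
      rw [add_sub_cancel_right, abs_neg]

/-- The value of `u` at an end of a cut is the mean of its values on the two sides of the cut. -/
theorem cut_value_eq_end_value (C : CutContour p n) {j : Fin (n + 1)} {κ κ' τe : ℝ}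
    (hτe : τe ∈ Icc (C.α j) (C.β j)) (hend : Tendsto u (𝓝[C.Jᶜ] (C.Γ τe)) (𝓝 κ'))
    (hcut : ∀ τ ∈ Ioo (C.α j) (C.β j),
      (∀ᶠ s : ℝ in 𝓝[>] 0, C.Γ τ + s * (Complex.I * deriv C.Γ τ) ∉ C.J ∧
        C.Γ τ - s * (Complex.I * deriv C.Γ τ) ∉ C.J) ∧
      Tendsto (fun s : ℝ => u (C.Γ τ + s * (Complex.I * deriv C.Γ τ)) +
          u (C.Γ τ - s * (Complex.I * deriv C.Γ τ))) (𝓝[>] 0) (𝓝 (2 * κ))) : κ = κ' := by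
  refine eq_of_forall_dist_le fun ε hε => ?_
  have h1 : ∀ᶠ w in 𝓝 (C.Γ τe), w ∈ C.Jᶜ → dist (u w) κ' < ε :=
    eventually_nhdsWithin_iff.1 (hend (Metric.ball_mem_nhds _ hε))
  have h2 : ∃ᶠ τ in 𝓝 τe, τ ∈ Ioo (C.α j) (C.β j) := by
    rw [← mem_closure_iff_frequently, closure_Ioo (C.α_lt_β j).ne]
    exact hτe
  obtain ⟨τ, hτ, hW⟩ := (h2.and_eventually
    (C.continuous.continuousAt.eventually h1.eventually_nhds)).exists
  obtain ⟨hJ, hlim⟩ := hcut τ hτ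
  have hp : Tendsto (fun s : ℝ => C.Γ τ + s * (Complex.I * deriv C.Γ τ)) (𝓝[>] 0) (𝓝 (C.Γ τ)) := by
    have : Continuous fun s : ℝ => C.Γ τ + s * (Complex.I * deriv C.Γ τ) := by fun_prop
    have h2 := this.tendsto 0
    simp only [Complex.ofReal_zero, zero_mul, add_zero] at h2
    exact h2.mono_left nhdsWithin_le_nhds
  have hm : Tendsto (fun s : ℝ => C.Γ τ - s * (Complex.I * deriv C.Γ τ)) (𝓝[>] 0) (𝓝 (C.Γ τ)) := by
    have : Continuous fun s : ℝ => C.Γ τ - s * (Complex.I * deriv C.Γ τ) := by fun_prop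
    have h2 := this.tendsto 0
    simp only [Complex.ofReal_zero, zero_mul, sub_zero] at h2
    exact h2.mono_left nhdsWithin_le_nhds
  have h3 : dist (2 * κ) (2 * κ') ≤ 2 * ε := by
    refine le_of_tendsto (hlim.dist tendsto_const_nhds) ?_
    filter_upwards [hJ, hp.eventually hW, hm.eventually hW] with s hs hs1 hs2
    rw [two_mul κ']
    refine (dist_add_add_le _ _ _ _).trans ?_
    linarith [hs1 hs.1, hs2 hs.2]
  rw [Real.dist_eq, ← mul_sub, abs_mul, abs_two] at h3
  rw [Real.dist_eq]
  linarith

end CutContour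

/-! ### Charts of the hyperelliptic curve and the vanishing of P. -/

/-- In the chart `φ` around the limit of `l`, the function `|u|` on `s` becomes `|Re g|`, and the
derivative of `g` vanishes only where the polynomial `P` does. -/
structure IsModelChart (u : ℂ → ℝ) (s : Set ℂ) (P : ℂ[X]) (l : Filter ℂ) (φ g : ℂ → ℂ) : Prop where
  differentiableAt : ∀ᶠ ζ in 𝓝 0, DifferentiableAt ℂ g ζ
  abs_eq : ∀ᶠ ζ in 𝓝 0, φ ζ ∈ s → |u (φ ζ)| = |(g ζ).re|
  mem_closure : ∀ᶠ ζ in 𝓝 0, ζ ∈ closure (φ ⁻¹' s)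
  surj : ∀ ε > 0, ∀ᶠ z in l, ∃ ζ, ‖ζ‖ < ε ∧ φ ζ = z
  hasDerivAt : ∀ᶠ ζ in 𝓝[≠] 0, ∃ c ≠ 0, HasDerivAt g (c * P.eval (φ ζ)) ζ

theorem IsModelChart.isLocalModel {u : ℂ → ℝ} {s : Set ℂ} {P : ℂ[X]} {l : Filter ℂ} {φ g : ℂ → ℂ}
    (h : IsModelChart u s P l φ g) : IsLocalModel u s l g where
  differentiableAt := h.differentiableAt
  near ε hε := by
    obtain ⟨r, hr, hball⟩ := Metric.eventually_nhds_iff_ball.1 h.abs_eq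
    filter_upwards [h.surj _ (lt_min hε hr)] with z ⟨ζ, hζ, hz⟩ hs
    subst hz
    exact ⟨ζ, hζ.trans_le (min_le_left _ _),
      hball ζ (mem_ball_zero_iff.2 (hζ.trans_le (min_le_right _ _))) hs⟩
  mem_closure := by
    obtain ⟨r, hr, hball⟩ := Metric.eventually_nhds_iff_ball.1 h.abs_eq
    filter_upwards [h.mem_closure, Metric.ball_mem_nhds 0 hr] with ζ hζ hb
    refine closure_mono ?_ (Metric.isOpen_ball.inter_closure ⟨hb, hζ⟩)
    rintro x ⟨hx, hxs⟩
    exact ⟨φ x, hxs, hball x hx hxs⟩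

/-- Otherwise a whole neighbourhood would be mapped into the zeros of `P` and the centre of the
chart, a finite set. -/
theorem IsModelChart.not_eventually_deriv_eq_zero {u : ℂ → ℝ} {s : Set ℂ} {P : ℂ[X]} (hP : P ≠ 0)
    {l : Filter ℂ} {φ g : ℂ → ℂ} (h : IsModelChart u s P l φ g)
    (hl : ∀ F : Set ℂ, F.Finite → F ∉ l) : ¬∀ᶠ ζ in 𝓝 0, deriv g ζ = 0 := by
  intro h0
  have h1 := h0.and (eventually_nhdsWithin_iff.1 h.hasDerivAt)
  obtain ⟨r, hr, hball⟩ := Metric.eventually_nhds_iff_ball.1 h1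
  refine hl ({φ 0} ∪ {z | P.IsRoot z}) ((finite_singleton _).union
    (Polynomial.finite_setOfPred_isRoot hP)) ?_
  filter_upwards [h.surj r hr] with z ⟨ζ, hζ, hz⟩
  subst hz
  by_cases h2 : ζ = 0
  · left; rw [h2]; rfl
  · right
    obtain ⟨h3, h4⟩ := hball ζ (mem_ball_zero_iff.2 hζ)
    obtain ⟨c, hc, h5⟩ := h4 h2
    rw [h5.deriv] at h3
    exact (mul_eq_zero.1 h3).resolve_left hc

theorem HasReDeriv.comp_complex {u : ℂ → ℝ} {c z : ℂ} (h : HasReDeriv u c z) {f : ℂ → ℂ} {f' ζ : ℂ}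
    (hf : HasDerivAt f f' ζ) (hz : f ζ = z) : HasReDeriv (fun ζ => u (f ζ)) (c * f') ζ := by
  subst hz
  have := HasFDerivAt.comp ζ h (hf.hasFDerivAt.restrictScalars ℝ)
  refine this.congr_fderiv ?_
  ext v
  simp [mul_comm, mul_left_comm]

theorem isPreconnected_ball_diff_zero {r : ℝ} : IsPreconnected (Metric.ball (0 : ℂ) r \ {0}) := by
  have h1 : Continuous fun x : ℝ × ℝ => (x.1 : ℂ) * Complex.exp (x.2 * Complex.I) := by fun_prop
  convert ((isPreconnected_Ioo (a := 0) (b := r)).prod isPreconnected_univ).image _ h1.continuousOn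
  ext z
  constructor
  · rintro ⟨h2, h3⟩
    exact ⟨(‖z‖, z.arg), ⟨⟨norm_pos_iff.2 h3, mem_ball_zero_iff.1 h2⟩, mem_univ _⟩,
      Complex.norm_mul_exp_arg_mul_I z⟩
  · rintro ⟨⟨ρ, θ⟩, ⟨hρ, -⟩, rfl⟩
    simp only at hρ ⊢
    refine ⟨?_, mul_ne_zero (by exact_mod_cast hρ.1.ne') (Complex.exp_ne_zero _)⟩
    rw [mem_ball_zero_iff, norm_mul, Complex.norm_exp_ofReal_mul_I, mul_one, Complex.norm_real,
      Real.norm_of_nonneg hρ.1.le]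
    exact hρ.2

namespace CutContour

variable {p n : ℕ} {P : ℂ[X]} {u : ℂ → ℝ}

/-- Along the gap, u minus the real part of `w` times the root has derivative Re(k R^{3/2} Γ'), of
integral zero. The subtracted term vanishes at both ends, so u takes the same limit there. -/
theorem end_values_gap_eq (C : CutContour p n)
    (hu : ∀ z ∉ C.J, HasReDeriv u (P.eval z / C.sqrtR z) z) {w k : ℂ[X]}
    (hP : P = w.derivative * rootPoly C.pts +
      Polynomial.C (1 / 2) * w * (rootPoly C.pts).derivative + k * rootPoly C.pts ^ 2)
    {j : Fin n} (hre : (∫ τ in (C.β j.castSucc)..(C.α j.succ),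
      k.eval (C.Γ τ) * C.gapRoot j τ ^ 3 * deriv C.Γ τ).re = 0) {κ₁ κ₂ : ℝ}
    (h₁ : Tendsto u (𝓝[C.Jᶜ] (C.b j.castSucc)) (𝓝 κ₁))
    (h₂ : Tendsto u (𝓝[C.Jᶜ] (C.a j.succ)) (𝓝 κ₂)) : κ₁ = κ₂ := by
  have hab := C.β_lt_α j
  set A := C.β j.castSucc with hA
  set B := C.α j.succ with hB
  have hJ : ∀ τ ∈ Ioo A B, C.Γ τ ∉ C.J := fun τ hτ => C.Γ_notMem_J_of_mem_gap hτ
  have hint : IntervalIntegrable (fun τ => k.eval (C.Γ τ) * C.gapRoot j τ ^ 3 * deriv C.Γ τ)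
      MeasureTheory.volume A B := by
    refine (C.intervalIntegrable_deriv hab).continuousOn_mul ?_
    rw [uIcc_of_le hab.le]
    exact (k.continuous.comp C.continuous).continuousOn.mul ((C.continuousOn_gapRoot j).pow 3)
  obtain ⟨F, hF, hd⟩ := C.exists_countable_hasDerivAt
  set f : ℝ → ℝ := fun τ => u (C.Γ τ) - (w.eval (C.Γ τ) * C.gapRoot j τ).re with hf
  have hwS : ContinuousOn (fun τ => (w.eval (C.Γ τ) * C.gapRoot j τ).re) (Icc A B) :=
    Complex.continuous_re.comp_continuousOn
      ((w.continuous.comp C.continuous).continuousOn.mul (C.continuousOn_gapRoot j))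
  have hlim : ∀ {x κ} (l : Filter ℝ), l ≤ 𝓝[Icc A B] x → Ioo A B ∈ l → C.gapRoot j x = 0 →
      x ∈ Icc A B → Tendsto u (𝓝[C.Jᶜ] (C.Γ x)) (𝓝 κ) → Tendsto f l (𝓝 κ) := by
    intro x κ l hl hlI h0 hx hκ
    have h3 : Tendsto C.Γ l (𝓝[C.Jᶜ] (C.Γ x)) := by
      refine tendsto_nhdsWithin_iff.2 ⟨C.continuous.continuousAt.tendsto.mono_left
        (hl.trans nhdsWithin_le_nhds), ?_⟩
      filter_upwards [hlI] with τ hτ using hJ τ hτ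
    have h4 := (hκ.comp h3).sub ((hwS x hx).tendsto.mono_left hl)
    rwa [h0, mul_zero, Complex.zero_re, sub_zero] at h4
  have hfc : ContinuousOn f (Ioo A B) := fun τ hτ =>
    ((ContinuousAt.comp (g := u) (hu _ (hJ τ hτ)).continuousAt C.continuous.continuousAt).sub
      (hwS.continuousAt (Icc_mem_nhds hτ.1 hτ.2))).continuousWithinAt
  have hla : Tendsto f (𝓝[>] A) (𝓝 κ₁) := hlim _
    (le_inf nhdsWithin_le_nhds (le_principal_iff.2
        (mem_of_superset (Ioc_mem_nhdsGT hab) Ioc_subset_Icc_self))) (Ioo_mem_nhdsGT hab)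
    (C.gapRoot_β j) ⟨le_rfl, hab.le⟩ h₁
  have hlb : Tendsto f (𝓝[<] B) (𝓝 κ₂) := hlim _
    (le_inf nhdsWithin_le_nhds (le_principal_iff.2
        (mem_of_superset (Ico_mem_nhdsLT hab) Ico_subset_Icc_self)))
    (Ioo_mem_nhdsLT hab) (C.gapRoot_α j) ⟨hab.le, le_rfl⟩ h₂
  have key := MeasureTheory.integral_eq_of_hasDerivAt_off_countable_of_le
    (extendFrom (Ioo A B) f)
    (fun τ => (k.eval (C.Γ τ) * C.gapRoot j τ ^ 3 * deriv C.Γ τ).re) hab.le hF.countable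
    (continuousOn_Icc_extendFrom_Ioo hfc hla hlb) (fun τ hτ => by
      have hτJ := hJ τ hτ.1
      have hS0 := C.sqrtR_ne_zero hτJ
      have h3 := (hu _ hτJ).comp (hd τ hτ.2) rfl
      have h4 : HasDerivAt (fun x => (w.eval (C.Γ x) * C.sqrtR (C.Γ x)).re) _ τ :=
        (((w.hasDerivAt (C.Γ τ)).fun_mul (C.hasDerivAt_sqrtR hτJ)).hasReDeriv).comp (hd τ hτ.2) rfl
      refine ((h3.fun_sub h4).congr_of_eventuallyEq ?_).congr_deriv ?_
      · filter_upwards [Ioo_mem_nhds hτ.1.1 hτ.1.2] with x hx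
        have hxe : extendFrom (Ioo A B) f x = f x :=
          extendFrom_extends hfc x hx
        rw [hxe, hf]
        simp only [C.gapRoot_of_mem hx]
      · rw [← Complex.sub_re, C.gapRoot_of_mem hτ.1, ← sub_mul]
        congr 2
        have hR : (rootPoly C.pts).eval (C.Γ τ) = C.sqrtR (C.Γ τ) ^ 2 := by
          rw [C.sqrtR_sq hτJ, R_eq]
        rw [hP]
        simp only [Polynomial.eval_add, Polynomial.eval_mul, Polynomial.eval_C,
          Polynomial.eval_pow, hR]
        field_simp
        ring) (by
      rw [intervalIntegrable_iff] at hint ⊢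
      exact hint.re)
  have hre' : (∫ τ in A..B, (k.eval (C.Γ τ) * C.gapRoot j τ ^ 3 * deriv C.Γ τ).re) = 0 := by
    rw [← hre]
    exact (Complex.reCLM.intervalIntegral_comp_comm hint)
  rw [hre', eq_lim_at_left_extendFrom_Ioo hab hla, eq_lim_at_right_extendFrom_Ioo hab hlb] at key
  linarith

/-- In the coordinate ζ = 1/z the differential becomes -(P / R^{1/2}) ζ⁻² dζ, and decay of order z⁻²
makes the singularity at ζ = 0 removable. -/
theorem exists_isModelChart_cobounded (C : CutContour p n)
    (hu : ∀ z ∉ C.J, HasReDeriv u (P.eval z / C.sqrtR z) z)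
    {c : ℂ} (hc : Tendsto (fun z => z ^ 2 * (P.eval z / z ^ (n + 1))) (Bornology.cobounded ℂ) (𝓝 c)) :
    ∃ φ g, IsModelChart u C.Jᶜ P (Bornology.cobounded ℂ) φ g := by
  obtain ⟨M, hM0, hM⟩ := C.exists_J_subset_ball
  have hr : 0 < M⁻¹ := inv_pos.2 hM0
  have hinvJ : ∀ ζ ∈ Metric.ball (0 : ℂ) M⁻¹ \ {0}, ζ⁻¹ ∉ C.J := fun ζ hζ hJ => by
    have h1 := hM _ hJ
    rw [norm_inv, inv_le_comm₀ (norm_pos_iff.2 hζ.2) hM0] at h1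
    exact absurd (mem_ball_zero_iff.1 hζ.1) (not_lt.2 h1)
  set f : ℂ → ℂ := fun ζ => -(P.eval ζ⁻¹ / C.sqrtR ζ⁻¹) / ζ ^ 2 with hf
  have hlim : Tendsto f (𝓝[≠] 0) (𝓝 (-c)) := by
    have h1 := (hc.div C.tendsto_sqrtR one_ne_zero).neg.comp (tendsto_inv₀_nhdsNE_zero (α := ℂ))
    rw [div_one] at h1
    refine h1.congr' ?_
    filter_upwards [self_mem_nhdsWithin] with ζ hζ
    have hζ0 : ζ ≠ 0 := hζ
    simp only [Function.comp_apply, Pi.div_apply, hf]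
    by_cases hS : C.sqrtR ζ⁻¹ = 0
    · simp [hS]
    · field_simp
  have hfd : ∀ ζ ∈ Metric.ball (0 : ℂ) M⁻¹ \ {0}, DifferentiableAt ℂ f ζ := fun ζ hζ => by
    have h0 : ζ ≠ 0 := hζ.2
    have h1 : DifferentiableAt ℂ (fun ζ : ℂ => C.sqrtR ζ⁻¹) ζ :=
      DifferentiableAt.comp (g := C.sqrtR) ζ (C.differentiableAt_sqrtR (hinvJ ζ hζ))
        (differentiableAt_inv h0)
    have h2 : DifferentiableAt ℂ (fun ζ : ℂ => P.eval ζ⁻¹) ζ :=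
      DifferentiableAt.comp (g := fun z => P.eval z) ζ P.differentiableAt (differentiableAt_inv h0)
    exact (h2.fun_div h1 (C.sqrtR_ne_zero (hinvJ ζ hζ))).fun_neg.fun_div (by fun_prop)
      (pow_ne_zero 2 h0)
  have hne : ∀ ζ ∈ Metric.ball (0 : ℂ) M⁻¹ \ {0}, Metric.ball (0 : ℂ) M⁻¹ \ {0} ∈ 𝓝 ζ :=
    fun ζ hζ => (Metric.isOpen_ball.sdiff isClosed_singleton).mem_nhds hζ
  have hd : DifferentiableOn ℂ (Function.update f 0 (-c)) (Metric.ball 0 M⁻¹) := by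
    rw [← Complex.differentiableOn_compl_singleton_and_continuousAt_iff (Metric.ball_mem_nhds 0 hr)]
    refine ⟨fun ζ hζ => ((hfd ζ hζ).congr_of_eventuallyEq ?_).differentiableWithinAt,
      continuousAt_update_same.2 hlim⟩
    filter_upwards [hne ζ hζ] with x hx
    exact Function.update_of_ne hx.2 _ _
  obtain ⟨g, hg⟩ := hd.isExactOn_ball
  have hgf : ∀ ζ ∈ Metric.ball (0 : ℂ) M⁻¹ \ {0}, HasDerivAt g (f ζ) ζ := fun ζ hζ =>
    (hg ζ hζ.1).congr_deriv (Function.update_of_ne hζ.2 _ _)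
  obtain ⟨κ, hκ⟩ : ∃ κ : ℝ, ∀ ζ ∈ Metric.ball (0 : ℂ) M⁻¹ \ {0}, u ζ⁻¹ - (g ζ).re = κ := by
    have hmem : ((M⁻¹ / 2 : ℝ) : ℂ) ∈ Metric.ball (0 : ℂ) M⁻¹ \ {0} := by
      refine ⟨?_, by simpa using hM0.ne'⟩
      rw [mem_ball_zero_iff, Complex.norm_real, Real.norm_of_nonneg (by positivity)]
      linarith
    refine ⟨_, fun ζ hζ => isPreconnected_ball_diff_zero.sub_eq_of_hasReDeriv
      (u := fun ζ => u ζ⁻¹) (v := fun ζ => (g ζ).re) (fun x hx => ?_) hζ hmem⟩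
    filter_upwards [hne x hx] with y hy
    refine ⟨f y, ?_, (hgf y hy).hasReDeriv⟩
    have := (hu _ (hinvJ y hy)).comp_complex (hasDerivAt_inv hy.2) rfl
    rw [hf]
    simp only
    convert this using 1
    have hy0 : y ≠ 0 := hy.2
    field_simp
  classical
  -- At ζ = 0 any point of `J` serves as value, since the comparison with u is then void.
  refine ⟨fun ζ => if ζ = 0 then C.pts (Sum.inl 0) else ζ⁻¹, fun ζ => g ζ + (κ : ℂ), ?_, ?_, ?_, ?_, ?_⟩
  · filter_upwards [Metric.ball_mem_nhds 0 hr] with ζ hζ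
    exact (hg ζ hζ).differentiableAt.add_const _
  · filter_upwards [Metric.ball_mem_nhds 0 hr] with ζ hζ
    by_cases h0 : ζ = 0
    · rw [if_pos h0]
      exact fun h => absurd (C.pts_mem_J _) h
    · intro _
      rw [if_neg h0, Complex.add_re, Complex.ofReal_re, ← hκ ζ ⟨hζ, h0⟩]
      ring_nf
  · filter_upwards [Metric.ball_mem_nhds 0 hr] with ζ hζ
    have h1 : ζ ∈ closure ({0}ᶜ : Set ℂ) := by rw [(dense_compl_singleton (0 : ℂ)).closure_eq]; trivial
    refine closure_mono ?_ (Metric.isOpen_ball.inter_closure ⟨hζ, h1⟩)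
    rintro x ⟨hx, hx0⟩
    have hx0' : x ≠ 0 := hx0
    rw [mem_preimage, if_neg hx0']
    exact hinvJ x ⟨hx, hx0⟩
  · intro ε hε
    have h1 : ∀ᶠ z : ℂ in Bornology.cobounded ℂ, ε⁻¹ < ‖z‖ :=
      tendsto_norm_cobounded_atTop.eventually_gt_atTop _
    filter_upwards [h1] with z hz
    have hz0 : z ≠ 0 := norm_pos_iff.1 ((inv_pos.2 hε).trans hz)
    refine ⟨z⁻¹, ?_, by rw [if_neg (inv_ne_zero hz0), inv_inv]⟩
    rw [norm_inv]
    exact inv_lt_of_inv_lt₀ hε hz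
  · filter_upwards [nhdsWithin_le_nhds (Metric.ball_mem_nhds 0 hr), self_mem_nhdsWithin] with ζ hζ h0
    have h0' : ζ ≠ 0 := h0
    refine ⟨-(C.sqrtR ζ⁻¹ * ζ ^ 2)⁻¹, neg_ne_zero.2 (inv_ne_zero (mul_ne_zero
      (C.sqrtR_ne_zero (hinvJ ζ ⟨hζ, h0⟩)) (pow_ne_zero 2 h0'))),
      ((hgf ζ ⟨hζ, h0⟩).add_const _).congr_deriv ?_⟩
    rw [if_neg h0', hf]
    have := C.sqrtR_ne_zero (hinvJ ζ ⟨hζ, h0⟩)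
    field_simp

end CutContour

theorem isOpenMap_const_add_sq (a : ℂ) : IsOpenMap fun v : ℂ => a + v ^ 2 := by
  have h : AnalyticOnNhd ℂ (fun v : ℂ => a + v ^ 2) univ := fun v _ => by fun_prop
  rcases h.is_constant_or_isOpen isPreconnected_univ with ⟨w, hw⟩ | h
  · have h0 := hw 0 trivial
    have h1 := hw 1 trivial
    simp only [ne_eq, OfNat.ofNat_ne_zero, not_false_eq_true, zero_pow, add_zero, one_pow] at h0 h1
    exact absurd (h1.trans h0.symm) (by simp)
  · exact fun s hs => h s (subset_univ _) hs

namespace CutContour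

variable {p n : ℕ} {P : ℂ[X]} {u : ℂ → ℝ}

theorem exists_isModelChart_compl (C : CutContour p n)
    (hu : ∀ z ∉ C.J, HasReDeriv u (P.eval z / C.sqrtR z) z) (κ : ℝ) {z₀ : ℂ} (hz₀ : z₀ ∉ C.J) :
    ∃ φ g, IsModelChart (fun z => u z - κ) C.Jᶜ P (𝓝 z₀) φ g := by
  obtain ⟨ε, hε, hball⟩ := Metric.isOpen_iff.1 C.isClosed_J.isOpen_compl z₀ hz₀
  have hd : DifferentiableOn ℂ (fun w => P.eval w / C.sqrtR w) (Metric.ball z₀ ε) := fun w hw =>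
    (P.differentiableAt.fun_div (C.differentiableAt_sqrtR (hball hw))
      (C.sqrtR_ne_zero (hball hw))).differentiableWithinAt
  obtain ⟨H, hH⟩ := hd.isExactOn_ball
  have hc : ∀ w ∈ Metric.ball z₀ ε, u w - (H w).re = u z₀ - (H z₀).re := fun w hw => by
    refine (convex_ball z₀ ε).isPreconnected.sub_eq_of_hasReDeriv (v := fun z => (H z).re)
      (fun x hx => ?_) hw (Metric.mem_ball_self hε)
    filter_upwards [Metric.isOpen_ball.mem_nhds hx] with y hy
    exact ⟨_, hu y (hball hy), (hH y hy).hasReDeriv⟩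
  have hmem : ∀ᶠ ζ : ℂ in 𝓝 0, z₀ + ζ ∈ Metric.ball z₀ ε := by
    filter_upwards [Metric.ball_mem_nhds 0 hε] with ζ hζ
    simpa using hζ
  have hHd : ∀ ζ, z₀ + ζ ∈ Metric.ball z₀ ε → HasDerivAt
      (fun ζ => H (z₀ + ζ) + ((u z₀ - (H z₀).re - κ : ℝ) : ℂ))
      (P.eval (z₀ + ζ) / C.sqrtR (z₀ + ζ)) ζ := fun ζ hζ =>
    ((hH _ hζ).comp_const_add z₀ ζ).add_const _
  refine ⟨fun ζ => z₀ + ζ, fun ζ => H (z₀ + ζ) + ((u z₀ - (H z₀).re - κ : ℝ) : ℂ),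
    hmem.mono fun ζ h => (hHd ζ h).differentiableAt, ?_, ?_, ?_, ?_⟩
  · filter_upwards [hmem] with ζ hζ _
    rw [Complex.add_re, Complex.ofReal_re, ← hc _ hζ]
    ring_nf
  · exact hmem.mono fun ζ hζ => subset_closure (hball hζ)
  · intro ε hε
    filter_upwards [Metric.ball_mem_nhds z₀ hε] with z hz
    exact ⟨z - z₀, by rwa [← dist_eq_norm], by ring⟩
  · filter_upwards [nhdsWithin_le_nhds hmem] with ζ hζ
    exact ⟨(C.sqrtR (z₀ + ζ))⁻¹, inv_ne_zero (C.sqrtR_ne_zero (hball hζ)),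
      (hHd ζ hζ).congr_deriv (by rw [div_eq_mul_inv, mul_comm])⟩

theorem isModelChart_cut (C : CutContour p n) {z₀ : ℂ} {κ : ℝ} {H : ℂ → ℂ}
    (hH : ∀ᶠ w in 𝓝 z₀, ∃ c ≠ 0, HasDerivAt H (c * P.eval w) w)
    (huH : ∀ᶠ w in 𝓝 z₀, w ∉ C.J → |u w - κ| = |(H w).re|) :
    IsModelChart (fun z => u z - κ) C.Jᶜ P (𝓝 z₀) (fun ζ => z₀ + ζ) (fun ζ => H (z₀ + ζ)) := by
  have ht : Tendsto (fun ζ : ℂ => z₀ + ζ) (𝓝 0) (𝓝 z₀) := by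
    have : Continuous fun ζ : ℂ => z₀ + ζ := by fun_prop
    simpa using this.tendsto 0
  have hd : ∀ᶠ ζ in 𝓝 0, ∃ c ≠ 0, HasDerivAt (fun ζ => H (z₀ + ζ)) (c * P.eval (z₀ + ζ)) ζ := by
    filter_upwards [ht.eventually hH] with ζ ⟨c, hc, h⟩
    exact ⟨c, hc, h.comp_const_add z₀ ζ⟩
  refine ⟨hd.mono fun ζ ⟨c, hc, h⟩ => h.differentiableAt, ht.eventually huH, .of_forall fun ζ => ?_,
    ?_, nhdsWithin_le_nhds hd⟩
  · exact (C.dense_compl_J.preimage (isOpenMap_add_left z₀)) ζ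
  · intro ε hε
    filter_upwards [Metric.ball_mem_nhds z₀ hε] with z hz
    exact ⟨z - z₀, by rwa [← dist_eq_norm], by ring⟩

theorem isModelChart_end (C : CutContour p n) {z₀ : ℂ} {κ : ℝ} {Y : ℂ → ℂ}
    (hY : ∀ᶠ v in 𝓝 0, ∃ c ≠ 0, HasDerivAt Y (c * P.eval (z₀ + v ^ 2)) v)
    (huY : ∀ᶠ v in 𝓝 0, z₀ + v ^ 2 ∉ C.J → |u (z₀ + v ^ 2) - κ| = |(Y v).re|) :
    IsModelChart (fun z => u z - κ) C.Jᶜ P (𝓝 z₀) (fun v => z₀ + v ^ 2) Y := by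
  refine ⟨hY.mono fun ζ ⟨c, hc, h⟩ => h.differentiableAt, huY, .of_forall fun ζ => ?_, ?_,
    nhdsWithin_le_nhds hY⟩
  · exact (C.dense_compl_J.preimage (isOpenMap_const_add_sq z₀)) ζ
  · intro ε hε
    filter_upwards [Metric.ball_mem_nhds z₀ (pow_pos hε 2)] with z hz
    obtain ⟨v, hv⟩ := IsAlgClosed.exists_pow_nat_eq (z - z₀) two_pos
    refine ⟨v, ?_, by rw [hv]; ring⟩
    rw [Metric.mem_ball, dist_eq_norm, ← hv, norm_pow] at hz
    exact lt_of_pow_lt_pow_left₀ 2 hε.le hz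

/-- The sum over all cuts is -1/2 times the residue integral at infinity, which is zero by decay.
This supplies the period over the last cut, which has no equation of its own. -/
theorem sum_integral_density_eq_zero (C : CutContour p n) {w k : ℂ[X]}
    (hP : P = w.derivative * rootPoly C.pts +
      Polynomial.C (1 / 2) * w * (rootPoly C.pts).derivative + k * rootPoly C.pts ^ 2) {c : ℂ}
    (hc : Tendsto (fun z => z ^ 2 * (P.eval z / z ^ (n + 1))) (Bornology.cobounded ℂ) (𝓝 c)) :
    ∑ j, ∫ τ in (C.α j)..(C.β j), C.density k j τ * deriv C.Γ τ = 0 := by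
  have h1 := C.tendsto_circleIntegral_div_sqrtR P
  simp only [C.integral_cut_reduction _ hP] at h1
  have h2 : Tendsto (fun z => z * (P.eval z / C.sqrtR z)) (Bornology.cobounded ℂ) (𝓝 0) := by
    have h3 := (tendsto_inv₀_cobounded (α := ℂ)).mul (hc.div C.tendsto_sqrtR one_ne_zero)
    rw [zero_mul] at h3
    refine h3.congr' ?_
    filter_upwards [C.eventually_cobounded_notMem_J] with z hz
    have hS := C.sqrtR_ne_zero hz.2
    have hz0 := hz.1
    simp only [Pi.div_apply]
    field_simp
  have h3 := tendsto_nhds_unique h1 (tendsto_circleIntegral_zero h2)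
  exact (mul_eq_zero.1 h3).resolve_left (by norm_num)

/-- A differential `P / R^{1/2} dz`, regular at infinity, with purely imaginary periods
vanishes. -/
theorem eq_zero_of_re_integral_eq_zero (C : CutContour p n) {w k : ℂ[X]}
    (hP : P = w.derivative * rootPoly C.pts +
      Polynomial.C (1 / 2) * w * (rootPoly C.pts).derivative + k * rootPoly C.pts ^ 2) {c : ℂ}
    (hc : Tendsto (fun z => z ^ 2 * (P.eval z / z ^ (n + 1))) (Bornology.cobounded ℂ) (𝓝 c))
    (hcut : ∀ j : Fin n, (∫ τ in (C.α j.castSucc)..(C.β j.castSucc),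
      C.density k j.castSucc τ * deriv C.Γ τ).re = 0)
    (hgap : ∀ j : Fin n, (∫ τ in (C.β j.castSucc)..(C.α j.succ),
      k.eval (C.Γ τ) * C.gapRoot j τ ^ 3 * deriv C.Γ τ).re = 0) : P = 0 := by
  have hre : ∀ j, (∫ τ in (C.α j)..(C.β j), C.density k j τ * deriv C.Γ τ).re = 0 := by
    have hsum := congrArg Complex.re (C.sum_integral_density_eq_zero hP hc)
    rw [Fin.sum_univ_castSucc, Complex.add_re, Complex.re_sum, Finset.sum_eq_zero fun j _ => hcut j,
      zero_add, Complex.zero_re] at hsum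
    exact fun j => Fin.lastCases hsum hcut j
  obtain ⟨u, hu⟩ := C.exists_re_primitive hP hre
  choose κe Y hlim hY₁ hY₂ using C.exists_end_value hu
  choose κc hκc using C.exists_cut_value hu
  have hα : ∀ j, κc j = κe (Sum.inl j) := fun j =>
    C.cut_value_eq_end_value (τe := C.α j) (left_mem_Icc.2 (C.α_lt_β j).le) (hlim (Sum.inl j))
      fun τ hτ => (hκc j τ hτ).2
  have hβ : ∀ j, κc j = κe (Sum.inr j) := fun j =>
    C.cut_value_eq_end_value (τe := C.β j) (right_mem_Icc.2 (C.α_lt_β j).le) (hlim (Sum.inr j))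
      fun τ hτ => (hκc j τ hτ).2
  have hgapκ : ∀ j : Fin n, κe (Sum.inr j.castSucc) = κe (Sum.inl j.succ) := fun j =>
    C.end_values_gap_eq hu hP (hgap j) (hlim (Sum.inr _)) (hlim (Sum.inl _))
  -- The constants agree from cut to cut: cut, its end, gap, next end, next cut. So one constant
  -- serves on all of `J`.
  have hκ : ∀ j, κc j = κc 0 := fun j => by
    induction j using Fin.induction with
    | zero => rfl
    | succ j ih => rw [← ih, hα j.succ, ← hgapκ, ← hβ]
  by_contra hP0
  -- With this constant subtracted, |u| is modelled by |Re g| around every point of the sphere, and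
  -- `P ≠ 0` would make every model nonconstant.
  refine not_forall_isLocalModel (u := fun z => u z - κc 0) (s := C.Jᶜ)
    C.dense_compl_J.nonempty fun l hl => ?_
  suffices H : ∃ φ g, IsModelChart (fun z => u z - κc 0) C.Jᶜ P l φ g by
    obtain ⟨φ, g, h⟩ := H
    refine ⟨g, h.isLocalModel, h.not_eventually_deriv_eq_zero hP0 fun F hF hFl => ?_⟩
    rcases hl with rfl | ⟨z, rfl⟩
    · have h1 : F ∩ Fᶜ ∈ Bornology.cobounded ℂ := inter_mem hFl (Bornology.isBounded_def.1 hF.isBounded)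
      rw [inter_compl_self] at h1
      exact (NeBot.ne inferInstance) (empty_mem_iff_bot.1 h1)
    · exact (infinite_of_mem_nhds z hFl) hF
  rcases hl with rfl | ⟨z, rfl⟩
  · refine C.exists_isModelChart_cobounded (fun z hz => ?_) hc
    exact HasFDerivAt.sub_const _ (hu z hz)
  · by_cases hz : z ∈ C.J
    · obtain ⟨j, τ, hτ, rfl⟩ := mem_iUnion.1 hz
      rcases eq_endpoints_or_mem_Ioo_of_mem_Icc hτ with h | h | h
      · rw [← hκ j, hα, h]
        exact ⟨_, _, C.isModelChart_end (hY₁ (Sum.inl j)) (hY₂ (Sum.inl j))⟩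
      · rw [← hκ j, hβ, h]
        exact ⟨_, _, C.isModelChart_end (hY₁ (Sum.inr j)) (hY₂ (Sum.inr j))⟩
      · obtain ⟨⟨H, h1, h2⟩, -⟩ := hκc j τ h
        rw [← hκ j]
        exact ⟨_, _, C.isModelChart_cut h1 h2⟩
    · exact C.exists_isModelChart_compl hu _ hz

end CutContour

/-! ### The implicit function theorem and its nondegeneracy. -/

/-- Real-analytic implicit function theorem with equal dimensions. -/
theorem exists_analytic_implicit {E Y Z : Type*} [NormedAddCommGroup E] [NormedSpace ℝ E]
    [CompleteSpace E] [NormedAddCommGroup Y] [NormedSpace ℝ Y] [FiniteDimensional ℝ Y]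
    [NormedAddCommGroup Z] [NormedSpace ℝ Z] [FiniteDimensional ℝ Z] {F : E × Y → Z} {t₀ : E} {y₀ : Y}
    (hF : AnalyticAt ℝ F (t₀, y₀)) (h0 : F (t₀, y₀) = 0)
    (hdim : Module.finrank ℝ Y = Module.finrank ℝ Z)
    (hinj : ∀ d, fderiv ℝ F (t₀, y₀) (0, d) = 0 → d = 0) :
    ∃ ψ : E → Y, AnalyticAt ℝ ψ t₀ ∧ ψ t₀ = y₀ ∧
      ∀ᶠ x in 𝓝 (t₀, y₀), F x = 0 ↔ x.2 = ψ x.1 := by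
  have : CompleteSpace Y := FiniteDimensional.complete ℝ Y
  have : CompleteSpace Z := FiniteDimensional.complete ℝ Z
  have hcd : ContDiffAt ℝ ⊤ F (t₀, y₀) := hF.contDiffAt
  set L : Y →L[ℝ] Z := fderiv ℝ F (t₀, y₀) ∘L .inr ℝ E Y with hL
  have hLinj : Function.Injective L := (injective_iff_map_eq_zero L).2 fun d hd => hinj d hd
  have hinv : L.IsInvertible :=
    ⟨(LinearEquiv.ofInjectiveOfFinrankEq L.toLinearMap hLinj hdim).toContinuousLinearEquiv, by
      ext d; rfl⟩
  have hne : (⊤ : WithTop ℕ∞) ≠ 0 := by simp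
  refine ⟨hcd.implicitFunction hne hinv,
    (hcd.contDiffAt_implicitFunction hne hinv).analyticAt,
    hcd.implicitFunction_apply_self hne hinv, ?_⟩
  filter_upwards [hcd.eventually_apply_eq_iff_implicitFunction hne hinv] with x hx
  rw [← h0, hx, eq_comm]

/-- At the root `y k` only the variation of its own factor survives; the cofactor is nonzero for
distinct roots, so the variation of R at `y k` detects the motion of this root. -/
theorem hasDerivAt_eval_rootPoly {ι : Type*} [Fintype ι] [DecidableEq ι] (y d : ι → ℂ) (k : ι) :
    HasDerivAt (fun s : ℂ => (rootPoly (y + s • d)).eval (y k))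
      (-d k * ∏ i ∈ Finset.univ.erase k, (y k - y i)) 0 := by
  have h1 : ∀ s : ℂ, (rootPoly (y + s • d)).eval (y k) =
      (-s * d k) * ∏ i ∈ Finset.univ.erase k, (y k - (y i + s * d i)) := fun s => by
    rw [eval_rootPoly, ← Finset.mul_prod_erase _ _ (Finset.mem_univ k)]
    simp
  have h2 : DifferentiableAt ℂ (fun s : ℂ =>
      ∏ i ∈ Finset.univ.erase k, (y k - (y i + s * d i))) 0 :=
    DifferentiableAt.fun_finsetProd fun i _ => by fun_prop
  have h3 : HasDerivAt (fun s : ℂ => -s * d k) (-1 * d k) 0 := (hasDerivAt_neg 0).mul_const _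
  refine ((h3.fun_mul h2.hasDerivAt).congr_of_eventuallyEq (.of_forall h1)).congr_deriv ?_
  simp

namespace CutContour

variable {p n : ℕ}

/-- A variation of the endpoints which preserves the endpoint equations to first order is trivial. -/
theorem variation_eq_zero (C : CutContour p n) (hp : 1 ≤ p) {t : Fin (2 * p - 1) → ℂ}
    (hh : ∀ z ∈ C.J, C.h t z ≠ 0) (d : Fin (n + 1) ⊕ Fin (n + 1) → ℂ)
    (h0 : ∀ l ≤ n, PowerSeries.coeff (2 * p - 1 - n + l) (fieldSeries p t C.pts) = 0)
    (h1 : ∀ l ≤ n + 1, HasDerivAt (fun s : ℂ =>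
      PowerSeries.coeff (2 * p - 1 - n + l) (fieldSeries p t (C.pts + s • d))) 0 0)
    (hI : ∀ f r : PowerSeries ℂ,
        HasCoeffDerivAt (fun s => fieldSeries p t (C.pts + s • d)) f 0 →
        HasCoeffDerivAt (fun s => (revRootPoly (C.pts + s • d) : PowerSeries ℂ)) r 0 →
        ∀ w k : ℂ[X], polyPart (2 * p - 1 - (n + 1)) f * rootPoly C.pts +
            Polynomial.C (1 / 2) * hPoly p n t C.pts * polyPart (2 * n + 2) r =
          w.derivative * rootPoly C.pts + Polynomial.C (1 / 2) * w * (rootPoly C.pts).derivative +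
            k * rootPoly C.pts ^ 2 →
        ∀ j : Fin n, (∫ τ in (C.α j.castSucc)..(C.β j.castSucc),
            k.eval (C.Γ τ) * C.cutRoot j.castSucc τ ^ 3 * deriv C.Γ τ).re = 0 ∧
          (∫ τ in (C.β j.castSucc)..(C.α j.succ),
            k.eval (C.Γ τ) * C.gapRoot j τ ^ 3 * deriv C.Γ τ).re = 0) : d = 0 := by
  classical
  have hn := C.le_of_h_ne_zero hp hh
  have hι : Fintype.card (Fin (n + 1) ⊕ Fin (n + 1)) = 2 * n + 2 := by
    rw [Fintype.card_sum, Fintype.card_fin]; ring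
  obtain ⟨f, r, hf, hr, c, hc⟩ := exists_variation hn hι t C.pts d h0 h1
  set P : ℂ[X] := polyPart (2 * p - 1 - (n + 1)) f * rootPoly C.pts +
    Polynomial.C (1 / 2) * hPoly p n t C.pts * polyPart (2 * n + 2) r with hPdef
  obtain ⟨w, k, hwk⟩ := exists_reduction C.pts_injective P
  have hint := hI f r hf hr w k hwk
  have hP0 : P = 0 := C.eq_zero_of_re_integral_eq_zero hwk hc (fun j => (hint j).1)
    fun j => (hint j).2
  funext e
  -- At an endpoint the term of P with R drops out, and h is nonzero there: the variation of R must
  -- vanish.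
  have he : (polyPart (2 * n + 2) r).eval (C.pts e) = 0 := by
    have h2 := congrArg (Polynomial.eval (C.pts e)) hP0
    rw [hPdef] at h2
    simp only [Polynomial.eval_add, Polynomial.eval_mul, Polynomial.eval_C, eval_rootPoly_self,
      mul_zero, zero_add, Polynomial.eval_zero] at h2
    have h3 := hh _ (C.pts_mem_J e)
    rw [C.h_eq hp hn] at h3
    exact (mul_eq_zero.1 h2).resolve_left (mul_ne_zero (by norm_num) h3)
  have hd1 := hasDerivAt_eval_rootPoly C.pts d e
  have hd2 : HasDerivAt (fun s : ℂ => (rootPoly (C.pts + s • d)).eval (C.pts e))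
      ((polyPart (2 * n + 2) r).eval (C.pts e)) 0 := by
    simp only [polyPart_revRootPoly, hι]
    simpa only [mul_zero, add_zero] using
      hasDerivAt_polyPart hr (2 * n + 2) (hasDerivAt_const (0 : ℂ) (C.pts e))
  have h4 := hd1.unique hd2
  rw [he] at h4
  refine neg_eq_zero.1 ((mul_eq_zero.1 h4).resolve_right (Finset.prod_ne_zero_iff.2 fun i hi => ?_))
  exact sub_ne_zero.2 fun h => Finset.ne_of_mem_erase hi (C.pts_injective h).symm

end CutContour

namespace CutContour

variable {p n : ℕ}

/-- Real parts of the integrals of `h R^{1/2}` along the cuts and gaps of a contour close to `C₀` are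
encoded by functions of the parameters and the endpoints alone. -/
theorem exists_integral_functions (C₀ : CutContour p n) (t₀ : Fin (2 * p - 1) → ℂ)
    {u v : ℝ} (huv : u < v) {S₀ : ℝ → ℂ}
    (H : IsRootPath C₀.pts u v C₀.Γ (deriv C₀.Γ) S₀) {e₁ e₂ : Fin (n + 1) ⊕ Fin (n + 1)}
    (he₁ : C₀.Γ u = C₀.pts e₁) (he₂ : C₀.Γ v = C₀.pts e₂) (he : e₁ ≠ e₂)
    (hne : ∀ τ ∈ Ioo u v, ∀ k, C₀.Γ τ ≠ C₀.pts k) :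
    ∃ I : (Fin (2 * p - 1) → ℂ) × (Fin (n + 1) ⊕ Fin (n + 1) → ℂ) → ℂ,
      AnalyticAt ℂ I (t₀, C₀.pts) ∧
      (∃ δ > 0, ∀ᶠ x in 𝓝 (t₀, C₀.pts), ∀ z z' S, IsRootPath x.2 u v z z' S →
        (∀ τ ∈ Icc u v, ‖z τ - C₀.Γ τ‖ < δ) → z u = x.2 e₁ → z v = x.2 e₂ →
        ((∫ τ in u..v, (hPoly p n x.1 x.2).eval (z τ) * S τ * z' τ).re = 0 ↔ (I x).re = 0)) ∧
      ∀ (d : Fin (n + 1) ⊕ Fin (n + 1) → ℂ) (f r : PowerSeries ℂ),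
        HasCoeffDerivAt (fun s => fieldSeries p t₀ (C₀.pts + s • d)) f 0 →
        HasCoeffDerivAt (fun s => (revRootPoly (C₀.pts + s • d) : PowerSeries ℂ)) r 0 →
        ∀ w k : ℂ[X],
        polyPart (2 * p - 1 - (n + 1)) f * rootPoly C₀.pts +
            Polynomial.C (1 / 2) * hPoly p n t₀ C₀.pts * polyPart (2 * n + 2) r =
          w.derivative * rootPoly C₀.pts + Polynomial.C (1 / 2) * w * (rootPoly C₀.pts).derivative +
            k * rootPoly C₀.pts ^ 2 →
        HasDerivAt (fun s : ℂ => I (t₀, C₀.pts + s • d))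
          (∫ τ in u..v, k.eval (C₀.Γ τ) * S₀ τ ^ 3 * deriv C₀.Γ τ) 0 := by
  have hι : Fintype.card (Fin (n + 1) ⊕ Fin (n + 1)) = 2 * n + 2 := by
    rw [Fintype.card_sum, Fintype.card_fin]; ring
  obtain ⟨I, hIa, hI, hId⟩ := exists_reference_integral p n t₀ C₀.pts_injective huv H he₁ he₂ he hι
  obtain ⟨δ, hδ, hcmp⟩ := exists_integral_comparison C₀.pts_injective huv H.continuousOn he₁ he₂ hne
  refine ⟨I, hIa, ⟨δ, hδ, ?_⟩, hId⟩
  have hy : ∀ᶠ x : (Fin (2 * p - 1) → ℂ) × (Fin (n + 1) ⊕ Fin (n + 1) → ℂ) in 𝓝 (t₀, C₀.pts),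
      ∀ k, ‖x.2 k - C₀.pts k‖ < δ := by
    refine eventually_all.2 fun k => ?_
    have hc : Continuous fun x : (Fin (2 * p - 1) → ℂ) × (Fin (n + 1) ⊕ Fin (n + 1) → ℂ) =>
      ‖x.2 k - C₀.pts k‖ := by fun_prop
    exact hc.continuousAt.eventually_lt_const (by simpa using hδ)
  filter_upwards [hI δ hδ, hy] with x ⟨z₂, z₂', S₂, hz₂, hcl₂, hu₂, hv₂, hIx⟩ hxy z z' S hz hcl hu hv
  rw [hIx]
  rcases hcmp x.2 hxy (hPoly p n x.1 x.2) z z' S z₂ z₂' S₂ hz hz₂ hcl hcl₂ hu hu₂ hv hv₂ with h | h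
  · rw [h]
  · rw [h, Complex.neg_re, neg_eq_zero]

/-- The endpoint equations define the endpoints as an analytic function of the parameters. -/
theorem exists_solution (C₀ : CutContour p n) (hp : 1 ≤ p) {t₀ : Fin (2 * p - 1) → ℂ}
    (h₀ : C₀.endpointMap t₀ = 0) (hh : ∀ z ∈ C₀.J, C₀.h t₀ z ≠ 0) :
    ∃ ψ : (Fin (2 * p - 1) → ℂ) → Fin (n + 1) ⊕ Fin (n + 1) → ℂ, AnalyticAt ℝ ψ t₀ ∧
      ψ t₀ = C₀.pts ∧ ∃ δ > 0, ∀ᶠ x in 𝓝 (t₀, C₀.pts), ∀ C : CutContour p n, C.CloseTo C₀ δ →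
        C.pts = x.2 → (C.endpointMap x.1 = 0 ↔ x.2 = ψ x.1) := by
  have hn := C₀.le_of_h_ne_zero hp hh
  choose I hIa hI hId using fun j => C₀.exists_integral_functions t₀ (C₀.α_lt_β j)
    (C₀.isRootPath_cut j) (e₁ := Sum.inl j) (e₂ := Sum.inr j) rfl rfl (by simp)
    fun τ hτ k => C₀.ne_pts_of_mem_cut hτ k
  choose I' hIa' hI' hId' using fun j : Fin n => C₀.exists_integral_functions t₀ (C₀.β_lt_α j)
    (C₀.isRootPath_gap j) (e₁ := Sum.inr j.castSucc) (e₂ := Sum.inl j.succ) rfl rfl (by simp)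
    fun τ hτ k => C₀.ne_pts_of_mem_gap hτ k
  choose δ₁ hδ₁ hev₁ using hI
  choose δ₂ hδ₂ hev₂ using hI'
  let X := (Fin (2 * p - 1) → ℂ) × (Fin (n + 1) ⊕ Fin (n + 1) → ℂ)
  -- Values rescaled by -πi, so that the last target is 2. Together with the real parts of `I` and
  -- `I'` they form a map that no longer refers to a contour.
  let M : Fin (n + 2) → X → ℂ := fun l x =>
    PowerSeries.coeff (2 * p - 1 - n + l) (fieldSeries p x.1 x.2) - if (l : ℕ) = n + 1 then 2 else 0
  have hMa : ∀ l x, AnalyticAt ℂ (M l) x := fun l x =>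
    (analyticAt_coeff_fieldSeries p _ x).fun_sub analyticAt_const
  let F : X → (Fin (n + 2) → ℂ) × (Fin n → ℝ) × (Fin n → ℝ) := fun x =>
    (fun l => M l x, fun j => (I j.castSucc x).re, fun j => (I' j x).re)
  have hFa : AnalyticAt ℝ F (t₀, C₀.pts) := by
    refine AnalyticAt.prod ?_ (AnalyticAt.prod ?_ ?_)
    · exact analyticAt_pi_iff.2 fun l => (hMa l _).restrictScalars
    · exact analyticAt_pi_iff.2 fun j => (Complex.reCLM.analyticAt _).comp
        ((hIa j.castSucc).restrictScalars (𝕜 := ℝ))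
    · exact analyticAt_pi_iff.2 fun j => (Complex.reCLM.analyticAt _).comp
        ((hIa' j).restrictScalars (𝕜 := ℝ))
  have hF0 : ∀ x : X, F x = 0 ↔ (∀ l ≤ n + 1,
      PowerSeries.coeff (2 * p - 1 - n + l) (fieldSeries p x.1 x.2) =
        if l = n + 1 then 2 else 0) ∧ ∀ j : Fin n, (I j.castSucc x).re = 0 ∧ (I' j x).re = 0 := by
    intro x
    simp only [F, M, Prod.mk_eq_zero, funext_iff, Pi.zero_apply, sub_eq_zero, forall_and]
    exact and_congr_left' ⟨fun h l hl => h ⟨l, by omega⟩, fun h l => h l (by omega)⟩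
  have hkey : ∃ δ > 0, ∀ᶠ x in 𝓝 (t₀, C₀.pts), ∀ C : CutContour p n, C.CloseTo C₀ δ →
      C.pts = x.2 → (C.endpointMap x.1 = 0 ↔ F x = 0) := by
    obtain ⟨δ, hδ, hδle⟩ : ∃ δ > 0, (∀ j, δ ≤ δ₁ j) ∧ ∀ j, δ ≤ δ₂ j := by
      have h1 : ∀ᶠ δ : ℝ in 𝓝[>] 0, (∀ j, δ ≤ δ₁ j) ∧ ∀ j, δ ≤ δ₂ j :=
        (eventually_all.2 fun j => mem_of_superset (Ioo_mem_nhdsGT (hδ₁ j)) fun δ h => h.2.le).and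
          (eventually_all.2 fun j => mem_of_superset (Ioo_mem_nhdsGT (hδ₂ j)) fun δ h => h.2.le)
      obtain ⟨δ, h2, h3⟩ := (h1.and self_mem_nhdsWithin).exists
      exact ⟨δ, h3, h2⟩
    refine ⟨δ, hδ, ?_⟩
    filter_upwards [eventually_all.2 hev₁, eventually_all.2 hev₂] with x hx₁ hx₂ C hC hCx
    obtain ⟨hα, hβ, hcl, -⟩ := hC
    rw [C.endpointMap_eq_zero_iff hp hn, hF0, hCx]
    refine and_congr_right' (forall_congr' fun j => and_congr ?_ ?_)
    · have hroot := C.isRootPath_cut j.castSucc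
      rw [hCx, hα, hβ] at hroot
      rw [hα, hβ]
      refine hx₁ j.castSucc _ _ _ hroot (fun τ _ => (hcl τ).trans_le (hδle.1 _)) ?_ ?_
      · rw [← hCx, ← hα]; rfl
      · rw [← hCx, ← hβ]; rfl
    · have hroot := C.isRootPath_gap j
      rw [hCx, hα, hβ] at hroot
      rw [hα, hβ]
      refine hx₂ j _ _ _ hroot (fun τ _ => (hcl τ).trans_le (hδle.2 _)) ?_ ?_
      · rw [← hCx, ← hβ]; rfl
      · rw [← hCx, ← hα]; rfl
  obtain ⟨δ, hδ, hkey⟩ := hkey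
  have hFx₀ : F (t₀, C₀.pts) = 0 := by
    refine (hkey.self_of_nhds C₀ ⟨rfl, rfl, fun τ => ?_, fun j τ _ => ?_⟩ rfl).1 h₀
    · rwa [sub_self, norm_zero]
    · rwa [sub_self, norm_zero]
  -- Both sides have real dimension 4(n + 1): on the right 2(n + 2) from the moments and 2n from the
  -- real parts.
  have hdim : Module.finrank ℝ (Fin (n + 1) ⊕ Fin (n + 1) → ℂ) =
      Module.finrank ℝ ((Fin (n + 2) → ℂ) × (Fin n → ℝ) × (Fin n → ℝ)) := by
    simp only [Module.finrank_prod, Module.finrank_pi_fintype, Complex.finrank_real_complex,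
      Finset.sum_const, Finset.card_univ, Fintype.card_sum, Fintype.card_fin, Module.finrank_self,
      smul_eq_mul]
    ring
  have hcoef := ((hF0 _).1 hFx₀).1
  have hinj : ∀ d, fderiv ℝ F (t₀, C₀.pts) (0, d) = 0 → d = 0 := by
    intro d hd
    have hline : HasDerivAt (fun s : ℝ => F (t₀, C₀.pts + s • d)) 0 0 := by
      have h1 : HasDerivAt (fun s : ℝ => (t₀, C₀.pts + s • d)) (0, d) 0 := by
        have := ((hasDerivAt_id (0 : ℝ)).smul_const d).const_add C₀.pts
        rw [one_smul] at this
        exact (hasDerivAt_const (0 : ℝ) t₀).prodMk this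
      have h2 := hFa.differentiableAt.hasFDerivAt.comp_hasDerivAt_of_eq (0 : ℝ) h1 (by simp)
      rwa [hd] at h2
    have hM0 : ∀ l, HasDerivAt (fun s : ℝ => M l (t₀, C₀.pts + s • d)) 0 0 := fun l =>
      hasDerivAt_pi.1 hline.fst l
    have hI0 : ∀ j : Fin n, HasDerivAt (fun s : ℝ => (I j.castSucc (t₀, C₀.pts + s • d)).re) 0 0 :=
      fun j => hasDerivAt_pi.1 hline.snd.fst j
    have hI0' : ∀ j : Fin n, HasDerivAt (fun s : ℝ => (I' j (t₀, C₀.pts + s • d)).re) 0 0 :=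
      fun j => hasDerivAt_pi.1 hline.snd.snd j
    have hre : ∀ {A : X → ℂ} {D : ℂ}, HasDerivAt (fun s : ℂ => A (t₀, C₀.pts + s • d)) D 0 →
        HasDerivAt (fun s : ℝ => A (t₀, C₀.pts + s • d)) D 0 := fun {A D} h => by
      have := HasDerivAt.comp_ofReal (z := (0 : ℝ)) (by simpa using h)
      simpa only [Complex.coe_smul] using this
    refine C₀.variation_eq_zero hp hh d (fun l hl => ?_) (fun l hl => ?_) ?_
    · rw [hcoef l (by omega), if_neg (by omega)]
    -- The coefficients are holomorphic in the endpoints. Their complex derivative exists, and it is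
    -- identified as zero by restriction to real `s`.
    · have h3 : DifferentiableAt ℂ (fun s : ℂ => M ⟨l, by omega⟩ (t₀, C₀.pts + s • d)) 0 :=
        (differentiableAt_coeff_fieldSeries p _ t₀ C₀.pts d).sub_const _
      have h4 := (hre h3.hasDerivAt).unique (hM0 ⟨l, by omega⟩)
      have h5 := h3.hasDerivAt
      rw [h4] at h5
      refine (h5.add_const (if l = n + 1 then (2 : ℂ) else 0)).congr_of_eventuallyEq
        (.of_forall fun s => ?_)
      simp only [M, sub_add_cancel]
    · intro f r hf hr w k hwk j
      constructor
      · exact (Complex.reCLM.hasFDerivAt.comp_hasDerivAt _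
          (hre (hId j.castSucc d f r hf hr w k hwk))).unique (hI0 j)
      · exact (Complex.reCLM.hasFDerivAt.comp_hasDerivAt _
          (hre (hId' j d f r hf hr w k hwk))).unique (hI0' j)
  obtain ⟨ψ, hψ, hψ0, hev⟩ := exists_analytic_implicit hFa hFx₀ hdim hinj
  refine ⟨ψ, hψ, hψ0, δ, hδ, ?_⟩
  filter_upwards [hkey, hev] with x h1 h2 C hC hCx
  rw [h1 C hC hCx, h2]

end CutContour

/-! ### Deformations of contours with prescribed endpoints. -/

namespace CutContour

variable {p n : ℕ}

/-- The derivative of `g` has norm at most 1/2, so it cannot cancel the velocity of the arc. -/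
theorem contDiffOn_perturb {γ : ℝ → ℂ} {g : ℂ → ℂ} (hg : ContDiff ℝ 1 g)
    (hL : LipschitzWith (1 / 2) g) {x y : ℝ} (hxy : x < y) (h : ContDiffOn ℝ 1 γ (Icc x y) ∧
      ∀ τ ∈ Icc x y, derivWithin γ (Icc x y) τ ≠ 0) :
    ContDiffOn ℝ 1 (fun τ => γ τ + g (γ τ)) (Icc x y) ∧
      ∀ τ ∈ Icc x y, derivWithin (fun τ => γ τ + g (γ τ)) (Icc x y) τ ≠ 0 := by
  refine ⟨h.1.add (hg.comp_contDiffOn h.1), fun τ hτ => ?_⟩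
  have h1 := (h.1.differentiableOn one_ne_zero τ hτ).hasDerivWithinAt
  have h2 := ((hg.differentiable one_ne_zero) (γ τ)).hasFDerivAt.comp_hasDerivWithinAt τ h1
  have h6 : HasDerivWithinAt (fun τ => γ τ + g (γ τ)) _ (Icc x y) τ := h1.fun_add h2
  rw [h6.derivWithin (uniqueDiffOn_Icc hxy τ hτ)]
  intro h0
  have h3 := (fderiv ℝ g (γ τ)).le_of_opNorm_le (norm_fderiv_le_of_lipschitz ℝ hL)
    (derivWithin γ (Icc x y) τ)
  rw [add_eq_zero_iff_eq_neg] at h0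
  have h4 := congrArg norm h0
  rw [norm_neg] at h4
  have h5 := norm_pos_iff.2 (h.2 τ hτ)
  rw [← h4] at h3
  push_cast at h3
  linarith

/-- The image of a contour under a small perturbation of the identity with bounded support. -/
def perturb (C : CutContour p n) (g : ℂ → ℂ) (hg : ContDiff ℝ 1 g) (hL : LipschitzWith (1 / 2) g)
    (hM : ∃ M : ℝ, ∀ z, M ≤ ‖z‖ → g z = 0) : CutContour p n where
  Γ τ := C.Γ τ + g (C.Γ τ)
  α := C.α
  β := C.β
  continuous := C.continuous.add (hL.continuous.comp C.continuous)
  injective τ τ' h := by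
    refine C.injective (sub_eq_zero.1 (norm_le_zero_iff.1 ?_))
    have h1 := hL.norm_sub_le (C.Γ τ) (C.Γ τ')
    have h2 : g (C.Γ τ) - g (C.Γ τ') = -(C.Γ τ - C.Γ τ') := by linear_combination h
    rw [h2, norm_neg] at h1
    push_cast at h1
    linarith
  piecewise_C1 := by
    obtain ⟨P, hP, h⟩ := C.piecewise_C1
    exact ⟨P, hP, fun x y hxy hd => contDiffOn_perturb hg hL hxy (h x y hxy hd)⟩
  sectors := by
    obtain ⟨M, hM⟩ := hM
    obtain ⟨ε, h1, h2, h⟩ := C.sectors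
    refine ⟨ε, h1, h2, fun r => ?_⟩
    obtain ⟨τ₀, τ₁, h3, h4, h5⟩ := h (max r M)
    refine ⟨τ₀, τ₁, h3, fun τ hτ => ?_, fun τ hτ => ?_⟩
    · rw [hM _ ((le_max_right _ _).trans (h4 τ hτ).2), add_zero]
      exact ⟨(h4 τ hτ).1, (le_max_left _ _).trans (h4 τ hτ).2⟩
    · rw [hM _ ((le_max_right _ _).trans (h5 τ hτ).2), add_zero]
      exact ⟨(h5 τ hτ).1, (le_max_left _ _).trans (h5 τ hτ).2⟩
  α_lt_β := C.α_lt_β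
  β_lt_α := C.β_lt_α
  cut_C1 j := contDiffOn_perturb hg hL (C.α_lt_β j) (C.cut_C1 j)

/-- Bump functions separating the endpoints allow each of them to be moved without disturbing the
others. -/
theorem exists_bump {ι : Type*} [Fintype ι] {y : ι → ℂ} (hy : Function.Injective y) (k : ι) :
    ∃ b : ℂ → ℝ, ContDiff ℝ 1 b ∧ HasCompactSupport b ∧ b (y k) = 1 ∧ (∀ i, i ≠ k → b (y i) = 0) ∧
      ∀ z, |b z| ≤ 1 := by
  have h1 : ∀ᶠ ρ : ℝ in 𝓝[>] 0, ∀ i, i ≠ k → ρ ≤ dist (y i) (y k) := by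
    refine eventually_all.2 fun i => ?_
    by_cases hi : i = k
    · exact .of_forall fun _ h => absurd hi h
    · have h1 : 0 < dist (y i) (y k) := dist_pos.2 fun h => hi (hy h)
      filter_upwards [Ioo_mem_nhdsGT h1] with ρ hρ _ using hρ.2.le
  obtain ⟨ρ, h2, h3⟩ := (h1.and self_mem_nhdsWithin).exists
  have hρ : 0 < ρ := h3
  let f : ContDiffBump (y k) := ⟨ρ / 2, ρ, by positivity, by linarith⟩
  refine ⟨f, f.contDiff, f.hasCompactSupport, f.one_of_mem_closedBall
    (Metric.mem_closedBall_self f.rIn_pos.le), fun i hi => f.zero_of_le_dist (h2 i hi), fun z => ?_⟩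
  rw [abs_of_nonneg f.nonneg]
  exact f.le_one

/-- The endpoints of a contour can be moved arbitrarily by small deformations. -/
theorem exists_deformation (C₀ : CutContour p n) {δ : ℝ} (hδ : 0 < δ) :
    ∃ ε > 0, ∀ y : Fin (n + 1) ⊕ Fin (n + 1) → ℂ, (∀ k, ‖y k - C₀.pts k‖ < ε) →
      ∃ C : CutContour p n, C.CloseTo C₀ δ ∧ C.pts = y := by
  choose b hb hbs hb1 hb0 hble using fun k => exists_bump C₀.pts_injective k
  choose K hK using fun k => ContDiff.lipschitzWith_of_hasCompactSupport (hbs k) (hb k) one_ne_zero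
  choose M hM using fun k => (hbs k).isCompact.isBounded.exists_norm_le
  choose D hD0 hD using C₀.exists_bound_deriv
  -- The three bounds give the Lipschitz constant 1/2 of the perturbation, uniform closeness, and
  -- closeness of the derivatives on the cuts.
  obtain ⟨ε, hε, h1, h2, h3⟩ : ∃ ε : ℝ, 0 < ε ∧ (∑ k, (K k : ℝ)) * ε ≤ 1 / 2 ∧
      (Fintype.card (Fin (n + 1) ⊕ Fin (n + 1)) : ℝ) * ε < δ ∧
      ∀ j, (∑ k, (K k : ℝ)) * ε * D j < δ := by
    have hev : ∀ {a c : ℝ}, 0 < c → ∀ᶠ ε : ℝ in 𝓝[>] 0, a * ε < c := fun {a c} hc => by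
      have : Continuous fun ε : ℝ => a * ε := by fun_prop
      exact nhdsWithin_le_nhds (this.continuousAt.eventually_lt_const (by simpa using hc))
    have hev3 : ∀ᶠ ε : ℝ in 𝓝[>] 0, ∀ j, (∑ k, (K k : ℝ)) * ε * D j < δ :=
      eventually_all.2 fun j => (hev (a := (∑ k, (K k : ℝ)) * D j) hδ).mono fun ε h => by linarith
    obtain ⟨ε, ⟨⟨h1, h2⟩, h3⟩, h4⟩ := ((((hev (a := ∑ k, (K k : ℝ)) (half_pos one_pos)).and
      (hev (a := (Fintype.card (Fin (n + 1) ⊕ Fin (n + 1)) : ℝ)) hδ)).and hev3).and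
      self_mem_nhdsWithin).exists
    exact ⟨ε, h4, h1.le, h2, h3⟩
  refine ⟨ε, hε, fun y hy => ?_⟩
  -- The sum of the bumps times the required displacements; at each endpoint only its own bump
  -- contributes.
  set g : ℂ → ℂ := fun z => ∑ k, (b k z : ℂ) * (y k - C₀.pts k) with hg
  have hgd : ContDiff ℝ 1 g := ContDiff.sum fun k _ =>
    (Complex.ofRealCLM.contDiff.comp (hb k)).mul contDiff_const
  have hgL : ∀ z w, ‖g z - g w‖ ≤ (∑ k, (K k : ℝ)) * ε * ‖z - w‖ := by
    intro z w
    rw [hg, ← Finset.sum_sub_distrib, Finset.sum_mul, Finset.sum_mul]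
    refine (norm_sum_le _ _).trans (Finset.sum_le_sum fun k _ => ?_)
    rw [← sub_mul, norm_mul, ← Complex.ofReal_sub, Complex.norm_real]
    calc _ ≤ (K k * ‖z - w‖) * ε :=
          mul_le_mul ((hK k).norm_sub_le z w) (hy k).le (norm_nonneg _) (by positivity)
      _ = _ := by ring
  have hL : LipschitzWith (1 / 2) g := by
    refine LipschitzWith.of_dist_le_mul fun z w => ?_
    rw [dist_eq_norm, dist_eq_norm]
    refine (hgL z w).trans (mul_le_mul_of_nonneg_right ?_ (norm_nonneg _))
    push_cast
    exact h1
  have hgM : ∃ M : ℝ, ∀ z, M ≤ ‖z‖ → g z = 0 := by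
    refine ⟨∑ k, |M k| + 1, fun z hz => Finset.sum_eq_zero fun k _ => ?_⟩
    have : b k z = 0 := by
      by_contra h
      have h4 := hM k z (subset_tsupport _ h)
      have h5 := Finset.single_le_sum (f := fun k => |M k|) (fun i _ => abs_nonneg (M i))
        (Finset.mem_univ k)
      linarith [le_abs_self (M k)]
    rw [this, Complex.ofReal_zero, zero_mul]
  refine ⟨C₀.perturb g hgd hL hgM, ⟨rfl, rfl, fun τ => ?_, fun j τ hτ => ?_⟩, ?_⟩
  · change ‖C₀.Γ τ + g (C₀.Γ τ) - C₀.Γ τ‖ < δ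
    rw [add_sub_cancel_left]
    refine lt_of_le_of_lt ((norm_sum_le _ _).trans (Finset.sum_le_sum fun k _ => ?_)) (b := ∑ _k, ε) ?_
    · rw [norm_mul, Complex.norm_real, Real.norm_eq_abs]
      exact (mul_le_mul (hble k _) (hy k).le (norm_nonneg _) zero_le_one).trans (one_mul ε).le
    · rwa [Finset.sum_const, nsmul_eq_mul]
  · have hd := C₀.hasDerivAt_cut hτ
    have h4 := ((hgd.differentiable one_ne_zero) (C₀.Γ τ)).hasFDerivAt.comp_hasDerivAt τ hd
    change ‖deriv (fun τ => C₀.Γ τ + g (C₀.Γ τ)) τ - deriv C₀.Γ τ‖ < δ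
    have h6 : HasDerivAt (fun τ => C₀.Γ τ + g (C₀.Γ τ)) _ τ := hd.fun_add h4
    rw [h6.deriv, add_sub_cancel_left]
    have hS : 0 ≤ (∑ k, (K k : ℝ)) * ε := mul_nonneg (Finset.sum_nonneg fun k _ => (K k).2) hε.le
    have h5 : ‖fderiv ℝ g (C₀.Γ τ)‖ ≤ (∑ k, (K k : ℝ)) * ε := by
      have : LipschitzWith ⟨_, hS⟩ g := LipschitzWith.of_dist_le_mul fun z w => by
        rw [dist_eq_norm, dist_eq_norm]; exact hgL z w
      exact norm_fderiv_le_of_lipschitz ℝ this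
    exact ((fderiv ℝ g (C₀.Γ τ)).le_of_opNorm_le h5 _).trans_lt
      ((mul_le_mul_of_nonneg_left (hD j τ hτ) hS).trans_lt (h3 j))
  · have hval : ∀ k, C₀.pts k + g (C₀.pts k) = y k := fun k => by
      rw [hg]
      simp only
      rw [Finset.sum_eq_single k (fun i _ hi => by rw [hb0 i k hi.symm, Complex.ofReal_zero, zero_mul])
        (fun h => absurd (Finset.mem_univ k) h), hb1]
      simp
    funext k
    rcases k with j | j
    · exact hval (Sum.inl j)
    · exact hval (Sum.inr j)

end CutContour

/-! ### Conclusion. -/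

theorem theorem1p2 (p n : ℕ) (hp : 1 ≤ p) (t₀ : Fin (2 * p - 1) → ℂ) (C₀ : CutContour p n)
    (h₀ : C₀.IsRegular t₀) :
    ∃ (Ω : Set (Fin (2 * p - 1) → ℂ)) (U : Set ((Fin (n + 1) → ℂ) × (Fin (n + 1) → ℂ)))
      (δ : ℝ) (a b : (Fin (2 * p - 1) → ℂ) → Fin (n + 1) → ℂ),
      IsOpen Ω ∧ t₀ ∈ Ω ∧ IsOpen U ∧ C₀.endpoints ∈ U ∧ 0 < δ ∧
      (∀ x ∈ U, ∃ C : CutContour p n, C.CloseTo C₀ δ ∧ C.endpoints = x) ∧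
      (a t₀, b t₀) = C₀.endpoints ∧
      (∀ t ∈ Ω, (a t, b t) ∈ U ∧ Function.Injective (Sum.elim (a t) (b t)) ∧
        ∀ C : CutContour p n, C.CloseTo C₀ δ →
          (C.endpointMap t = 0 ↔ C.endpoints = (a t, b t))) ∧
      (∀ j, AnalyticOnNhd ℝ (fun t => (a t j).re) Ω ∧ AnalyticOnNhd ℝ (fun t => (a t j).im) Ω ∧
        AnalyticOnNhd ℝ (fun t => (b t j).re) Ω ∧ AnalyticOnNhd ℝ (fun t => (b t j).im) Ω) := by
  obtain ⟨ψ, hψ, hψ0, δ₁, hδ₁, hev⟩ := C₀.exists_solution hp h₀.endpoint_eq h₀.h_ne_zero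
  obtain ⟨r, hr, hball⟩ := Metric.eventually_nhds_iff_ball.1 hev
  -- The bound by `r` forces the endpoints of every `δ`-deformation into the ball where the
  -- equations have been solved, so uniqueness holds among all `δ`-deformations.
  set δ := min δ₁ r with hδdef
  have hδ : 0 < δ := lt_min hδ₁ hr
  obtain ⟨ε, hε, hdef⟩ := C₀.exists_deformation hδ
  have hδ' : ∀ C : CutContour p n, C.CloseTo C₀ δ → C.pts ∈ Metric.ball C₀.pts r := by
    rintro C ⟨hα, hβ, hcl, -⟩
    rw [mem_ball_iff_norm, pi_norm_lt_iff hr]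
    rintro (j | j)
    · change ‖C.Γ (C.α j) - C₀.Γ (C₀.α j)‖ < r
      rw [hα]; exact (hcl _).trans_le (min_le_right _ _)
    · change ‖C.Γ (C.β j) - C₀.Γ (C₀.β j)‖ < r
      rw [hβ]; exact (hcl _).trans_le (min_le_right _ _)
  set U : Set ((Fin (n + 1) → ℂ) × (Fin (n + 1) → ℂ)) :=
    {x | Sum.elim x.1 x.2 ∈ Metric.ball C₀.pts ε} with hU
  have hcont : Continuous fun x : (Fin (n + 1) → ℂ) × (Fin (n + 1) → ℂ) => Sum.elim x.1 x.2 := by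
    refine continuous_pi fun k => ?_
    rcases k with j | j
    · exact (continuous_apply j).comp continuous_fst
    · exact (continuous_apply j).comp continuous_snd
  have hsplit : ∀ y : Fin (n + 1) ⊕ Fin (n + 1) → ℂ,
      Sum.elim (fun j => y (Sum.inl j)) (fun j => y (Sum.inr j)) = y := fun y =>
    Sum.elim_comp_inl_inr y
  have hreal : ∀ y ∈ Metric.ball C₀.pts ε, ∃ C : CutContour p n, C.CloseTo C₀ δ ∧ C.pts = y :=
    fun y hy => hdef y ((pi_norm_lt_iff hε).1 (mem_ball_iff_norm.1 hy))
  have hpts : ∀ (C : CutContour p n) (y : Fin (n + 1) ⊕ Fin (n + 1) → ℂ), C.pts = y ↔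
      C.endpoints = (fun j => y (Sum.inl j), fun j => y (Sum.inr j)) := by
    intro C y
    constructor
    · rintro rfl; rfl
    · intro h
      have h1 := congrArg (fun x : (Fin (n + 1) → ℂ) × (Fin (n + 1) → ℂ) => Sum.elim x.1 x.2) h
      exact h1.trans (hsplit y)
  have hΩ : ∀ᶠ t in 𝓝 t₀, AnalyticAt ℝ ψ t ∧ ψ t ∈ Metric.ball C₀.pts ε ∧ t ∈ Metric.ball t₀ r :=
    hψ.eventually_analyticAt.and ((hψ.continuousAt.eventually (by
      rw [hψ0]; exact Metric.ball_mem_nhds _ hε)).and (Metric.ball_mem_nhds _ hr))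
  obtain ⟨Ω, hΩ, hΩo, ht₀⟩ := eventually_nhds_iff.1 hΩ
  refine ⟨Ω, U, δ, fun t j => ψ t (Sum.inl j), fun t j => ψ t (Sum.inr j), hΩo, ht₀,
    Metric.isOpen_ball.preimage hcont, Metric.mem_ball_self hε, hδ, fun x hx => ?_,
    ((hpts C₀ _).1 hψ0.symm).symm, fun t ht => ?_, fun j => ?_⟩
  · obtain ⟨C, hC, hCy⟩ := hreal _ hx
    exact ⟨C, hC, (hpts C _).1 hCy⟩
  · obtain ⟨-, h2, h3⟩ := hΩ t ht
    rw [hsplit]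
    refine ⟨?_, ?_, fun C hC => ?_⟩
    · rw [hU, mem_ofPred_eq, hsplit]; exact h2
    -- Distinctness comes from a contour with these endpoints, which is injective.
    · obtain ⟨C, -, hCy⟩ := hreal _ h2
      rw [← hCy]; exact C.pts_injective
    · have hx : (t, C.pts) ∈ Metric.ball (t₀, C₀.pts) r := by
        rw [← ball_prod_same]; exact ⟨h3, hδ' C hC⟩
      have hC' : C.CloseTo C₀ δ₁ := ⟨hC.1, hC.2.1, fun τ => (hC.2.2.1 τ).trans_le (min_le_left _ _),
        fun j τ hτ => (hC.2.2.2 j τ hτ).trans_le (min_le_left _ _)⟩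
      rw [← hpts]
      exact hball _ hx C hC' rfl
  · have hre : ∀ k, AnalyticOnNhd ℝ (fun t => (ψ t k).re) Ω := fun k t ht =>
      (Complex.reCLM.analyticAt _).comp (analyticAt_pi_iff.1 (hΩ t ht).1 k)
    have him : ∀ k, AnalyticOnNhd ℝ (fun t => (ψ t k).im) Ω := fun k t ht =>
      (Complex.imCLM.analyticAt _).comp (analyticAt_pi_iff.1 (hΩ t ht).1 k)
    exact ⟨hre _, him _, hre _, him _⟩
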